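/- Let $2\le k\le n-1$, and let $\Sigma^k$ be a compact smooth manifold with boundary, smoothly immersed in the closed unit ball of $\mathbb R^n$ by $x$, with $x(\partial\Sigma)\subset S^{n-1}$, as a free boundary minimal submanifold: its mean curvature vector vanishes, and along $\partial\Sigma$ its outward unit conormal is the position vector $x$. Let $\mathscr N$ be its normal bundle, $D^\perp$ the normal connection, $\sigma$ the second fundamental form, and let $$JW=\Delta^\perp W-\sum_{i,j=1}^k(\sigma(e_i,e_j),W)\,\sigma(e_i,e_j)$$ be the Jacobi operator, where $\Delta^\perp$ is the nonnegative Laplacian of $(\mathscr N,D^\perp)$ and $(e_i)$ is an orthonormal basis of the tangent space. Let $W^{1,2}(\mathscr N)$ be the space of $L^2$ sections of $\mathscr N$ whose weak covariant derivative $D^\perp W$ is in $L^2$. For $V,W\in W^{1,2}(\mathscr N)$ let $$Q(V,W)=\int_\Sigma\Big(\sum_i(D^\perp_{e_i}V,D^\perp_{e_i}W)-\sum_{i,j}(\sigma(e_i,e_j),V)(\sigma(e_i,e_j),W)\Big)-\int_{\partial\Sigma}(V,W),$$ the boundary term being taken in the sense of traces. Let $\mathscr E$ be the space of all $W\in W^{1,2}(\mathscr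 N)$ with $JW=0$ weakly in the interior of $\Sigma$, i.e. $\int_\Sigma (W,J\Phi)=0$ for all smooth sections $\Phi$ of $\mathscr N$ with compact support in the interior. Let $\mathscr A$ be the operator associated with the form $Q$ on $\mathscr E$ in the Hilbert space $\overline{\mathscr E}$ (the closure of $\mathscr E$ in $L^2(\mathscr N)$): its domain $\mathcal D(\mathscr A)$ consists of the $V\in\mathscr E$ for which there is $F\in\overline{\mathscr E}$ with $Q(V,W)=\int_\Sigma(F,W)$ for all $W\in\mathscr E$, and $\mathscr A V=F$, which is unique. For $v\in\mathbb R^n\setminus\{0\}$ let $v^\perp$ be the section of $\mathscr N$ obtained by projecting $v$ orthogonally onto the normal space at each point. Then $v^\perp\in\mathcal D(\mathscr A)$ and $$\mathscr A v^\perp=-k\,v^\perp,$$ so that $v^\perp$, unless it vanishes identically, is an eigenfunction of $\mathscr A$ with eigenvalue $-k$. In other words, for every $W\in\mathscr E$, $$Q(v^\perp,W)=-k\int_\Sigma(v^\perp,W).$$ -/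

import Mathlib

open scoped Manifold ContDiff
open MeasureTheory

noncomputable section

namespace FreeBoundary

/-- The ambient Euclidean space `ℝⁿ`. -/
abbrev Amb (n : ℕ) : Type := EuclideanSpace ℝ (Fin n)

/-- The jacobian `√det(Lᵀ L)` of a linear map between Euclidean spaces. -/
def jac {ι : Type*} [Fintype ι] {n : ℕ} (L : EuclideanSpace ℝ ι →L[ℝ] Amb n) : ℝ :=
  Real.sqrt ((ContinuousLinearMap.adjoint L).comp L).det

/-- The inclusion of the hyperplane `{y | y 0 = 0}` (with the coordinates other than `0` as
coordinates) into `ℝᵏ`. -/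
def hyperplaneIncl (k : ℕ) [NeZero k] :
    EuclideanSpace ℝ {i : Fin k // i ≠ 0} →L[ℝ] EuclideanSpace ℝ (Fin k) :=
  LinearMap.toContinuousLinearMap
    { toFun := fun z => WithLp.toLp 2 (fun i => if h : i ≠ 0 then z ⟨i, h⟩ else 0)
      map_add' := by
        intro a b
        ext i
        by_cases h : i = 0 <;> simp [h]
      map_smul' := by
        intro r a
        ext i
        by_cases h : i = 0 <;> simp [h] }

section

variable {n k : ℕ} [NeZero k]
variable {M : Type*} [TopologicalSpace M] [ChartedSpace (EuclideanHalfSpace k) M]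

/-! ### First order geometry of an immersion

Vector fields along an immersion of `M` are functions `M → ℝⁿ`. -/

/-- The differential of a map at a point, tangent spaces being read in the preferred chart. -/
def diff (k : ℕ) [NeZero k] [ChartedSpace (EuclideanHalfSpace k) M] {F : Type*} [NormedAddCommGroup F] [NormedSpace ℝ F] (f : M → F) (p : M) :
    EuclideanSpace ℝ (Fin k) →L[ℝ] F :=
  mfderiv (𝓡∂ k) 𝓘(ℝ, F) f p

/-- A smooth immersion `x : M → ℝⁿ` of a `k`-dimensional manifold with boundary `M`, i.e. an
immersed submanifold `Σ` of `ℝⁿ`. -/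
structure Immersion (k n : ℕ) [NeZero k] (M : Type*) [TopologicalSpace M]
    [ChartedSpace (EuclideanHalfSpace k) M] where
  toFun : M → Amb n
  smooth : ContMDiff (𝓡∂ k) 𝓘(ℝ, Amb n) ∞ toFun
  immersive : ∀ p, Function.Injective (diff k toFun p)

/-- The differential `dx_p` of an immersion `x`. -/
def Immersion.dx (x : Immersion k n M) (p : M) : EuclideanSpace ℝ (Fin k) →L[ℝ] Amb n :=
  diff k x.toFun p

/-- The tangent plane `dx_p(T_pΣ) ⊆ ℝⁿ`. -/
def tangentPlane (x : Immersion k n M) (p : M) : Submodule ℝ (Amb n) :=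
  LinearMap.range (x.dx p : EuclideanSpace ℝ (Fin k) →ₗ[ℝ] Amb n)

/-- The normal space `N_pΣ ⊆ ℝⁿ`. -/
def normalSpace (x : Immersion k n M) (p : M) : Submodule ℝ (Amb n) := (tangentPlane x p)ᗮ

/-- The orthogonal projection `u ↦ u^⊤` of `ℝⁿ` onto the tangent plane at `p`. -/
def tanProj (x : Immersion k n M) (p : M) : Amb n →L[ℝ] Amb n := (tangentPlane x p).starProjection

/-- The orthogonal projection `u ↦ u^⊥` of `ℝⁿ` onto the normal space at `p`. -/
def norProj (x : Immersion k n M) (p : M) : Amb n →L[ℝ] Amb n := (normalSpace x p).starProjection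

/-- The Moore-Penrose inverse `(LᵀL)⁻¹Lᵀ` of `L = dx_p`: for `x` an immersion it sends `u ∈ ℝⁿ` to
the unique `ξ ∈ T_pΣ` with `dx_p ξ = u^⊤`. -/
def pullVec (x : Immersion k n M) (p : M) : Amb n →L[ℝ] EuclideanSpace ℝ (Fin k) :=
  (((ContinuousLinearMap.adjoint (x.dx p)).comp (x.dx p)).inverse).comp
    (ContinuousLinearMap.adjoint (x.dx p))

/-- The derivative `D_u f` of `f` at `p` in the direction of the tangent vector `u ∈ ℝⁿ`
(for arbitrary `u`, in the direction `u^⊤`). -/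
def tanDeriv {F : Type*} [NormedAddCommGroup F] [NormedSpace ℝ F] (x : Immersion k n M) (f : M → F)
    (p : M) : Amb n →L[ℝ] F :=
  (diff k f p).comp (pullVec x p)

/-- The normal connection `D^⊥_u W = (D_u W)^⊥`. -/
def norDeriv (x : Immersion k n M) (W : M → Amb n) (p : M) : Amb n →L[ℝ] Amb n :=
  (norProj x p).comp (tanDeriv x W p)

/-- An orthonormal basis `(e_i)` of the tangent plane at `p`, as vectors of `ℝⁿ`. -/
def tanFrame (x : Immersion k n M) (p : M) (i : Fin (Module.finrank ℝ (tangentPlane x p))) : Amb n :=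
  (stdOrthonormalBasis ℝ (tangentPlane x p) i : Amb n)

/-- The divergence `∑ᵢ ⟨D_{e_i} X, e_i⟩` of a vector field tangent to `Σ`. -/
def tanDiv (x : Immersion k n M) (X : M → Amb n) (p : M) : ℝ :=
  ∑ i, inner ℝ (tanDeriv x X p (tanFrame x p i)) (tanFrame x p i)

/-! ### Curvature -/

/-- The second fundamental form `σ(a,b) = (D_a B)^⊥` for `a, b` tangent at `p`, where `B` is the
tangent vector field `q ↦ b^⊤` extending `b`. -/
def sff (x : Immersion k n M) (p : M) (a b : Amb n) : Amb n :=
  norProj x p (tanDeriv x (fun q => tanProj x q b) p a)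

/-- The mean curvature vector, the trace of the second fundamental form. -/
def meanCurv (x : Immersion k n M) (p : M) : Amb n :=
  ∑ i, sff x p (tanFrame x p i) (tanFrame x p i)

/-- The Simons operator `S(w) = ∑ᵢⱼ ⟨σ(e_i,e_j), w⟩ σ(e_i,e_j)` on the normal space at `p`. -/
def simons (x : Immersion k n M) (p : M) (w : Amb n) : Amb n :=
  ∑ i, ∑ j, inner ℝ (sff x p (tanFrame x p i) (tanFrame x p j)) w •
    sff x p (tanFrame x p i) (tanFrame x p j)

/-- The second covariant derivative `D^⊥_a D^⊥_B W - D^⊥_{(D_a B)^⊤} W` of a normal field `W`, for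
`a, b` tangent at `p`, where `B` is the tangent vector field `q ↦ b^⊤` extending `b`. -/
def norHess (x : Immersion k n M) (W : M → Amb n) (p : M) (a b : Amb n) : Amb n :=
  norDeriv x (fun q => norDeriv x W q (tanProj x q b)) p a
    - norDeriv x W p (tanProj x p (tanDeriv x (fun q => tanProj x q b) p a))

/-- The (nonnegative) Laplacian of the normal bundle. -/
def norLaplacian (x : Immersion k n M) (W : M → Amb n) (p : M) : Amb n :=
  -∑ i, norHess x W p (tanFrame x p i) (tanFrame x p i)

/-- The Jacobi (stability) operator `J W = Δ^⊥ W - S(W)` on smooth normal fields. -/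
def jacobi (x : Immersion k n M) (W : M → Amb n) (p : M) : Amb n :=
  norLaplacian x W p - simons x p (W p)

/-! ### The free boundary condition -/

/-- The tangent space at the boundary point `p` of the boundary of `Σ`, as a subspace of `ℝⁿ`. -/
def boundaryTangent (x : Immersion k n M) (p : M) : Submodule ℝ (Amb n) :=
  LinearMap.range ((x.dx p).comp (hyperplaneIncl k) :
    EuclideanSpace ℝ {i : Fin k // i ≠ 0} →ₗ[ℝ] Amb n)

/-- The component orthogonal to the boundary of the image under `dx_p` of the inward pointing
coordinate vector, at a boundary point `p`. -/
def inwardVec (x : Immersion k n M) (p : M) : Amb n :=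
  (boundaryTangent x p)ᗮ.starProjection (x.dx p (EuclideanSpace.single (0 : Fin k) (1 : ℝ)))

/-- The outward unit conormal of the boundary of `Σ` at the boundary point `p`. -/
def conormal (x : Immersion k n M) (p : M) : Amb n := -(‖inwardVec x p‖⁻¹ • inwardVec x p)

/-- The immersion `x` is a free boundary minimal submanifold of the unit ball:
it maps `M` into the closed ball and the boundary of `M` into the sphere, it has zero mean
curvature, and it meets the sphere orthogonally, i.e. its outward unit conormal along the boundary
is the position vector. -/
structure IsFreeBoundaryMinimal (x : Immersion k n M) : Prop where
  ball : ∀ p, x.toFun p ∈ Metric.closedBall (0 : Amb n) 1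
  sphere : ∀ p ∈ (𝓡∂ k).boundary M, x.toFun p ∈ Metric.sphere (0 : Amb n) 1
  orthogonal : ∀ p ∈ (𝓡∂ k).boundary M, conormal x p = x.toFun p
  minimal : ∀ p, meanCurv x p = 0

/-! ### The volume measures of `Σ` and of its boundary -/

/-- The differential at `y` of `x` read in the chart `c` (with values in the half-space of `ℝᵏ`). -/
def chartDiff (x : Immersion k n M) (c : OpenPartialHomeomorph M (EuclideanHalfSpace k))
    (y : EuclideanSpace ℝ (Fin k)) : EuclideanSpace ℝ (Fin k) →L[ℝ] Amb n :=
  fderivWithin ℝ (x.toFun ∘ (c.extend (𝓡∂ k)).symm) (Set.range (𝓡∂ k)) y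

variable [MeasurableSpace M]

/-- The `k`-dimensional volume on the domain of the chart `c`, i.e. `√(det g) dy` in the chart. -/
def chartVol (x : Immersion k n M) (c : OpenPartialHomeomorph M (EuclideanHalfSpace k)) : Measure M :=
  Measure.map (c.extend (𝓡∂ k)).symm
    ((volume.restrict (c.extend (𝓡∂ k)).target).withDensity
      fun y => ENNReal.ofReal (jac (chartDiff x c y)))

/-- The `(k-1)`-dimensional volume on the part of the boundary in the domain of the chart `c`. -/
def chartBdryVol (x : Immersion k n M) (c : OpenPartialHomeomorph M (EuclideanHalfSpace k)) :
    Measure M :=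
  Measure.map (fun z => (c.extend (𝓡∂ k)).symm (hyperplaneIncl k z))
    ((volume.restrict (hyperplaneIncl k ⁻¹' (c.extend (𝓡∂ k)).target)).withDensity
      fun z => ENNReal.ofReal (jac ((chartDiff x c (hyperplaneIncl k z)).comp (hyperplaneIncl k))))

/-- The Riemannian volume measure of `Σ` (with the metric induced by `x`). The chart measures agree
on overlaps, and their supremum is the measure that restricts to each of them on its domain. -/
def vol (x : Immersion k n M) : Measure M :=
  ⨆ c ∈ atlas (EuclideanHalfSpace k) M, chartVol x c

/-- The Riemannian volume measure of the boundary of `Σ`, as a measure on `M` that is carried by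
the boundary. -/
def bdryVol (x : Immersion k n M) : Measure M :=
  ⨆ c ∈ atlas (EuclideanHalfSpace k) M, chartBdryVol x c

/-! ### Sobolev sections of the normal bundle -/

/-- Smooth (up to the boundary) tangent vector fields. -/
def IsTangentField (x : Immersion k n M) (X : M → Amb n) : Prop :=
  ContMDiff (𝓡∂ k) 𝓘(ℝ, Amb n) ∞ X ∧ ∀ p, X p ∈ tangentPlane x p

/-- Smooth (up to the boundary) normal vector fields. -/
def IsNormalField (x : Immersion k n M) (Φ : M → Amb n) : Prop :=
  ContMDiff (𝓡∂ k) 𝓘(ℝ, Amb n) ∞ Φ ∧ ∀ p, Φ p ∈ normalSpace x p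

/-- `W` is an `L²` section of the normal bundle. -/
def IsL2Normal (x : Immersion k n M) (W : M → Amb n) : Prop :=
  MemLp W 2 (vol x) ∧ ∀ᵐ p ∂(vol x), W p ∈ normalSpace x p

/-- `G` is the weak covariant derivative `D^⊥ W`, and is square integrable. At `p` it is a linear
map from the tangent plane to the normal space, extended by `0` to `ℝⁿ`; it is tested against
smooth tangent fields `X` with compact support in the interior and smooth normal fields `Φ`. -/
def IsWeakDeriv (x : Immersion k n M) (W : M → Amb n) (G : M → Amb n →L[ℝ] Amb n) : Prop :=
  MemLp G 2 (vol x) ∧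
  (∀ᵐ p ∂(vol x), ∀ u, G p u ∈ normalSpace x p ∧ G p u = G p (tanProj x p u)) ∧
  ∀ X Φ : M → Amb n, IsTangentField x X → tsupport X ⊆ (𝓡∂ k).interior M → IsNormalField x Φ →
    ∫ p, inner ℝ (G p (X p)) (Φ p) ∂(vol x) =
      -∫ p, (inner ℝ (W p) (norDeriv x Φ p (X p)) + tanDiv x X p * inner ℝ (W p) (Φ p)) ∂(vol x)

/-- The Sobolev space `W^{1,2}` of sections of the normal bundle. -/
def IsSobolev (x : Immersion k n M) (W : M → Amb n) : Prop :=
  IsL2Normal x W ∧ ∃ G, IsWeakDeriv x W G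

open Classical in
/-- The weak covariant derivative `D^⊥ W` of a Sobolev section (unique almost everywhere). -/
def weakDeriv (x : Immersion k n M) (W : M → Amb n) : M → Amb n →L[ℝ] Amb n :=
  if h : ∃ G, IsWeakDeriv x W G then h.choose else 0

/-- `τ` is the trace on the boundary of the Sobolev section `W`: the square integrable normal field
along the boundary for which Green's formula holds with all smooth test fields. -/
def IsTrace (x : Immersion k n M) (W : M → Amb n) (τ : M → Amb n) : Prop :=
  MemLp τ 2 (bdryVol x) ∧ (∀ᵐ p ∂(bdryVol x), τ p ∈ normalSpace x p) ∧
  ∀ X Φ : M → Amb n, IsTangentField x X → IsNormalField x Φ →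
    ∫ p, (inner ℝ (weakDeriv x W p (X p)) (Φ p) + inner ℝ (W p) (norDeriv x Φ p (X p))
      + tanDiv x X p * inner ℝ (W p) (Φ p)) ∂(vol x) =
      ∫ p, inner ℝ (X p) (conormal x p) * inner ℝ (τ p) (Φ p) ∂(bdryVol x)

open Classical in
/-- The trace on the boundary of a Sobolev section (unique almost everywhere). -/
def trace (x : Immersion k n M) (W : M → Amb n) : M → Amb n :=
  if h : ∃ τ, IsTrace x W τ then h.choose else 0

/-! ### The index form, the Jacobi-harmonic sections and the operator of the form -/

/-- The index form
`Q(V,W) = ∫_Σ (⟨D^⊥V, D^⊥W⟩_HS - ∑ᵢⱼ ⟨σ(e_i,e_j),V⟩⟨σ(e_i,e_j),W⟩) - ∫_∂Σ ⟨V,W⟩`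
on Sobolev sections. -/
def indexForm (x : Immersion k n M) (V W : M → Amb n) : ℝ :=
  (∫ p, ((∑ i, inner ℝ (weakDeriv x V p (tanFrame x p i)) (weakDeriv x W p (tanFrame x p i)))
    - ∑ i, ∑ j, inner ℝ (sff x p (tanFrame x p i) (tanFrame x p j)) (V p) *
        inner ℝ (sff x p (tanFrame x p i) (tanFrame x p j)) (W p)) ∂(vol x))
  - ∫ p, inner ℝ (trace x V p) (trace x W p) ∂(bdryVol x)

/-- `J W = 0` in the interior of `Σ` in the weak sense (`J` is formally self-adjoint). -/
def IsWeaklyJacobi (x : Immersion k n M) (W : M → Amb n) : Prop :=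
  ∀ Φ : M → Amb n, IsNormalField x Φ → tsupport Φ ⊆ (𝓡∂ k).interior M →
    ∫ p, inner ℝ (W p) (jacobi x Φ p) ∂(vol x) = 0

/-- The space `𝓔` of the sections `W ∈ W^{1,2}` of the normal bundle with `J W = 0` in the interior,
as a subset of `L²`. -/
def hardy (x : Immersion k n M) : Set (Lp (Amb n) 2 (vol x)) :=
  {W | IsSobolev x W ∧ IsWeaklyJacobi x W}

/-- `F` represents the linear form `Q(W, ·)` on `𝓔`: it lies in the `L²`-closure of `𝓔`, and
`Q(W,V) = ∫_Σ ⟨F,V⟩` for every `V ∈ 𝓔`. There is at most one such `F`. -/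
def Represents (x : Immersion k n M) (W F : Lp (Amb n) 2 (vol x)) : Prop :=
  F ∈ closure (hardy x) ∧
    ∀ V ∈ hardy x, indexForm x W V = ∫ p, inner ℝ (F p) (V p) ∂(vol x)

/-- The domain of the operator associated with the form `Q` on `𝓔`. -/
def opDomain (x : Immersion k n M) : Set (Lp (Amb n) 2 (vol x)) :=
  {W | W ∈ hardy x ∧ ∃ F, Represents x W F}

open Classical in
/-- The operator `𝒜` associated with the form `Q` with form domain `𝓔`, in the Hilbert space
that is the `L²`-closure of `𝓔` (`0` outside its domain): `Q(W,V) = ∫_Σ ⟨𝒜W,V⟩` for all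
`W` in its domain and `V ∈ 𝓔`. -/
def formOp (x : Immersion k n M) (W : Lp (Amb n) 2 (vol x)) : Lp (Amb n) 2 (vol x) :=
  if h : W ∈ opDomain x then h.2.choose else 0

/-- The normal field `v^⊥`, for a constant vector `v`. -/
def norPart (x : Immersion k n M) (v : Amb n) (p : M) : Amb n := norProj x p v

end

end FreeBoundary

end

/-!
For the constant vector `v` put `V = v^⊥`, and consider the normal field
`Φ = (|x|² - 1)/2 • v^⊥ - ⟨x, v⟩ x^⊥` (`confNor`), the normal part of a field that differs from a
conformal vector field of the ball by a multiple of `v`. It has three properties.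

* `J Φ = -k v^⊥` (`jacobi_confNor`). Indeed `v^⊥` and `x^⊥` are Jacobi fields
  (`norLaplacian_norPart`, `norLaplacian_posNor`), since translations and dilations preserve
  minimality. By the Leibniz rule only first order terms, which cancel, and the Laplacian of
  `|x|²/2`, which is `k`, remain.
* `Φ = 0` on the boundary, where `|x| = 1` and `x` is tangent to `Σ`.
* `D_x Φ = v^⊥ - D_x v^⊥` on the boundary, with `D` the normal connection and `x` the conormal
  (`norDeriv_boundary`).

Let `W` be a weakly Jacobi Sobolev section with weak derivative `G` and trace `τ`. Green's formula
(`IsSobolevTriple.green`) with the Jacobi field `V`, and then with `Φ`, gives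
`Q(V, W) = ∫_∂ ⟨τ, D_x V - V⟩ = -∫_∂ ⟨τ, D_x Φ⟩ = ∫ (⟨W, Δ^⊥ Φ⟩ - ⟨G, D Φ⟩)`.
The weak Jacobi equation of `W`, tested with `Φ`, replaces `∫ ⟨G, D Φ⟩` by `∫ ⟨W, S Φ⟩`, where `S` is
the Simons operator. Hence `Q(V, W) = ∫ ⟨W, J Φ⟩ = -k ∫ ⟨V, W⟩` (`indexForm_norPart`). The field `Φ`
vanishes on the boundary but need not have compact support in the interior. It is an admissible
test field by cutoff (`IsSobolevTriple.integral_of_vanish`). The cutoffs are functions of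
`1 - |x|²` (`exists_cutoff`): this is positive in the interior by the maximum principle (`halfSq_neg`),
and dominates every smooth function that vanishes on the boundary (`exists_abs_le_halfSq`).

The traces in `Q` have to be shown to exist, and to be unique. Weakly differentiable functions are
tested first against fields tangent to the boundary, again by cutoff
(`IsScalarPair.integral_eq_zero`). So `∫ (⟨∇w, Y⟩ + w div Y)` depends only on the normal component of
`Y` along the boundary. Near the boundary `Y` may therefore be replaced by an explicit field with the
same normal component (`exists_extension_of_box`). For `w = 1` this proves the divergence theorem
(`integral_tanDiv`). In general it bounds the pairing by the `L²` norm of the normal component on the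
boundary, so that the Riesz representation theorem provides the trace (`IsScalarPair.exists_trace`).
A section of the normal bundle is treated through its components in `ℝⁿ`
(`IsWeakDeriv.exists_trace`, `IsSobolevTriple.unique`).

The geometry is written in terms of the projection `P` onto the tangent planes and its derivative
`B = D P` (`dProj`), and traces are sums over the standard basis of `ℝⁿ`, which avoids local frames.
Integrals are computed in charts, by `vol_restrict`, `bdryVol_restrict` and the formula for the
divergence in coordinates, `jac_mul_tanDiv`.
-/

set_option linter.unusedSectionVars false

noncomputable section

namespace FreeBoundary

/-! ### The Moore–Penrose inverse -/

section LinearAlgebra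

variable {E E' F : Type*} [NormedAddCommGroup E] [InnerProductSpace ℝ E] [FiniteDimensional ℝ E]
  [NormedAddCommGroup E'] [InnerProductSpace ℝ E'] [FiniteDimensional ℝ E']
  [NormedAddCommGroup F] [InnerProductSpace ℝ F] [FiniteDimensional ℝ F]

/-- The Moore–Penrose inverse `(LᵀL)⁻¹Lᵀ`. The inverse of a non-invertible operator being `0`, this is
the Moore–Penrose inverse for injective `L` only. -/
def pinv (L : E →L[ℝ] F) : F →L[ℝ] E :=
  (((ContinuousLinearMap.adjoint L).comp L).inverse).comp (ContinuousLinearMap.adjoint L)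

/-- The Gram operator `LᵀL` of an injective map is invertible. -/
lemma exists_gram_equiv (L : E →L[ℝ] F) (hL : Function.Injective L) :
    ∃ e : E ≃L[ℝ] E, (e : E →L[ℝ] E) = (ContinuousLinearMap.adjoint L).comp L := by
  have hinj : Function.Injective ((ContinuousLinearMap.adjoint L).comp L : E →ₗ[ℝ] E) := by
    rw [← LinearMap.ker_eq_bot, LinearMap.ker_eq_bot']
    intro ξ hξ
    have h1 : inner ℝ (L ξ) (L ξ) = 0 := by
      rw [← ContinuousLinearMap.adjoint_inner_left]
      have : ContinuousLinearMap.adjoint L (L ξ) = 0 := hξ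
      rw [this, inner_zero_left]
    exact hL (by rw [inner_self_eq_zero.1 h1, map_zero])
  refine ⟨(LinearEquiv.ofInjectiveEndo _ hinj).toContinuousLinearEquiv, ?_⟩
  ext ξ
  rfl

lemma pinv_apply_apply (L : E →L[ℝ] F) (hL : Function.Injective L) (ξ : E) :
    pinv L (L ξ) = ξ := by
  obtain ⟨e, he⟩ := exists_gram_equiv L hL
  have h1 : ContinuousLinearMap.adjoint L (L ξ) = e ξ := by
    change _ = (e : E →L[ℝ] E) ξ
    rw [he]; rfl
  simp only [pinv, ← he, ContinuousLinearMap.inverse_equiv, ContinuousLinearMap.comp_apply]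
  rw [h1]
  exact e.symm_apply_apply ξ

lemma pinv_apply_orthogonal (L : E →L[ℝ] F) {u : F} (hu : ∀ ξ, inner ℝ (L ξ) u = 0) :
    pinv L u = 0 := by
  have : ContinuousLinearMap.adjoint L u = 0 := by
    refine ext_inner_left ℝ fun ξ => ?_
    rw [ContinuousLinearMap.adjoint_inner_right, hu, inner_zero_right]
  simp [pinv, this]

/-- For injective `L`, the map `L ∘ pinv L` is the orthogonal projection onto the range of `L`. -/
lemma apply_pinv (L : E →L[ℝ] F) (hL : Function.Injective L) (u : F) :
    L (pinv L u) = (LinearMap.range (L : E →ₗ[ℝ] F)).starProjection u := by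
  set K := LinearMap.range (L : E →ₗ[ℝ] F)
  have hdec : u = K.starProjection u + Kᗮ.starProjection u := by
    rw [Submodule.starProjection_add_starProjection_orthogonal]
  obtain ⟨ξ, hξ⟩ : ∃ ξ, L ξ = K.starProjection u := Submodule.starProjection_apply_mem K u
  have h2 : pinv L (Kᗮ.starProjection u) = 0 := by
    refine pinv_apply_orthogonal L fun ζ => ?_
    exact Submodule.inner_right_of_mem_orthogonal (K := K) ⟨ζ, rfl⟩
      (Submodule.starProjection_apply_mem Kᗮ u)
  conv_lhs => rw [hdec, map_add, h2, add_zero, ← hξ, pinv_apply_apply L hL, hξ]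

/-- The Moore–Penrose inverse of a reparametrized map. Derivatives `T ∘ pinv L` along the range of `L`
therefore do not depend on the parametrization. -/
lemma apply_pinv_comp (L : E →L[ℝ] F) (A : E' →L[ℝ] E) (hL : Function.Injective L)
    (hA : Function.Bijective A) (u : F) : A (pinv (L.comp A) u) = pinv L u := by
  have hr : LinearMap.range (L.comp A : E' →ₗ[ℝ] F) = LinearMap.range (L : E →ₗ[ℝ] F) := by
    ext w
    constructor
    · rintro ⟨ξ, rfl⟩; exact ⟨A ξ, rfl⟩
    · rintro ⟨ξ, rfl⟩
      obtain ⟨η, rfl⟩ := hA.2 ξ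
      exact ⟨η, rfl⟩
  apply hL
  have h1 := apply_pinv (L.comp A) (hL.comp hA.1) u
  have h2 : L (A (pinv (L.comp A) u)) =
      (LinearMap.range (L.comp A : E' →ₗ[ℝ] F)).starProjection u := h1
  rw [apply_pinv L hL, h2]
  simp only [hr]

/-- Taking adjoints, as a continuous linear map (over `ℝ`). -/
def adjointCLM : (E →L[ℝ] F) →L[ℝ] (F →L[ℝ] E) :=
  LinearMap.toContinuousLinearMap
    { toFun := fun L => ContinuousLinearMap.adjoint L
      map_add' := fun a b => map_add _ a b
      map_smul' := fun r a => by simp }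

lemma contDiffAt_gram (L : E →L[ℝ] F) {m : WithTop ℕ∞} :
    ContDiffAt ℝ m (fun L : E →L[ℝ] F => (ContinuousLinearMap.adjoint L).comp L) L :=
  ContDiffAt.clm_comp (adjointCLM (E := E) (F := F)).contDiff.contDiffAt contDiffAt_id

lemma contDiffAt_pinv (L : E →L[ℝ] F) (hL : Function.Injective L) {m : WithTop ℕ∞} :
    ContDiffAt ℝ m (pinv : (E →L[ℝ] F) → (F →L[ℝ] E)) L := by
  obtain ⟨e, he⟩ := exists_gram_equiv L hL
  have h1 : ContDiffAt ℝ m (fun L : E →L[ℝ] F =>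
      ((ContinuousLinearMap.adjoint L).comp L).inverse) L := by
    refine ContDiffAt.comp L (g := ContinuousLinearMap.inverse) ?_ (contDiffAt_gram L)
    simpa only [← he] using contDiffAt_map_inverse e
  exact h1.clm_comp (adjointCLM (E := E) (F := F)).contDiff.contDiffAt

end LinearAlgebra

/-! ### The jacobian and its derivative -/

section Jacobian

variable {ι : Type*} [Fintype ι] [DecidableEq ι] {n : ℕ}

lemma det_toMatrix_basisFun (T : EuclideanSpace ℝ ι →L[ℝ] EuclideanSpace ℝ ι) :
    T.det = (Matrix.of fun i j => T (EuclideanSpace.single j (1 : ℝ)) i).det := by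
  rw [ContinuousLinearMap.det, ← LinearMap.det_toMatrix (EuclideanSpace.basisFun ι ℝ).toBasis]
  congr 1

lemma det_gram (L : EuclideanSpace ℝ ι →L[ℝ] Amb n) :
    ((ContinuousLinearMap.adjoint L).comp L).det =
      (Matrix.of fun i j => (inner ℝ (L (EuclideanSpace.single i (1 : ℝ)))
        (L (EuclideanSpace.single j (1 : ℝ))) : ℝ)).det := by
  rw [det_toMatrix_basisFun]
  congr 1
  ext i j
  rw [Matrix.of_apply, Matrix.of_apply, ← ContinuousLinearMap.adjoint_inner_right,
    EuclideanSpace.inner_single_left]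
  simp

lemma det_gram_comp (L : EuclideanSpace ℝ ι →L[ℝ] Amb n)
    (A : EuclideanSpace ℝ ι →L[ℝ] EuclideanSpace ℝ ι) :
    ((ContinuousLinearMap.adjoint (L.comp A)).comp (L.comp A)).det =
      A.det ^ 2 * ((ContinuousLinearMap.adjoint L).comp L).det := by
  have h1 : (ContinuousLinearMap.adjoint A).det = A.det := by
    rw [det_toMatrix_basisFun, det_toMatrix_basisFun, ← Matrix.det_transpose]
    congr 1
    ext i j
    have : inner ℝ (EuclideanSpace.single j (1 : ℝ))
      (ContinuousLinearMap.adjoint A (EuclideanSpace.single i (1 : ℝ))) =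
      inner ℝ (A (EuclideanSpace.single j (1 : ℝ))) (EuclideanSpace.single i (1 : ℝ)) :=
      ContinuousLinearMap.adjoint_inner_right A _ _
    rw [EuclideanSpace.inner_single_left, EuclideanSpace.inner_single_right] at this
    simpa using this
  have h2 : (ContinuousLinearMap.adjoint (L.comp A)).comp (L.comp A) =
      (ContinuousLinearMap.adjoint A).comp
        (((ContinuousLinearMap.adjoint L).comp L).comp A) := by
    rw [ContinuousLinearMap.adjoint_comp]; rfl
  rw [h2]
  have h3 : ∀ S T : EuclideanSpace ℝ ι →L[ℝ] EuclideanSpace ℝ ι, (S.comp T).det = S.det * T.det :=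
    fun S T => LinearMap.det_comp _ _
  rw [h3, h3, h1]
  ring

lemma jac_comp (L : EuclideanSpace ℝ ι →L[ℝ] Amb n)
    (A : EuclideanSpace ℝ ι →L[ℝ] EuclideanSpace ℝ ι) : jac (L.comp A) = |A.det| * jac L := by
  rw [jac, det_gram_comp, Real.sqrt_mul (sq_nonneg _), Real.sqrt_sq_eq_abs, jac]

lemma det_gram_pos (L : EuclideanSpace ℝ ι →L[ℝ] Amb n) (hL : Function.Injective L) :
    0 < ((ContinuousLinearMap.adjoint L).comp L).det := by
  rw [det_gram]
  have := Matrix.posDef_gram_of_linearIndependent (𝕜 := ℝ)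
    (v := fun i => L (EuclideanSpace.single i (1 : ℝ))) (by
      have h := (EuclideanSpace.basisFun ι ℝ).toBasis.linearIndependent.map'
        (L : EuclideanSpace ℝ ι →ₗ[ℝ] Amb n) (LinearMap.ker_eq_bot.2 hL)
      have h2 : (fun i => L (EuclideanSpace.single i (1 : ℝ))) =
          (L : EuclideanSpace ℝ ι →ₗ[ℝ] Amb n) ∘ (EuclideanSpace.basisFun ι ℝ).toBasis := by
        ext i : 1
        simp
      rw [h2]
      exact h)
  exact this.det_pos

lemma jac_pos (L : EuclideanSpace ℝ ι →L[ℝ] Amb n) (hL : Function.Injective L) : 0 < jac L :=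
  Real.sqrt_pos.2 (det_gram_pos L hL)

lemma contDiff_det {m : WithTop ℕ∞} :
    ContDiff ℝ m (fun T : EuclideanSpace ℝ ι →L[ℝ] EuclideanSpace ℝ ι => T.det) := by
  simp only [det_toMatrix_basisFun, Matrix.det_apply, Matrix.of_apply]
  refine ContDiff.sum fun σ _ => ContDiff.const_smul _ ?_
  refine contDiff_prod fun i _ => ?_
  have : (fun T : EuclideanSpace ℝ ι →L[ℝ] EuclideanSpace ℝ ι =>
      T (EuclideanSpace.single i (1 : ℝ)) (σ i)) =
      (EuclideanSpace.proj (σ i) : EuclideanSpace ℝ ι →L[ℝ] ℝ) ∘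
        (ContinuousLinearMap.apply ℝ (EuclideanSpace ℝ ι) (EuclideanSpace.single i (1 : ℝ))) := by
    ext T; simp
  rw [this]
  exact (ContinuousLinearMap.contDiff _).comp (ContinuousLinearMap.contDiff _)

lemma contDiffAt_jac (L : EuclideanSpace ℝ ι →L[ℝ] Amb n) (hL : Function.Injective L)
    {m : WithTop ℕ∞} :
    ContDiffAt ℝ m (jac : (EuclideanSpace ℝ ι →L[ℝ] Amb n) → ℝ) L := by
  refine ContDiffAt.sqrt ?_ (det_gram_pos L hL).ne'
  exact ContDiffAt.comp L (g := fun T : EuclideanSpace ℝ ι →L[ℝ] EuclideanSpace ℝ ι => T.det)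
    contDiff_det.contDiffAt (contDiffAt_gram L)

/-- Jacobi's formula for the derivative of the determinant at an invertible matrix. -/
lemma fderiv_det_apply (e : EuclideanSpace ℝ ι ≃L[ℝ] EuclideanSpace ℝ ι)
    (S : EuclideanSpace ℝ ι →L[ℝ] EuclideanSpace ℝ ι) :
    fderiv ℝ (fun T : EuclideanSpace ℝ ι →L[ℝ] EuclideanSpace ℝ ι => T.det) e S =
      (e : EuclideanSpace ℝ ι →L[ℝ] EuclideanSpace ℝ ι).det *
        LinearMap.trace ℝ _ ((e.symm : EuclideanSpace ℝ ι →L[ℝ] EuclideanSpace ℝ ι).comp S :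
          EuclideanSpace ℝ ι →ₗ[ℝ] EuclideanSpace ℝ ι) := by
  have hd : DifferentiableAt ℝ (fun T : EuclideanSpace ℝ ι →L[ℝ] EuclideanSpace ℝ ι => T.det) e :=
    (contDiff_det (ι := ι) (m := 1)).differentiable one_ne_zero _
  set U := (e.symm : EuclideanSpace ℝ ι →L[ℝ] EuclideanSpace ℝ ι).comp S with hU
  have hline : HasDerivAt (fun t : ℝ => ((e : EuclideanSpace ℝ ι →L[ℝ] EuclideanSpace ℝ ι) +
      t • S).det) (fderiv ℝ (fun T : EuclideanSpace ℝ ι →L[ℝ] EuclideanSpace ℝ ι => T.det) e S) 0 := by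
    have h1 : HasDerivAt (fun t : ℝ => (e : EuclideanSpace ℝ ι →L[ℝ] EuclideanSpace ℝ ι) + t • S)
        S 0 := by
      simpa using ((hasDerivAt_id (0 : ℝ)).smul_const S).const_add
        (e : EuclideanSpace ℝ ι →L[ℝ] EuclideanSpace ℝ ι)
    have h2 : HasFDerivAt (fun T : EuclideanSpace ℝ ι →L[ℝ] EuclideanSpace ℝ ι => T.det)
        (fderiv ℝ (fun T : EuclideanSpace ℝ ι →L[ℝ] EuclideanSpace ℝ ι => T.det) e)
        ((e : EuclideanSpace ℝ ι →L[ℝ] EuclideanSpace ℝ ι) + (0 : ℝ) • S) := by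
      have h0 : (e : EuclideanSpace ℝ ι →L[ℝ] EuclideanSpace ℝ ι) + (0 : ℝ) • S = e := by
        ext1 ξ
        simp
      rw [h0]
      exact hd.hasFDerivAt
    exact h2.comp_hasDerivAt 0 h1
  set N := LinearMap.toMatrix (EuclideanSpace.basisFun ι ℝ).toBasis
    (EuclideanSpace.basisFun ι ℝ).toBasis (U : EuclideanSpace ℝ ι →ₗ[ℝ] EuclideanSpace ℝ ι) with hN
  set q := (Matrix.det (1 + (Polynomial.X : Polynomial ℝ) • N.map Polynomial.C)).divX.divX with hq
  have hpoly : ∀ t : ℝ, ((e : EuclideanSpace ℝ ι →L[ℝ] EuclideanSpace ℝ ι) + t • S).det =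
      (e : EuclideanSpace ℝ ι →L[ℝ] EuclideanSpace ℝ ι).det *
        (1 + N.trace * t + q.eval t * t ^ 2) := by
    intro t
    have h1 : (e : EuclideanSpace ℝ ι →L[ℝ] EuclideanSpace ℝ ι) + t • S =
        (e : EuclideanSpace ℝ ι →L[ℝ] EuclideanSpace ℝ ι).comp
          (ContinuousLinearMap.id ℝ _ + t • U) := by
      ext1 ξ
      simp [hU]
    have h2 : (ContinuousLinearMap.id ℝ (EuclideanSpace ℝ ι) + t • U).det =
        1 + N.trace * t + q.eval t * t ^ 2 := by
      rw [← Matrix.det_one_add_smul, ContinuousLinearMap.det,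
        ← LinearMap.det_toMatrix (EuclideanSpace.basisFun ι ℝ).toBasis]
      congr 1
      rw [ContinuousLinearMap.toLinearMap_add, ContinuousLinearMap.toLinearMap_smul, map_add,
        map_smul, ← hN]
      congr 1
      exact LinearMap.toMatrix_id _
    rw [h1, ← h2]
    exact LinearMap.det_comp _ _
  have hline' : HasDerivAt (fun t : ℝ => ((e : EuclideanSpace ℝ ι →L[ℝ] EuclideanSpace ℝ ι) +
      t • S).det) ((e : EuclideanSpace ℝ ι →L[ℝ] EuclideanSpace ℝ ι).det * N.trace) 0 := by
    rw [funext hpoly]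
    have h3 := (((hasDerivAt_id (0 : ℝ)).const_mul N.trace).const_add 1).add
      ((q.hasDerivAt 0).mul ((hasDerivAt_id (0 : ℝ)).pow 2))
    have h4 := h3.const_mul (e : EuclideanSpace ℝ ι →L[ℝ] EuclideanSpace ℝ ι).det
    exact h4.congr_deriv (by simp)
  rw [hline.unique hline', LinearMap.trace_eq_matrix_trace ℝ (EuclideanSpace.basisFun ι ℝ).toBasis]

/-- The derivative of `√det(LᵀL)` in the direction `S` is `√det(LᵀL)` times the trace of
`(LᵀL)⁻¹LᵀS`. -/
lemma fderiv_jac_apply (L : EuclideanSpace ℝ ι →L[ℝ] Amb n) (hL : Function.Injective L)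
    (S : EuclideanSpace ℝ ι →L[ℝ] Amb n) :
    fderiv ℝ (jac : (EuclideanSpace ℝ ι →L[ℝ] Amb n) → ℝ) L S =
      jac L * LinearMap.trace ℝ _ ((pinv L).comp S :
        EuclideanSpace ℝ ι →ₗ[ℝ] EuclideanSpace ℝ ι) := by
  obtain ⟨e, he⟩ := exists_gram_equiv L hL
  have hpos := det_gram_pos L hL
  have hg : HasFDerivAt (fun L : EuclideanSpace ℝ ι →L[ℝ] Amb n =>
      (ContinuousLinearMap.adjoint L).comp L)
      ((ContinuousLinearMap.compL ℝ _ _ _ (ContinuousLinearMap.adjoint L)) +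
        ((ContinuousLinearMap.compL ℝ _ _ _).flip L).comp adjointCLM) L := by
    have := (adjointCLM (E := EuclideanSpace ℝ ι) (F := Amb n)).hasFDerivAt.clm_comp
      (hasFDerivAt_id (𝕜 := ℝ) L)
    exact this
  have hdet : HasFDerivAt (fun T : EuclideanSpace ℝ ι →L[ℝ] EuclideanSpace ℝ ι => T.det)
      (fderiv ℝ (fun T : EuclideanSpace ℝ ι →L[ℝ] EuclideanSpace ℝ ι => T.det) e)
      ((ContinuousLinearMap.adjoint L).comp L) := by
    rw [← he]
    exact ((contDiff_det (ι := ι) (m := 1)).differentiable one_ne_zero _).hasFDerivAt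
  have hcomp := (HasFDerivAt.comp (f := fun L : EuclideanSpace ℝ ι →L[ℝ] Amb n =>
    (ContinuousLinearMap.adjoint L).comp L) L hdet hg).sqrt hpos.ne'
  have hjac : HasFDerivAt (jac : (EuclideanSpace ℝ ι →L[ℝ] Amb n) → ℝ) _ L := hcomp
  rw [hjac.fderiv]
  simp only [Function.comp_apply, _root_.smul_apply, ContinuousLinearMap.comp_apply,
    _root_.add_apply, fderiv_det_apply]
  have hS : (ContinuousLinearMap.compL ℝ (EuclideanSpace ℝ ι) (Amb n) (EuclideanSpace ℝ ι)
      (ContinuousLinearMap.adjoint L)) S + (ContinuousLinearMap.compL ℝ (EuclideanSpace ℝ ι) (Amb n)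
      (EuclideanSpace ℝ ι)).flip L (adjointCLM S) =
      (ContinuousLinearMap.adjoint L).comp S + (ContinuousLinearMap.adjoint S).comp L := rfl
  rw [hS]
  have hpinv : pinv L = (e.symm : EuclideanSpace ℝ ι →L[ℝ] EuclideanSpace ℝ ι).comp
      (ContinuousLinearMap.adjoint L) := by
    rw [pinv, ← he, ContinuousLinearMap.inverse_equiv]
  set esym := (e.symm : EuclideanSpace ℝ ι →L[ℝ] EuclideanSpace ℝ ι)
  -- the two summands are adjoint to each other up to conjugation, so that their traces agree
  have hadj : ∀ T : EuclideanSpace ℝ ι →L[ℝ] EuclideanSpace ℝ ι,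
      LinearMap.trace ℝ _ (ContinuousLinearMap.adjoint T :
        EuclideanSpace ℝ ι →ₗ[ℝ] EuclideanSpace ℝ ι) = LinearMap.trace ℝ _
        (T : EuclideanSpace ℝ ι →ₗ[ℝ] EuclideanSpace ℝ ι) := by
    intro T
    rw [LinearMap.trace_eq_sum_inner _ (EuclideanSpace.basisFun ι ℝ),
      LinearMap.trace_eq_sum_inner _ (EuclideanSpace.basisFun ι ℝ)]
    refine Finset.sum_congr rfl fun i _ => ?_
    rw [ContinuousLinearMap.coe_coe, ContinuousLinearMap.coe_coe,
      ContinuousLinearMap.adjoint_inner_right, real_inner_comm]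
  have hsym : ContinuousLinearMap.adjoint esym = esym := by
    have h1 : ContinuousLinearMap.adjoint (e : EuclideanSpace ℝ ι →L[ℝ] EuclideanSpace ℝ ι) = e := by
      rw [he, ContinuousLinearMap.adjoint_comp, ContinuousLinearMap.adjoint_adjoint]
    ext1 ξ
    refine ext_inner_left ℝ fun ζ => ?_
    rw [ContinuousLinearMap.adjoint_inner_right]
    obtain ⟨z, rfl⟩ := e.surjective ζ
    obtain ⟨y, rfl⟩ := e.surjective ξ
    have h2 : inner ℝ (ContinuousLinearMap.adjoint
      (e : EuclideanSpace ℝ ι →L[ℝ] EuclideanSpace ℝ ι) z) y = inner ℝ z (e y) :=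
      ContinuousLinearMap.adjoint_inner_left _ _ _
    rw [h1] at h2
    simpa [esym] using h2.symm
  have htr : LinearMap.trace ℝ _ (esym.comp ((ContinuousLinearMap.adjoint S).comp L) :
      EuclideanSpace ℝ ι →ₗ[ℝ] EuclideanSpace ℝ ι) = LinearMap.trace ℝ _
      (esym.comp ((ContinuousLinearMap.adjoint L).comp S) :
        EuclideanSpace ℝ ι →ₗ[ℝ] EuclideanSpace ℝ ι) := by
    have h1 : LinearMap.trace ℝ _ (esym.comp ((ContinuousLinearMap.adjoint S).comp L) :
      EuclideanSpace ℝ ι →ₗ[ℝ] EuclideanSpace ℝ ι) = LinearMap.trace ℝ _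
      ((((ContinuousLinearMap.adjoint S).comp L).comp esym :
        EuclideanSpace ℝ ι →L[ℝ] EuclideanSpace ℝ ι) :
        EuclideanSpace ℝ ι →ₗ[ℝ] EuclideanSpace ℝ ι) :=
      LinearMap.trace_comp_comm' _ _
    rw [h1, ← hadj]
    congr 2
    rw [ContinuousLinearMap.adjoint_comp, ContinuousLinearMap.adjoint_comp, hsym,
      ContinuousLinearMap.adjoint_adjoint]
  rw [ContinuousLinearMap.comp_add, ContinuousLinearMap.toLinearMap_add, map_add, htr, hpinv, jac,
    ← he, ContinuousLinearMap.comp_assoc]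
  have hs : Real.sqrt (e : EuclideanSpace ℝ ι →L[ℝ] EuclideanSpace ℝ ι).det ≠ 0 := by
    rw [he]; exact (Real.sqrt_pos.2 hpos).ne'
  -- the square root in the denominator of the derivative of `√` is absorbed by the determinant
  have hsq : (e : EuclideanSpace ℝ ι →L[ℝ] EuclideanSpace ℝ ι).det =
      Real.sqrt (e : EuclideanSpace ℝ ι →L[ℝ] EuclideanSpace ℝ ι).det ^ 2 := by
    rw [Real.sq_sqrt]; rw [he]; exact hpos.le
  simp only [smul_eq_mul]
  field_simp
  rw [← hsq]
  ring

end Jacobian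

/-! ### The jacobian and the restriction to the boundary hyperplane -/

section HyperplaneJacobian

variable {n k : ℕ} [NeZero k]

lemma hyperplaneIncl_apply (z : EuclideanSpace ℝ {i : Fin k // i ≠ 0}) (i : Fin k) :
    hyperplaneIncl k z i = if h : i ≠ 0 then z ⟨i, h⟩ else 0 := rfl

@[simp] lemma hyperplaneIncl_apply_zero (z : EuclideanSpace ℝ {i : Fin k // i ≠ 0}) :
    hyperplaneIncl k z 0 = 0 := by
  simp [hyperplaneIncl_apply]

@[simp] lemma hyperplaneIncl_single (j : {i : Fin k // i ≠ 0}) :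
    hyperplaneIncl k (EuclideanSpace.single j 1) = EuclideanSpace.single (j : Fin k) 1 := by
  ext i
  rw [hyperplaneIncl_apply]
  split_ifs with h
  · by_cases hij : i = j
    · subst hij
      simp
    · have : (⟨i, h⟩ : {i : Fin k // i ≠ 0}) ≠ j := fun h' => hij (congrArg Subtype.val h')
      simp [hij, this]
  · have h0 : i = 0 := not_not.1 h
    subst h0
    simp [j.2.symm]

/-- The projection of `ℝᵏ` onto the hyperplane coordinates. -/
def hyperplaneProj (k : ℕ) [NeZero k] :
    EuclideanSpace ℝ (Fin k) →L[ℝ] EuclideanSpace ℝ {i : Fin k // i ≠ 0} :=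
  LinearMap.toContinuousLinearMap
    { toFun := fun y => WithLp.toLp 2 (fun i => y i.1)
      map_add' := by intro a b; ext i; simp
      map_smul' := by intro r a; ext i; simp }

@[simp] lemma hyperplaneProj_apply (y : EuclideanSpace ℝ (Fin k)) (i : {i : Fin k // i ≠ 0}) :
    hyperplaneProj k y i = y i := rfl

@[simp] lemma hyperplaneProj_incl (z : EuclideanSpace ℝ {i : Fin k // i ≠ 0}) :
    hyperplaneProj k (hyperplaneIncl k z) = z := by
  ext i
  simp [hyperplaneIncl_apply, i.2]

lemma hyperplaneIncl_proj (y : EuclideanSpace ℝ (Fin k)) :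
    hyperplaneIncl k (hyperplaneProj k y) = y - y 0 • EuclideanSpace.single 0 1 := by
  ext i
  rw [hyperplaneIncl_apply]
  split_ifs with h
  · simp [h]
  · have h0 : i = 0 := not_not.1 h
    subst h0
    simp

lemma hyperplaneIncl_injective : Function.Injective (hyperplaneIncl k) :=
  Function.LeftInverse.injective hyperplaneProj_incl

/-- Expansion of the determinant along a column with a single nonzero entry. -/
lemma det_eq_mul_of_column_zero (M : Matrix (Fin k) (Fin k) ℝ) (h : ∀ i, i ≠ 0 → M i 0 = 0) :
    M.det = M 0 0 * (Matrix.toSquareBlockProp M fun i => ¬ i = 0).det := by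
  have key : ∀ (p : Fin k → Prop) [DecidablePred p] (_ : ∀ i, p i ↔ i = 0),
      (Matrix.toSquareBlockProp M p).det = M 0 0 := by
    intro p _ hp
    have : Subsingleton {i : Fin k // p i} :=
      ⟨fun a b => Subtype.ext (((hp _).1 a.2).trans ((hp _).1 b.2).symm)⟩
    exact Matrix.det_eq_elem_of_subsingleton _ (⟨0, (hp 0).2 rfl⟩ : {i : Fin k // p i})
  rw [Matrix.twoBlockTriangular_det _ (fun i => i = 0), key _ fun i => Iff.rfl]
  intro i hi j hj
  subst hj
  exact h i hi

/-- The `k`-dimensional volume density of `L` is the `(k-1)`-dimensional volume density of its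
restriction to the hyperplane `{y | y 0 = 0}`, times the height of `L e₀` above the image of the
hyperplane. This relates the volume of `Σ` with that of its boundary. -/
lemma jac_eq_abs_inner_mul_jac (L : EuclideanSpace ℝ (Fin k) →L[ℝ] Amb n)
    (ν : Amb n) (hν : ‖ν‖ = 1)
    (hr : ν ∈ LinearMap.range (L : EuclideanSpace ℝ (Fin k) →ₗ[ℝ] Amb n))
    (ho : ∀ z, inner ℝ ν (L (hyperplaneIncl k z)) = 0) :
    jac L = |inner ℝ ν (L (EuclideanSpace.single 0 1))| * jac (L.comp (hyperplaneIncl k)) := by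
  classical
  obtain ⟨ξ, hξ'⟩ := hr
  have hξ : L ξ = ν := hξ'
  -- the endomorphism that fixes the hyperplane and sends `e₀` to the preimage `ξ` of `ν`
  set A : EuclideanSpace ℝ (Fin k) →L[ℝ] EuclideanSpace ℝ (Fin k) :=
    (hyperplaneIncl k).comp (hyperplaneProj k) +
      (EuclideanSpace.proj (0 : Fin k) : EuclideanSpace ℝ (Fin k) →L[ℝ] ℝ).smulRight ξ with hA
  have hA0 : A (EuclideanSpace.single 0 1) = ξ := by
    have : hyperplaneProj k (EuclideanSpace.single 0 1) = 0 := by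
      ext i; simp [i.2]
    simp [hA, this]
  have hAj : ∀ j : Fin k, j ≠ 0 → A (EuclideanSpace.single j 1) = EuclideanSpace.single j 1 := by
    intro j hj
    have : hyperplaneProj k (EuclideanSpace.single j 1) = EuclideanSpace.single ⟨j, hj⟩ 1 := by
      rw [← hyperplaneIncl_single ⟨j, hj⟩, hyperplaneProj_incl]
    simp [hA, this, hj.symm]
  have hdetA : A.det = ξ 0 := by
    rw [det_toMatrix_basisFun, ← Matrix.det_transpose, det_eq_mul_of_column_zero]
    · have h2 : (Matrix.toSquareBlockProp (Matrix.of fun i j =>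
          A (EuclideanSpace.single j (1 : ℝ)) i).transpose fun i => ¬ i = 0) = 1 := by
        ext i j
        change A (EuclideanSpace.single i.1 1) j.1 = _
        rw [hAj _ i.2, Matrix.one_apply]
        simp [Subtype.ext_iff, eq_comm]
      rw [h2, Matrix.det_one, mul_one]
      change A (EuclideanSpace.single 0 1) 0 = ξ 0
      rw [hA0]
    · intro j hj
      change A (EuclideanSpace.single j 1) 0 = 0
      rw [hAj j hj]
      simp [Ne.symm hj]
  have hone : ξ 0 * inner ℝ ν (L (EuclideanSpace.single 0 1)) = 1 := by
    have h1 : ξ = hyperplaneIncl k (hyperplaneProj k ξ) + ξ 0 • EuclideanSpace.single 0 1 := by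
      rw [hyperplaneIncl_proj]; abel
    have h2 : inner ℝ ν (L ξ) = 1 := by
      rw [hξ, real_inner_self_eq_norm_sq, hν]; norm_num
    rw [h1, map_add, inner_add_right, ho, zero_add, map_smul, inner_smul_right] at h2
    exact h2
  have hgram : jac (L.comp A) = jac (L.comp (hyperplaneIncl k)) := by
    rw [jac, jac, det_gram, det_gram, det_eq_mul_of_column_zero]
    · have h1 : (inner ℝ (L (A (EuclideanSpace.single 0 1)))
          (L (A (EuclideanSpace.single 0 1))) : ℝ) = 1 := by
        rw [hA0, hξ, real_inner_self_eq_norm_sq, hν]; norm_num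
      rw [Matrix.of_apply, ContinuousLinearMap.comp_apply, h1, one_mul]
      congr 2
      ext i j
      change inner ℝ (L (A (EuclideanSpace.single i.1 1))) (L (A (EuclideanSpace.single j.1 1))) =
        inner ℝ (L (hyperplaneIncl k (EuclideanSpace.single i 1)))
          (L (hyperplaneIncl k (EuclideanSpace.single j 1)))
      rw [hAj _ i.2, hAj _ j.2, hyperplaneIncl_single, hyperplaneIncl_single]
    · intro i hi
      rw [Matrix.of_apply, ContinuousLinearMap.comp_apply, ContinuousLinearMap.comp_apply, hA0, hξ,
        hAj i hi, real_inner_comm, ← hyperplaneIncl_single ⟨i, hi⟩, ho]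
  rw [← hgram, jac_comp, hdetA, ← mul_assoc, ← abs_mul, mul_comm _ (ξ 0), hone, abs_one, one_mul]

end HyperplaneJacobian

/-! ### Traces over subspaces of `ℝⁿ` -/

section Traces

variable {V : Type*} [AddCommGroup V] [Module ℝ V] {n : ℕ}

/-- The trace over an orthonormal basis of a subspace of a bilinear map is the trace over the
standard basis after inserting the orthogonal projection. -/
lemma sum_orthonormalBasis_eq {ι : Type*} [Fintype ι] (K : Submodule ℝ (Amb n))
    (b : OrthonormalBasis ι ℝ K) (β : Amb n →ₗ[ℝ] Amb n →ₗ[ℝ] V) :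
    ∑ i, β (b i) (b i) =
      ∑ a, β (K.starProjection (EuclideanSpace.single a 1)) (EuclideanSpace.single a 1) := by
  have h1 : ∀ a : Fin n, K.starProjection (EuclideanSpace.single a (1 : ℝ)) =
      ∑ i, (b i : Amb n) a • (b i : Amb n) := by
    intro a
    rw [Submodule.starProjection_apply, ← b.sum_repr (K.orthogonalProjectionOnto _),
      AddSubmonoidClass.coe_finsetSum]
    refine Finset.sum_congr rfl fun i _ => ?_
    rw [b.repr_apply_apply, Submodule.coe_smul, Submodule.coe_inner,
      ← Submodule.starProjection_apply, ← Submodule.inner_starProjection_left_eq_right,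
      Submodule.starProjection_eq_self_iff.2 (b i).2, EuclideanSpace.inner_single_right]
    simp
  have h2 : ∀ i, (b i : Amb n) = ∑ a, (b i : Amb n) a • EuclideanSpace.single a (1 : ℝ) := by
    intro i
    conv_lhs => rw [← (EuclideanSpace.basisFun (Fin n) ℝ).sum_repr (b i : Amb n)]
    simp
  simp_rw [h1, map_sum, map_smul, LinearMap.sum_apply, LinearMap.smul_apply]
  rw [Finset.sum_comm]
  refine Finset.sum_congr rfl fun i _ => ?_
  refine (congrArg (β (b i)) (h2 i)).trans ?_
  rw [map_sum]
  simp_rw [map_smul]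

/-- Under a trace, a linear map can be moved to the other argument as its adjoint. -/
lemma sum_clm_comp_left (β : Amb n →ₗ[ℝ] Amb n →ₗ[ℝ] V) (C : Amb n →L[ℝ] Amb n) :
    ∑ a, β (C (EuclideanSpace.single a 1)) (EuclideanSpace.single a 1) =
      ∑ a, β (EuclideanSpace.single a 1)
        (ContinuousLinearMap.adjoint C (EuclideanSpace.single a 1)) := by
  have h2 : ∀ u : Amb n, u = ∑ a, u a • EuclideanSpace.single a (1 : ℝ) := by
    intro u
    conv_lhs => rw [← (EuclideanSpace.basisFun (Fin n) ℝ).sum_repr u]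
    simp
  have h3 : ∀ a b : Fin n, ContinuousLinearMap.adjoint C (EuclideanSpace.single b 1) a =
      C (EuclideanSpace.single a 1) b := by
    intro a b
    have := ContinuousLinearMap.adjoint_inner_right C (EuclideanSpace.single a (1 : ℝ))
      (EuclideanSpace.single b (1 : ℝ))
    rw [EuclideanSpace.inner_single_left, EuclideanSpace.inner_single_right] at this
    simpa using this
  have h4 : ∀ a, β (C (EuclideanSpace.single a 1)) (EuclideanSpace.single a 1) =
      ∑ b, C (EuclideanSpace.single a 1) b •
        β (EuclideanSpace.single b 1) (EuclideanSpace.single a 1) := by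
    intro a
    conv_lhs => rw [h2 (C (EuclideanSpace.single a 1))]
    simp
  have h5 : ∀ b, β (EuclideanSpace.single b 1)
      (ContinuousLinearMap.adjoint C (EuclideanSpace.single b 1)) =
      ∑ a, C (EuclideanSpace.single a 1) b •
        β (EuclideanSpace.single b 1) (EuclideanSpace.single a 1) := by
    intro b
    conv_lhs => rw [h2 (ContinuousLinearMap.adjoint C (EuclideanSpace.single b 1))]
    simp [h3]
  simp_rw [h4, h5]
  rw [Finset.sum_comm]

end Traces

/-! ### Differentiation in charts -/

section ChartCalculus

variable {n k : ℕ} [NeZero k] {M : Type*} [TopologicalSpace M]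
  [ChartedSpace (EuclideanHalfSpace k) M]
  {F : Type*} [NormedAddCommGroup F] [NormedSpace ℝ F]

lemma mem_range_halfSpace_iff {y : EuclideanSpace ℝ (Fin k)} :
    y ∈ Set.range (𝓡∂ k) ↔ 0 ≤ y 0 := by
  rw [range_modelWithCornersEuclideanHalfSpace]; rfl

lemma uniqueDiffWithinAt_range {y : EuclideanSpace ℝ (Fin k)} (hy : y ∈ Set.range (𝓡∂ k)) :
    UniqueDiffWithinAt ℝ (Set.range (𝓡∂ k)) y := (𝓡∂ k).uniqueDiffOn y hy

lemma extend_target_mem_nhdsWithin' {c : OpenPartialHomeomorph M (EuclideanHalfSpace k)}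
    {y : EuclideanSpace ℝ (Fin k)} (hy : y ∈ (c.extend (𝓡∂ k)).target) :
    (c.extend (𝓡∂ k)).target ∈ nhdsWithin y (Set.range (𝓡∂ k)) := by
  have h1 : (c.extend (𝓡∂ k)).symm y ∈ c.source := by
    rw [← c.extend_source (I := 𝓡∂ k)]
    exact (c.extend (𝓡∂ k)).map_target hy
  have := c.extend_target_mem_nhdsWithin (I := 𝓡∂ k) h1
  rwa [(c.extend (𝓡∂ k)).right_inv hy] at this

lemma range_of_mem_extend_target {c : OpenPartialHomeomorph M (EuclideanHalfSpace k)}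
    {y : EuclideanSpace ℝ (Fin k)} (hy : y ∈ (c.extend (𝓡∂ k)).target) :
    y ∈ Set.range (𝓡∂ k) := c.extend_target_subset_range hy

lemma uniqueDiffOn_extend_target (c : OpenPartialHomeomorph M (EuclideanHalfSpace k)) :
    UniqueDiffOn ℝ (c.extend (𝓡∂ k)).target := by
  rw [c.extend_target]
  exact (𝓡∂ k).uniqueDiffOn_preimage c.open_target

lemma diff_eq_fderivWithin {f : M → F} {p : M} (hf : MDifferentiableAt (𝓡∂ k) 𝓘(ℝ, F) f p) :
    diff k f p = fderivWithin ℝ (f ∘ (extChartAt (𝓡∂ k) p).symm) (Set.range (𝓡∂ k))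
      (extChartAt (𝓡∂ k) p p) := by
  have : mfderiv (𝓡∂ k) 𝓘(ℝ, F) f p = fderivWithin ℝ (f ∘ (extChartAt (𝓡∂ k) p).symm)
      (Set.range (𝓡∂ k)) (extChartAt (𝓡∂ k) p p) := by
    exact hf.mfderiv
  exact this

/-- The expression of `f` in the chart `c`, as a function on the image of the chart in `ℝᵏ`. -/
def inChart (c : OpenPartialHomeomorph M (EuclideanHalfSpace k)) (f : M → F) :
    EuclideanSpace ℝ (Fin k) → F := f ∘ (c.extend (𝓡∂ k)).symm

lemma inChart_extend {c : OpenPartialHomeomorph M (EuclideanHalfSpace k)} (f : M → F) {p : M}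
    (hp : p ∈ c.source) : inChart c f (c.extend (𝓡∂ k) p) = f p := by
  rw [inChart, Function.comp_apply, c.extend_left_inv hp]

lemma extend_mem_target {c : OpenPartialHomeomorph M (EuclideanHalfSpace k)} {p : M}
    (hp : p ∈ c.source) : c.extend (𝓡∂ k) p ∈ (c.extend (𝓡∂ k)).target :=
  (c.extend (𝓡∂ k)).map_source (by rwa [c.extend_source])

variable [IsManifold (𝓡∂ k) ∞ M]

lemma contDiffOn_inChart {c : OpenPartialHomeomorph M (EuclideanHalfSpace k)}
    (hc : c ∈ atlas (EuclideanHalfSpace k) M) {f : M → F}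
    (hf : ContMDiff (𝓡∂ k) 𝓘(ℝ, F) ∞ f) :
    ContDiffOn ℝ ∞ (inChart c f) (c.extend (𝓡∂ k)).target := by
  rw [← contMDiffOn_iff_contDiffOn, c.extend_target']
  exact hf.comp_contMDiffOn
    (contMDiffOn_extend_symm (IsManifold.subset_maximalAtlas (I := 𝓡∂ k) (n := ∞) hc))

lemma contDiffWithinAt_inChart {c : OpenPartialHomeomorph M (EuclideanHalfSpace k)}
    (hc : c ∈ atlas (EuclideanHalfSpace k) M) {f : M → F}
    (hf : ContMDiff (𝓡∂ k) 𝓘(ℝ, F) ∞ f) {y : EuclideanSpace ℝ (Fin k)}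
    (hy : y ∈ (c.extend (𝓡∂ k)).target) :
    ContDiffWithinAt ℝ ∞ (inChart c f) (Set.range (𝓡∂ k)) y :=
  (contDiffOn_inChart hc hf y hy).mono_of_mem_nhdsWithin (extend_target_mem_nhdsWithin' hy)

lemma differentiableWithinAt_inChart {c : OpenPartialHomeomorph M (EuclideanHalfSpace k)}
    (hc : c ∈ atlas (EuclideanHalfSpace k) M) {f : M → F}
    (hf : ContMDiff (𝓡∂ k) 𝓘(ℝ, F) ∞ f) {y : EuclideanSpace ℝ (Fin k)}
    (hy : y ∈ (c.extend (𝓡∂ k)).target) :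
    DifferentiableWithinAt ℝ (inChart c f) (Set.range (𝓡∂ k)) y :=
  (contDiffWithinAt_inChart hc hf hy).differentiableWithinAt (by simp)

lemma contDiffOn_fderivWithin_range {c : OpenPartialHomeomorph M (EuclideanHalfSpace k)}
    {g : EuclideanSpace ℝ (Fin k) → F} (hg : ContDiffOn ℝ ∞ g (c.extend (𝓡∂ k)).target) :
    ContDiffOn ℝ ∞ (fun y => fderivWithin ℝ g (Set.range (𝓡∂ k)) y) (c.extend (𝓡∂ k)).target := by
  refine (hg.fderivWithin (uniqueDiffOn_extend_target c) (m := ∞) (by simp)).congr fun y hy => ?_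
  have h1 : nhdsWithin y (Set.range (𝓡∂ k)) = nhdsWithin y (c.extend (𝓡∂ k)).target :=
    le_antisymm (nhdsWithin_le_iff.2 (extend_target_mem_nhdsWithin' hy))
      (nhdsWithin_mono _ c.extend_target_subset_range)
  exact fderivWithin_congr_set (nhdsWithin_eq_iff_eventuallyEq.1 h1)

/-- The derivative of the coordinate change from the preferred chart at `p` to the chart `c`. -/
def coordChange (c : OpenPartialHomeomorph M (EuclideanHalfSpace k)) (p : M) :
    EuclideanSpace ℝ (Fin k) →L[ℝ] EuclideanSpace ℝ (Fin k) :=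
  fderivWithin ℝ (c.extend (𝓡∂ k) ∘ (extChartAt (𝓡∂ k) p).symm) (Set.range (𝓡∂ k))
    (extChartAt (𝓡∂ k) p p)

/-- The differential of `f`, defined in the preferred chart at `p`, in an arbitrary chart around `p`. -/
lemma diff_eq_comp_coordChange {c : OpenPartialHomeomorph M (EuclideanHalfSpace k)}
    (hc : c ∈ atlas (EuclideanHalfSpace k) M) {f : M → F}
    (hf : ContMDiff (𝓡∂ k) 𝓘(ℝ, F) ∞ f) {p : M} (hp : p ∈ c.source) :
    diff k f p = (fderivWithin ℝ (inChart c f) (Set.range (𝓡∂ k)) (c.extend (𝓡∂ k) p)).comp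
      (coordChange c p) := by
  have hp0 : p ∈ (chartAt (EuclideanHalfSpace k) p).source := mem_chart_source _ p
  rw [diff_eq_fderivWithin (hf.mdifferentiableAt (by simp)), coordChange]
  have hsymm : (extChartAt (𝓡∂ k) p).symm (extChartAt (𝓡∂ k) p p) = p :=
    extChartAt_to_inv p
  have hy : extChartAt (𝓡∂ k) p p ∈ Set.range (𝓡∂ k) :=
    extChartAt_target_subset_range p (mem_extChartAt_target p)
  have hnear : ∀ᶠ y in nhdsWithin (extChartAt (𝓡∂ k) p p) (Set.range (𝓡∂ k)),
      (extChartAt (𝓡∂ k) p).symm y ∈ c.source := by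
    have h1 : ContinuousAt (extChartAt (𝓡∂ k) p).symm (extChartAt (𝓡∂ k) p p) :=
      continuousAt_extChartAt_symm p
    have h2 : c.source ∈ nhds ((extChartAt (𝓡∂ k) p).symm (extChartAt (𝓡∂ k) p p)) := by
      rw [hsymm]; exact c.open_source.mem_nhds hp
    exact (h1.eventually h2).filter_mono nhdsWithin_le_nhds
  have heq : f ∘ (extChartAt (𝓡∂ k) p).symm =ᶠ[nhdsWithin (extChartAt (𝓡∂ k) p p)
      (Set.range (𝓡∂ k))] inChart c f ∘ (c.extend (𝓡∂ k) ∘ (extChartAt (𝓡∂ k) p).symm) := by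
    filter_upwards [hnear] with y hy
    simp only [Function.comp_apply]
    exact (inChart_extend f hy).symm
  rw [heq.fderivWithin_eq (by
    simp only [Function.comp_apply, hsymm]
    exact (inChart_extend f hp).symm)]
  have hd2 : DifferentiableWithinAt ℝ (c.extend (𝓡∂ k) ∘ (extChartAt (𝓡∂ k) p).symm)
      (Set.range (𝓡∂ k)) (extChartAt (𝓡∂ k) p p) := by
    have := ModelWithCorners.contDiffWithinAt_extendCoordChange (𝕜 := ℝ) (n := ∞)
      (I := 𝓡∂ k) (e := chartAt (EuclideanHalfSpace k) p) (e' := c) (x := extChartAt (𝓡∂ k) p p)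
      (IsManifold.chart_mem_maximalAtlas p) (IsManifold.subset_maximalAtlas hc) (by
        rw [PartialEquiv.trans_source, PartialEquiv.symm_source]
        refine ⟨mem_extChartAt_target p, ?_⟩
        rw [Set.mem_preimage, c.extend_source]
        change (extChartAt (𝓡∂ k) p).symm (extChartAt (𝓡∂ k) p p) ∈ _
        rwa [hsymm])
    exact this.differentiableWithinAt (by simp)
  have hval : (c.extend (𝓡∂ k) ∘ (extChartAt (𝓡∂ k) p).symm) (extChartAt (𝓡∂ k) p p) =
      c.extend (𝓡∂ k) p := by rw [Function.comp_apply, hsymm]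
  have hd1 : DifferentiableWithinAt ℝ (inChart c f) (Set.range (𝓡∂ k))
      ((c.extend (𝓡∂ k) ∘ (extChartAt (𝓡∂ k) p).symm) (extChartAt (𝓡∂ k) p p)) := by
    rw [hval]
    exact differentiableWithinAt_inChart hc hf (extend_mem_target hp)
  rw [fderivWithin_comp _ hd1 hd2 (fun y _ => by
    rw [Function.comp_apply, c.extend_coe]
    exact ⟨_, rfl⟩) (uniqueDiffWithinAt_range hy), hval]

variable (x : Immersion k n M) {c : OpenPartialHomeomorph M (EuclideanHalfSpace k)}

lemma dx_eq_chartDiff_comp (hc : c ∈ atlas (EuclideanHalfSpace k) M) {p : M}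
    (hp : p ∈ c.source) :
    x.dx p = (chartDiff x c (c.extend (𝓡∂ k) p)).comp (coordChange c p) :=
  diff_eq_comp_coordChange hc x.smooth hp

lemma coordChange_bijective (x : Immersion k n M) (hc : c ∈ atlas (EuclideanHalfSpace k) M) {p : M}
    (hp : p ∈ c.source) : Function.Bijective (coordChange c p) := by
  have hinj : Function.Injective (coordChange c p) := by
    have h := x.immersive p
    change Function.Injective (x.dx p) at h
    rw [dx_eq_chartDiff_comp x hc hp] at h
    exact Function.Injective.of_comp h
  exact ⟨hinj, (LinearMap.injective_iff_surjective
    (f := (coordChange c p : EuclideanSpace ℝ (Fin k) →ₗ[ℝ] EuclideanSpace ℝ (Fin k)))).1 hinj⟩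

lemma chartDiff_injective (hc : c ∈ atlas (EuclideanHalfSpace k) M)
    {y : EuclideanSpace ℝ (Fin k)} (hy : y ∈ (c.extend (𝓡∂ k)).target) :
    Function.Injective (chartDiff x c y) := by
  have hp : (c.extend (𝓡∂ k)).symm y ∈ c.source := by
    rw [← c.extend_source (I := 𝓡∂ k)]
    exact (c.extend (𝓡∂ k)).map_target hy
  have h := x.immersive ((c.extend (𝓡∂ k)).symm y)
  change Function.Injective (x.dx _) at h
  rw [dx_eq_chartDiff_comp x hc hp, (c.extend (𝓡∂ k)).right_inv hy] at h
  exact Function.Injective.of_comp_right h (coordChange_bijective x hc hp).2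

/-- The tangential derivative can be computed in any chart. -/
lemma tanDeriv_eq (hc : c ∈ atlas (EuclideanHalfSpace k) M) {f : M → F}
    (hf : ContMDiff (𝓡∂ k) 𝓘(ℝ, F) ∞ f) {p : M} (hp : p ∈ c.source) :
    tanDeriv x f p = (fderivWithin ℝ (inChart c f) (Set.range (𝓡∂ k)) (c.extend (𝓡∂ k) p)).comp
      (pinv (chartDiff x c (c.extend (𝓡∂ k) p))) := by
  ext u
  have h1 : pullVec x p = pinv (x.dx p) := rfl
  rw [tanDeriv, h1, diff_eq_comp_coordChange hc hf hp, ContinuousLinearMap.comp_apply,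
    ContinuousLinearMap.comp_apply, ContinuousLinearMap.comp_apply, dx_eq_chartDiff_comp x hc hp,
    apply_pinv_comp _ _ (chartDiff_injective x hc (extend_mem_target hp))
      (coordChange_bijective x hc hp)]

lemma tangentPlane_eq (hc : c ∈ atlas (EuclideanHalfSpace k) M) {p : M} (hp : p ∈ c.source) :
    tangentPlane x p = LinearMap.range (chartDiff x c (c.extend (𝓡∂ k) p) :
      EuclideanSpace ℝ (Fin k) →ₗ[ℝ] Amb n) := by
  rw [tangentPlane, dx_eq_chartDiff_comp x hc hp]
  ext w
  constructor
  · rintro ⟨ξ, rfl⟩; exact ⟨_, rfl⟩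
  · rintro ⟨ξ, rfl⟩
    obtain ⟨η, rfl⟩ := (coordChange_bijective x hc hp).2 ξ
    exact ⟨η, rfl⟩

lemma tanProj_eq (hc : c ∈ atlas (EuclideanHalfSpace k) M) {p : M} (hp : p ∈ c.source) :
    tanProj x p = (chartDiff x c (c.extend (𝓡∂ k) p)).comp
      (pinv (chartDiff x c (c.extend (𝓡∂ k) p))) := by
  ext1 u
  rw [ContinuousLinearMap.comp_apply,
    apply_pinv _ (chartDiff_injective x hc (extend_mem_target hp)), tanProj]
  simp only [tangentPlane_eq x hc hp]

lemma contDiffOn_chartDiff (hc : c ∈ atlas (EuclideanHalfSpace k) M) :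
    ContDiffOn ℝ ∞ (chartDiff x c) (c.extend (𝓡∂ k)).target :=
  contDiffOn_fderivWithin_range (contDiffOn_inChart hc x.smooth)

lemma contDiffOn_pinv_chartDiff (hc : c ∈ atlas (EuclideanHalfSpace k) M) :
    ContDiffOn ℝ ∞ (fun y => pinv (chartDiff x c y)) (c.extend (𝓡∂ k)).target := fun y hy =>
  ((contDiffAt_pinv _ (chartDiff_injective x hc hy)).comp_contDiffWithinAt y
    (contDiffOn_chartDiff x hc y hy))

lemma contDiffOn_jac_chartDiff (hc : c ∈ atlas (EuclideanHalfSpace k) M) :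
    ContDiffOn ℝ ∞ (fun y => jac (chartDiff x c y)) (c.extend (𝓡∂ k)).target := fun y hy =>
  ((contDiffAt_jac _ (chartDiff_injective x hc hy)).comp_contDiffWithinAt y
    (contDiffOn_chartDiff x hc y hy))

lemma contMDiffAt_of_inChart {f : M → F} (p : M)
    (hf : ContDiffWithinAt ℝ ∞ (inChart (chartAt (EuclideanHalfSpace k) p) f) (Set.range (𝓡∂ k))
      (extChartAt (𝓡∂ k) p p)) : ContMDiffAt (𝓡∂ k) 𝓘(ℝ, F) ∞ f p := by
  have h1 : ContMDiffWithinAt (𝓡∂ k) 𝓘(ℝ, F) ∞ (inChart (chartAt (EuclideanHalfSpace k) p) f ∘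
      extChartAt (𝓡∂ k) p) Set.univ p := by
    refine ContMDiffWithinAt.comp (t := Set.range (𝓡∂ k)) p hf.contMDiffWithinAt
      (contMDiffAt_extChartAt (n := ∞)).contMDiffWithinAt fun q _ => ?_
    exact ⟨_, rfl⟩
  rw [contMDiffWithinAt_univ] at h1
  refine h1.congr_of_eventuallyEq ?_
  filter_upwards [(chartAt (EuclideanHalfSpace k) p).open_source.mem_nhds (mem_chart_source _ p)]
    with q hq
  exact (inChart_extend f hq).symm

/-- Smoothness can be tested in the charts of the atlas. -/
lemma contMDiff_of_inChart {f : M → F} (hf : ∀ c ∈ atlas (EuclideanHalfSpace k) M,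
    ContDiffOn ℝ ∞ (inChart c f) (c.extend (𝓡∂ k)).target) : ContMDiff (𝓡∂ k) 𝓘(ℝ, F) ∞ f := by
  intro p
  apply contMDiffAt_of_inChart
  have h2 : extChartAt (𝓡∂ k) p p ∈ ((chartAt (EuclideanHalfSpace k) p).extend (𝓡∂ k)).target :=
    mem_extChartAt_target p
  exact (hf _ (chart_mem_atlas _ p) _ h2).mono_of_mem_nhdsWithin (extend_target_mem_nhdsWithin' h2)

lemma symm_mem_source {y : EuclideanSpace ℝ (Fin k)} (hy : y ∈ (c.extend (𝓡∂ k)).target) :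
    (c.extend (𝓡∂ k)).symm y ∈ c.source := by
  rw [← c.extend_source (I := 𝓡∂ k)]
  exact (c.extend (𝓡∂ k)).map_target hy

lemma inChart_tanDeriv (hc : c ∈ atlas (EuclideanHalfSpace k) M) {f : M → F}
    (hf : ContMDiff (𝓡∂ k) 𝓘(ℝ, F) ∞ f) {y : EuclideanSpace ℝ (Fin k)}
    (hy : y ∈ (c.extend (𝓡∂ k)).target) :
    inChart c (tanDeriv x f) y = (fderivWithin ℝ (inChart c f) (Set.range (𝓡∂ k)) y).comp
      (pinv (chartDiff x c y)) := by
  rw [inChart, Function.comp_apply, tanDeriv_eq x hc hf (symm_mem_source hy),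
    (c.extend (𝓡∂ k)).right_inv hy]

lemma contMDiff_tanDeriv {f : M → F} (hf : ContMDiff (𝓡∂ k) 𝓘(ℝ, F) ∞ f) :
    ContMDiff (𝓡∂ k) 𝓘(ℝ, Amb n →L[ℝ] F) ∞ (tanDeriv x f) :=
  contMDiff_of_inChart fun _ hc =>
    ((contDiffOn_fderivWithin_range (contDiffOn_inChart hc hf)).clm_comp
      (contDiffOn_pinv_chartDiff x hc)).congr fun _ hy => inChart_tanDeriv x hc hf hy

lemma contMDiff_tanProj : ContMDiff (𝓡∂ k) 𝓘(ℝ, Amb n →L[ℝ] Amb n) ∞ (tanProj x) :=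
  contMDiff_of_inChart fun _ hc =>
    ((contDiffOn_chartDiff x hc).clm_comp (contDiffOn_pinv_chartDiff x hc)).congr fun y hy => by
      rw [inChart, Function.comp_apply, tanProj_eq x hc (symm_mem_source hy),
        PartialEquiv.right_inv _ hy]

/-! ### Rules of calculus for the tangential derivative -/

lemma tanDeriv_toFun (p : M) : tanDeriv x x.toFun p = tanProj x p := by
  rw [tanDeriv_eq x (chart_mem_atlas _ p) x.smooth (mem_chart_source _ p),
    tanProj_eq x (chart_mem_atlas _ p) (mem_chart_source _ p)]
  rfl

lemma tanDeriv_tanProj (f : M → F) (p : M) (u : Amb n) :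
    tanDeriv x f p (tanProj x p u) = tanDeriv x f p u := by
  have h1 : tanProj x p u = x.dx p (pinv (x.dx p) u) :=
    (apply_pinv (x.dx p) (x.immersive p) u).symm
  have h2 : pullVec x p = pinv (x.dx p) := rfl
  rw [tanDeriv, ContinuousLinearMap.comp_apply, ContinuousLinearMap.comp_apply, h1, h2,
    pinv_apply_apply (x.dx p) (x.immersive p)]

variable {F₁ F₂ : Type*} [NormedAddCommGroup F₁] [NormedSpace ℝ F₁]
  [NormedAddCommGroup F₂] [NormedSpace ℝ F₂]

lemma tanDeriv_of_hasFDerivWithinAt {f : M → F} (hf : ContMDiff (𝓡∂ k) 𝓘(ℝ, F) ∞ f) {p : M}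
    {f' : EuclideanSpace ℝ (Fin k) →L[ℝ] F}
    (h : HasFDerivWithinAt (inChart (chartAt (EuclideanHalfSpace k) p) f) f' (Set.range (𝓡∂ k))
      (extChartAt (𝓡∂ k) p p)) :
    tanDeriv x f p = f'.comp (pullVec x p) := by
  rw [tanDeriv, diff_eq_fderivWithin (hf.mdifferentiableAt (by simp))]
  congr 1
  exact h.fderivWithin (uniqueDiffWithinAt_range
    (extChartAt_target_subset_range p (mem_extChartAt_target p)))

lemma hasFDerivWithinAt_inChart {f : M → F} (hf : ContMDiff (𝓡∂ k) 𝓘(ℝ, F) ∞ f) (p : M) :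
    HasFDerivWithinAt (inChart (chartAt (EuclideanHalfSpace k) p) f) (diff k f p)
      (Set.range (𝓡∂ k)) (extChartAt (𝓡∂ k) p p) := by
  rw [diff_eq_fderivWithin (hf.mdifferentiableAt (by simp))]
  exact (differentiableWithinAt_inChart (chart_mem_atlas _ p) hf
    (mem_extChartAt_target p)).hasFDerivWithinAt

/-- The Leibniz rule. -/
lemma tanDeriv_bilin (B : F₁ →L[ℝ] F₂ →L[ℝ] F) {f : M → F₁} {g : M → F₂}
    (hf : ContMDiff (𝓡∂ k) 𝓘(ℝ, F₁) ∞ f) (hg : ContMDiff (𝓡∂ k) 𝓘(ℝ, F₂) ∞ g) (p : M)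
    (u : Amb n) :
    tanDeriv x (fun q => B (f q) (g q)) p u =
      B (tanDeriv x f p u) (g p) + B (f p) (tanDeriv x g p u) := by
  have hB : ContMDiff (𝓡∂ k) 𝓘(ℝ, F) ∞ (fun q => B (f q) (g q)) :=
    (B.contMDiff.comp hf).clm_apply hg
  have h := B.hasFDerivWithinAt_of_bilinear (hasFDerivWithinAt_inChart hf p)
    (hasFDerivWithinAt_inChart hg p)
  rw [tanDeriv_of_hasFDerivWithinAt x hB h]
  have e1 : inChart (chartAt (EuclideanHalfSpace k) p) f (extChartAt (𝓡∂ k) p p) = f p :=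
    inChart_extend f (mem_chart_source _ p)
  have e2 : inChart (chartAt (EuclideanHalfSpace k) p) g (extChartAt (𝓡∂ k) p p) = g p :=
    inChart_extend g (mem_chart_source _ p)
  simp only [ContinuousLinearMap.comp_apply, _root_.add_apply, ContinuousLinearMap.precompR_apply,
    ContinuousLinearMap.precompL_apply, e1, e2, tanDeriv]
  exact add_comm _ _

lemma tanDeriv_const (a : F) (p : M) : tanDeriv x (fun _ => a) p = 0 := by
  rw [tanDeriv_of_hasFDerivWithinAt x contMDiff_const (hasFDerivWithinAt_const a _ _)]
  simp

lemma tanDeriv_add {f g : M → F} (hf : ContMDiff (𝓡∂ k) 𝓘(ℝ, F) ∞ f)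
    (hg : ContMDiff (𝓡∂ k) 𝓘(ℝ, F) ∞ g) (p : M) :
    tanDeriv x (fun q => f q + g q) p = tanDeriv x f p + tanDeriv x g p := by
  rw [tanDeriv_of_hasFDerivWithinAt x (f := fun q => f q + g q) (hf.add hg)
    ((hasFDerivWithinAt_inChart hf p).add (hasFDerivWithinAt_inChart hg p))]
  rfl

lemma tanDeriv_sub {f g : M → F} (hf : ContMDiff (𝓡∂ k) 𝓘(ℝ, F) ∞ f)
    (hg : ContMDiff (𝓡∂ k) 𝓘(ℝ, F) ∞ g) (p : M) :
    tanDeriv x (fun q => f q - g q) p = tanDeriv x f p - tanDeriv x g p := by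
  rw [tanDeriv_of_hasFDerivWithinAt x (f := fun q => f q - g q) (hf.sub hg)
    ((hasFDerivWithinAt_inChart hf p).sub (hasFDerivWithinAt_inChart hg p))]
  rfl

lemma tanDeriv_sum {ι : Type*} (s : Finset ι) {f : ι → M → F}
    (hf : ∀ i ∈ s, ContMDiff (𝓡∂ k) 𝓘(ℝ, F) ∞ (f i)) (p : M) :
    tanDeriv x (fun q => ∑ i ∈ s, f i q) p = ∑ i ∈ s, tanDeriv x (f i) p := by
  classical
  induction s using Finset.induction_on with
  | empty => simpa using tanDeriv_const x (0 : F) p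
  | insert a s ha ih =>
    simp_rw [Finset.sum_insert ha]
    rw [tanDeriv_add x (hf a (Finset.mem_insert_self a s))
      (contMDiff_finsetSum fun i hi => hf i (Finset.mem_insert_of_mem hi)),
      ih fun i hi => hf i (Finset.mem_insert_of_mem hi)]

/-- The chain rule with a function of one variable. -/
lemma tanDeriv_comp_real {h : ℝ → ℝ} (hh : ContDiff ℝ ∞ h) {f : M → ℝ}
    (hf : ContMDiff (𝓡∂ k) 𝓘(ℝ, ℝ) ∞ f) (p : M) (u : Amb n) :
    tanDeriv x (fun q => h (f q)) p u = deriv h (f p) * tanDeriv x f p u := by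
  have h1 : HasDerivAt h (deriv h (inChart (chartAt (EuclideanHalfSpace k) p) f
      (extChartAt (𝓡∂ k) p p))) (inChart (chartAt (EuclideanHalfSpace k) p) f
      (extChartAt (𝓡∂ k) p p)) := (hh.differentiable (by simp) _).hasDerivAt
  have h2 := h1.comp_hasFDerivWithinAt _ (hasFDerivWithinAt_inChart hf p)
  rw [tanDeriv_of_hasFDerivWithinAt x (f := fun q => h (f q)) (hh.contMDiff.comp hf) h2]
  have e1 : inChart (chartAt (EuclideanHalfSpace k) p) f (extChartAt (𝓡∂ k) p p) = f p :=
    inChart_extend f (mem_chart_source _ p)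
  rw [e1]
  simp [tanDeriv]

/-- The second tangential derivative is symmetric on tangent vectors: in a chart it is the second
derivative of `f` minus a term with the second derivative of the immersion. -/
lemma tanDeriv_tanDeriv_comm {f : M → F} (hf : ContMDiff (𝓡∂ k) 𝓘(ℝ, F) ∞ f) (p : M)
    {a b : Amb n} (ha : a ∈ tangentPlane x p) (hb : b ∈ tangentPlane x p) :
    tanDeriv x (tanDeriv x f) p a b = tanDeriv x (tanDeriv x f) p b a := by
  set c := chartAt (EuclideanHalfSpace k) p
  have hc : c ∈ atlas (EuclideanHalfSpace k) M := chart_mem_atlas _ p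
  have hp : p ∈ c.source := mem_chart_source _ p
  set y := c.extend (𝓡∂ k) p with hy'
  have hy : y ∈ (c.extend (𝓡∂ k)).target := extend_mem_target hp
  have hyr := range_of_mem_extend_target hy
  have hu := uniqueDiffWithinAt_range hyr
  have hL := chartDiff_injective x hc hy
  rw [tangentPlane_eq x hc hp] at ha hb
  obtain ⟨α, rfl⟩ := ha
  obtain ⟨β, rfl⟩ := hb
  rw [ContinuousLinearMap.coe_coe, ← hy']
  have hcl : y ∈ closure (interior (Set.range (𝓡∂ k))) := (𝓡∂ k).range_subset_closure_interior hyr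
  have h2top : minSmoothness ℝ 2 ≤ (∞ : WithTop ℕ∞) := by
    rw [minSmoothness_of_isRCLikeNormedField]
    exact WithTop.coe_le_coe.2 le_top
  have hsf := (contDiffWithinAt_inChart hc hf hy).isSymmSndFDerivWithinAt h2top
    (𝓡∂ k).uniqueDiffOn hcl hyr
  have hsx := (contDiffWithinAt_inChart hc x.smooth hy).isSymmSndFDerivWithinAt h2top
    (𝓡∂ k).uniqueDiffOn hcl hyr
  -- the derivative of the Moore–Penrose inverse, along the image of `L`
  have hDR : DifferentiableWithinAt ℝ (fun y => pinv (chartDiff x c y)) (Set.range (𝓡∂ k)) y :=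
    ((contDiffOn_pinv_chartDiff x hc y hy).mono_of_mem_nhdsWithin
      (extend_target_mem_nhdsWithin' hy)).differentiableWithinAt (by simp)
  have hDL : DifferentiableWithinAt ℝ (chartDiff x c) (Set.range (𝓡∂ k)) y :=
    ((contDiffOn_chartDiff x hc y hy).mono_of_mem_nhdsWithin
      (extend_target_mem_nhdsWithin' hy)).differentiableWithinAt (by simp)
  have hDf : DifferentiableWithinAt ℝ (fun y => fderivWithin ℝ (inChart c f) (Set.range (𝓡∂ k)) y)
      (Set.range (𝓡∂ k)) y :=
    ((contDiffOn_fderivWithin_range (contDiffOn_inChart hc hf) y hy).mono_of_mem_nhdsWithin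
      (extend_target_mem_nhdsWithin' hy)).differentiableWithinAt (by simp)
  have hRL : ∀ ξ ζ, fderivWithin ℝ (fun y => pinv (chartDiff x c y)) (Set.range (𝓡∂ k)) y ξ
      (chartDiff x c y ζ) = - pinv (chartDiff x c y)
        (fderivWithin ℝ (chartDiff x c) (Set.range (𝓡∂ k)) y ξ ζ) := by
    intro ξ ζ
    have h1 := hDR.hasFDerivWithinAt.clm_apply
      (hDL.hasFDerivWithinAt.clm_apply (hasFDerivWithinAt_const (𝕜 := ℝ) ζ y (Set.range (𝓡∂ k))))
    have h2 : (fun y' => pinv (chartDiff x c y') (chartDiff x c y' ζ)) =ᶠ[nhdsWithin y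
        (Set.range (𝓡∂ k))] fun _ => ζ := by
      filter_upwards [extend_target_mem_nhdsWithin' hy] with y' hy'
      exact pinv_apply_apply _ (chartDiff_injective x hc hy') ζ
    have h3 := (hasFDerivWithinAt_const (𝕜 := ℝ) ζ y (Set.range (𝓡∂ k))).congr_of_eventuallyEq h2
      (pinv_apply_apply _ hL ζ)
    have h4 := DFunLike.congr_fun (UniqueDiffWithinAt.eq hu h1 h3) ξ
    simp only [_root_.add_apply, ContinuousLinearMap.comp_apply, ContinuousLinearMap.flip_apply,
      _root_.zero_apply, map_zero, zero_add] at h4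
    rw [eq_neg_iff_add_eq_zero, add_comm]
    exact h4
  have key : ∀ ξ ζ, tanDeriv x (tanDeriv x f) p (chartDiff x c y ξ) (chartDiff x c y ζ) =
      fderivWithin ℝ (fderivWithin ℝ (inChart c f) (Set.range (𝓡∂ k))) (Set.range (𝓡∂ k)) y ξ ζ -
      fderivWithin ℝ (inChart c f) (Set.range (𝓡∂ k)) y (pinv (chartDiff x c y)
        (fderivWithin ℝ (chartDiff x c) (Set.range (𝓡∂ k)) y ξ ζ)) := by
    intro ξ ζ
    rw [tanDeriv_eq x hc (contMDiff_tanDeriv x hf) hp, ContinuousLinearMap.comp_apply,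
      pinv_apply_apply _ hL]
    have h1 := hDf.hasFDerivWithinAt.clm_comp hDR.hasFDerivWithinAt
    have h2 : inChart c (tanDeriv x f) =ᶠ[nhdsWithin y (Set.range (𝓡∂ k))] fun y' =>
        (fderivWithin ℝ (inChart c f) (Set.range (𝓡∂ k)) y').comp (pinv (chartDiff x c y')) := by
      filter_upwards [extend_target_mem_nhdsWithin' hy] with y' hy'
      exact inChart_tanDeriv x hc hf hy'
    rw [h2.fderivWithin_eq (inChart_tanDeriv x hc hf hy), h1.fderivWithin hu]
    simp only [_root_.add_apply, ContinuousLinearMap.comp_apply, ContinuousLinearMap.compL_apply,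
      ContinuousLinearMap.flip_apply, pinv_apply_apply _ hL, hRL, map_neg]
    rw [neg_add_eq_sub]
  have hx2 : ∀ ξ ζ, fderivWithin ℝ (chartDiff x c) (Set.range (𝓡∂ k)) y ξ ζ =
      fderivWithin ℝ (chartDiff x c) (Set.range (𝓡∂ k)) y ζ ξ := fun ξ ζ => hsx ξ ζ
  change tanDeriv x (tanDeriv x f) p (chartDiff x c y α) (chartDiff x c y β) =
    tanDeriv x (tanDeriv x f) p (chartDiff x c y β) (chartDiff x c y α)
  rw [key, key, hx2 α β, hsf α β]

end ChartCalculus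

/-! ### The second fundamental form and the Jacobi operator -/

/-- The standard basis vectors of the ambient space. Traces over tangent planes are written as sums
over this basis, so that no smooth local frames are needed. -/
abbrev bv {n : ℕ} (a : Fin n) : Amb n := EuclideanSpace.single a (1 : ℝ)

section Tangential

variable {n k : ℕ} [NeZero k] {M : Type*} [TopologicalSpace M]
  [ChartedSpace (EuclideanHalfSpace k) M] (x : Immersion k n M)

lemma sum_coord_smul_bv (u : Amb n) : ∑ a, u a • bv a = u := by
  conv_rhs => rw [← (EuclideanSpace.basisFun (Fin n) ℝ).sum_repr u]
  simp

lemma sum_inner_smul_bv (u : Amb n) : ∑ a, (inner ℝ u (bv a) : ℝ) • bv a = u := by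
  conv_rhs => rw [← sum_coord_smul_bv u]
  refine Finset.sum_congr rfl fun a _ => ?_
  rw [EuclideanSpace.inner_single_right]
  simp

lemma tanProj_mem (p : M) (u : Amb n) : tanProj x p u ∈ tangentPlane x p :=
  Submodule.starProjection_apply_mem _ u

lemma tanProj_eq_self_iff {p : M} {u : Amb n} : tanProj x p u = u ↔ u ∈ tangentPlane x p :=
  Submodule.starProjection_eq_self_iff

@[simp] lemma tanProj_tanProj (p : M) (u : Amb n) : tanProj x p (tanProj x p u) = tanProj x p u :=
  (tanProj_eq_self_iff x).2 (tanProj_mem x p u)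

lemma inner_tanProj_left (p : M) (u w : Amb n) :
    inner ℝ (tanProj x p u) w = inner ℝ u (tanProj x p w) :=
  Submodule.inner_starProjection_left_eq_right _ u w

lemma adjoint_tanProj (p : M) : ContinuousLinearMap.adjoint (tanProj x p) = tanProj x p := by
  ext1 u
  refine ext_inner_left ℝ fun w => ?_
  rw [ContinuousLinearMap.adjoint_inner_right, inner_tanProj_left]

lemma norProj_apply (p : M) (u : Amb n) : norProj x p u = u - tanProj x p u := by
  change (tangentPlane x p)ᗮ.starProjection u = _
  rw [tanProj, Submodule.starProjection_orthogonal]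
  simp

lemma mem_normalSpace_iff {p : M} {u : Amb n} : u ∈ normalSpace x p ↔ tanProj x p u = 0 := by
  rw [tanProj, Submodule.starProjection_apply_eq_zero_iff, normalSpace]

lemma norProj_mem (p : M) (u : Amb n) : norProj x p u ∈ normalSpace x p := by
  rw [mem_normalSpace_iff, norProj_apply, map_sub, tanProj_tanProj, sub_self]

lemma norProj_eq_self {p : M} {u : Amb n} (hu : u ∈ normalSpace x p) : norProj x p u = u := by
  rw [norProj_apply, (mem_normalSpace_iff x).1 hu, sub_zero]

@[simp] lemma norProj_tanProj (p : M) (u : Amb n) : norProj x p (tanProj x p u) = 0 := by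
  rw [norProj_apply, tanProj_tanProj, sub_self]

lemma inner_norProj_left (p : M) (u w : Amb n) :
    inner ℝ (norProj x p u) w = inner ℝ u (norProj x p w) :=
  Submodule.inner_starProjection_left_eq_right _ u w

/-- A trace over the orthonormal frame of the tangent plane, over the standard basis of `ℝⁿ`. -/
lemma sum_tanFrame {V : Type*} [AddCommGroup V] [Module ℝ V] (p : M)
    (β : Amb n →ₗ[ℝ] Amb n →ₗ[ℝ] V) :
    ∑ i, β (tanFrame x p i) (tanFrame x p i) = ∑ a, β (tanProj x p (bv a)) (bv a) :=
  sum_orthonormalBasis_eq (tangentPlane x p) (stdOrthonormalBasis ℝ (tangentPlane x p)) β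

lemma sum_tanProj_left {V : Type*} [AddCommGroup V] [Module ℝ V] (p : M)
    (β : Amb n →ₗ[ℝ] Amb n →ₗ[ℝ] V) :
    ∑ a, β (tanProj x p (bv a)) (bv a) = ∑ a, β (bv a) (tanProj x p (bv a)) := by
  rw [sum_clm_comp_left, adjoint_tanProj]

/-- The algebraic bilinear map underlying a continuous one. -/
abbrev toBilin {V : Type*} [NormedAddCommGroup V] [NormedSpace ℝ V]
    (β : Amb n →L[ℝ] Amb n →L[ℝ] V) : Amb n →ₗ[ℝ] Amb n →ₗ[ℝ] V :=
  (ContinuousLinearMap.coeLM ℝ).comp (β : Amb n →ₗ[ℝ] Amb n →L[ℝ] V)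

lemma sum_tanFrame_clm {V : Type*} [NormedAddCommGroup V] [NormedSpace ℝ V] (p : M)
    (β : Amb n →L[ℝ] Amb n →L[ℝ] V) :
    ∑ i, β (tanFrame x p i) (tanFrame x p i) = ∑ a, β (tanProj x p (bv a)) (bv a) :=
  sum_tanFrame x p (toBilin β)

lemma sum_tanProj_left_clm {V : Type*} [NormedAddCommGroup V] [NormedSpace ℝ V] (p : M)
    (β : Amb n →L[ℝ] Amb n →L[ℝ] V) :
    ∑ a, β (tanProj x p (bv a)) (bv a) = ∑ a, β (bv a) (tanProj x p (bv a)) :=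
  sum_tanProj_left x p (toBilin β)

/-- The trace of the projection onto a tangent plane is the dimension `k`. -/
lemma sum_inner_tanProj_bv (p : M) :
    ∑ a, (inner ℝ (tanProj x p (bv a)) (bv a) : ℝ) = k := by
  have h0 : ∑ i, (inner ℝ (tanFrame x p i) (tanFrame x p i) : ℝ) =
      ∑ a, (inner ℝ (tanProj x p (bv a)) (bv a) : ℝ) := sum_tanFrame_clm x p (innerSL ℝ (E := Amb n))
  rw [← h0]
  have h1 : ∀ i, (inner ℝ (tanFrame x p i) (tanFrame x p i) : ℝ) = 1 := by
    intro i
    rw [real_inner_self_eq_norm_sq]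
    have : ‖tanFrame x p i‖ = 1 :=
      (stdOrthonormalBasis ℝ (tangentPlane x p)).orthonormal.1 i
    rw [this]; norm_num
  rw [Finset.sum_congr rfl fun i _ => h1 i]
  have h2 : Module.finrank ℝ (tangentPlane x p) = k := by
    have hi : Function.Injective (x.dx p : EuclideanSpace ℝ (Fin k) →ₗ[ℝ] Amb n) := x.immersive p
    rw [tangentPlane, LinearMap.finrank_range_of_inj hi]
    simp
  simp [h2]

variable [IsManifold (𝓡∂ k) ∞ M]

lemma contMDiff_norProj : ContMDiff (𝓡∂ k) 𝓘(ℝ, Amb n →L[ℝ] Amb n) ∞ (norProj x) := by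
  have h : norProj x = fun p => ContinuousLinearMap.id ℝ (Amb n) - tanProj x p := by
    funext p; ext1 u; simp [norProj_apply]
  rw [h]
  exact contMDiff_const.sub (contMDiff_tanProj x)

/-- The derivative `B_u = D_u P` of the orthogonal projection `P` onto the tangent planes. Each `B_u`
is a symmetric operator that exchanges tangent and normal vectors, and `B_u w = σ(u, w)` for
tangent `u` and `w`. -/
def dProj (p : M) : Amb n →L[ℝ] Amb n →L[ℝ] Amb n := tanDeriv x (tanProj x) p

lemma contMDiff_dProj : ContMDiff (𝓡∂ k) 𝓘(ℝ, Amb n →L[ℝ] Amb n →L[ℝ] Amb n) ∞ (dProj x) :=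
  contMDiff_tanDeriv x (contMDiff_tanProj x)

lemma dProj_tanProj_left (p : M) (u : Amb n) : dProj x p (tanProj x p u) = dProj x p u :=
  tanDeriv_tanProj x _ p u

lemma tanDeriv_clm_apply {F G : Type*} [NormedAddCommGroup F] [NormedSpace ℝ F]
    [NormedAddCommGroup G] [NormedSpace ℝ G] {T : M → F →L[ℝ] G} {f : M → F}
    (hT : ContMDiff (𝓡∂ k) 𝓘(ℝ, F →L[ℝ] G) ∞ T) (hf : ContMDiff (𝓡∂ k) 𝓘(ℝ, F) ∞ f) (p : M)
    (u : Amb n) : tanDeriv x (fun q => T q (f q)) p u =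
      tanDeriv x T p u (f p) + T p (tanDeriv x f p u) :=
  tanDeriv_bilin x (ContinuousLinearMap.id ℝ (F →L[ℝ] G)) hT hf p u

lemma tanDeriv_clm_apply_const {F G : Type*} [NormedAddCommGroup F] [NormedSpace ℝ F]
    [NormedAddCommGroup G] [NormedSpace ℝ G] {T : M → F →L[ℝ] G}
    (hT : ContMDiff (𝓡∂ k) 𝓘(ℝ, F →L[ℝ] G) ∞ T) (w : F) (p : M)
    (u : Amb n) : tanDeriv x (fun q => T q w) p u = tanDeriv x T p u w := by
  rw [tanDeriv_clm_apply x hT contMDiff_const, tanDeriv_const]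
  simp

lemma tanDeriv_smul {F : Type*} [NormedAddCommGroup F] [NormedSpace ℝ F] {g : M → ℝ} {f : M → F}
    (hg : ContMDiff (𝓡∂ k) 𝓘(ℝ, ℝ) ∞ g) (hf : ContMDiff (𝓡∂ k) 𝓘(ℝ, F) ∞ f) (p : M)
    (u : Amb n) : tanDeriv x (fun q => g q • f q) p u =
      tanDeriv x g p u • f p + g p • tanDeriv x f p u :=
  tanDeriv_bilin x (ContinuousLinearMap.lsmul ℝ ℝ) hg hf p u

lemma tanDeriv_inner {f g : M → Amb n} (hf : ContMDiff (𝓡∂ k) 𝓘(ℝ, Amb n) ∞ f)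
    (hg : ContMDiff (𝓡∂ k) 𝓘(ℝ, Amb n) ∞ g) (p : M) (u : Amb n) :
    tanDeriv x (fun q => (inner ℝ (f q) (g q) : ℝ)) p u =
      inner ℝ (tanDeriv x f p u) (g p) + inner ℝ (f p) (tanDeriv x g p u) :=
  tanDeriv_bilin x (innerSL ℝ) hf hg p u

lemma contMDiff_inner {f g : M → Amb n} (hf : ContMDiff (𝓡∂ k) 𝓘(ℝ, Amb n) ∞ f)
    (hg : ContMDiff (𝓡∂ k) 𝓘(ℝ, Amb n) ∞ g) :
    ContMDiff (𝓡∂ k) 𝓘(ℝ, ℝ) ∞ (fun q => (inner ℝ (f q) (g q) : ℝ)) :=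
  ((innerSL ℝ (E := Amb n)).contMDiff.comp hf).clm_apply hg

lemma tanDeriv_tanProj_apply {f : M → Amb n} (hf : ContMDiff (𝓡∂ k) 𝓘(ℝ, Amb n) ∞ f) (p : M)
    (u : Amb n) : tanDeriv x (fun q => tanProj x q (f q)) p u =
      dProj x p u (f p) + tanProj x p (tanDeriv x f p u) :=
  tanDeriv_clm_apply x (contMDiff_tanProj x) hf p u

lemma tanDeriv_norProj_apply {f : M → Amb n} (hf : ContMDiff (𝓡∂ k) 𝓘(ℝ, Amb n) ∞ f) (p : M)
    (u : Amb n) : tanDeriv x (fun q => norProj x q (f q)) p u =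
      norProj x p (tanDeriv x f p u) - dProj x p u (f p) := by
  have h : (fun q => norProj x q (f q)) = fun q => f q - tanProj x q (f q) := by
    funext q; rw [norProj_apply]
  rw [h, tanDeriv_sub x hf ((contMDiff_tanProj x).clm_apply hf), _root_.sub_apply,
    tanDeriv_tanProj_apply x hf, norProj_apply]
  abel

/-- The derivative of the identity `P P = P`. -/
lemma dProj_idem (p : M) (u w : Amb n) :
    dProj x p u (tanProj x p w) + tanProj x p (dProj x p u w) = dProj x p u w := by
  have h1 := tanDeriv_tanProj_apply x (f := fun q => tanProj x q w)
    ((contMDiff_tanProj x).clm_apply contMDiff_const) p u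
  simp only [tanProj_tanProj] at h1
  rw [tanDeriv_clm_apply_const x (contMDiff_tanProj x)] at h1
  exact h1.symm

lemma inner_dProj_left (p : M) (u w z : Amb n) :
    inner ℝ (dProj x p u w) z = inner ℝ w (dProj x p u z) := by
  have hw : ∀ w : Amb n, ContMDiff (𝓡∂ k) 𝓘(ℝ, Amb n) ∞ (fun q => tanProj x q w) := fun w =>
    (contMDiff_tanProj x).clm_apply contMDiff_const
  have h1 := tanDeriv_inner x (hw w) (contMDiff_const (c := z)) p u
  have h2 := tanDeriv_inner x (contMDiff_const (c := w)) (hw z) p u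
  simp only [inner_tanProj_left] at h1
  rw [h2] at h1
  simpa [tanDeriv_const, tanDeriv_clm_apply_const x (contMDiff_tanProj x), dProj] using h1.symm

/-- Symmetry of the second fundamental form. Both sides are second derivatives of the immersion,
because the derivative of `x` is `P`. -/
lemma dProj_comm (p : M) (u w : Amb n) :
    dProj x p u (tanProj x p w) = dProj x p w (tanProj x p u) := by
  have h : tanDeriv x x.toFun = tanProj x := funext fun p => tanDeriv_toFun x p
  have h1 := tanDeriv_tanDeriv_comm x x.smooth p (tanProj_mem x p u) (tanProj_mem x p w)
  rw [h] at h1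
  change dProj x p _ _ = dProj x p _ _ at h1
  rwa [dProj_tanProj_left, dProj_tanProj_left] at h1

lemma tanProj_dProj_tanProj (p : M) (u w : Amb n) :
    tanProj x p (dProj x p u (tanProj x p w)) = 0 := by
  have := dProj_idem x p u (tanProj x p w)
  rw [tanProj_tanProj] at this
  simpa using this

lemma norProj_dProj (p : M) (u w : Amb n) :
    norProj x p (dProj x p u w) = dProj x p u (tanProj x p w) := by
  rw [norProj_apply, sub_eq_iff_eq_add, dProj_idem]

lemma tanProj_dProj (p : M) (u w : Amb n) :
    tanProj x p (dProj x p u w) = dProj x p u (norProj x p w) := by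
  rw [norProj_apply, map_sub, eq_sub_iff_add_eq, add_comm, dProj_idem]

/-- `B_u B_u w` has normal part `B_u B_u w^⊥`. -/
lemma norProj_dProj_dProj (p : M) (u z w : Amb n) :
    norProj x p (dProj x p u (dProj x p z w)) = dProj x p u (dProj x p z (norProj x p w)) := by
  rw [norProj_dProj, tanProj_dProj]

lemma sff_eq (p : M) (a b : Amb n) : sff x p a b = dProj x p a (tanProj x p b) := by
  rw [sff, tanDeriv_clm_apply_const x (contMDiff_tanProj x)]
  exact norProj_dProj x p a b

/-- The mean curvature as a trace over the standard basis. -/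
lemma sum_dProj_bv_tanProj (hH : ∀ p, meanCurv x p = 0) (p : M) :
    ∑ a, dProj x p (bv a) (tanProj x p (bv a)) = 0 := by
  have h1 := hH p
  rw [meanCurv] at h1
  simp_rw [sff_eq] at h1
  have h2 := sum_tanFrame_clm x p
    (((ContinuousLinearMap.compL ℝ (Amb n) (Amb n) (Amb n)).flip (tanProj x p)).comp (dProj x p))
  simp only [ContinuousLinearMap.comp_apply, ContinuousLinearMap.flip_apply,
    ContinuousLinearMap.compL_apply, dProj_tanProj_left] at h2
  rw [← h2, h1]

/-- In the minimal case the divergence `∑ₐ D_a(P εₐ)` of the projection onto the tangent planes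
vanishes, where `εₐ` are the standard basis vectors. -/
lemma sum_dProj_bv (hH : ∀ p, meanCurv x p = 0) (p : M) : ∑ a, dProj x p (bv a) (bv a) = 0 := by
  have h1 : ∑ a, tanProj x p (dProj x p (bv a) (bv a)) = 0 := by
    have h2 := sum_tanProj_left_clm x p
      ((ContinuousLinearMap.compL ℝ (Amb n) (Amb n) (Amb n) (tanProj x p)).comp (dProj x p))
    simp only [ContinuousLinearMap.comp_apply, ContinuousLinearMap.compL_apply,
      dProj_tanProj_left, tanProj_dProj_tanProj] at h2
    simpa using h2
  have h3 := sum_dProj_bv_tanProj x hH p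
  calc ∑ a, dProj x p (bv a) (bv a)
      = ∑ a, (dProj x p (bv a) (tanProj x p (bv a)) + tanProj x p (dProj x p (bv a) (bv a))) :=
        Finset.sum_congr rfl fun a _ => (dProj_idem x p _ _).symm
    _ = 0 := by rw [Finset.sum_add_distrib, h1, h3, add_zero]

lemma tanDiv_eq (X : M → Amb n) (p : M) :
    tanDiv x X p = ∑ a, inner ℝ (tanDeriv x X p (bv a)) (bv a) := by
  have h := sum_tanFrame_clm x p ((innerSL ℝ (E := Amb n)).comp (tanDeriv x X p))
  simp only [ContinuousLinearMap.comp_apply, innerSL_apply_apply, tanDeriv_tanProj] at h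
  exact h

/-- The Simons operator is `∑ₐ B_a B_a` on normal vectors. -/
lemma simons_eq {p : M} {w : Amb n} (hw : w ∈ normalSpace x p) :
    simons x p w = ∑ a, dProj x p (bv a) (dProj x p (bv a) w) := by
  have h1 : ∀ u : Amb n, ∑ j, (inner ℝ (sff x p u (tanFrame x p j)) w : ℝ) •
      sff x p u (tanFrame x p j) = dProj x p u (dProj x p u w) := by
    intro u
    have h2 := sum_tanFrame_clm x p
      (((ContinuousLinearMap.lsmul ℝ ℝ).flip.comp ((dProj x p u).comp (tanProj x p))).flip.comp
        ((innerSL ℝ w).comp ((dProj x p u).comp (tanProj x p))))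
    simp only [ContinuousLinearMap.comp_apply, ContinuousLinearMap.flip_apply,
      ContinuousLinearMap.lsmul_apply, innerSL_apply_apply, tanProj_tanProj] at h2
    simp_rw [sff_eq, real_inner_comm w]
    rw [h2]
    have h3 : ∀ a, inner ℝ w (dProj x p u (tanProj x p (bv a))) =
        (inner ℝ (tanProj x p (dProj x p u w)) (bv a) : ℝ) := by
      intro a
      rw [inner_tanProj_left, inner_dProj_left]
    have h4 : tanProj x p (dProj x p u w) = dProj x p u w := by
      rw [tanProj_dProj, norProj_eq_self x hw]
    simp_rw [h3, h4, ← map_smul]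
    rw [← map_sum, ← map_sum, sum_inner_smul_bv, h4]
  rw [simons]
  simp_rw [h1]
  have h5 := sum_tanFrame_clm x p (((ContinuousLinearMap.compL ℝ (Amb n) (Amb n) (Amb n)).flip
    ((dProj x p).flip w)).comp (dProj x p))
  simp only [ContinuousLinearMap.comp_apply, ContinuousLinearMap.flip_apply,
    ContinuousLinearMap.compL_apply, dProj_tanProj_left] at h5
  rw [h5]

lemma contMDiff_norDeriv {W : M → Amb n} (hW : ContMDiff (𝓡∂ k) 𝓘(ℝ, Amb n) ∞ W) :
    ContMDiff (𝓡∂ k) 𝓘(ℝ, Amb n →L[ℝ] Amb n) ∞ (norDeriv x W) :=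
  (contMDiff_norProj x).clm_comp (contMDiff_tanDeriv x hW)

lemma norDeriv_apply (W : M → Amb n) (p : M) (u : Amb n) :
    norDeriv x W p u = norProj x p (tanDeriv x W p u) := rfl

lemma norDeriv_tanProj (W : M → Amb n) (p : M) (u : Amb n) :
    norDeriv x W p (tanProj x p u) = norDeriv x W p u := by
  rw [norDeriv_apply, tanDeriv_tanProj, norDeriv_apply]

/-- In the minimal case the correction term `D^⊥_{(D_a B)^⊤} W` of the second covariant derivative
drops out of the Laplacian. -/
lemma norLaplacian_eq (hH : ∀ p, meanCurv x p = 0) {W : M → Amb n}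
    (hW : ContMDiff (𝓡∂ k) 𝓘(ℝ, Amb n) ∞ W) (p : M) :
    norLaplacian x W p =
      -∑ a, norProj x p (tanDeriv x (fun q => norDeriv x W q (bv a)) p (bv a)) := by
  rw [norLaplacian]
  congr 1
  have h1 : ∀ a b, norHess x W p a b = norProj x p (tanDeriv x (norDeriv x W) p a b) -
      norDeriv x W p (dProj x p a b) := by
    intro a b
    rw [norHess, norDeriv_tanProj]
    simp_rw [norDeriv_tanProj]
    rw [norDeriv_apply, tanDeriv_clm_apply_const x (contMDiff_norDeriv x hW),
      tanDeriv_clm_apply_const x (contMDiff_tanProj x)]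
    rfl
  simp_rw [h1, tanDeriv_clm_apply_const x (contMDiff_norDeriv x hW)]
  rw [Finset.sum_sub_distrib]
  have h2 := sum_tanFrame_clm x p (dProj x p)
  simp only [dProj_tanProj_left, sum_dProj_bv x hH] at h2
  rw [← map_sum (norDeriv x W p), h2, map_zero, sub_zero]
  have h3 := sum_tanFrame_clm x p ((ContinuousLinearMap.compL ℝ (Amb n) (Amb n) (Amb n)
    (norProj x p)).comp (tanDeriv x (norDeriv x W) p))
  simpa only [ContinuousLinearMap.comp_apply, ContinuousLinearMap.compL_apply,
    tanDeriv_tanProj] using h3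

/-- The traced Codazzi equation of a minimal submanifold: the normal part of `(∑ₐ D_a D_a P) w`
vanishes for tangent `w`. -/
lemma norProj_sum_tanDeriv_dProj (hH : ∀ p, meanCurv x p = 0) (p : M) (w : Amb n) :
    norProj x p (∑ a, tanDeriv x (dProj x) p (bv a) (bv a) (tanProj x p w)) = 0 := by
  set w' := tanProj x p w with hw'
  have hB := contMDiff_dProj x
  have hP := contMDiff_tanProj x
  -- differentiate the symmetry of the second fundamental form
  have h1 : ∀ a : Fin n, tanDeriv x (dProj x) p (bv a) (bv a) w' +
      dProj x p (bv a) (dProj x p (bv a) w') =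
      tanDeriv x (dProj x) p (bv a) w' (tanProj x p (bv a)) +
        dProj x p w' (dProj x p (bv a) (bv a)) := by
    intro a
    have e : (fun q => dProj x q (bv a) (tanProj x q w')) =
        fun q => dProj x q w' (tanProj x q (bv a)) := funext fun q => dProj_comm x q _ _
    have e2 : tanDeriv x (fun q => dProj x q (bv a) (tanProj x q w')) p (bv a) =
      tanDeriv x (fun q => dProj x q w' (tanProj x q (bv a))) p (bv a) := by rw [e]
    rw [tanDeriv_clm_apply x (hB.clm_apply contMDiff_const) (hP.clm_apply contMDiff_const),
      tanDeriv_clm_apply x (hB.clm_apply contMDiff_const) (hP.clm_apply contMDiff_const),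
      tanDeriv_clm_apply_const x hB, tanDeriv_clm_apply_const x hB,
      tanDeriv_clm_apply_const x hP, tanDeriv_clm_apply_const x hP, hw', tanProj_tanProj] at e2
    exact e2
  have h2 : ∑ a, tanDeriv x (dProj x) p (bv a) (bv a) w' =
      ∑ a, tanDeriv x (dProj x) p (bv a) w' (tanProj x p (bv a)) -
      ∑ a, dProj x p (bv a) (dProj x p (bv a) w') := by
    rw [eq_sub_iff_add_eq, ← Finset.sum_add_distrib, Finset.sum_congr rfl fun a _ => h1 a,
      Finset.sum_add_distrib, ← map_sum, sum_dProj_bv x hH, map_zero, add_zero]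
  -- exchange the two derivatives of `P`
  have h3 : ∑ a, tanDeriv x (dProj x) p (bv a) w' (tanProj x p (bv a)) =
      ∑ a, tanDeriv x (dProj x) p w' (bv a) (tanProj x p (bv a)) := by
    have e1 : ∀ a : Fin n, tanDeriv x (dProj x) p (bv a) w' =
        tanDeriv x (dProj x) p w' (tanProj x p (bv a)) := by
      intro a
      rw [← tanDeriv_tanProj]
      exact tanDeriv_tanDeriv_comm x hP p (tanProj_mem x p _) (tanProj_mem x p w)
    simp_rw [e1]
    have e2 := sum_tanProj_left_clm x p
      (((ContinuousLinearMap.compL ℝ (Amb n) (Amb n) (Amb n)).flip (tanProj x p)).comp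
        (tanDeriv x (dProj x) p w'))
    simpa only [ContinuousLinearMap.comp_apply, ContinuousLinearMap.flip_apply,
      ContinuousLinearMap.compL_apply, tanProj_tanProj] using e2
  -- differentiate the vanishing of the mean curvature
  have h4 : ∑ a, tanDeriv x (dProj x) p w' (bv a) (tanProj x p (bv a)) +
      ∑ a, dProj x p (bv a) (dProj x p w' (bv a)) = 0 := by
    have e : (fun q => ∑ a, dProj x q (bv a) (tanProj x q (bv a))) = fun _ => (0 : Amb n) :=
      funext fun q => sum_dProj_bv_tanProj x hH q
    have e2 : tanDeriv x (fun q => ∑ a, dProj x q (bv a) (tanProj x q (bv a))) p w' = 0 := by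
      rw [e, tanDeriv_const]; rfl
    rw [tanDeriv_sum x _ fun a _ => (hB.clm_apply contMDiff_const).clm_apply
      (hP.clm_apply contMDiff_const), _root_.sum_apply] at e2
    rw [← Finset.sum_add_distrib, ← e2]
    refine Finset.sum_congr rfl fun a _ => ?_
    rw [tanDeriv_clm_apply x (hB.clm_apply contMDiff_const) (hP.clm_apply contMDiff_const),
      tanDeriv_clm_apply_const x hB, tanDeriv_clm_apply_const x hP]
    rfl
  -- the remaining second order terms in `B` have no normal part
  have h5 : ∑ a, norProj x p (dProj x p (bv a) (dProj x p w' (bv a))) = 0 := by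
    have e2 := sum_tanProj_left_clm x p
      (((ContinuousLinearMap.compL ℝ (Amb n) (Amb n) (Amb n)).flip
        ((tanProj x p).comp (dProj x p w'))).comp (dProj x p))
    simp only [ContinuousLinearMap.comp_apply, ContinuousLinearMap.flip_apply,
      ContinuousLinearMap.compL_apply, dProj_tanProj_left, tanProj_dProj_tanProj] at e2
    simp_rw [norProj_dProj]
    rw [e2]
    simp
  have h6 : ∑ a, norProj x p (dProj x p (bv a) (dProj x p (bv a) w')) = 0 := by
    refine Finset.sum_eq_zero fun a _ => ?_
    rw [norProj_dProj_dProj, hw', norProj_tanProj, map_zero, map_zero]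
  rw [h2, h3, eq_neg_of_add_eq_zero_left h4, map_sub, map_neg, map_sum, map_sum, h5, h6]
  simp

end Tangential

/-! ### Translations and the position vector as Jacobi fields -/

section JacobiFields

variable {n k : ℕ} [NeZero k] {M : Type*} [TopologicalSpace M]
  [ChartedSpace (EuclideanHalfSpace k) M] [IsManifold (𝓡∂ k) ∞ M] (x : Immersion k n M)

lemma sum_inner_smul_clm {V : Type*} [NormedAddCommGroup V] [NormedSpace ℝ V]
    (β : Amb n →L[ℝ] Amb n →L[ℝ] V) (u z : Amb n) :
    ∑ a, (inner ℝ u (bv a) : ℝ) • β (bv a) z = β u z := by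
  conv_rhs => rw [← sum_inner_smul_bv u, map_sum, _root_.sum_apply]
  refine Finset.sum_congr rfl fun a _ => ?_
  rw [map_smul, _root_.smul_apply]

lemma norDeriv_smul {g : M → ℝ} {W : M → Amb n} (hg : ContMDiff (𝓡∂ k) 𝓘(ℝ, ℝ) ∞ g)
    (hW : IsNormalField x W) (p : M) (u : Amb n) :
    norDeriv x (fun q => g q • W q) p u =
      tanDeriv x g p u • W p + g p • norDeriv x W p u := by
  rw [norDeriv_apply, tanDeriv_smul x hg hW.1, map_add, map_smul, map_smul,
    norProj_eq_self x (hW.2 p), norDeriv_apply]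

lemma norDeriv_sub {V W : M → Amb n} (hV : ContMDiff (𝓡∂ k) 𝓘(ℝ, Amb n) ∞ V)
    (hW : ContMDiff (𝓡∂ k) 𝓘(ℝ, Amb n) ∞ W) (p : M) (u : Amb n) :
    norDeriv x (fun q => V q - W q) p u = norDeriv x V p u - norDeriv x W p u := by
  rw [norDeriv_apply, tanDeriv_sub x hV hW, _root_.sub_apply, map_sub, norDeriv_apply,
    norDeriv_apply]

/-- The Leibniz rule `Δ^⊥(gW) = g Δ^⊥W - 2 D^⊥_{∇g} W - (tr ∇²g) W`, with the nonnegative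
Laplacian `Δ^⊥`. -/
lemma norLaplacian_smul (hH : ∀ p, meanCurv x p = 0) {g : M → ℝ} {W : M → Amb n}
    (hg : ContMDiff (𝓡∂ k) 𝓘(ℝ, ℝ) ∞ g) (hW : IsNormalField x W) (p : M) :
    norLaplacian x (fun q => g q • W q) p = g p • norLaplacian x W p -
      (2 : ℝ) • ∑ a, tanDeriv x g p (bv a) • norDeriv x W p (bv a) -
      (∑ a, tanDeriv x (fun q => tanDeriv x g q (bv a)) p (bv a)) • W p := by
  have hDg : ∀ a : Fin n, ContMDiff (𝓡∂ k) 𝓘(ℝ, ℝ) ∞ (fun q => tanDeriv x g q (bv a)) := fun a =>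
    (contMDiff_tanDeriv x hg).clm_apply contMDiff_const
  have hDW : ∀ a : Fin n, ContMDiff (𝓡∂ k) 𝓘(ℝ, Amb n) ∞ (fun q => norDeriv x W q (bv a)) :=
    fun a => (contMDiff_norDeriv x hW.1).clm_apply contMDiff_const
  rw [norLaplacian_eq x hH (W := fun q => g q • W q) (hg.smul hW.1), norLaplacian_eq x hH hW.1, smul_neg, Finset.smul_sum,
    Finset.smul_sum, Finset.sum_smul, ← sub_eq_zero]
  have h1 : ∀ a : Fin n, norProj x p (tanDeriv x (fun q => norDeriv x (fun q => g q • W q) q (bv a))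
      p (bv a)) = tanDeriv x (fun q => tanDeriv x g q (bv a)) p (bv a) • W p +
        (2 : ℝ) • (tanDeriv x g p (bv a) • norDeriv x W p (bv a)) +
        g p • norProj x p (tanDeriv x (fun q => norDeriv x W q (bv a)) p (bv a)) := by
    intro a
    simp_rw [norDeriv_smul x hg hW]
    rw [tanDeriv_add x (f := fun q => tanDeriv x g q (bv a) • W q)
      (g := fun q => g q • norDeriv x W q (bv a)) ((hDg a).smul hW.1) (hg.smul (hDW a)), _root_.add_apply,
      tanDeriv_smul x (hDg a) hW.1, tanDeriv_smul x hg (hDW a)]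
    simp only [map_add, map_smul, norProj_eq_self x (hW.2 p)]
    rw [norProj_eq_self x (show norDeriv x W p (bv a) ∈ normalSpace x p from norProj_mem x p _),
      ← norDeriv_apply,
      two_smul]
    abel
  simp_rw [h1]
  simp only [Finset.sum_add_distrib]
  abel

lemma norLaplacian_sub (hH : ∀ p, meanCurv x p = 0) {V W : M → Amb n}
    (hV : ContMDiff (𝓡∂ k) 𝓘(ℝ, Amb n) ∞ V) (hW : ContMDiff (𝓡∂ k) 𝓘(ℝ, Amb n) ∞ W) (p : M) :
    norLaplacian x (fun q => V q - W q) p = norLaplacian x V p - norLaplacian x W p := by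
  rw [norLaplacian_eq x hH (hV.sub hW), norLaplacian_eq x hH hV, norLaplacian_eq x hH hW]
  simp_rw [norDeriv_sub x hV hW]
  have h : ∀ (W : M → Amb n) (_ : ContMDiff (𝓡∂ k) 𝓘(ℝ, Amb n) ∞ W) (a : Fin n),
      ContMDiff (𝓡∂ k) 𝓘(ℝ, Amb n) ∞ (fun q => norDeriv x W q (bv a)) :=
    fun W hW a => (contMDiff_norDeriv x hW).clm_apply contMDiff_const
  simp_rw [fun a => tanDeriv_sub x (h V hV a) (h W hW a) p, _root_.sub_apply, map_sub,
    Finset.sum_sub_distrib]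
  abel

lemma simons_smul (g : ℝ) (p : M) (w : Amb n) : simons x p (g • w) = g • simons x p w := by
  simp_rw [simons, inner_smul_right, Finset.smul_sum, mul_smul]

lemma simons_sub (p : M) (w z : Amb n) :
    simons x p (w - z) = simons x p w - simons x p z := by
  simp_rw [simons, inner_sub_right, sub_smul, Finset.sum_sub_distrib]

lemma isNormalField_norPart (v : Amb n) : IsNormalField x (norPart x v) :=
  ⟨(contMDiff_norProj x).clm_apply contMDiff_const, fun p => norProj_mem x p v⟩

lemma tanDeriv_norPart (v : Amb n) (p : M) (u : Amb n) :
    tanDeriv x (norPart x v) p u = -dProj x p u v := by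
  have h := tanDeriv_norProj_apply x (contMDiff_const (c := v)) p u
  rw [tanDeriv_const, _root_.zero_apply, map_zero, zero_sub] at h
  exact h

lemma norDeriv_norPart (v : Amb n) (p : M) (u : Amb n) :
    norDeriv x (norPart x v) p u = -dProj x p u (tanProj x p v) := by
  rw [norDeriv_apply, tanDeriv_norPart, map_neg, norProj_dProj]

/-- If `W = Y^⊥` with `D^⊥_u W = -B_u Y^⊤` and `∑ₐ B_a (D_a Y)^⊤ = 0`, then `W` satisfies the Jacobi
equation. Constant vectors and the position vector are such fields `Y`, as translations and
dilations preserve minimality. -/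
lemma norLaplacian_eq_simons_of (hH : ∀ p, meanCurv x p = 0) {Y W : M → Amb n}
    (hY : ContMDiff (𝓡∂ k) 𝓘(ℝ, Amb n) ∞ Y) (hW : ContMDiff (𝓡∂ k) 𝓘(ℝ, Amb n) ∞ W)
    (hWY : ∀ p, W p = norProj x p (Y p))
    (hD : ∀ p u, norDeriv x W p u = -dProj x p u (tanProj x p (Y p)))
    (hYB : ∀ p, ∑ a, dProj x p (bv a) (tanProj x p (tanDeriv x Y p (bv a))) = 0) (p : M) :
    norLaplacian x W p = simons x p (W p) := by
  have hB := contMDiff_dProj x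
  have hP := contMDiff_tanProj x
  have hWn : W p ∈ normalSpace x p := by rw [hWY]; exact norProj_mem x p _
  rw [norLaplacian_eq x hH hW, simons_eq x hWn]
  have h1 : ∀ a : Fin n, norProj x p (tanDeriv x (fun q => norDeriv x W q (bv a)) p (bv a)) =
      -(norProj x p (tanDeriv x (dProj x) p (bv a) (bv a) (tanProj x p (Y p))) +
        dProj x p (bv a) (dProj x p (bv a) (W p)) +
        dProj x p (bv a) (tanProj x p (tanDeriv x Y p (bv a)))) := by
    intro a
    have e : (fun q => norDeriv x W q (bv a)) =
        fun q => (0 : Amb n) - dProj x q (bv a) (tanProj x q (Y q)) :=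
      funext fun q => by rw [hD, zero_sub]
    rw [e, tanDeriv_sub x contMDiff_const ((hB.clm_apply contMDiff_const).clm_apply
      (hP.clm_apply hY)), tanDeriv_const, _root_.sub_apply, _root_.zero_apply, zero_sub,
      tanDeriv_clm_apply x (hB.clm_apply contMDiff_const) (hP.clm_apply hY),
      tanDeriv_clm_apply_const x hB, tanDeriv_tanProj_apply x hY, map_neg, map_add, map_add,
      map_add, norProj_dProj_dProj, ← hWY, norProj_dProj, tanProj_tanProj, add_assoc]
  simp_rw [h1]
  rw [Finset.sum_neg_distrib, neg_neg, Finset.sum_add_distrib, Finset.sum_add_distrib, hYB,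
    ← map_sum, norProj_sum_tanDeriv_dProj x hH]
  simp

/-- The field `v^⊥` satisfies the Jacobi equation. -/
lemma norLaplacian_norPart (hH : ∀ p, meanCurv x p = 0) (v : Amb n) (p : M) :
    norLaplacian x (norPart x v) p = simons x p (norPart x v p) :=
  norLaplacian_eq_simons_of x hH contMDiff_const (isNormalField_norPart x v).1 (fun _ => rfl)
    (norDeriv_norPart x v) (fun p => by simp [tanDeriv_const]) p

/-- The normal part `x^⊥` of the position vector. -/
def posNor (p : M) : Amb n := norProj x p (x.toFun p)

lemma isNormalField_posNor : IsNormalField x (posNor x) :=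
  ⟨(contMDiff_norProj x).clm_apply x.smooth, fun p => norProj_mem x p _⟩

lemma tanDeriv_posNor (p : M) (u : Amb n) :
    tanDeriv x (posNor x) p u = -dProj x p u (x.toFun p) := by
  have h := tanDeriv_norProj_apply x x.smooth p u
  rw [tanDeriv_toFun, norProj_tanProj, zero_sub] at h
  exact h

lemma norDeriv_posNor (p : M) (u : Amb n) :
    norDeriv x (posNor x) p u = -dProj x p u (tanProj x p (x.toFun p)) := by
  rw [norDeriv_apply, tanDeriv_posNor, map_neg, norProj_dProj]

/-- The field `x^⊥` satisfies the Jacobi equation. -/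
lemma norLaplacian_posNor (hH : ∀ p, meanCurv x p = 0) (p : M) :
    norLaplacian x (posNor x) p = simons x p (posNor x p) :=
  norLaplacian_eq_simons_of x hH x.smooth (isNormalField_posNor x).1 (fun _ => rfl)
    (norDeriv_posNor x) (fun p => by
      simp only [tanDeriv_toFun, tanProj_tanProj]
      exact sum_dProj_bv_tanProj x hH p) p

/-- The function `(|x|² - 1)/2`, negative in the interior of a free boundary minimal submanifold and
`0` on the boundary. It serves as a defining function of the boundary, as the function in the
conformal field below, and to build cutoff functions. -/
def halfSq (p : M) : ℝ := (inner ℝ (x.toFun p) (x.toFun p) - 1) / 2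

lemma contMDiff_halfSq : ContMDiff (𝓡∂ k) 𝓘(ℝ, ℝ) ∞ (halfSq x) := by
  have h1 := (contMDiff_inner x.smooth x.smooth).sub (contMDiff_const (c := (1 : ℝ)))
  exact h1.div_const 2

lemma tanDeriv_halfSq (p : M) (u : Amb n) :
    tanDeriv x (halfSq x) p u = inner ℝ (x.toFun p) (tanProj x p u) := by
  have h0 := contMDiff_inner x.smooth x.smooth
  have h1 : halfSq x = fun q => (2⁻¹ : ℝ) • ((inner ℝ (x.toFun q) (x.toFun q) : ℝ) - 1) := by
    funext q; rw [halfSq, smul_eq_mul]; ring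
  rw [h1, tanDeriv_smul x contMDiff_const (h0.sub contMDiff_const), tanDeriv_const,
    tanDeriv_sub x h0 contMDiff_const, tanDeriv_const, _root_.sub_apply,
    tanDeriv_inner x x.smooth x.smooth, tanDeriv_toFun,
    real_inner_comm (x.toFun p) (tanProj x p u)]
  simp
  ring

/-- The second derivatives of `|x|²/2` at an arbitrary point. -/
lemma tanDeriv_tanDeriv_halfSq (p : M) (a : Fin n) :
    tanDeriv x (fun q => tanDeriv x (halfSq x) q (bv a)) p (bv a) =
      inner ℝ (tanProj x p (bv a)) (bv a) + inner ℝ (x.toFun p) (dProj x p (bv a) (bv a)) := by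
  simp_rw [tanDeriv_halfSq]
  rw [tanDeriv_inner x x.smooth ((contMDiff_tanProj x).clm_apply contMDiff_const),
    tanDeriv_toFun, tanDeriv_clm_apply_const x (contMDiff_tanProj x), inner_tanProj_left,
    tanProj_tanProj, inner_tanProj_left]
  rw [← inner_tanProj_left]
  rfl

/-- On a minimal submanifold `∑ₐ D_a D_a (|x|²/2) = k`. -/
lemma sum_tanDeriv_tanDeriv_halfSq (hH : ∀ p, meanCurv x p = 0) (p : M) :
    ∑ a, tanDeriv x (fun q => tanDeriv x (halfSq x) q (bv a)) p (bv a) = k := by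
  simp_rw [tanDeriv_tanDeriv_halfSq]
  rw [Finset.sum_add_distrib, sum_inner_tanProj_bv, ← inner_sum, sum_dProj_bv x hH]
  simp

lemma tanDeriv_inner_pos (v : Amb n) (p : M) (u : Amb n) :
    tanDeriv x (fun q => (inner ℝ (x.toFun q) v : ℝ)) p u = inner ℝ (tanProj x p u) v := by
  rw [tanDeriv_inner x x.smooth contMDiff_const, tanDeriv_toFun, tanDeriv_const]
  simp

/-- The normal part `Φ = (|x|² - 1)/2 • v^⊥ - ⟨x, v⟩ x^⊥` of a field that differs from a conformal
vector field of the ball only by a multiple of `v`. -/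
def confNor (v : Amb n) (p : M) : Amb n :=
  halfSq x p • norPart x v p - (inner ℝ (x.toFun p) v : ℝ) • posNor x p

lemma contMDiff_inner_pos (v : Amb n) :
    ContMDiff (𝓡∂ k) 𝓘(ℝ, ℝ) ∞ (fun q => (inner ℝ (x.toFun q) v : ℝ)) :=
  contMDiff_inner x.smooth contMDiff_const

lemma isNormalField_confNor (v : Amb n) : IsNormalField x (confNor x v) :=
  ⟨((contMDiff_halfSq x).smul (isNormalField_norPart x v).1).sub
    ((contMDiff_inner_pos x v).smul (isNormalField_posNor x).1), fun p =>
    Submodule.sub_mem _ (Submodule.smul_mem _ _ ((isNormalField_norPart x v).2 p))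
      (Submodule.smul_mem _ _ ((isNormalField_posNor x).2 p))⟩

/-- The field `Φ` solves `J Φ = -k v^⊥`. The two terms `2 σ(x^⊤, v^⊤)` that the Leibniz rule yields
cancel, and `k` is the Laplacian of `|x|²/2`. -/
lemma jacobi_confNor (hH : ∀ p, meanCurv x p = 0) (v : Amb n) (p : M) :
    jacobi x (confNor x v) p = -(k : ℝ) • norPart x v p := by
  have hV := isNormalField_norPart x v
  have hN := isNormalField_posNor x
  have h1 : norLaplacian x (confNor x v) p =
      norLaplacian x (fun q => halfSq x q • norPart x v q) p -
      norLaplacian x (fun q => (inner ℝ (x.toFun q) v : ℝ) • posNor x q) p :=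
    norLaplacian_sub x hH ((contMDiff_halfSq x).smul hV.1) ((contMDiff_inner_pos x v).smul hN.1) p
  have h2 : ∑ a, tanDeriv x (halfSq x) p (bv a) • norDeriv x (norPart x v) p (bv a) =
      -dProj x p (x.toFun p) (tanProj x p v) := by
    simp_rw [norDeriv_norPart, tanDeriv_halfSq, ← inner_tanProj_left, smul_neg]
    rw [Finset.sum_neg_distrib]
    rw [sum_inner_smul_clm, dProj_tanProj_left]
  have h3 : ∑ a, tanDeriv x (fun q => (inner ℝ (x.toFun q) v : ℝ)) p (bv a) •
      norDeriv x (posNor x) p (bv a) = -dProj x p v (tanProj x p (x.toFun p)) := by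
    simp_rw [norDeriv_posNor, tanDeriv_inner_pos, real_inner_comm v, ← inner_tanProj_left,
      smul_neg]
    rw [Finset.sum_neg_distrib]
    rw [sum_inner_smul_clm, dProj_tanProj_left]
  have h4 : ∑ a, tanDeriv x (fun q => tanDeriv x (fun q => (inner ℝ (x.toFun q) v : ℝ)) q (bv a)) p
      (bv a) = 0 := by
    simp_rw [tanDeriv_inner_pos]
    have : ∀ a : Fin n, tanDeriv x (fun q => (inner ℝ (tanProj x q (bv a)) v : ℝ)) p (bv a) =
        inner ℝ (dProj x p (bv a) (bv a)) v := by
      intro a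
      rw [tanDeriv_inner x ((contMDiff_tanProj x).clm_apply contMDiff_const) contMDiff_const,
        tanDeriv_clm_apply_const x (contMDiff_tanProj x), tanDeriv_const]
      simp [dProj]
    simp_rw [this]
    rw [← sum_inner, sum_dProj_bv x hH, inner_zero_left]
  rw [jacobi, h1, norLaplacian_smul x hH (contMDiff_halfSq x) hV,
    norLaplacian_smul x hH (contMDiff_inner_pos x v) hN, h2, h3, h4,
    sum_tanDeriv_tanDeriv_halfSq x hH, norLaplacian_norPart x hH, norLaplacian_posNor x hH, confNor,
    simons_sub, simons_smul, simons_smul, dProj_comm x p (x.toFun p) v]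
  simp only [zero_smul, neg_smul]
  abel

lemma norDeriv_confNor (v : Amb n) (p : M) (u : Amb n) :
    norDeriv x (confNor x v) p u =
      (inner ℝ (x.toFun p) (tanProj x p u) : ℝ) • norPart x v p
      - halfSq x p • dProj x p u (tanProj x p v)
      - ((inner ℝ (tanProj x p u) v : ℝ) • posNor x p
        - (inner ℝ (x.toFun p) v : ℝ) • dProj x p u (tanProj x p (x.toFun p))) := by
  have hV := isNormalField_norPart x v
  have hN := isNormalField_posNor x
  have h1 := norDeriv_sub x (V := fun q => halfSq x q • norPart x v q)
    (W := fun q => (inner ℝ (x.toFun q) v : ℝ) • posNor x q)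
    ((contMDiff_halfSq x).smul hV.1) ((contMDiff_inner_pos x v).smul hN.1) p u
  refine h1.trans ?_
  rw [norDeriv_smul x (contMDiff_halfSq x) hV, norDeriv_smul x (contMDiff_inner_pos x v) hN,
    tanDeriv_halfSq, tanDeriv_inner_pos, norDeriv_norPart, norDeriv_posNor]
  simp only [smul_neg]
  abel

end JacobiFields

/-! ### Images of measures with density under parametrizations -/

section ParamMeasure

variable {E M : Type*} [NormedAddCommGroup E] [NormedSpace ℝ E] [FiniteDimensional ℝ E]
  [MeasurableSpace E] [BorelSpace E] [MeasurableSpace M] {μ : Measure E} [μ.IsAddHaarMeasure]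

/-- The image under the parametrization `s` of the measure `J μ` on `Ω`. Negative values of the density
`J` count as `0`. -/
def paramMeasure (μ : Measure E) (s : E → M) (Ω : Set E) (J : E → ℝ) : Measure M :=
  Measure.map s ((μ.restrict Ω).withDensity fun y => ENNReal.ofReal (J y))

lemma aemeasurable_withDensity {s : E → M} {Ω : Set E} {J : E → ℝ}
    (hs : AEMeasurable s (μ.restrict Ω)) :
    AEMeasurable s ((μ.restrict Ω).withDensity fun y => ENNReal.ofReal (J y)) :=
  hs.mono_ac (withDensity_absolutelyContinuous _ _)

lemma lintegral_paramMeasure {s : E → M} {Ω : Set E} {J : E → ℝ}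
    (hs : AEMeasurable s (μ.restrict Ω)) (hJ : AEMeasurable J (μ.restrict Ω)) {f : M → ENNReal}
    (hf : Measurable f) :
    ∫⁻ p, f p ∂(paramMeasure μ s Ω J) = ∫⁻ y in Ω, ENNReal.ofReal (J y) * f (s y) ∂μ := by
  rw [paramMeasure, lintegral_map' hf.aemeasurable (aemeasurable_withDensity hs)]
  exact lintegral_withDensity_eq_lintegral_mul₀ hJ.ennreal_ofReal (hf.comp_aemeasurable hs)

lemma lintegral_paramMeasure_indicator {s : E → M} {Ω : Set E} (hΩ : MeasurableSet Ω) {J : E → ℝ}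
    (hs : AEMeasurable s (μ.restrict Ω)) (hJ : AEMeasurable J (μ.restrict Ω)) {A : Set M}
    (hA : MeasurableSet A) (hΩA : MeasurableSet (Ω ∩ s ⁻¹' A)) :
    paramMeasure μ s Ω J A = ∫⁻ y in Ω ∩ s ⁻¹' A, ENNReal.ofReal (J y) ∂μ := by
  rw [← lintegral_indicator_one hA, lintegral_paramMeasure hs hJ (measurable_one.indicator hA),
    ← lintegral_indicator hΩ, ← lintegral_indicator hΩA]
  congr 1
  funext y
  by_cases h1 : y ∈ Ω <;> by_cases h2 : s y ∈ A <;> simp [Set.indicator, h1, h2]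

/-- Two parametrizations that differ by a change of variables induce the same measure. -/
lemma paramMeasure_restrict_eq {s₁ s₂ : E → M} {Ω₁ Ω₂ : Set E} {J₁ J₂ : E → ℝ}
    (hΩ₁ : MeasurableSet Ω₁) (hΩ₂ : MeasurableSet Ω₂)
    (hs₁ : AEMeasurable s₁ (μ.restrict Ω₁)) (hs₂ : AEMeasurable s₂ (μ.restrict Ω₂))
    (hJ₁ : AEMeasurable J₁ (μ.restrict Ω₁)) (hJ₂ : AEMeasurable J₂ (μ.restrict Ω₂))
    {U : Set M} (hU : MeasurableSet U) (hm₁ : MeasurableSet (Ω₁ ∩ s₁ ⁻¹' U))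
    (hm₂ : MeasurableSet (Ω₂ ∩ s₂ ⁻¹' U)) {m : E → E} {m' : E → E →L[ℝ] E}
    (hm : ∀ y ∈ Ω₁ ∩ s₁ ⁻¹' U, HasFDerivWithinAt m (m' y) (Ω₁ ∩ s₁ ⁻¹' U) y)
    (hbij : Set.BijOn m (Ω₁ ∩ s₁ ⁻¹' U) (Ω₂ ∩ s₂ ⁻¹' U))
    (hs : ∀ y ∈ Ω₁ ∩ s₁ ⁻¹' U, s₂ (m y) = s₁ y)
    (hJ : ∀ y ∈ Ω₁ ∩ s₁ ⁻¹' U, J₁ y = |(m' y).det| * J₂ (m y)) :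
    (paramMeasure μ s₁ Ω₁ J₁).restrict U = (paramMeasure μ s₂ Ω₂ J₂).restrict U := by
  refine Measure.ext_of_lintegral _ fun f hf => ?_
  rw [← lintegral_indicator hU, ← lintegral_indicator hU,
    lintegral_paramMeasure hs₁ hJ₁ (hf.indicator hU),
    lintegral_paramMeasure hs₂ hJ₂ (hf.indicator hU)]
  have key : ∀ (s : E → M) (Ω : Set E) (J : E → ℝ), MeasurableSet Ω →
      MeasurableSet (Ω ∩ s ⁻¹' U) →
      ∫⁻ y in Ω, ENNReal.ofReal (J y) * U.indicator f (s y) ∂μ =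
        ∫⁻ y in Ω ∩ s ⁻¹' U, ENNReal.ofReal (J y) * f (s y) ∂μ := by
    intro s Ω J hΩ hΩU
    rw [← lintegral_indicator hΩ, ← lintegral_indicator hΩU]
    congr 1
    funext y
    by_cases h1 : y ∈ Ω <;> by_cases h2 : s y ∈ U <;> simp [Set.indicator, h1, h2]
  rw [key _ _ _ hΩ₁ hm₁, key _ _ _ hΩ₂ hm₂, ← hbij.image_eq,
    lintegral_image_eq_lintegral_abs_det_fderiv_mul μ hm₁ hm hbij.injOn]
  refine setLIntegral_congr_fun hm₁ fun y hy => ?_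
  rw [hJ y hy, hs y hy, ENNReal.ofReal_mul (abs_nonneg _), mul_assoc]

/-- A supremum of measures that agree on the overlaps of their carriers restricts to each of them on
its carrier. -/
lemma iSup_measure_restrict {C : Type*} {S : Set C} (ν : C → Measure M) (U : C → Set M)
    (hU : ∀ c ∈ S, MeasurableSet (U c)) (h0 : ∀ c ∈ S, ν c (U c)ᶜ = 0)
    (h1 : ∀ c ∈ S, ∀ c' ∈ S, (ν c).restrict (U c ∩ U c') = (ν c').restrict (U c ∩ U c'))
    {c : C} (hc : c ∈ S) : (⨆ c ∈ S, ν c).restrict (U c) = ν c := by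
  have hr : ∀ c ∈ S, (ν c).restrict (U c) = ν c := fun c hc =>
    Measure.restrict_eq_self_of_ae_mem (mem_ae_iff.2 (h0 c hc))
  set Λ := ⨆ c ∈ S, ν c with hΛ
  have hle : Λ ≤ ν c + Λ.restrict (U c)ᶜ := by
    refine iSup₂_le fun c' hc' => ?_
    rw [← Measure.restrict_add_restrict_compl (μ := ν c') (hU c hc)]
    refine add_le_add ?_ (Measure.restrict_mono le_rfl (le_iSup₂ (f := fun c (_ : c ∈ S) => ν c)
      c' hc'))
    have : (ν c').restrict (U c) = (ν c').restrict (U c ∩ U c') := by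
      conv_lhs => rw [← hr c' hc']
      rw [Measure.restrict_restrict (hU c hc)]
    rw [this, ← h1 c hc c' hc']
    exact Measure.restrict_le_self
  apply le_antisymm
  · calc Λ.restrict (U c) ≤ (ν c + Λ.restrict (U c)ᶜ).restrict (U c) := 
          Measure.restrict_mono le_rfl hle
      _ = ν c := by
          rw [Measure.restrict_add, Measure.restrict_restrict (hU c hc), Set.inter_compl_self,
            Measure.restrict_empty, add_zero, hr c hc]
  · conv_lhs => rw [← hr c hc]
    exact Measure.restrict_mono le_rfl (le_iSup₂ (f := fun c (_ : c ∈ S) => ν c) c hc)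

lemma iSup_measure_null {C : Type*} {S : Set C} (ν : C → Measure M) {N : Set M}
    (hN : MeasurableSet N) (h : ∀ c ∈ S, ν c N = 0) : (⨆ c ∈ S, ν c) N = 0 := by
  have hle : (⨆ c ∈ S, ν c) ≤ (⨆ c ∈ S, ν c).restrict Nᶜ := by
    refine iSup₂_le fun c hc => ?_
    have h1 : (ν c).restrict Nᶜ = ν c :=
      Measure.restrict_eq_self_of_ae_mem (mem_ae_iff.2 (by
        change ν c (Nᶜ)ᶜ = 0
        rw [compl_compl, h c hc]))
    conv_lhs => rw [← h1]
    exact Measure.restrict_mono le_rfl (le_iSup₂ (f := fun c (_ : c ∈ S) => ν c) c hc)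
  have := hle N
  rw [Measure.restrict_apply hN, Set.inter_compl_self, measure_empty] at this
  exact le_antisymm this bot_le

variable {F : Type*} [NormedAddCommGroup F] [NormedSpace ℝ F]

lemma integral_paramMeasure {s : E → M} {Ω : Set E} {J : E → ℝ}
    (hs : AEMeasurable s (μ.restrict Ω))
    (hJ : AEMeasurable J (μ.restrict Ω)) (hpos : ∀ᵐ y ∂(μ.restrict Ω), 0 < J y) {f : M → F}
    (hf : AEStronglyMeasurable f (paramMeasure μ s Ω J)) :
    ∫ p, f p ∂(paramMeasure μ s Ω J) = ∫ y in Ω, J y • f (s y) ∂μ := by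
  rw [paramMeasure, integral_map (aemeasurable_withDensity hs) hf,
    integral_withDensity_eq_integral_toReal_smul₀ hJ.ennreal_ofReal
      (Filter.Eventually.of_forall fun _ => ENNReal.ofReal_lt_top)]
  refine integral_congr_ae (hpos.mono fun y hy => ?_)
  simp only
  rw [ENNReal.toReal_ofReal hy.le]

lemma integrable_paramMeasure {s : E → M} {Ω : Set E} {J : E → ℝ}
    (hs : AEMeasurable s (μ.restrict Ω))
    (hJ : AEMeasurable J (μ.restrict Ω)) (hpos : ∀ᵐ y ∂(μ.restrict Ω), 0 < J y) {f : M → F}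
    (hf : AEStronglyMeasurable f (paramMeasure μ s Ω J)) :
    Integrable f (paramMeasure μ s Ω J) ↔ IntegrableOn (fun y => J y • f (s y)) Ω μ := by
  rw [paramMeasure, integrable_map_measure hf (aemeasurable_withDensity hs),
    integrable_withDensity_iff_integrable_smul₀' hJ.ennreal_ofReal
      (Filter.Eventually.of_forall fun _ => ENNReal.ofReal_lt_top)]
  refine integrable_congr (hpos.mono fun y hy => ?_)
  simp only [Function.comp_apply]
  rw [ENNReal.toReal_ofReal hy.le]

end ParamMeasure

/-! ### Changes of coordinates -/

section ChartMeasure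

variable {n k : ℕ} [NeZero k] {M : Type*} [TopologicalSpace M]
  [ChartedSpace (EuclideanHalfSpace k) M] [IsManifold (𝓡∂ k) ∞ M]
  {c c' : OpenPartialHomeomorph M (EuclideanHalfSpace k)}

/-- The change of coordinates from the chart `c` to the chart `c'`. -/
def transition (c c' : OpenPartialHomeomorph M (EuclideanHalfSpace k)) :
    EuclideanSpace ℝ (Fin k) → EuclideanSpace ℝ (Fin k) :=
  c'.extend (𝓡∂ k) ∘ (c.extend (𝓡∂ k)).symm

/-- The derivative of the change of coordinates from the chart `c` to the chart `c'`. -/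
def transitionDeriv (c c' : OpenPartialHomeomorph M (EuclideanHalfSpace k))
    (y : EuclideanSpace ℝ (Fin k)) : EuclideanSpace ℝ (Fin k) →L[ℝ] EuclideanSpace ℝ (Fin k) :=
  fderivWithin ℝ (transition c c') (Set.range (𝓡∂ k)) y

/-- The part of the image of the chart `c` that corresponds to the set `U`. -/
def chartDomain (c : OpenPartialHomeomorph M (EuclideanHalfSpace k)) (U : Set M) :
    Set (EuclideanSpace ℝ (Fin k)) :=
  (c.extend (𝓡∂ k)).target ∩ (c.extend (𝓡∂ k)).symm ⁻¹' U

lemma transition_mem_target {y : EuclideanSpace ℝ (Fin k)} (hy : y ∈ chartDomain c c'.source) :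
    transition c c' y ∈ (c'.extend (𝓡∂ k)).target := extend_mem_target hy.2

lemma symm_transition {y : EuclideanSpace ℝ (Fin k)} (hy : y ∈ chartDomain c c'.source) :
    (c'.extend (𝓡∂ k)).symm (transition c c' y) = (c.extend (𝓡∂ k)).symm y :=
  c'.extend_left_inv hy.2

lemma hasFDerivWithinAt_transition (hc : c ∈ atlas (EuclideanHalfSpace k) M)
    (hc' : c' ∈ atlas (EuclideanHalfSpace k) M) {y : EuclideanSpace ℝ (Fin k)}
    (hy : y ∈ chartDomain c c'.source) :
    HasFDerivWithinAt (transition c c') (transitionDeriv c c' y) (Set.range (𝓡∂ k)) y := by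
  have := ModelWithCorners.contDiffWithinAt_extendCoordChange (𝕜 := ℝ) (n := ∞)
    (I := 𝓡∂ k) (e := c) (e' := c') (x := y)
    (IsManifold.subset_maximalAtlas hc) (IsManifold.subset_maximalAtlas hc') (by
      rw [PartialEquiv.trans_source, PartialEquiv.symm_source]
      refine ⟨hy.1, ?_⟩
      rw [Set.mem_preimage, c'.extend_source]
      exact hy.2)
  exact (this.differentiableWithinAt (by simp)).hasFDerivWithinAt

lemma symm_eventually_mem {y : EuclideanSpace ℝ (Fin k)} {U : Set M} (hU : IsOpen U)
    (hy : y ∈ chartDomain c U) :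
    ∀ᶠ z in nhdsWithin y (Set.range (𝓡∂ k)), z ∈ chartDomain c U := by
  have h1 := extend_target_mem_nhdsWithin' hy.1
  have h2 : ContinuousWithinAt (c.extend (𝓡∂ k)).symm (Set.range (𝓡∂ k)) y :=
    (c.continuousOn_extend_symm y hy.1).mono_of_mem_nhdsWithin h1
  filter_upwards [h1, h2 (hU.mem_nhds hy.2)] with z hz hz' using ⟨hz, hz'⟩

variable (x : Immersion k n M)

lemma chartDiff_eq_comp_transitionDeriv (hc : c ∈ atlas (EuclideanHalfSpace k) M)
    (hc' : c' ∈ atlas (EuclideanHalfSpace k) M) {y : EuclideanSpace ℝ (Fin k)}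
    (hy : y ∈ chartDomain c c'.source) :
    chartDiff x c y = (chartDiff x c' (transition c c' y)).comp (transitionDeriv c c' y) := by
  have h1 : HasFDerivWithinAt (inChart c' x.toFun) (chartDiff x c' (transition c c' y))
      (Set.range (𝓡∂ k)) (transition c c' y) :=
    (differentiableWithinAt_inChart hc' x.smooth (transition_mem_target hy)).hasFDerivWithinAt
  have h2 := h1.comp y (hasFDerivWithinAt_transition hc hc' hy) (fun z _ => by
    rw [transition, Function.comp_apply, c'.extend_coe]
    exact ⟨_, rfl⟩)
  have h3 : x.toFun ∘ (c.extend (𝓡∂ k)).symm =ᶠ[nhdsWithin y (Set.range (𝓡∂ k))]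
      inChart c' x.toFun ∘ transition c c' := by
    filter_upwards [symm_eventually_mem c'.open_source hy] with z hz
    rw [Function.comp_apply, Function.comp_apply, inChart, Function.comp_apply, symm_transition hz]
  exact (h2.congr_of_eventuallyEq h3
    (h3.self_of_nhdsWithin (range_of_mem_extend_target hy.1))).fderivWithin
    (uniqueDiffWithinAt_range (range_of_mem_extend_target hy.1))

lemma jac_chartDiff_transition (hc : c ∈ atlas (EuclideanHalfSpace k) M)
    (hc' : c' ∈ atlas (EuclideanHalfSpace k) M) {y : EuclideanSpace ℝ (Fin k)}
    (hy : y ∈ chartDomain c c'.source) :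
    jac (chartDiff x c y) =
      |(transitionDeriv c c' y).det| * jac (chartDiff x c' (transition c c' y)) := by
  rw [chartDiff_eq_comp_transitionDeriv x hc hc' hy, jac_comp]

/-- Every chart of the atlas detects the boundary, by the vanishing of its first coordinate. -/
lemma mem_boundary_iff (hc : c ∈ atlas (EuclideanHalfSpace k) M) {p : M} (hp : p ∈ c.source) :
    p ∈ (𝓡∂ k).boundary M ↔ c.extend (𝓡∂ k) p 0 = 0 := by
  have h1 : p ∈ (𝓡∂ k).interior M ↔ 0 < c.extend (𝓡∂ k) p 0 := by
    change (𝓡∂ k).IsInteriorPoint p ↔ _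
    rw [ModelWithCorners.isInteriorPoint_iff_of_mem_atlas (n := ∞) (by simp) hc hp]
    have h2 : c.extend (𝓡∂ k) p ∈ interior (Set.range (𝓡∂ k)) ↔ 0 < c.extend (𝓡∂ k) p 0 := by
      rw [interior_range_modelWithCornersEuclideanHalfSpace]; rfl
    rw [← h2]
    exact ⟨fun h => c.interior_extend_target_subset_interior_range h,
      fun h => c.mem_interior_extend_target (c.map_source hp) h⟩
  rw [← ModelWithCorners.compl_interior, Set.mem_compl_iff, h1, not_lt]
  have h3 : 0 ≤ c.extend (𝓡∂ k) p 0 :=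
    mem_range_halfSpace_iff.1 (range_of_mem_extend_target (extend_mem_target hp))
  exact ⟨fun h => le_antisymm h h3, fun h => h.le⟩

lemma symm_mem_boundary_iff (hc : c ∈ atlas (EuclideanHalfSpace k) M)
    {y : EuclideanSpace ℝ (Fin k)} (hy : y ∈ (c.extend (𝓡∂ k)).target) :
    (c.extend (𝓡∂ k)).symm y ∈ (𝓡∂ k).boundary M ↔ y 0 = 0 := by
  rw [mem_boundary_iff hc (symm_mem_source hy), (c.extend (𝓡∂ k)).right_inv hy]

lemma isOpen_preimage_hyperplaneIncl (c : OpenPartialHomeomorph M (EuclideanHalfSpace k)) :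
    IsOpen (hyperplaneIncl k ⁻¹' (c.extend (𝓡∂ k)).target) := by
  have h : hyperplaneIncl k ⁻¹' (c.extend (𝓡∂ k)).target =
      hyperplaneIncl k ⁻¹' ((𝓡∂ k).symm ⁻¹' c.target) := by
    ext z
    rw [c.extend_target]
    refine ⟨fun h => h.1, fun h => ⟨h, ?_⟩⟩
    rw [mem_range_halfSpace_iff, hyperplaneIncl_apply_zero]
  rw [h]
  exact (c.open_target.preimage (𝓡∂ k).continuous_symm).preimage (hyperplaneIncl k).continuous

/-- The change of coordinates between the boundary parts of two charts. -/
def bdryTransition (c c' : OpenPartialHomeomorph M (EuclideanHalfSpace k)) :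
    EuclideanSpace ℝ {i : Fin k // i ≠ 0} → EuclideanSpace ℝ {i : Fin k // i ≠ 0} :=
  fun z => hyperplaneProj k (transition c c' (hyperplaneIncl k z))

/-- The derivative of the change of coordinates between the boundary parts of two charts. -/
def bdryTransitionDeriv (c c' : OpenPartialHomeomorph M (EuclideanHalfSpace k))
    (z : EuclideanSpace ℝ {i : Fin k // i ≠ 0}) :
    EuclideanSpace ℝ {i : Fin k // i ≠ 0} →L[ℝ] EuclideanSpace ℝ {i : Fin k // i ≠ 0} :=
  (hyperplaneProj k).comp ((transitionDeriv c c' (hyperplaneIncl k z)).comp (hyperplaneIncl k))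

/-- Changes of coordinates preserve the boundary hyperplane. -/
lemma transition_zero (hc : c ∈ atlas (EuclideanHalfSpace k) M)
    (hc' : c' ∈ atlas (EuclideanHalfSpace k) M) {y : EuclideanSpace ℝ (Fin k)}
    (hy : y ∈ chartDomain c c'.source) (h0 : y 0 = 0) : transition c c' y 0 = 0 := by
  rw [← symm_mem_boundary_iff hc' (transition_mem_target hy), symm_transition hy,
    symm_mem_boundary_iff hc hy.1, h0]

lemma hyperplaneIncl_bdryTransition (hc : c ∈ atlas (EuclideanHalfSpace k) M)
    (hc' : c' ∈ atlas (EuclideanHalfSpace k) M) {z : EuclideanSpace ℝ {i : Fin k // i ≠ 0}}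
    (hz : hyperplaneIncl k z ∈ chartDomain c c'.source) :
    hyperplaneIncl k (bdryTransition c c' z) = transition c c' (hyperplaneIncl k z) := by
  rw [bdryTransition, hyperplaneIncl_proj,
    transition_zero hc hc' hz (hyperplaneIncl_apply_zero z), zero_smul, sub_zero]

lemma isOpen_preimage_chartDomain {U : Set M} (hU : IsOpen U) :
    IsOpen (hyperplaneIncl k ⁻¹' chartDomain c U) := by
  have h : hyperplaneIncl k ⁻¹' chartDomain c U =
    hyperplaneIncl k ⁻¹' (c.extend (𝓡∂ k)).target ∩
      (fun z => (c.extend (𝓡∂ k)).symm (hyperplaneIncl k z)) ⁻¹' U := rfl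
  rw [h]
  refine ContinuousOn.isOpen_inter_preimage ?_ (isOpen_preimage_hyperplaneIncl c) hU
  exact c.continuousOn_extend_symm.comp (hyperplaneIncl k).continuous.continuousOn fun z hz => hz

lemma hasFDerivAt_transition_incl (hc : c ∈ atlas (EuclideanHalfSpace k) M)
    (hc' : c' ∈ atlas (EuclideanHalfSpace k) M) {z : EuclideanSpace ℝ {i : Fin k // i ≠ 0}}
    (hz : hyperplaneIncl k z ∈ chartDomain c c'.source) :
    HasFDerivAt (fun z => transition c c' (hyperplaneIncl k z))
      ((transitionDeriv c c' (hyperplaneIncl k z)).comp (hyperplaneIncl k)) z := by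
  have h := (hasFDerivWithinAt_transition hc hc' hz).comp z
    ((hyperplaneIncl k).hasFDerivAt.hasFDerivWithinAt (s := Set.univ)) (fun z _ => by
      rw [mem_range_halfSpace_iff, hyperplaneIncl_apply_zero])
  exact hasFDerivWithinAt_univ.1 h

lemma hasFDerivAt_bdryTransition (hc : c ∈ atlas (EuclideanHalfSpace k) M)
    (hc' : c' ∈ atlas (EuclideanHalfSpace k) M) {z : EuclideanSpace ℝ {i : Fin k // i ≠ 0}}
    (hz : hyperplaneIncl k z ∈ chartDomain c c'.source) :
    HasFDerivAt (bdryTransition c c') (bdryTransitionDeriv c c' z) z :=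
  (hyperplaneProj k).hasFDerivAt.comp z (hasFDerivAt_transition_incl hc hc' hz)

lemma transitionDeriv_comp_incl (hc : c ∈ atlas (EuclideanHalfSpace k) M)
    (hc' : c' ∈ atlas (EuclideanHalfSpace k) M) {z : EuclideanSpace ℝ {i : Fin k // i ≠ 0}}
    (hz : hyperplaneIncl k z ∈ chartDomain c c'.source) :
    (transitionDeriv c c' (hyperplaneIncl k z)).comp (hyperplaneIncl k) =
      (hyperplaneIncl k).comp (bdryTransitionDeriv c c' z) := by
  have h1 := (hyperplaneIncl k).hasFDerivAt.comp z (hasFDerivAt_bdryTransition hc hc' hz)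
  refine (hasFDerivAt_transition_incl hc hc' hz).unique (h1.congr_of_eventuallyEq ?_)
  filter_upwards [(isOpen_preimage_chartDomain c'.open_source).mem_nhds hz] with w hw
  exact (hyperplaneIncl_bdryTransition hc hc' hw).symm

lemma jac_bdry_transition (hc : c ∈ atlas (EuclideanHalfSpace k) M)
    (hc' : c' ∈ atlas (EuclideanHalfSpace k) M) {z : EuclideanSpace ℝ {i : Fin k // i ≠ 0}}
    (hz : hyperplaneIncl k z ∈ chartDomain c c'.source) :
    jac ((chartDiff x c (hyperplaneIncl k z)).comp (hyperplaneIncl k)) =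
      |(bdryTransitionDeriv c c' z).det| *
        jac ((chartDiff x c' (hyperplaneIncl k (bdryTransition c c' z))).comp
          (hyperplaneIncl k)) := by
  rw [chartDiff_eq_comp_transitionDeriv x hc hc' hz, ContinuousLinearMap.comp_assoc,
    transitionDeriv_comp_incl hc hc' hz, ← ContinuousLinearMap.comp_assoc, jac_comp,
    hyperplaneIncl_bdryTransition hc hc' hz]

lemma transition_transition {y : EuclideanSpace ℝ (Fin k)} (hy : y ∈ chartDomain c c'.source) :
    transition c' c (transition c c' y) = y := by
  rw [transition, Function.comp_apply, symm_transition hy, PartialEquiv.right_inv _ hy.1]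

lemma transition_mem {U : Set M} {y : EuclideanSpace ℝ (Fin k)}
    (hy : y ∈ chartDomain c (U ∩ c'.source)) :
    transition c c' y ∈ chartDomain c' U := by
  have h : y ∈ chartDomain c c'.source := ⟨hy.1, hy.2.2⟩
  refine ⟨transition_mem_target h, ?_⟩
  rw [Set.mem_preimage, symm_transition h]
  exact hy.2.1

lemma bijOn_transition :
    Set.BijOn (transition c c') (chartDomain c (c.source ∩ c'.source))
      (chartDomain c' (c.source ∩ c'.source)) := by
  have hl : ∀ {c c' : OpenPartialHomeomorph M (EuclideanHalfSpace k)}, Set.LeftInvOn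
      (transition c' c) (transition c c') (chartDomain c (c.source ∩ c'.source)) :=
    by intro c c' y hy; exact transition_transition ⟨hy.1, hy.2.2⟩
  have hm : ∀ {c c' : OpenPartialHomeomorph M (EuclideanHalfSpace k)}, Set.MapsTo
      (transition c c') (chartDomain c (c.source ∩ c'.source))
      (chartDomain c' (c.source ∩ c'.source)) :=
    by intro c c' y hy; exact transition_mem ⟨hy.1, ⟨hy.2, hy.2.2⟩⟩
  refine Set.InvOn.bijOn (f' := transition c' c) ⟨hl, ?_⟩ hm ?_
  · rw [Set.inter_comm]; exact hl
  · rw [Set.inter_comm]; exact hm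

lemma bijOn_bdryTransition (hc : c ∈ atlas (EuclideanHalfSpace k) M)
    (hc' : c' ∈ atlas (EuclideanHalfSpace k) M) :
    Set.BijOn (bdryTransition c c') (hyperplaneIncl k ⁻¹' chartDomain c (c.source ∩ c'.source))
      (hyperplaneIncl k ⁻¹' chartDomain c' (c.source ∩ c'.source)) := by
  have hl : ∀ {c c' : OpenPartialHomeomorph M (EuclideanHalfSpace k)},
      c ∈ atlas (EuclideanHalfSpace k) M → c' ∈ atlas (EuclideanHalfSpace k) M → Set.LeftInvOn
      (bdryTransition c' c) (bdryTransition c c')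
      (hyperplaneIncl k ⁻¹' chartDomain c (c.source ∩ c'.source)) := by
    intro c c' hc hc' y hy
    have hy' : hyperplaneIncl k y ∈ chartDomain c c'.source := ⟨hy.1, hy.2.2⟩
    rw [bdryTransition, hyperplaneIncl_bdryTransition hc hc' hy',
      transition_transition hy', hyperplaneProj_incl]
  have hm : ∀ {c c' : OpenPartialHomeomorph M (EuclideanHalfSpace k)},
      c ∈ atlas (EuclideanHalfSpace k) M → c' ∈ atlas (EuclideanHalfSpace k) M → Set.MapsTo
      (bdryTransition c c') (hyperplaneIncl k ⁻¹' chartDomain c (c.source ∩ c'.source))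
      (hyperplaneIncl k ⁻¹' chartDomain c' (c.source ∩ c'.source)) := by
    intro c c' hc hc' y hy
    have hy' : hyperplaneIncl k y ∈ chartDomain c c'.source := ⟨hy.1, hy.2.2⟩
    rw [Set.mem_preimage, hyperplaneIncl_bdryTransition hc hc' hy']
    exact transition_mem ⟨hy.1, ⟨hy.2, hy.2.2⟩⟩
  refine Set.InvOn.bijOn (f' := bdryTransition c' c) ⟨hl hc hc', ?_⟩ (hm hc hc') ?_
  · rw [Set.inter_comm]; exact hl hc' hc
  · rw [Set.inter_comm]; exact hm hc' hc

end ChartMeasure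

/-! ### The volume measures in charts -/

section Volume

variable {n k : ℕ} [NeZero k] {M : Type*} [TopologicalSpace M]
  [ChartedSpace (EuclideanHalfSpace k) M] [IsManifold (𝓡∂ k) ∞ M]
  {c c' : OpenPartialHomeomorph M (EuclideanHalfSpace k)}
  [MeasurableSpace M] [BorelSpace M] (x : Immersion k n M)

lemma measurableSet_extend_target (c : OpenPartialHomeomorph M (EuclideanHalfSpace k)) :
    MeasurableSet (c.extend (𝓡∂ k)).target := by
  rw [c.extend_target]
  exact ((c.open_target.preimage (𝓡∂ k).continuous_symm).measurableSet).inter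
    (𝓡∂ k).isClosed_range.measurableSet

lemma measurableSet_chartDomain {U : Set M} (hU : IsOpen U) :
    MeasurableSet (chartDomain c U) := by
  obtain ⟨V, hV, h⟩ := (continuousOn_iff' (f := (c.extend (𝓡∂ k)).symm)
    (s := (c.extend (𝓡∂ k)).target)).1 c.continuousOn_extend_symm U hU
  rw [chartDomain, Set.inter_comm, h]
  exact hV.measurableSet.inter (measurableSet_extend_target c)

lemma aemeasurable_extend_symm :
    AEMeasurable (c.extend (𝓡∂ k)).symm (volume.restrict (c.extend (𝓡∂ k)).target) :=
  c.continuousOn_extend_symm.aemeasurable (measurableSet_extend_target c)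

lemma continuousOn_symm_incl : ContinuousOn (fun z => (c.extend (𝓡∂ k)).symm (hyperplaneIncl k z))
    (hyperplaneIncl k ⁻¹' (c.extend (𝓡∂ k)).target) :=
  c.continuousOn_extend_symm.comp (hyperplaneIncl k).continuous.continuousOn fun _ hz => hz

lemma aemeasurable_symm_incl :
    AEMeasurable (fun z => (c.extend (𝓡∂ k)).symm (hyperplaneIncl k z))
      (volume.restrict (hyperplaneIncl k ⁻¹' (c.extend (𝓡∂ k)).target)) :=
  continuousOn_symm_incl.aemeasurable (isOpen_preimage_hyperplaneIncl c).measurableSet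

lemma continuous_jac {ι : Type*} [Fintype ι] [DecidableEq ι] :
    Continuous (jac : (EuclideanSpace ℝ ι →L[ℝ] Amb n) → ℝ) := by
  unfold jac
  refine Real.continuous_sqrt.comp
    ((contDiff_det (ι := ι) (m := 0)).continuous.comp ?_)
  exact (ContinuousLinearMap.adjoint (𝕜 := ℝ) (E := EuclideanSpace ℝ ι)
    (F := Amb n)).continuous.clm_comp continuous_id

lemma continuousOn_jac_chartDiff (hc : c ∈ atlas (EuclideanHalfSpace k) M) :
    ContinuousOn (fun y => jac (chartDiff x c y)) (c.extend (𝓡∂ k)).target :=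
  (contDiffOn_jac_chartDiff x hc).continuousOn

lemma continuousOn_jac_chartDiff_incl (hc : c ∈ atlas (EuclideanHalfSpace k) M) :
    ContinuousOn (fun y => jac ((chartDiff x c y).comp (hyperplaneIncl k)))
      (c.extend (𝓡∂ k)).target :=
  continuous_jac.comp_continuousOn ((contDiffOn_chartDiff x hc).continuousOn.clm_comp
    continuousOn_const)

lemma aemeasurable_jac (hc : c ∈ atlas (EuclideanHalfSpace k) M) :
    AEMeasurable (fun y => jac (chartDiff x c y))
      (volume.restrict (c.extend (𝓡∂ k)).target) :=
  (continuousOn_jac_chartDiff x hc).aemeasurable (measurableSet_extend_target c)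

lemma aemeasurable_jac_incl (hc : c ∈ atlas (EuclideanHalfSpace k) M) :
    AEMeasurable (fun z => jac ((chartDiff x c (hyperplaneIncl k z)).comp (hyperplaneIncl k)))
      (volume.restrict (hyperplaneIncl k ⁻¹' (c.extend (𝓡∂ k)).target)) :=
  ((continuousOn_jac_chartDiff_incl x hc).comp (hyperplaneIncl k).continuous.continuousOn
    fun _ hz => hz).aemeasurable (isOpen_preimage_hyperplaneIncl c).measurableSet

lemma chartVol_eq : chartVol x c = paramMeasure volume (c.extend (𝓡∂ k)).symm
    (c.extend (𝓡∂ k)).target (fun y => jac (chartDiff x c y)) := rfl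

lemma chartBdryVol_eq : chartBdryVol x c =
    paramMeasure volume (fun z => (c.extend (𝓡∂ k)).symm (hyperplaneIncl k z))
      (hyperplaneIncl k ⁻¹' (c.extend (𝓡∂ k)).target)
      (fun z => jac ((chartDiff x c (hyperplaneIncl k z)).comp (hyperplaneIncl k))) := rfl

lemma chartVol_restrict_inter (hc : c ∈ atlas (EuclideanHalfSpace k) M)
    (hc' : c' ∈ atlas (EuclideanHalfSpace k) M) :
    (chartVol x c).restrict (c.source ∩ c'.source) =
      (chartVol x c').restrict (c.source ∩ c'.source) := by
  have ho : IsOpen (c.source ∩ c'.source) := c.open_source.inter c'.open_source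
  rw [chartVol_eq, chartVol_eq]
  refine paramMeasure_restrict_eq (m := transition c c') (m' := transitionDeriv c c')
    (measurableSet_extend_target c) (measurableSet_extend_target c') aemeasurable_extend_symm
    aemeasurable_extend_symm (aemeasurable_jac x hc) (aemeasurable_jac x hc') ho.measurableSet
    (measurableSet_chartDomain ho) (measurableSet_chartDomain ho) ?_ bijOn_transition ?_ ?_
  · intro y hy
    exact (hasFDerivWithinAt_transition hc hc' ⟨hy.1, hy.2.2⟩).mono
      fun z hz => range_of_mem_extend_target hz.1
  · exact fun y hy => symm_transition ⟨hy.1, hy.2.2⟩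
  · exact fun y hy => jac_chartDiff_transition x hc hc' ⟨hy.1, hy.2.2⟩

lemma chartBdryVol_restrict_inter (hc : c ∈ atlas (EuclideanHalfSpace k) M)
    (hc' : c' ∈ atlas (EuclideanHalfSpace k) M) :
    (chartBdryVol x c).restrict (c.source ∩ c'.source) =
      (chartBdryVol x c').restrict (c.source ∩ c'.source) := by
  have ho : IsOpen (c.source ∩ c'.source) := c.open_source.inter c'.open_source
  rw [chartBdryVol_eq, chartBdryVol_eq]
  refine paramMeasure_restrict_eq (m := bdryTransition c c') (m' := bdryTransitionDeriv c c')
    (isOpen_preimage_hyperplaneIncl c).measurableSet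
    (isOpen_preimage_hyperplaneIncl c').measurableSet aemeasurable_symm_incl
    aemeasurable_symm_incl (aemeasurable_jac_incl x hc) (aemeasurable_jac_incl x hc')
    ho.measurableSet (isOpen_preimage_chartDomain ho).measurableSet
    (isOpen_preimage_chartDomain ho).measurableSet ?_ (bijOn_bdryTransition hc hc') ?_ ?_
  · intro z hz
    exact (hasFDerivAt_bdryTransition hc hc' ⟨hz.1, hz.2.2⟩).hasFDerivWithinAt
  · intro z hz
    have hz' : hyperplaneIncl k z ∈ chartDomain c c'.source := ⟨hz.1, hz.2.2⟩
    rw [hyperplaneIncl_bdryTransition hc hc' hz', symm_transition hz']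
  · exact fun z hz => jac_bdry_transition x hc hc' ⟨hz.1, hz.2.2⟩

lemma paramMeasure_null {E : Type*} [NormedAddCommGroup E] [NormedSpace ℝ E]
    [FiniteDimensional ℝ E] [MeasurableSpace E] [BorelSpace E] {μ : Measure E}
    [μ.IsAddHaarMeasure] {s : E → M} {Ω : Set E} {J : E → ℝ} (hΩ : MeasurableSet Ω)
    (hs : AEMeasurable s (μ.restrict Ω)) {N : Set M} (hN : MeasurableSet N)
    (h : ∀ᵐ y ∂μ, y ∈ Ω → s y ∉ N) : paramMeasure μ s Ω J N = 0 := by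
  rw [paramMeasure, Measure.map_apply_of_aemeasurable (aemeasurable_withDensity hs) hN]
  apply withDensity_absolutelyContinuous
  have h1 : ∀ᵐ y ∂(μ.restrict Ω), s y ∉ N := (ae_restrict_iff' hΩ).2 h
  exact compl_mem_ae_iff.1 h1

lemma chartVol_compl_source : chartVol x c c.sourceᶜ = 0 :=
  paramMeasure_null (measurableSet_extend_target c) aemeasurable_extend_symm
    c.open_source.measurableSet.compl
    (Filter.Eventually.of_forall fun _ hy h => h (symm_mem_source hy))

lemma chartBdryVol_compl_source : chartBdryVol x c c.sourceᶜ = 0 :=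
  paramMeasure_null (isOpen_preimage_hyperplaneIncl c).measurableSet aemeasurable_symm_incl
    c.open_source.measurableSet.compl
    (Filter.Eventually.of_forall fun _ hy h => h (symm_mem_source hy))

/-- On the domain of a chart the volume measure is the one computed in the chart. -/
lemma vol_restrict (hc : c ∈ atlas (EuclideanHalfSpace k) M) :
    (vol x).restrict c.source = chartVol x c :=
  iSup_measure_restrict (fun c => chartVol x c) (fun c => c.source)
    (fun c _ => c.open_source.measurableSet) (fun _ _ => chartVol_compl_source x)
    (fun _ hc _ hc' => chartVol_restrict_inter x hc hc') hc

/-- On the domain of a chart the boundary measure is the one computed in the chart. -/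
lemma bdryVol_restrict (hc : c ∈ atlas (EuclideanHalfSpace k) M) :
    (bdryVol x).restrict c.source = chartBdryVol x c :=
  iSup_measure_restrict (fun c => chartBdryVol x c) (fun c => c.source)
    (fun c _ => c.open_source.measurableSet) (fun _ _ => chartBdryVol_compl_source x)
    (fun _ hc _ hc' => chartBdryVol_restrict_inter x hc hc') hc

lemma measurableSet_boundary : MeasurableSet ((𝓡∂ k).boundary M) :=
  (ModelWithCorners.isClosed_boundary (n := ∞) (by simp)).measurableSet

lemma measurableSet_interior : MeasurableSet ((𝓡∂ k).interior M) :=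
  (ModelWithCorners.isOpen_interior (n := ∞) (by simp)).measurableSet

lemma vol_boundary : vol x ((𝓡∂ k).boundary M) = 0 := by
  refine iSup_measure_null (fun c => chartVol x c) measurableSet_boundary fun c hc => ?_
  refine paramMeasure_null (measurableSet_extend_target c) aemeasurable_extend_symm
    measurableSet_boundary ?_
  have h1 : (volume : Measure (EuclideanSpace ℝ (Fin k))) {y | y 0 = 0} = 0 := by
    refine Measure.addHaar_submodule volume (LinearMap.ker
      ((EuclideanSpace.proj (0 : Fin k) : EuclideanSpace ℝ (Fin k) →L[ℝ] ℝ) :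
        EuclideanSpace ℝ (Fin k) →ₗ[ℝ] ℝ)) fun h => ?_
    have h3 : EuclideanSpace.single (0 : Fin k) (1 : ℝ) ∈ LinearMap.ker
      ((EuclideanSpace.proj (0 : Fin k) : EuclideanSpace ℝ (Fin k) →L[ℝ] ℝ) :
        EuclideanSpace ℝ (Fin k) →ₗ[ℝ] ℝ) := h ▸ trivial
    simp at h3
  filter_upwards [compl_mem_ae_iff.2 h1] with y hy hyt h
  exact hy ((symm_mem_boundary_iff hc hyt).1 h)

lemma bdryVol_interior : bdryVol x ((𝓡∂ k).interior M) = 0 := by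
  refine iSup_measure_null (fun c => chartBdryVol x c) measurableSet_interior fun c hc => ?_
  refine paramMeasure_null (isOpen_preimage_hyperplaneIncl c).measurableSet
    aemeasurable_symm_incl measurableSet_interior (Filter.Eventually.of_forall fun z hz h => ?_)
  rw [← ModelWithCorners.compl_boundary] at h
  exact h ((symm_mem_boundary_iff hc hz).2 (hyperplaneIncl_apply_zero z))

lemma ae_mem_interior : ∀ᵐ p ∂(vol x), p ∈ (𝓡∂ k).interior M := by
  rw [ae_iff]
  have h : {p | p ∉ (𝓡∂ k).interior M} = (𝓡∂ k).boundary M :=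
    ModelWithCorners.compl_interior
  rw [h, vol_boundary]

lemma ae_mem_boundary : ∀ᵐ p ∂(bdryVol x), p ∈ (𝓡∂ k).boundary M := by
  rw [ae_iff]
  have h : {p | p ∉ (𝓡∂ k).boundary M} = (𝓡∂ k).interior M :=
    ModelWithCorners.compl_boundary
  rw [h, bdryVol_interior]

lemma paramMeasure_lt_top {E : Type*} [NormedAddCommGroup E] [NormedSpace ℝ E]
    [FiniteDimensional ℝ E] [MeasurableSpace E] [BorelSpace E] {μ : Measure E}
    [μ.IsAddHaarMeasure] {s : E → M} {Ω : Set E} {J : E → ℝ} (hΩ : MeasurableSet Ω)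
    (hs : AEMeasurable s (μ.restrict Ω)) {V : Set M} (hV : MeasurableSet V)
    (hm : MeasurableSet (Ω ∩ s ⁻¹' V)) (hJ : AEMeasurable J (μ.restrict Ω)) {C r : ℝ} {y₀ : E}
    (h : ∀ y ∈ Ω ∩ s ⁻¹' V, J y ≤ C ∧ y ∈ Metric.ball y₀ r) : paramMeasure μ s Ω J V < ⊤ := by
  rw [lintegral_paramMeasure_indicator hΩ hs hJ hV hm]
  calc ∫⁻ y in Ω ∩ s ⁻¹' V, ENNReal.ofReal (J y) ∂μ
      ≤ ∫⁻ _ in Ω ∩ s ⁻¹' V, ENNReal.ofReal C ∂μ :=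
        setLIntegral_mono' hm fun y hy => ENNReal.ofReal_le_ofReal (h y hy).1
    _ = ENNReal.ofReal C * μ (Ω ∩ s ⁻¹' V) := setLIntegral_const _ _
    _ < ⊤ := ENNReal.mul_lt_top ENNReal.ofReal_lt_top
        ((measure_mono fun y hy => (h y hy).2).trans_lt measure_ball_lt_top)

lemma exists_open_bound {c : OpenPartialHomeomorph M (EuclideanHalfSpace k)} {p : M}
    (hp : p ∈ c.source) {g : EuclideanSpace ℝ (Fin k) → ℝ}
    (hg : ContinuousOn g (c.extend (𝓡∂ k)).target) :
    ∃ V : Set M, IsOpen V ∧ p ∈ V ∧ V ⊆ c.source ∧ ∃ C : ℝ, ∀ y ∈ chartDomain c V,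
      g y ≤ C ∧ y ∈ Metric.ball (c.extend (𝓡∂ k) p) 1 := by
  have h1 : ContinuousOn (c.extend (𝓡∂ k)) c.source := by
    simpa only [c.extend_source] using c.continuousOn_extend (I := 𝓡∂ k)
  have h2 : ContinuousOn (fun q => g (c.extend (𝓡∂ k) q)) c.source :=
    hg.comp h1 fun q hq => extend_mem_target hq
  have h3 : ∀ᶠ q in nhds p, q ∈ c.source ∧ g (c.extend (𝓡∂ k) q) < g (c.extend (𝓡∂ k) p) + 1 ∧
      c.extend (𝓡∂ k) q ∈ Metric.ball (c.extend (𝓡∂ k) p) 1 := by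
    have hs := c.open_source.mem_nhds hp
    exact Filter.Eventually.and hs (((h2.continuousAt hs).eventually_lt continuousAt_const
      (lt_add_one _)).and ((h1.continuousAt hs).eventually
        (Metric.ball_mem_nhds _ one_pos)))
  obtain ⟨V, hV, hVo, hpV⟩ := eventually_nhds_iff.1 h3
  refine ⟨V, hVo, hpV, fun q hq => (hV q hq).1, g (c.extend (𝓡∂ k) p) + 1, fun y hy => ?_⟩
  have := (hV _ hy.2).2
  rw [(c.extend (𝓡∂ k)).right_inv hy.1] at this
  exact ⟨this.1.le, this.2⟩

lemma isLocallyFiniteMeasure_vol : IsLocallyFiniteMeasure (vol x) := by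
  refine ⟨fun p => ?_⟩
  have hc := chart_mem_atlas (EuclideanHalfSpace k) p
  obtain ⟨V, hVo, hpV, hVs, C, hC⟩ := exists_open_bound (mem_chart_source _ p)
    (continuousOn_jac_chartDiff x hc)
  refine ⟨V, hVo.mem_nhds hpV, ?_⟩
  rw [← Measure.restrict_eq_self (vol x) hVs, vol_restrict x hc]
  exact paramMeasure_lt_top (measurableSet_extend_target _) aemeasurable_extend_symm
    hVo.measurableSet (measurableSet_chartDomain hVo) (aemeasurable_jac x hc) hC

lemma isLocallyFiniteMeasure_bdryVol : IsLocallyFiniteMeasure (bdryVol x) := by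
  refine ⟨fun p => ?_⟩
  have hc := chart_mem_atlas (EuclideanHalfSpace k) p
  obtain ⟨V, hVo, hpV, hVs, C, hC⟩ := exists_open_bound (mem_chart_source _ p)
    (continuousOn_jac_chartDiff_incl x hc)
  refine ⟨V, hVo.mem_nhds hpV, ?_⟩
  rw [← Measure.restrict_eq_self (bdryVol x) hVs, bdryVol_restrict x hc]
  refine paramMeasure_lt_top (isOpen_preimage_hyperplaneIncl _).measurableSet
    aemeasurable_symm_incl hVo.measurableSet (isOpen_preimage_chartDomain hVo).measurableSet
    (aemeasurable_jac_incl x hc) (C := C)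
    (y₀ := 0) (r := ‖hyperplaneProj k‖ * (‖extChartAt (𝓡∂ k) p p‖ + 1) + 1) fun z hz => ⟨(hC _ hz).1, ?_⟩
  have h1 := (hC _ hz).2
  rw [mem_ball_iff_norm] at h1
  rw [mem_ball_zero_iff]
  calc ‖z‖ = ‖hyperplaneProj k (hyperplaneIncl k z)‖ := by rw [hyperplaneProj_incl]
    _ ≤ ‖hyperplaneProj k‖ * ‖hyperplaneIncl k z‖ := (hyperplaneProj k).le_opNorm _
    _ ≤ ‖hyperplaneProj k‖ * (‖extChartAt (𝓡∂ k) p p‖ + 1) := by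
        gcongr
        refine (norm_le_norm_add_norm_sub' _ (extChartAt (𝓡∂ k) p p)).trans ?_
        gcongr
        exact h1.le
    _ < _ := lt_add_one _

instance isFiniteMeasure_vol [CompactSpace M] : IsFiniteMeasure (vol x) :=
  have := isLocallyFiniteMeasure_vol x
  inferInstance

instance isFiniteMeasure_bdryVol [CompactSpace M] : IsFiniteMeasure (bdryVol x) :=
  have := isLocallyFiniteMeasure_bdryVol x
  inferInstance

variable {F : Type*} [NormedAddCommGroup F] [NormedSpace ℝ F]

lemma ae_jac_pos (hc : c ∈ atlas (EuclideanHalfSpace k) M) :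
    ∀ᵐ y ∂(volume.restrict (c.extend (𝓡∂ k)).target), 0 < jac (chartDiff x c y) :=
  (ae_restrict_iff' (measurableSet_extend_target c)).2
    (Filter.Eventually.of_forall fun _ hy => jac_pos _ (chartDiff_injective x hc hy))

lemma ae_jac_incl_pos (hc : c ∈ atlas (EuclideanHalfSpace k) M) :
    ∀ᵐ z ∂(volume.restrict (hyperplaneIncl k ⁻¹' (c.extend (𝓡∂ k)).target)),
      0 < jac ((chartDiff x c (hyperplaneIncl k z)).comp (hyperplaneIncl k)) :=
  (ae_restrict_iff' (isOpen_preimage_hyperplaneIncl c).measurableSet).2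
    (Filter.Eventually.of_forall fun _ hy => jac_pos _
      ((chartDiff_injective x hc hy).comp hyperplaneIncl_injective))

lemma integral_vol_eq_chart (hc : c ∈ atlas (EuclideanHalfSpace k) M) {f : M → F}
    (hf : AEStronglyMeasurable f (vol x)) (h0 : ∀ p ∉ c.source, f p = 0) :
    ∫ p, f p ∂(vol x) = ∫ y in (c.extend (𝓡∂ k)).target, jac (chartDiff x c y) • inChart c f y := by
  rw [← setIntegral_eq_integral_of_forall_compl_eq_zero (s := c.source) h0, vol_restrict x hc,
    chartVol_eq]
  refine integral_paramMeasure aemeasurable_extend_symm (aemeasurable_jac x hc) (ae_jac_pos x hc) ?_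
  rw [← chartVol_eq, ← vol_restrict x hc]
  exact hf.restrict

lemma integral_bdryVol_eq_chart (hc : c ∈ atlas (EuclideanHalfSpace k) M) {f : M → F}
    (hf : AEStronglyMeasurable f (bdryVol x)) (h0 : ∀ p ∉ c.source, f p = 0) :
    ∫ p, f p ∂(bdryVol x) = ∫ z in hyperplaneIncl k ⁻¹' (c.extend (𝓡∂ k)).target,
      jac ((chartDiff x c (hyperplaneIncl k z)).comp (hyperplaneIncl k)) •
        inChart c f (hyperplaneIncl k z) := by
  rw [← setIntegral_eq_integral_of_forall_compl_eq_zero (s := c.source) h0, bdryVol_restrict x hc,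
    chartBdryVol_eq]
  refine integral_paramMeasure aemeasurable_symm_incl (aemeasurable_jac_incl x hc)
    (ae_jac_incl_pos x hc) ?_
  rw [← chartBdryVol_eq, ← bdryVol_restrict x hc]
  exact hf.restrict

end Volume

/-! ### The divergence in coordinates -/

section Divergence

variable {n k : ℕ} [NeZero k] {M : Type*} [TopologicalSpace M]
  [ChartedSpace (EuclideanHalfSpace k) M] [IsManifold (𝓡∂ k) ∞ M] (x : Immersion k n M)
  {c : OpenPartialHomeomorph M (EuclideanHalfSpace k)}

/-- The components in the chart `c` of the field `Y` (of its tangential part, in general). -/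
def chartVec (x : Immersion k n M) (c : OpenPartialHomeomorph M (EuclideanHalfSpace k))
    (Y : M → Amb n) (y : EuclideanSpace ℝ (Fin k)) : EuclideanSpace ℝ (Fin k) :=
  pinv (chartDiff x c y) (inChart c Y y)

/-- The components in the chart `c` of the field `Y`, times the volume density: the vector field
`√g η` whose Euclidean divergence is `√g div Y`. -/
def chartFlux (x : Immersion k n M) (c : OpenPartialHomeomorph M (EuclideanHalfSpace k))
    (Y : M → Amb n) (y : EuclideanSpace ℝ (Fin k)) : EuclideanSpace ℝ (Fin k) :=
  jac (chartDiff x c y) • chartVec x c Y y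

lemma contDiffOn_chartVec (hc : c ∈ atlas (EuclideanHalfSpace k) M) {Y : M → Amb n}
    (hY : ContMDiff (𝓡∂ k) 𝓘(ℝ, Amb n) ∞ Y) :
    ContDiffOn ℝ ∞ (chartVec x c Y) (c.extend (𝓡∂ k)).target :=
  (contDiffOn_pinv_chartDiff x hc).clm_apply (contDiffOn_inChart hc hY)

lemma contDiffOn_chartFlux (hc : c ∈ atlas (EuclideanHalfSpace k) M) {Y : M → Amb n}
    (hY : ContMDiff (𝓡∂ k) 𝓘(ℝ, Amb n) ∞ Y) :
    ContDiffOn ℝ ∞ (chartFlux x c Y) (c.extend (𝓡∂ k)).target :=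
  (contDiffOn_jac_chartDiff x hc).smul (contDiffOn_chartVec x hc hY)

lemma chartDiff_chartVec (hc : c ∈ atlas (EuclideanHalfSpace k) M) {Y : M → Amb n}
    (hY : ∀ p, Y p ∈ tangentPlane x p) {y : EuclideanSpace ℝ (Fin k)}
    (hy : y ∈ (c.extend (𝓡∂ k)).target) : chartDiff x c y (chartVec x c Y y) = inChart c Y y := by
  have h1 := tanProj_eq x hc (symm_mem_source hy)
  rw [(c.extend (𝓡∂ k)).right_inv hy] at h1
  have h2 := DFunLike.congr_fun h1 (inChart c Y y)
  rw [ContinuousLinearMap.comp_apply] at h2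
  rw [chartVec, ← h2]
  exact (tanProj_eq_self_iff x).2 (hY _)

lemma _root_.ContDiffOn.differentiableWithinAt_range {E : Type*} [NormedAddCommGroup E]
    [NormedSpace ℝ E] {g : EuclideanSpace ℝ (Fin k) → E}
    (hg : ContDiffOn ℝ ∞ g (c.extend (𝓡∂ k)).target) {y : EuclideanSpace ℝ (Fin k)}
    (hy : y ∈ (c.extend (𝓡∂ k)).target) :
    DifferentiableWithinAt ℝ g (Set.range (𝓡∂ k)) y :=
  ((hg y hy).mono_of_mem_nhdsWithin (extend_target_mem_nhdsWithin' hy)).differentiableWithinAt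
    (by simp)

/-- The divergence in coordinates, `√g div Y = ∑ᵢ ∂ᵢ (√g ηⁱ)`. -/
lemma jac_mul_tanDiv (hc : c ∈ atlas (EuclideanHalfSpace k) M) {Y : M → Amb n}
    (hY : IsTangentField x Y) {y : EuclideanSpace ℝ (Fin k)}
    (hy : y ∈ (c.extend (𝓡∂ k)).target) :
    jac (chartDiff x c y) * inChart c (tanDiv x Y) y =
      LinearMap.trace ℝ _ (fderivWithin ℝ (chartFlux x c Y) (Set.range (𝓡∂ k)) y :
        EuclideanSpace ℝ (Fin k) →ₗ[ℝ] EuclideanSpace ℝ (Fin k)) := by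
  have hyr := range_of_mem_extend_target hy
  have hu := uniqueDiffWithinAt_range hyr
  have hL := chartDiff_injective x hc hy
  have hp := symm_mem_source hy
  set L := chartDiff x c y with hLdef
  set η := chartVec x c Y y with hη
  set DL := fderivWithin ℝ (chartDiff x c) (Set.range (𝓡∂ k)) y with hDLdef
  set Dη := fderivWithin ℝ (chartVec x c Y) (Set.range (𝓡∂ k)) y with hDη
  have hDL : HasFDerivWithinAt (chartDiff x c) DL (Set.range (𝓡∂ k)) y :=
    ((contDiffOn_chartDiff x hc).differentiableWithinAt_range hy).hasFDerivWithinAt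
  have hdη : HasFDerivWithinAt (chartVec x c Y) Dη (Set.range (𝓡∂ k)) y :=
    ((contDiffOn_chartVec x hc hY.1).differentiableWithinAt_range hy).hasFDerivWithinAt
  have hsx := (contDiffWithinAt_inChart hc x.smooth hy).isSymmSndFDerivWithinAt (by
      rw [minSmoothness_of_isRCLikeNormedField]
      exact WithTop.coe_le_coe.2 le_top)
    (𝓡∂ k).uniqueDiffOn ((𝓡∂ k).range_subset_closure_interior hyr) hyr
  have hsymm : DL.flip η = DL η := by
    ext1 ξ
    exact hsx ξ η
  have hDY : fderivWithin ℝ (inChart c Y) (Set.range (𝓡∂ k)) y = L.comp Dη + DL.flip η := by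
    have h1 := hDL.clm_apply hdη
    refine (h1.congr_of_eventuallyEq ?_ ?_).fderivWithin hu
    · filter_upwards [extend_target_mem_nhdsWithin' hy] with y' hy'
      exact (chartDiff_chartVec x hc hY.2 hy').symm
    · exact (chartDiff_chartVec x hc hY.2 hy).symm
  have hJ : HasFDerivWithinAt (fun y => jac (chartDiff x c y))
      ((fderiv ℝ (jac : (EuclideanSpace ℝ (Fin k) →L[ℝ] Amb n) → ℝ) L).comp DL)
      (Set.range (𝓡∂ k)) y :=
    HasFDerivAt.comp_hasFDerivWithinAt y
      ((contDiffAt_jac (m := 1) L hL).differentiableAt one_ne_zero).hasFDerivAt hDL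
  have hflux := (hJ.smul hdη).fderivWithin hu
  have e1 : inChart c (tanDiv x Y) y = LinearMap.trace ℝ _
      ((pinv L).comp (L.comp Dη + DL.flip η) :
        EuclideanSpace ℝ (Fin k) →ₗ[ℝ] EuclideanSpace ℝ (Fin k)) := by
    rw [← hDY, inChart, Function.comp_apply, tanDiv_eq, tanDeriv_eq x hc hY.1 hp,
      (c.extend (𝓡∂ k)).right_inv hy]
    rw [ContinuousLinearMap.toLinearMap_comp, LinearMap.trace_comp_comm',
      LinearMap.trace_eq_sum_inner _ (EuclideanSpace.basisFun (Fin n) ℝ)]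
    refine Finset.sum_congr rfl fun a _ => ?_
    rw [real_inner_comm]
    simp [hLdef]
  have e2 : (pinv L).comp (L.comp Dη + DL.flip η) = Dη + (pinv L).comp (DL η) := by
    rw [hsymm]
    ext1 ξ
    simp only [ContinuousLinearMap.comp_apply, _root_.add_apply, map_add, pinv_apply_apply L hL]
  have hfl : fderivWithin ℝ (chartFlux x c Y) (Set.range (𝓡∂ k)) y =
      jac L • Dη + ((fderiv ℝ (jac : (EuclideanSpace ℝ (Fin k) →L[ℝ] Amb n) → ℝ) L).comp
        DL).smulRight η := hflux
  have e3 : LinearMap.trace ℝ _ ((((fderiv ℝ (jac : (EuclideanSpace ℝ (Fin k) →L[ℝ] Amb n) → ℝ)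
      L).comp DL).smulRight η : EuclideanSpace ℝ (Fin k) →L[ℝ] EuclideanSpace ℝ (Fin k)) :
        EuclideanSpace ℝ (Fin k) →ₗ[ℝ] EuclideanSpace ℝ (Fin k)) =
      fderiv ℝ (jac : (EuclideanSpace ℝ (Fin k) →L[ℝ] Amb n) → ℝ) L (DL η) := by
    have := LinearMap.trace_smulRight
      (((fderiv ℝ (jac : (EuclideanSpace ℝ (Fin k) →L[ℝ] Amb n) → ℝ) L).comp DL :
        EuclideanSpace ℝ (Fin k) →L[ℝ] ℝ) : EuclideanSpace ℝ (Fin k) →ₗ[ℝ] ℝ) η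
    exact this
  rw [hfl, e1, e2, ContinuousLinearMap.toLinearMap_add, ContinuousLinearMap.toLinearMap_add, map_add, map_add, e3, fderiv_jac_apply L hL,
    ContinuousLinearMap.toLinearMap_smul, map_smul]
  rw [smul_eq_mul]
  ring

end Divergence

/-! ### Divergences with compact support in Euclidean space -/

section Extension

variable {E F : Type*} [NormedAddCommGroup E] [NormedSpace ℝ E] [NormedAddCommGroup F]
  [NormedSpace ℝ F]

/-- Extension by zero of a smooth function with compact support in an open set. -/
lemma contDiff_indicator {Ω K : Set E} (hΩ : IsOpen Ω) (hK : IsCompact K) (hKΩ : K ⊆ Ω) {g : E → F}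
    (hg : ContDiffOn ℝ ∞ g Ω) (h0 : ∀ y ∈ Ω, y ∉ K → g y = 0) :
    ContDiff ℝ ∞ (Ω.indicator g) ∧ ∀ y ∉ K, Ω.indicator g y = 0 := by
  have h1 : ∀ y ∉ K, Ω.indicator g y = 0 := fun y hy => by
    by_cases h : y ∈ Ω
    · rw [Set.indicator_of_mem h, h0 y h hy]
    · exact Set.indicator_of_notMem h _
  refine ⟨contDiff_iff_contDiffAt.2 fun y => ?_, h1⟩
  by_cases hy : y ∈ K
  · refine ((hg y (hKΩ hy)).contDiffAt (hΩ.mem_nhds (hKΩ hy))).congr_of_eventuallyEq ?_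
    filter_upwards [hΩ.mem_nhds (hKΩ hy)] with z hz
    exact Set.indicator_of_mem hz _
  · refine (contDiffAt_const (c := (0 : F))).congr_of_eventuallyEq ?_
    filter_upwards [hK.isClosed.isOpen_compl.mem_nhds hy] with z hz
    exact h1 z hz

lemma integral_fderiv_eq_zero [FiniteDimensional ℝ E] [MeasurableSpace E] [BorelSpace E]
    (μ : Measure E) [μ.IsAddHaarMeasure] {g : E → ℝ} (hg : ContDiff ℝ ∞ g)
    (hs : HasCompactSupport g) (v : E) : ∫ y, fderiv ℝ g y v ∂μ = 0 := by
  have h1 : Continuous fun y => fderiv ℝ g y v :=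
    (hg.continuous_fderiv (by simp)).clm_apply continuous_const
  have h := integral_smul_fderiv_eq_neg_fderiv_smul_of_integrable (𝕜 := ℝ) (μ := μ)
    (f := fun _ : E => (1 : ℝ)) (g := g) (v := v) (by simp) (by
      simpa using h1.integrable_of_hasCompactSupport (hs.fderiv_apply (𝕜 := ℝ) v))
    (by simpa using hg.continuous.integrable_of_hasCompactSupport hs)
    (fun y _ => differentiableAt_const _) (fun y _ => hg.differentiable (by simp) y)
  simpa using h

lemma integral_trace_fderiv_eq_zero {ι : Type*} [Fintype ι]
    {g : EuclideanSpace ℝ ι → EuclideanSpace ℝ ι} (hg : ContDiff ℝ ∞ g)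
    (hs : HasCompactSupport g) :
    ∫ y, LinearMap.trace ℝ _ (fderiv ℝ g y : EuclideanSpace ℝ ι →ₗ[ℝ] EuclideanSpace ℝ ι) = 0 := by
  classical
  have h1 : ∀ (i : ι) y, inner ℝ (EuclideanSpace.basisFun ι ℝ i)
      (fderiv ℝ g y (EuclideanSpace.basisFun ι ℝ i)) =
      fderiv ℝ (fun y => inner ℝ (EuclideanSpace.basisFun ι ℝ i) (g y)) y
        (EuclideanSpace.basisFun ι ℝ i) := by
    intro i y
    have := ((innerSL ℝ (EuclideanSpace.basisFun ι ℝ i)).hasFDerivAt.comp y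
      (hg.differentiable (by simp) y).hasFDerivAt).fderiv
    have h2 : (fun y => (inner ℝ (EuclideanSpace.basisFun ι ℝ i) (g y) : ℝ)) =
      (innerSL ℝ (EuclideanSpace.basisFun ι ℝ i)) ∘ g := rfl
    rw [h2, this]
    rfl
  have h2 : ∀ i : ι, ContDiff ℝ ∞ fun y => (inner ℝ (EuclideanSpace.basisFun ι ℝ i) (g y) : ℝ) :=
    fun i => contDiff_const.inner ℝ hg
  have h3 : ∀ i : ι, HasCompactSupport
      fun y => (inner ℝ (EuclideanSpace.basisFun ι ℝ i) (g y) : ℝ) := fun i =>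
    hs.comp_left (g := fun w => (inner ℝ (EuclideanSpace.basisFun ι ℝ i) w : ℝ))
      (inner_zero_right _)
  simp_rw [LinearMap.trace_eq_sum_inner _ (EuclideanSpace.basisFun ι ℝ),
    ContinuousLinearMap.coe_coe, h1]
  rw [integral_finsetSum]
  · exact Finset.sum_eq_zero fun i _ => integral_fderiv_eq_zero volume (h2 i) (h3 i) _
  · intro i _
    exact ((h2 i).continuous_fderiv (by simp)).clm_apply continuous_const
      |>.integrable_of_hasCompactSupport ((h3 i).fderiv_apply (𝕜 := ℝ) _)

end Extension

/-! ### The divergence theorem for fields with compact support in the interior -/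

section InteriorDivergence

variable {n k : ℕ} [NeZero k] {M : Type*} [TopologicalSpace M]
  [ChartedSpace (EuclideanHalfSpace k) M] [IsManifold (𝓡∂ k) ∞ M]
  {c : OpenPartialHomeomorph M (EuclideanHalfSpace k)}

/-- A smooth partition of unity subordinate to a family of neighbourhoods of the points of a
compact manifold. -/
lemma exists_smooth_partition [T2Space M] [CompactSpace M] (U : M → Set M)
    (hU : ∀ p, IsOpen (U p)) (hp : ∀ p, p ∈ U p) :
    ∃ (t : Finset M) (ψ : t → M → ℝ), (∀ i, ContMDiff (𝓡∂ k) 𝓘(ℝ, ℝ) ∞ (ψ i)) ∧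
      (∀ i : t, tsupport (ψ i) ⊆ U i) ∧ ∀ p, ∑ i, ψ i p = 1 := by
  obtain ⟨t, ht⟩ := isCompact_univ.elim_finite_subcover U hU fun p _ => Set.mem_iUnion.2 ⟨p, hp p⟩
  obtain ⟨f, hf⟩ := SmoothPartitionOfUnity.exists_isSubordinate (𝓡∂ k) (s := Set.univ)
    isClosed_univ (fun i : t => U i) (fun i => hU i) (fun p hp => by
      obtain ⟨i, hi, h⟩ := Set.mem_iUnion₂.1 (ht hp)
      exact Set.mem_iUnion.2 ⟨⟨i, hi⟩, h⟩)
  refine ⟨t, fun i => f i, fun i => (f i).contMDiff, hf, fun p => ?_⟩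
  rw [← f.sum_eq_one (Set.mem_univ p), finsum_eq_sum_of_fintype]

lemma interior_target_eq (c : OpenPartialHomeomorph M (EuclideanHalfSpace k)) :
    interior (c.extend (𝓡∂ k)).target = {y | y ∈ (c.extend (𝓡∂ k)).target ∧ 0 < y 0} := by
  rw [c.extend_target, interior_inter, interior_range_modelWithCornersEuclideanHalfSpace,
    (c.open_target.preimage (𝓡∂ k).continuous_symm).interior_eq]
  ext y
  constructor
  · rintro ⟨h1, h2⟩
    have h2' : 0 < y 0 := h2
    exact ⟨⟨h1, mem_range_halfSpace_iff.2 h2'.le⟩, h2'⟩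
  · rintro ⟨⟨h1, _⟩, h2⟩
    exact ⟨h1, h2⟩

/-- The image of the set `A` in the chart `c`. -/
def chartSupport (c : OpenPartialHomeomorph M (EuclideanHalfSpace k)) (A : Set M) :
    Set (EuclideanSpace ℝ (Fin k)) := c.extend (𝓡∂ k) '' A

lemma isCompact_chartSupport [CompactSpace M] {A : Set M} (hA : IsClosed A) (hAc : A ⊆ c.source) :
    IsCompact (chartSupport c A) := by
  refine hA.isCompact.image_of_continuousOn ?_
  have : ContinuousOn (c.extend (𝓡∂ k)) c.source := by
    simpa only [c.extend_source] using c.continuousOn_extend (I := 𝓡∂ k)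
  exact this.mono hAc

lemma inChart_eq_zero {F : Type*} [Zero F] {f : M → F} {y : EuclideanSpace ℝ (Fin k)}
    (hy : y ∈ (c.extend (𝓡∂ k)).target) (h : y ∉ chartSupport c (tsupport f)) :
    f ((c.extend (𝓡∂ k)).symm y) = 0 := by
  by_contra hne
  exact h ⟨_, subset_tsupport f hne, (c.extend (𝓡∂ k)).right_inv hy⟩

variable (x : Immersion k n M)

lemma chartFlux_eq_zero {Y : M → Amb n} {y : EuclideanSpace ℝ (Fin k)}
    (hy : y ∈ (c.extend (𝓡∂ k)).target) (h : y ∉ chartSupport c (tsupport Y)) :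
    chartFlux x c Y y = 0 := by
  rw [chartFlux, chartVec, inChart, Function.comp_apply, inChart_eq_zero hy h, map_zero, smul_zero]

lemma tanDeriv_eq_zero {F : Type*} [NormedAddCommGroup F] [NormedSpace ℝ F] {f : M → F} {p : M}
    (hp : p ∉ tsupport f) : tanDeriv x f p = 0 := by
  have h1 : f =ᶠ[nhds p] fun _ => 0 := notMem_tsupport_iff_eventuallyEq.1 hp
  have h2 : mfderiv (𝓡∂ k) 𝓘(ℝ, F) f p = mfderiv (𝓡∂ k) 𝓘(ℝ, F) (fun _ : M => (0 : F)) p :=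
    h1.mfderiv_eq
  have h3 := tanDeriv_const x (0 : F) p
  rw [← h3, tanDeriv, tanDeriv]
  congr 1

lemma tanDiv_eq_zero {Y : M → Amb n} {p : M} (hp : p ∉ tsupport Y) : tanDiv x Y p = 0 := by
  simp [tanDiv, tanDeriv_eq_zero x hp]

lemma continuous_tanDiv {Y : M → Amb n} (hY : ContMDiff (𝓡∂ k) 𝓘(ℝ, Amb n) ∞ Y) :
    Continuous (tanDiv x Y) := by
  have h : tanDiv x Y = fun p => ∑ a, inner ℝ (tanDeriv x Y p (bv a)) (bv a) :=
    funext fun p => tanDiv_eq x Y p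
  rw [h]
  exact continuous_finsetSum _ fun a _ =>
    (((contMDiff_tanDeriv x hY).continuous.clm_apply continuous_const).inner continuous_const)

lemma isTangentField_smul {ψ : M → ℝ} (hψ : ContMDiff (𝓡∂ k) 𝓘(ℝ, ℝ) ∞ ψ) {Y : M → Amb n}
    (hY : IsTangentField x Y) : IsTangentField x (fun p => ψ p • Y p) :=
  ⟨hψ.smul hY.1, fun p => Submodule.smul_mem _ _ (hY.2 p)⟩

lemma tanDiv_sum {ι : Type*} (s : Finset ι) {Y : ι → M → Amb n}
    (hY : ∀ i ∈ s, ContMDiff (𝓡∂ k) 𝓘(ℝ, Amb n) ∞ (Y i)) (p : M) :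
    tanDiv x (fun q => ∑ i ∈ s, Y i q) p = ∑ i ∈ s, tanDiv x (Y i) p := by
  simp_rw [tanDiv_eq]
  rw [tanDeriv_sum x s hY, Finset.sum_comm]
  simp [sum_inner]

lemma tanDiv_smul {g : M → ℝ} (hg : ContMDiff (𝓡∂ k) 𝓘(ℝ, ℝ) ∞ g) {Y : M → Amb n}
    (hY : IsTangentField x Y) (p : M) :
    tanDiv x (fun q => g q • Y q) p = tanDeriv x g p (Y p) + g p * tanDiv x Y p := by
  simp_rw [tanDiv_eq, tanDeriv_smul x hg hY.1, inner_add_left, inner_smul_left]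
  rw [Finset.sum_add_distrib, Finset.mul_sum]
  congr 1
  conv_rhs => rw [← sum_inner_smul_bv (Y p), map_sum]
  refine Finset.sum_congr rfl fun a _ => ?_
  rw [map_smul, smul_eq_mul, mul_comm]
  rfl

variable [MeasurableSpace M] [BorelSpace M]

lemma integral_tanDiv_eq_zero_of_chart [CompactSpace M]
    (hc : c ∈ atlas (EuclideanHalfSpace k) M) {Y : M → Amb n}
    (hY : IsTangentField x Y) (hs : tsupport Y ⊆ c.source) (hi : tsupport Y ⊆ (𝓡∂ k).interior M) :
    ∫ p, tanDiv x Y p ∂(vol x) = 0 := by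
  have hK := isCompact_chartSupport (isClosed_tsupport Y) hs
  set K := chartSupport c (tsupport Y) with hKdef
  set T := (c.extend (𝓡∂ k)).target with hT
  have hKi : K ⊆ interior T := by
    rw [interior_target_eq]
    rintro _ ⟨p, hp, rfl⟩
    have h1 := extend_mem_target (c := c) (hs hp)
    refine ⟨h1, lt_of_le_of_ne (mem_range_halfSpace_iff.1 (range_of_mem_extend_target h1)) ?_⟩
    intro h
    have h2 := (mem_boundary_iff hc (hs hp)).2 h.symm
    rw [← ModelWithCorners.compl_interior] at h2
    exact h2 (hi hp)
  -- the flux in the chart has compact support in the interior, and extends by zero to `ℝᵏ`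
  obtain ⟨hV, hV0⟩ := contDiff_indicator isOpen_interior hK hKi
    ((contDiffOn_chartFlux x hc hY.1).mono interior_subset)
    (fun y hy h => chartFlux_eq_zero x (interior_subset hy) h)
  set V := (interior T).indicator (chartFlux x c Y) with hVdef
  have hVeq : ∀ y ∈ T, V y = chartFlux x c Y y := by
    intro y hy
    by_cases h : y ∈ K
    · exact Set.indicator_of_mem (hKi h) _
    · rw [hV0 y h, chartFlux_eq_zero x hy h]
  rw [integral_vol_eq_chart x hc (continuous_tanDiv x hY.1).aestronglyMeasurable
    (fun p hp => tanDiv_eq_zero x fun h => hp (hs h))]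
  have hV1 := integral_trace_fderiv_eq_zero hV (HasCompactSupport.intro hK hV0)
  rw [← setIntegral_eq_integral_of_forall_compl_eq_zero (s := T)] at hV1
  · rw [← hV1]
    refine setIntegral_congr_fun (measurableSet_extend_target c) fun y hy => ?_
    simp only [smul_eq_mul]
    rw [jac_mul_tanDiv x hc hY hy]
    have h1 : fderivWithin ℝ (chartFlux x c Y) (Set.range (𝓡∂ k)) y =
        fderivWithin ℝ V (Set.range (𝓡∂ k)) y := by
      refine Filter.EventuallyEq.fderivWithin_eq ?_ (hVeq y hy).symm
      filter_upwards [extend_target_mem_nhdsWithin' hy] with z hz using (hVeq z hz).symm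
    rw [h1, ((hV.differentiable (by simp)) y).fderivWithin
      (uniqueDiffWithinAt_range (range_of_mem_extend_target hy))]
  · intro y hy
    have h1 : y ∉ K := fun h => hy (interior_subset (hKi h))
    have h2 : V =ᶠ[nhds y] fun _ => 0 := by
      filter_upwards [hK.isClosed.isOpen_compl.mem_nhds h1] with z hz using hV0 z hz
    rw [h2.fderiv_eq]
    simp

variable [T2Space M] [CompactSpace M]

/-- The divergence theorem for fields with compact support in the interior. -/
lemma integral_tanDiv_eq_zero {Y : M → Amb n} (hY : IsTangentField x Y)
    (hi : tsupport Y ⊆ (𝓡∂ k).interior M) : ∫ p, tanDiv x Y p ∂(vol x) = 0 := by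
  obtain ⟨t, ψ, hψ, hs, h1⟩ := exists_smooth_partition (M := M) (k := k)
    (fun p => (chartAt (EuclideanHalfSpace k) p).source)
    (fun p => (chartAt (EuclideanHalfSpace k) p).open_source) (fun p => mem_chart_source _ p)
  have h2 : Y = fun q => ∑ i, ψ i q • Y q := by
    funext q
    rw [← Finset.sum_smul, h1, one_smul]
  have hYi : ∀ i, IsTangentField x (fun q => ψ i q • Y q) :=
    fun i => isTangentField_smul x (hψ i) hY
  have h3 : tanDiv x Y = fun p => ∑ i, tanDiv x (fun q => ψ i q • Y q) p := by
    funext p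
    conv_lhs => rw [h2]
    exact tanDiv_sum x _ (fun i _ => (hYi i).1) p
  rw [h3, integral_finsetSum]
  · refine Finset.sum_eq_zero fun i _ => ?_
    exact integral_tanDiv_eq_zero_of_chart x (chart_mem_atlas _ i.1) (hYi i)
      ((tsupport_smul_subset_left (ψ i) Y).trans (hs i))
      ((tsupport_smul_subset_right (ψ i) Y).trans hi)
  · intro i _
    exact (continuous_tanDiv x (hYi i).1).integrable_of_hasCompactSupport
      (HasCompactSupport.of_compactSpace _)

end InteriorDivergence

/-! ### The geometry at the free boundary -/

section BoundaryGeometry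

variable {n k : ℕ} [NeZero k] {M : Type*} [TopologicalSpace M]
  [ChartedSpace (EuclideanHalfSpace k) M] [IsManifold (𝓡∂ k) ∞ M] (x : Immersion k n M)
  {c : OpenPartialHomeomorph M (EuclideanHalfSpace k)}
  {F : Type*} [NormedAddCommGroup F] [NormedSpace ℝ F]

lemma tanDeriv_chartDiff (hc : c ∈ atlas (EuclideanHalfSpace k) M) {f : M → F}
    (hf : ContMDiff (𝓡∂ k) 𝓘(ℝ, F) ∞ f) {y : EuclideanSpace ℝ (Fin k)}
    (hy : y ∈ (c.extend (𝓡∂ k)).target) (ξ : EuclideanSpace ℝ (Fin k)) :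
    tanDeriv x f ((c.extend (𝓡∂ k)).symm y) (chartDiff x c y ξ) =
      fderivWithin ℝ (inChart c f) (Set.range (𝓡∂ k)) y ξ := by
  rw [tanDeriv_eq x hc hf (symm_mem_source hy), (c.extend (𝓡∂ k)).right_inv hy,
    ContinuousLinearMap.comp_apply, pinv_apply_apply _ (chartDiff_injective x hc hy)]

lemma fderivWithin_incl_eq_zero (hc : c ∈ atlas (EuclideanHalfSpace k) M) {f : M → F}
    (hf : ContMDiff (𝓡∂ k) 𝓘(ℝ, F) ∞ f) (h0 : ∀ p ∈ (𝓡∂ k).boundary M, f p = 0)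
    {z : EuclideanSpace ℝ {i : Fin k // i ≠ 0}}
    (hz : hyperplaneIncl k z ∈ (c.extend (𝓡∂ k)).target)
    (ζ : EuclideanSpace ℝ {i : Fin k // i ≠ 0}) :
    fderivWithin ℝ (inChart c f) (Set.range (𝓡∂ k)) (hyperplaneIncl k z) (hyperplaneIncl k ζ)
      = 0 := by
  have h1 := hasFDerivWithinAt_univ.1
    ((differentiableWithinAt_inChart hc hf hz).hasFDerivWithinAt.comp z
      ((hyperplaneIncl k).hasFDerivAt.hasFDerivWithinAt (s := Set.univ)) (fun z _ => by
        rw [mem_range_halfSpace_iff, hyperplaneIncl_apply_zero]))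
  have h2 : (inChart c f ∘ hyperplaneIncl k) =ᶠ[nhds z] fun _ => 0 := by
    filter_upwards [(isOpen_preimage_hyperplaneIncl c).mem_nhds hz] with w hw
    exact h0 _ ((symm_mem_boundary_iff hc hw).2 (hyperplaneIncl_apply_zero w))
  have h3 := h1.unique ((hasFDerivAt_const (0 : F) z).congr_of_eventuallyEq h2)
  exact DFunLike.congr_fun h3 ζ

/-- The points of a chart with vanishing first coordinate lie on the boundary. -/
lemma symm_incl_mem_boundary (hc : c ∈ atlas (EuclideanHalfSpace k) M)
    {z : EuclideanSpace ℝ {i : Fin k // i ≠ 0}}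
    (hz : hyperplaneIncl k z ∈ (c.extend (𝓡∂ k)).target) :
    (c.extend (𝓡∂ k)).symm (hyperplaneIncl k z) ∈ (𝓡∂ k).boundary M :=
  (symm_mem_boundary_iff hc hz).2 (hyperplaneIncl_apply_zero z)

variable {x}

lemma halfSq_nonpos (hx : IsFreeBoundaryMinimal x) (p : M) : halfSq x p ≤ 0 := by
  have h := hx.ball p
  rw [mem_closedBall_zero_iff] at h
  rw [halfSq, real_inner_self_eq_norm_sq]
  nlinarith [norm_nonneg (x.toFun p)]

lemma norm_pos_boundary (hx : IsFreeBoundaryMinimal x) {p : M} (hp : p ∈ (𝓡∂ k).boundary M) :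
    ‖x.toFun p‖ = 1 := by simpa using hx.sphere p hp

lemma halfSq_boundary (hx : IsFreeBoundaryMinimal x) {p : M} (hp : p ∈ (𝓡∂ k).boundary M) :
    halfSq x p = 0 := by
  rw [halfSq, real_inner_self_eq_norm_sq, norm_pos_boundary hx hp]
  norm_num

/-- Along the boundary the position vector is tangent to the submanifold. -/
lemma pos_mem_tangentPlane (hx : IsFreeBoundaryMinimal x) {p : M}
    (hp : p ∈ (𝓡∂ k).boundary M) : x.toFun p ∈ tangentPlane x p := by
  rw [← hx.orthogonal p hp, conormal]
  refine Submodule.neg_mem _ (Submodule.smul_mem _ _ ?_)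
  rw [inwardVec, Submodule.starProjection_orthogonal]
  have hle : boundaryTangent x p ≤ tangentPlane x p := by
    rintro _ ⟨ζ, rfl⟩
    exact ⟨hyperplaneIncl k ζ, rfl⟩
  exact Submodule.sub_mem _ ⟨_, rfl⟩ (hle (Submodule.starProjection_apply_mem _ _))

lemma tanProj_pos (hx : IsFreeBoundaryMinimal x) {p : M} (hp : p ∈ (𝓡∂ k).boundary M) :
    tanProj x p (x.toFun p) = x.toFun p := (tanProj_eq_self_iff x).2 (pos_mem_tangentPlane hx hp)

lemma posNor_boundary (hx : IsFreeBoundaryMinimal x) {p : M} (hp : p ∈ (𝓡∂ k).boundary M) :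
    posNor x p = 0 := by rw [posNor, norProj_apply, tanProj_pos hx hp, sub_self]

lemma confNor_boundary (hx : IsFreeBoundaryMinimal x) (v : Amb n) {p : M}
    (hp : p ∈ (𝓡∂ k).boundary M) : confNor x v p = 0 := by
  rw [confNor, halfSq_boundary hx hp, posNor_boundary hx hp]
  simp

/-- Along the boundary, `⟨x, ·⟩` is the differential of `(|x|² - 1)/2`. -/
lemma inner_pos_eq_tanDeriv (hx : IsFreeBoundaryMinimal x) {p : M}
    (hp : p ∈ (𝓡∂ k).boundary M) (u : Amb n) :
    inner ℝ (x.toFun p) u = tanDeriv x (halfSq x) p u := by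
  rw [tanDeriv_halfSq, ← inner_tanProj_left, tanProj_pos hx hp]

lemma inner_pos_chartDiff_incl (hx : IsFreeBoundaryMinimal x)
    (hc : c ∈ atlas (EuclideanHalfSpace k) M) {z : EuclideanSpace ℝ {i : Fin k // i ≠ 0}}
    (hz : hyperplaneIncl k z ∈ (c.extend (𝓡∂ k)).target)
    (ζ : EuclideanSpace ℝ {i : Fin k // i ≠ 0}) :
    inner ℝ (x.toFun ((c.extend (𝓡∂ k)).symm (hyperplaneIncl k z)))
      (chartDiff x c (hyperplaneIncl k z) (hyperplaneIncl k ζ)) = 0 := by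
  rw [inner_pos_eq_tanDeriv hx (symm_incl_mem_boundary hc hz),
    tanDeriv_chartDiff x hc (contMDiff_halfSq x) hz,
    fderivWithin_incl_eq_zero hc (contMDiff_halfSq x) (fun p hp => halfSq_boundary hx hp) hz]

lemma eq_add_hyperplaneIncl (ξ : EuclideanSpace ℝ (Fin k)) :
    ξ = ξ 0 • EuclideanSpace.single 0 1 + hyperplaneIncl k (hyperplaneProj k ξ) := by
  rw [hyperplaneIncl_proj]; abel

lemma inner_pos_chartDiff (hx : IsFreeBoundaryMinimal x)
    (hc : c ∈ atlas (EuclideanHalfSpace k) M) {z : EuclideanSpace ℝ {i : Fin k // i ≠ 0}}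
    (hz : hyperplaneIncl k z ∈ (c.extend (𝓡∂ k)).target) (ξ : EuclideanSpace ℝ (Fin k)) :
    inner ℝ (x.toFun ((c.extend (𝓡∂ k)).symm (hyperplaneIncl k z)))
      (chartDiff x c (hyperplaneIncl k z) ξ) =
    ξ 0 * inner ℝ (x.toFun ((c.extend (𝓡∂ k)).symm (hyperplaneIncl k z)))
      (chartDiff x c (hyperplaneIncl k z) (EuclideanSpace.single 0 1)) := by
  conv_lhs => rw [eq_add_hyperplaneIncl ξ]
  rw [map_add, inner_add_right, inner_pos_chartDiff_incl hx hc hz, map_smul, inner_smul_right,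
    add_zero]

lemma pos_mem_range_chartDiff (hx : IsFreeBoundaryMinimal x)
    (hc : c ∈ atlas (EuclideanHalfSpace k) M) {z : EuclideanSpace ℝ {i : Fin k // i ≠ 0}}
    (hz : hyperplaneIncl k z ∈ (c.extend (𝓡∂ k)).target) :
    x.toFun ((c.extend (𝓡∂ k)).symm (hyperplaneIncl k z)) ∈ LinearMap.range
      (chartDiff x c (hyperplaneIncl k z) : EuclideanSpace ℝ (Fin k) →ₗ[ℝ] Amb n) := by
  have h := pos_mem_tangentPlane hx (symm_incl_mem_boundary hc hz)
  rwa [tangentPlane_eq x hc (symm_mem_source hz), (c.extend (𝓡∂ k)).right_inv hz] at h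

/-- The position vector points outwards along the boundary: `⟨x, ∂₀x⟩ < 0`, since `|x|² - 1` is
nonpositive and vanishes on the boundary. -/
lemma inner_pos_chartDiff_neg (hx : IsFreeBoundaryMinimal x)
    (hc : c ∈ atlas (EuclideanHalfSpace k) M) {z : EuclideanSpace ℝ {i : Fin k // i ≠ 0}}
    (hz : hyperplaneIncl k z ∈ (c.extend (𝓡∂ k)).target) :
    inner ℝ (x.toFun ((c.extend (𝓡∂ k)).symm (hyperplaneIncl k z)))
      (chartDiff x c (hyperplaneIncl k z) (EuclideanSpace.single 0 1)) < 0 := by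
  have hb := symm_incl_mem_boundary hc hz
  refine lt_of_le_of_ne ?_ fun h => ?_
  · rw [inner_pos_eq_tanDeriv hx hb, tanDeriv_chartDiff x hc (contMDiff_halfSq x) hz]
    refine IsLocalMaxOn.hasFDerivWithinAt_nonpos (s := Set.range (𝓡∂ k))
      (a := hyperplaneIncl k z) (f := inChart c (halfSq x)) ?_
      (differentiableWithinAt_inChart hc (contMDiff_halfSq x) hz).hasFDerivWithinAt ?_
    · refine Filter.Eventually.of_forall fun y => ?_
      have h1 : inChart c (halfSq x) (hyperplaneIncl k z) = 0 := halfSq_boundary hx hb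
      rw [h1]
      exact halfSq_nonpos hx _
    · refine mem_posTangentConeAt_of_segment_subset ?_
      rintro _ ⟨a, b, ha, hb, hab, rfl⟩
      rw [mem_range_halfSpace_iff]
      simp only [PiLp.add_apply, PiLp.smul_apply, hyperplaneIncl_apply_zero, smul_eq_mul,
        PiLp.single_apply, if_true]
      nlinarith
  · -- the product is not zero: else all tangent vectors, among them `x`, are normal to `x`
    obtain ⟨ξ, hξ⟩ := pos_mem_range_chartDiff hx hc hz
    have h1 := inner_pos_chartDiff hx hc hz ξ
    have hξ' : chartDiff x c (hyperplaneIncl k z) ξ =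
      x.toFun ((c.extend (𝓡∂ k)).symm (hyperplaneIncl k z)) := hξ
    rw [h, mul_zero, hξ', real_inner_self_eq_norm_sq, norm_pos_boundary hx hb] at h1
    norm_num at h1

/-- The normal component of a tangent field along the boundary is, up to the volume density, minus the
first component of its flux in a chart. -/
lemma jac_mul_inner_pos (hx : IsFreeBoundaryMinimal x)
    (hc : c ∈ atlas (EuclideanHalfSpace k) M) {Y : M → Amb n} (hY : ∀ p, Y p ∈ tangentPlane x p)
    {z : EuclideanSpace ℝ {i : Fin k // i ≠ 0}}
    (hz : hyperplaneIncl k z ∈ (c.extend (𝓡∂ k)).target) :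
    jac ((chartDiff x c (hyperplaneIncl k z)).comp (hyperplaneIncl k)) *
      inner ℝ (Y ((c.extend (𝓡∂ k)).symm (hyperplaneIncl k z)))
        (x.toFun ((c.extend (𝓡∂ k)).symm (hyperplaneIncl k z))) =
      -(chartFlux x c Y (hyperplaneIncl k z) 0) := by
  have hb := symm_incl_mem_boundary hc hz
  have h1 := jac_eq_abs_inner_mul_jac (chartDiff x c (hyperplaneIncl k z)) _
    (norm_pos_boundary hx hb) (pos_mem_range_chartDiff hx hc hz)
    (fun ζ => inner_pos_chartDiff_incl hx hc hz ζ)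
  have h2 := inner_pos_chartDiff hx hc hz (chartVec x c Y (hyperplaneIncl k z))
  rw [chartDiff_chartVec x hc hY hz, inChart, Function.comp_apply, real_inner_comm] at h2
  rw [abs_of_neg (inner_pos_chartDiff_neg hx hc hz)] at h1
  rw [h2, chartFlux, PiLp.smul_apply, h1, smul_eq_mul]
  ring

/-- A function that vanishes on the boundary varies only in the conormal direction `x` there. -/
lemma tanDeriv_of_vanish (hx : IsFreeBoundaryMinimal x) {f : M → F}
    (hf : ContMDiff (𝓡∂ k) 𝓘(ℝ, F) ∞ f) (h0 : ∀ p ∈ (𝓡∂ k).boundary M, f p = 0) {p : M}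
    (hp : p ∈ (𝓡∂ k).boundary M) (u : Amb n) :
    tanDeriv x f p u = (inner ℝ u (x.toFun p) : ℝ) • tanDeriv x f p (x.toFun p) := by
  set c := chartAt (EuclideanHalfSpace k) p with hcdef
  have hc : c ∈ atlas (EuclideanHalfSpace k) M := chart_mem_atlas _ p
  have hps : p ∈ c.source := mem_chart_source _ p
  set y := c.extend (𝓡∂ k) p with hy
  have hyT : y ∈ (c.extend (𝓡∂ k)).target := extend_mem_target hps
  set z := hyperplaneProj k y with hz
  have hzy : hyperplaneIncl k z = y := by
    rw [hz, hyperplaneIncl_proj, (mem_boundary_iff hc hps).1 hp, zero_smul, sub_zero]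
  have hpy : (c.extend (𝓡∂ k)).symm y = p := c.extend_left_inv hps
  have hzT : hyperplaneIncl k z ∈ (c.extend (𝓡∂ k)).target := hzy ▸ hyT
  -- vectors orthogonal to `x` are tangent to the boundary
  have key : ∀ w : Amb n, inner ℝ w (x.toFun p) = (0 : ℝ) → tanDeriv x f p w = 0 := by
    intro w hw
    obtain ⟨ξ, hξ⟩ : tanProj x p w ∈ LinearMap.range
        (chartDiff x c y : EuclideanSpace ℝ (Fin k) →ₗ[ℝ] Amb n) := by
      rw [hy, ← tangentPlane_eq x hc hps]; exact tanProj_mem x p w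
    have hξ' : chartDiff x c y ξ = tanProj x p w := hξ
    have h1 := inner_pos_chartDiff hx hc hzT ξ
    have h2 := inner_pos_chartDiff_neg hx hc hzT
    rw [hzy, hpy] at h1 h2
    rw [hξ', ← inner_tanProj_left, tanProj_pos hx hp, real_inner_comm, hw] at h1
    have h3 : ξ 0 = 0 := by
      rcases mul_eq_zero.1 h1.symm with h | h
      · exact h
      · exact absurd h h2.ne
    have h4 := tanDeriv_chartDiff x hc hf hyT ξ
    have h5 := fderivWithin_incl_eq_zero hc hf h0 hzT (hyperplaneProj k ξ)
    rw [hyperplaneIncl_proj ξ, h3, zero_smul, sub_zero, hzy] at h5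
    rw [hpy, hξ', tanDeriv_tanProj, h5] at h4
    exact h4
  have h := key (u - (inner ℝ u (x.toFun p) : ℝ) • x.toFun p) (by
    rw [inner_sub_left, inner_smul_left, real_inner_self_eq_norm_sq, norm_pos_boundary hx hp]
    simp)
  rw [map_sub, map_smul, sub_eq_zero] at h
  exact h

end BoundaryGeometry

/-! ### The maximum principle, and decay at the boundary -/

/-- The second derivative test at a maximum. -/
lemma not_pos_of_max {E : Type*} [NormedAddCommGroup E] [NormedSpace ℝ E] {g : E → ℝ}
    {G : E → E →L[ℝ] ℝ} {G' : E →L[ℝ] E →L[ℝ] ℝ} {y : E}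
    (hg : ∀ᶠ z in nhds y, HasFDerivAt g (G z) z) (hG : HasFDerivAt G G' y) (h0 : G y = 0)
    (hmax : ∀ z, g z ≤ g y) (ξ : E) : ¬ 0 < G' ξ ξ := by
  intro ha
  have hl0 : y + (0 : ℝ) • ξ = y := by simp
  have hld : ∀ s : ℝ, HasDerivAt (fun s : ℝ => y + s • ξ) ξ s := fun s => by
    simpa using ((hasDerivAt_id s).smul_const ξ).const_add y
  have hline : Filter.Tendsto (fun s : ℝ => y + s • ξ) (nhds 0) (nhds y) := by
    have := (hld 0).continuousAt.tendsto
    rwa [hl0] at this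
  have hd1 : ∀ᶠ s in nhds (0 : ℝ), HasDerivAt (fun s : ℝ => g (y + s • ξ)) (G (y + s • ξ) ξ) s :=
    (hline.eventually hg).mono fun s hs => hs.comp_hasDerivAt s (hld s)
  have hderiv : deriv (fun s : ℝ => g (y + s • ξ)) =ᶠ[nhds 0] fun s => G (y + s • ξ) ξ :=
    hd1.mono fun s hs => hs.deriv
  have hdd : deriv (deriv (fun s : ℝ => g (y + s • ξ))) 0 = G' ξ ξ := by
    rw [hderiv.deriv_eq]
    have h1 : HasFDerivAt G G' (y + (0 : ℝ) • ξ) := by rwa [hl0]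
    have h2 := (ContinuousLinearMap.apply ℝ ℝ ξ).hasFDerivAt.comp_hasDerivAt (0 : ℝ)
      (h1.comp_hasDerivAt (0 : ℝ) (hld 0))
    exact h2.deriv
  have hd0 : deriv (fun s : ℝ => g (y + s • ξ)) 0 = 0 := by
    rw [hderiv.self_of_nhds]
    simp only [hl0, h0, _root_.zero_apply]
  have hmin := isLocalMin_of_deriv_deriv_pos (by rw [hdd]; exact ha) hd0
    hd1.self_of_nhds.continuousAt
  have hconst : (fun s : ℝ => g (y + s • ξ)) =ᶠ[nhds 0] fun _ => g y := by
    filter_upwards [hmin] with s hs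
    refine le_antisymm (hmax _) ?_
    simpa only [hl0] using hs
  have h1 : deriv (deriv (fun s : ℝ => g (y + s • ξ))) 0 = 0 := by
    rw [hconst.deriv.deriv_eq]
    simp
  rw [hdd] at h1
  exact ha.ne' h1

section Depth

variable {n k : ℕ} [NeZero k] {M : Type*} [TopologicalSpace M]
  [ChartedSpace (EuclideanHalfSpace k) M] [IsManifold (𝓡∂ k) ∞ M] {x : Immersion k n M}
  {c : OpenPartialHomeomorph M (EuclideanHalfSpace k)}

lemma fderivWithin_eq_zero_of_max (hx : IsFreeBoundaryMinimal x)
    {y : EuclideanSpace ℝ (Fin k)} (hy : y ∈ interior (c.extend (𝓡∂ k)).target)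
    (h : halfSq x ((c.extend (𝓡∂ k)).symm y) = 0) :
    fderivWithin ℝ (inChart c (halfSq x)) (Set.range (𝓡∂ k)) y = 0 := by
  have hn : Set.range (𝓡∂ k) ∈ nhds y := Filter.mem_of_superset
    (mem_interior_iff_mem_nhds.1 hy) c.extend_target_subset_range
  rw [fderivWithin_of_mem_nhds hn]
  refine IsLocalMax.fderiv_eq_zero (Filter.Eventually.of_forall fun z => ?_)
  rw [inChart, Function.comp_apply, Function.comp_apply, h]
  exact halfSq_nonpos hx _

/-- The interior of a free boundary minimal submanifold lies in the open ball. The function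
`(|x|² - 1)/2` has `k > 0` as the trace of its second derivative, so it has no interior maximum. -/
lemma halfSq_neg (hx : IsFreeBoundaryMinimal x) {p : M} (hp : p ∈ (𝓡∂ k).interior M) :
    halfSq x p < 0 := by
  refine lt_of_le_of_ne (halfSq_nonpos hx p) fun h0 => ?_
  set c := chartAt (EuclideanHalfSpace k) p with hcdef
  have hc : c ∈ atlas (EuclideanHalfSpace k) M := chart_mem_atlas _ p
  have hps : p ∈ c.source := mem_chart_source _ p
  set y := c.extend (𝓡∂ k) p with hy
  have hyT : y ∈ (c.extend (𝓡∂ k)).target := extend_mem_target hps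
  have hyi : y ∈ interior (c.extend (𝓡∂ k)).target :=
    (ModelWithCorners.isInteriorPoint_iff_of_mem_atlas (n := ∞) (by simp) hc hps).1 hp
  have hpy : (c.extend (𝓡∂ k)).symm y = p := c.extend_left_inv hps
  set g := inChart c (halfSq x) with hg
  have hgT := contDiffOn_inChart hc (contMDiff_halfSq x)
  have hTn : (c.extend (𝓡∂ k)).target ∈ nhds y := mem_interior_iff_mem_nhds.1 hyi
  have hgrad : fderivWithin ℝ g (Set.range (𝓡∂ k)) y = 0 :=
    fderivWithin_eq_zero_of_max hx hyi (by rw [hpy, h0])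
  -- some second derivative is positive
  have hsum := sum_tanDeriv_tanDeriv_halfSq x hx.minimal p
  obtain ⟨a, ha⟩ : ∃ a, 0 < tanDeriv x (fun q => tanDeriv x (halfSq x) q (bv a)) p (bv a) := by
    by_contra hcon
    push Not at hcon
    have h1 := Finset.sum_nonpos fun a (_ : a ∈ Finset.univ) => hcon a
    rw [hsum] at h1
    exact absurd h1 (not_le.2 (Nat.cast_pos.2 (NeZero.pos k)))
  -- at a critical point the second derivative in the chart is the geometric one
  set ξ := pinv (chartDiff x c y) (bv a) with hξ
  have hDg : HasFDerivWithinAt (fun y => fderivWithin ℝ g (Set.range (𝓡∂ k)) y)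
      (fderivWithin ℝ (fun y => fderivWithin ℝ g (Set.range (𝓡∂ k)) y) (Set.range (𝓡∂ k)) y)
      (Set.range (𝓡∂ k)) y :=
    ((contDiffOn_fderivWithin_range hgT).differentiableWithinAt_range hyT).hasFDerivWithinAt
  have hsecond : tanDeriv x (fun q => tanDeriv x (halfSq x) q (bv a)) p (bv a) =
      fderivWithin ℝ (fun y => fderivWithin ℝ g (Set.range (𝓡∂ k)) y) (Set.range (𝓡∂ k)) y ξ ξ := by
    have hcm : ContMDiff (𝓡∂ k) 𝓘(ℝ, ℝ) ∞ (fun q => tanDeriv x (halfSq x) q (bv a)) :=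
      (contMDiff_tanDeriv x (contMDiff_halfSq x)).clm_apply contMDiff_const
    rw [tanDeriv_eq x hc hcm hps, ContinuousLinearMap.comp_apply, ← hξ]
    have hR : HasFDerivWithinAt (fun y => pinv (chartDiff x c y) (bv a)) _ (Set.range (𝓡∂ k)) y :=
      (((contDiffOn_pinv_chartDiff x hc).clm_apply
        contDiffOn_const).differentiableWithinAt_range hyT).hasFDerivWithinAt
    have h1 := hDg.clm_apply hR
    have h2 : inChart c (fun q => tanDeriv x (halfSq x) q (bv a)) =ᶠ[nhdsWithin y
        (Set.range (𝓡∂ k))] fun y' => fderivWithin ℝ g (Set.range (𝓡∂ k)) y'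
          (pinv (chartDiff x c y') (bv a)) := by
      filter_upwards [extend_target_mem_nhdsWithin' hyT] with y' hy'
      exact DFunLike.congr_fun (inChart_tanDeriv x hc (contMDiff_halfSq x) hy') (bv a)
    rw [(h1.congr_of_eventuallyEq h2 (h2.self_of_nhdsWithin
      (range_of_mem_extend_target hyT))).fderivWithin
        (uniqueDiffWithinAt_range (range_of_mem_extend_target hyT)), hgrad]
    simp [hξ]
  rw [hsecond] at ha
  have hn : Set.range (𝓡∂ k) ∈ nhds y := Filter.mem_of_superset hTn c.extend_target_subset_range
  refine not_pos_of_max (g := g) (G := fun y => fderivWithin ℝ g (Set.range (𝓡∂ k)) y) ?_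
    (hDg.hasFDerivAt hn) hgrad (fun z => ?_) ξ ha
  · filter_upwards [isOpen_interior.mem_nhds hyi] with z hz
    exact (hgT.differentiableWithinAt_range (interior_subset hz)).hasFDerivWithinAt.hasFDerivAt
      (Filter.mem_of_superset (mem_interior_iff_mem_nhds.1 hz) c.extend_target_subset_range)
  · have h1 : g y = 0 := by rw [hg, inChart, Function.comp_apply, hpy, h0]
    rw [h1]
    exact halfSq_nonpos hx _

/-- A smooth function that vanishes on the boundary is bounded by a multiple of `1 - |x|²`. In the
interior this is compactness; at the boundary the derivative of `|x|²` in the inward direction is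
strictly negative. -/
lemma exists_abs_le_halfSq [CompactSpace M] (hx : IsFreeBoundaryMinimal x) {f : M → ℝ}
    (hf : ContMDiff (𝓡∂ k) 𝓘(ℝ, ℝ) ∞ f) (h0 : ∀ p ∈ (𝓡∂ k).boundary M, f p = 0) :
    ∃ C : ℝ, 0 ≤ C ∧ ∀ p, |f p| ≤ C * -halfSq x p := by
  suffices h : ∃ C : ℝ, 0 ≤ C ∧ ∀ p ∈ (Set.univ : Set M), |f p| ≤ C * -halfSq x p by simpa using h
  refine IsCompact.induction_on (p := fun s => ∃ C : ℝ, 0 ≤ C ∧ ∀ p ∈ s, |f p| ≤ C * -halfSq x p)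
    isCompact_univ ⟨0, le_rfl, by simp⟩ ?_ ?_ ?_
  · rintro s t hst ⟨C, hC, h⟩
    exact ⟨C, hC, fun p hp => h p (hst hp)⟩
  · rintro s t ⟨C, hC, h⟩ ⟨C', hC', h'⟩
    refine ⟨max C C', hC.trans (le_max_left _ _), fun p hp => ?_⟩
    have hd : 0 ≤ -halfSq x p := neg_nonneg.2 (halfSq_nonpos hx p)
    rcases hp with hp | hp
    · exact (h p hp).trans (mul_le_mul_of_nonneg_right (le_max_left _ _) hd)
    · exact (h' p hp).trans (mul_le_mul_of_nonneg_right (le_max_right _ _) hd)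
  intro p _
  simp only [nhdsWithin_univ]
  have hcf : Continuous f := hf.continuous
  have hch : Continuous (halfSq x) := (contMDiff_halfSq x).continuous
  -- in the interior, `1 - |x|²` is locally bounded below
  by_cases hpb : p ∈ (𝓡∂ k).interior M
  · have hneg := halfSq_neg hx hpb
    have hC : 0 ≤ (|f p| + 1) / (-halfSq x p / 2) := by
      have := abs_nonneg (f p)
      have : 0 < -halfSq x p := by linarith
      positivity
    refine ⟨{q | |f q| < |f p| + 1 ∧ halfSq x q < halfSq x p / 2}, ?_,
      (|f p| + 1) / (-halfSq x p / 2), hC, ?_⟩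
    · exact Filter.Eventually.and
        (hcf.abs.continuousAt.eventually_lt continuousAt_const (lt_add_one _))
        (hch.continuousAt.eventually_lt continuousAt_const (by linarith))
    · rintro q ⟨h1, h2⟩
      calc |f q| ≤ |f p| + 1 := h1.le
        _ = (|f p| + 1) / (-halfSq x p / 2) * (-halfSq x p / 2) :=
            (div_mul_cancel₀ _ (by linarith)).symm
        _ ≤ _ := mul_le_mul_of_nonneg_left (by linarith) hC
  rw [← ModelWithCorners.compl_boundary, Set.mem_compl_iff, not_not] at hpb
  -- at a boundary point, integrate from the boundary along the first coordinate lines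
  set c := chartAt (EuclideanHalfSpace k) p with hcdef
  have hc : c ∈ atlas (EuclideanHalfSpace k) M := chart_mem_atlas _ p
  have hps : p ∈ c.source := mem_chart_source _ p
  set y := c.extend (𝓡∂ k) p with hy
  have hyT : y ∈ (c.extend (𝓡∂ k)).target := extend_mem_target hps
  have hpy : (c.extend (𝓡∂ k)).symm y = p := c.extend_left_inv hps
  set e : EuclideanSpace ℝ (Fin k) := EuclideanSpace.single 0 1 with he
  have hzy : hyperplaneIncl k (hyperplaneProj k y) = y := by
    rw [hyperplaneIncl_proj, (mem_boundary_iff hc hps).1 hpb, zero_smul, sub_zero]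
  -- the derivatives in the inward direction
  set a := fun y => fderivWithin ℝ (inChart c f) (Set.range (𝓡∂ k)) y e with ha
  set b := fun y => fderivWithin ℝ (inChart c (halfSq x)) (Set.range (𝓡∂ k)) y e with hb
  have hac : ContinuousOn a (c.extend (𝓡∂ k)).target :=
    (contDiffOn_fderivWithin_range (contDiffOn_inChart hc hf)).continuousOn.clm_apply
      continuousOn_const
  have hbc : ContinuousOn b (c.extend (𝓡∂ k)).target :=
    (contDiffOn_fderivWithin_range (contDiffOn_inChart hc
      (contMDiff_halfSq x))).continuousOn.clm_apply continuousOn_const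
  have hby : b y < 0 := by
    have h := inner_pos_chartDiff_neg hx hc (z := hyperplaneProj k y) (by rw [hzy]; exact hyT)
    rw [hzy, inner_pos_eq_tanDeriv hx (by rw [hpy]; exact hpb),
      tanDeriv_chartDiff x hc (contMDiff_halfSq x) hyT] at h
    exact h
  have hTn := extend_target_mem_nhdsWithin' hyT
  have hev : ∀ᶠ w in nhdsWithin y (Set.range (𝓡∂ k)),
      w ∈ (c.extend (𝓡∂ k)).target ∧ |a w| < |a y| + 1 ∧ b w < b y / 2 := by
    have h1 : ContinuousWithinAt a (Set.range (𝓡∂ k)) y := (hac y hyT).mono_of_mem_nhdsWithin hTn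
    have h2 : ContinuousWithinAt b (Set.range (𝓡∂ k)) y := (hbc y hyT).mono_of_mem_nhdsWithin hTn
    exact Filter.Eventually.and hTn ((h1.abs.eventually_lt continuousWithinAt_const
      (lt_add_one _)).and (h2.eventually_lt continuousWithinAt_const (by linarith)))
  obtain ⟨r, hr, hB⟩ := Metric.mem_nhdsWithin_iff.1 hev
  set A := |a y| + 1 with hA
  have hA0 : 0 ≤ A := by positivity
  set β := -b y / 2 with hβ
  have hβ0 : 0 < β := by rw [hβ]; linarith
  have hproj : Continuous fun w : EuclideanSpace ℝ (Fin k) =>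
      hyperplaneIncl k (hyperplaneProj k w) :=
    (hyperplaneIncl k).continuous.comp (hyperplaneProj k).continuous
  have hcφ : ContinuousAt (c.extend (𝓡∂ k)) p := c.continuousAt_extend hps
  refine ⟨{q | q ∈ c.source ∧ c.extend (𝓡∂ k) q ∈ Metric.ball y r ∧
    hyperplaneIncl k (hyperplaneProj k (c.extend (𝓡∂ k) q)) ∈ Metric.ball y r}, ?_,
    A / β, by positivity, ?_⟩
  · refine Filter.Eventually.and (c.open_source.mem_nhds hps) (Filter.Eventually.and
      (hcφ.eventually (Metric.ball_mem_nhds _ hr)) ?_)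
    refine (hproj.continuousAt.comp hcφ).eventually (Metric.isOpen_ball.mem_nhds ?_)
    rw [Function.comp_apply, ← hy, hzy]
    exact Metric.mem_ball_self hr
  rintro q ⟨hqs, hq1, hq2⟩
  set w := c.extend (𝓡∂ k) q with hw
  have hwT : w ∈ (c.extend (𝓡∂ k)).target := extend_mem_target hqs
  have hw0 : 0 ≤ w 0 := mem_range_halfSpace_iff.1 (range_of_mem_extend_target hwT)
  set w' := hyperplaneIncl k (hyperplaneProj k w) with hw'
  have hww' : w = w' + w 0 • e := by rw [hw', hyperplaneIncl_proj]; abel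
  have hw'0 : w' 0 = 0 := hyperplaneIncl_apply_zero _
  have hseg : ∀ s ∈ Set.Icc (0 : ℝ) (w 0), w' + s • e ∈ Metric.ball y r ∩ Set.range (𝓡∂ k) := by
    intro s hs
    refine ⟨?_, ?_⟩
    · rcases eq_or_lt_of_le hw0 with h | h
      · have : s = 0 := le_antisymm (by rw [h]; exact hs.2) hs.1
        simpa [this] using hq2
      · refine (convex_ball y r).segment_subset hq2 hq1 ⟨1 - s / w 0, s / w 0, ?_, ?_, by ring, ?_⟩
        · rw [sub_nonneg, div_le_one h]; exact hs.2
        · exact div_nonneg hs.1 h.le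
        · have h1 : (s / w 0) • w = (s / w 0) • w' + s • e := by
            conv_lhs => rw [hww']
            rw [smul_add, smul_smul, ← hww', div_mul_cancel₀ _ h.ne']
          rw [h1, ← add_assoc, ← add_smul, sub_add_cancel, one_smul]
    · rw [mem_range_halfSpace_iff]
      simp [hw'0, he, hs.1]
  have hderiv : ∀ (u : M → ℝ), ContMDiff (𝓡∂ k) 𝓘(ℝ, ℝ) ∞ u → ∀ s ∈ Set.Icc (0 : ℝ) (w 0),
      HasDerivWithinAt (fun s : ℝ => inChart c u (w' + s • e))
        (fderivWithin ℝ (inChart c u) (Set.range (𝓡∂ k)) (w' + s • e) e) (Set.Icc 0 (w 0)) s := by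
    intro u hu s hs
    have h1 := (differentiableWithinAt_inChart hc hu (hB (hseg s hs)).1).hasFDerivWithinAt
    have h2 : HasDerivWithinAt (fun s : ℝ => w' + s • e) e (Set.Icc 0 (w 0)) s := by
      simpa using (((hasDerivAt_id s).smul_const e).const_add w').hasDerivWithinAt
    exact h1.comp_hasDerivWithinAt s h2 fun s hs => (hseg s hs).2
  have hbd : ∀ u : M → ℝ, (∀ q ∈ (𝓡∂ k).boundary M, u q = 0) → inChart c u w' = 0 := by
    intro u hu
    have hw'T : w' ∈ (c.extend (𝓡∂ k)).target := by
      have := (hB (hseg 0 ⟨le_rfl, hw0⟩)).1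
      simpa using this
    exact hu _ ((symm_mem_boundary_iff hc hw'T).2 hw'0)
  -- both signs of `f` at once: compare `σ f` with a multiple of `1 - |x|²` along the line
  have key : ∀ σ : ℝ, |σ| = 1 → σ * f q ≤ A / β * -halfSq x q := by
    intro σ hσ
    have hmono : MonotoneOn (fun s : ℝ => A / β * -inChart c (halfSq x) (w' + s • e) -
        σ * inChart c f (w' + s • e)) (Set.Icc 0 (w 0)) := by
      have hd : ∀ s ∈ Set.Icc (0 : ℝ) (w 0), HasDerivWithinAt
          (fun s : ℝ => A / β * -inChart c (halfSq x) (w' + s • e) -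
            σ * inChart c f (w' + s • e)) (A / β * -b (w' + s • e) - σ * a (w' + s • e))
            (Set.Icc 0 (w 0)) s := fun s hs =>
        ((hderiv _ (contMDiff_halfSq x) s hs).neg.const_mul _).sub ((hderiv _ hf s hs).const_mul _)
      refine monotoneOn_of_hasDerivWithinAt_nonneg (convex_Icc 0 (w 0))
        (fun s hs => (hd s hs).continuousWithinAt)
        (fun s hs => (hd s (interior_subset hs)).mono interior_subset) fun s hs => ?_
      obtain ⟨-, h1, h2⟩ := hB (hseg s (interior_subset hs))
      have h3 : σ * a (w' + s • e) ≤ A := by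
        calc σ * a (w' + s • e) ≤ |σ * a (w' + s • e)| := le_abs_self _
          _ = |a (w' + s • e)| := by rw [abs_mul, hσ, one_mul]
          _ ≤ A := h1.le
      have h4 : A ≤ A / β * -b (w' + s • e) := by
        calc A = A / β * β := (div_mul_cancel₀ _ hβ0.ne').symm
          _ ≤ _ := mul_le_mul_of_nonneg_left (by rw [hβ]; linarith) (by positivity)
      linarith
    have h1 := hmono ⟨le_rfl, hw0⟩ ⟨hw0, le_rfl⟩ hw0
    simp only [zero_smul, add_zero, ← hww'] at h1
    rw [hbd f h0, hbd (halfSq x) (fun q hq => halfSq_boundary hx hq), hw, inChart_extend _ hqs,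
      inChart_extend _ hqs] at h1
    linarith
  rw [abs_le]
  constructor
  · have := key (-1) (by simp)
    linarith
  · have := key 1 (by simp)
    linarith

end Depth

/-! ### Weakly differentiable functions, and fields tangent to the boundary -/

section ScalarPair

variable {n k : ℕ} [NeZero k] {M : Type*} [TopologicalSpace M]
  [ChartedSpace (EuclideanHalfSpace k) M] [IsManifold (𝓡∂ k) ∞ M] {x : Immersion k n M}

/-- Cutoff functions `χ m` with compact support in the interior that converge to `1` there, whose
gradient `h m • x^⊤` is at most a multiple of the inverse distance to the boundary. Dominated
convergence then applies to `∇(χ m)` times a function that vanishes on the boundary. -/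
lemma exists_cutoff (hx : IsFreeBoundaryMinimal x) :
    ∃ (χ h : ℕ → M → ℝ) (K : ℝ), (∀ m, ContMDiff (𝓡∂ k) 𝓘(ℝ, ℝ) ∞ (χ m)) ∧
      (∀ m, tsupport (χ m) ⊆ (𝓡∂ k).interior M) ∧ (∀ m p, |χ m p| ≤ 1) ∧
      (∀ p ∈ (𝓡∂ k).interior M, ∀ᶠ m in Filter.atTop, χ m p = 1 ∧ h m p = 0) ∧
      (∀ m p u, tanDeriv x (χ m) p u = h m p * inner ℝ (x.toFun p) (tanProj x p u)) ∧
      (∀ m, Continuous (h m)) ∧ ∀ m p, |h m p| * -halfSq x p ≤ K := by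
  set η : ℝ → ℝ := fun t => Real.smoothTransition (t - 1) with hη
  have hηs : ContDiff ℝ ∞ η := Real.smoothTransition.contDiff.comp (contDiff_id.sub contDiff_const)
  have hη0 : ∀ t ≤ 1, η t = 0 := fun t ht => Real.smoothTransition.zero_of_nonpos (by linarith)
  have hη1 : ∀ t, 2 ≤ t → η t = 1 := fun t ht => Real.smoothTransition.one_of_one_le (by linarith)
  -- `η` is `0` up to `1`, and `1` from `2` on; the cutoffs are `η ((m + 1) (1 - |x|²)/2)`
  have hd2 : ∀ t, 2 < t → deriv η t = 0 := fun t ht => by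
    have : η =ᶠ[nhds t] fun _ => 1 := by
      filter_upwards [eventually_gt_nhds ht] with s hs using hη1 s hs.le
    rw [this.deriv_eq, deriv_const]
  have hdc : Continuous (deriv η) := hηs.continuous_deriv (by simp)
  obtain ⟨K, hK⟩ := (isCompact_Icc (a := (0 : ℝ)) (b := 2)).exists_bound_of_continuousOn
    hdc.continuousOn
  have hK0 : 0 ≤ K := (norm_nonneg _).trans (hK 0 (by norm_num))
  have hsc : ∀ m : ℕ, ContDiff ℝ ∞ fun t : ℝ => η (-((m + 1 : ℝ) * t)) := fun m =>
    hηs.comp (contDiff_const.mul contDiff_id).neg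
  refine ⟨fun m p => η (-((m + 1 : ℝ) * halfSq x p)), fun m p =>
    deriv η (-((m + 1 : ℝ) * halfSq x p)) * -(m + 1 : ℝ), K * 2,
    fun m => (hsc m).contMDiff.comp (contMDiff_halfSq x), fun m => ?_, fun m p => ?_,
    fun p hp => ?_, fun m p u => ?_, fun m => ?_, fun m p => ?_⟩
  · have hcl : IsClosed {p | halfSq x p ≤ -(m + 1 : ℝ)⁻¹} :=
      isClosed_le (contMDiff_halfSq x).continuous continuous_const
    refine (closure_minimal (fun p hp => ?_) hcl).trans fun p hp => ?_
    · by_contra hcon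
      refine hp (hη0 _ ?_)
      rw [Set.mem_ofPred_eq, not_le] at hcon
      have hm : (0 : ℝ) < m + 1 := by positivity
      have := mul_lt_mul_of_pos_left hcon hm
      rw [mul_neg, mul_inv_cancel₀ hm.ne'] at this
      linarith
    · rw [← ModelWithCorners.compl_boundary]
      intro hb
      rw [Set.mem_ofPred_eq, halfSq_boundary hx hb] at hp
      have hm : (0 : ℝ) < (m + 1 : ℝ)⁻¹ := by positivity
      linarith
  · rw [abs_of_nonneg (Real.smoothTransition.nonneg _)]
    exact Real.smoothTransition.le_one _
  · have hneg := halfSq_neg hx hp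
    have ht : Filter.Tendsto (fun m : ℕ => ((m : ℝ) + 1) * -halfSq x p) Filter.atTop
        Filter.atTop :=
      (Filter.tendsto_atTop_add_const_right _ _ tendsto_natCast_atTop_atTop).atTop_mul_const
        (by linarith)
    filter_upwards [ht.eventually_gt_atTop 2] with m hm
    rw [mul_neg] at hm
    exact ⟨hη1 _ hm.le, by rw [hd2 _ hm, zero_mul]⟩
  · rw [tanDeriv_comp_real x (hsc m) (contMDiff_halfSq x), tanDeriv_halfSq]
    congr 1
    have h1 : HasDerivAt (fun t : ℝ => -((m + 1 : ℝ) * t)) (-((m + 1 : ℝ) * 1)) (halfSq x p) :=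
      ((hasDerivAt_id _).const_mul _).neg
    have h2 := ((hηs.differentiable (by simp) (-((m + 1 : ℝ) * halfSq x p))).hasDerivAt.comp
      (halfSq x p) h1).deriv
    rw [mul_one] at h2
    exact h2
  · exact (hdc.comp (continuous_const.mul (contMDiff_halfSq x).continuous).neg).mul
      continuous_const
  · have hnp := halfSq_nonpos hx p
    set t := -((m + 1 : ℝ) * halfSq x p) with ht
    have hm : (0 : ℝ) ≤ m + 1 := by positivity
    have ht0 : 0 ≤ t := by rw [ht]; nlinarith
    rw [abs_mul, abs_neg, abs_of_nonneg hm, mul_assoc]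
    have h1 : (m + 1 : ℝ) * -halfSq x p = t := by rw [ht]; ring
    rw [h1]
    -- `h m` is `-(m + 1) η'(t)` with `t = (m + 1) (1 - |x|²)/2`, and `η'(t) t` is bounded
    by_cases h2 : t ≤ 2
    · exact mul_le_mul (hK t ⟨ht0, h2⟩) h2 ht0 hK0
    · rw [hd2 t (not_le.1 h2)]
      simp only [abs_zero, zero_mul]
      positivity

variable [MeasurableSpace M] [BorelSpace M]

section Continuity
variable [CompactSpace M] {E F G : Type*} [NormedAddCommGroup E] [NormedSpace ℝ E]
  [NormedAddCommGroup F] [NormedSpace ℝ F] [NormedAddCommGroup G] [NormedSpace ℝ G]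
  {μ : Measure M}

lemma aestronglyMeasurable_of_continuous (k : ℕ) [NeZero k]
    [ChartedSpace (EuclideanHalfSpace k) M] {g : M → F}
    (hg : Continuous g) : AEStronglyMeasurable g μ := by
  have : SecondCountableTopology (EuclideanHalfSpace k) :=
    TopologicalSpace.Subtype.secondCountableTopology _
  have : SecondCountableTopology M :=
    ChartedSpace.secondCountable_of_sigmaCompact (EuclideanHalfSpace k) M
  exact hg.aestronglyMeasurable

lemma exists_norm_le_of_continuous {g : M → F} (hg : Continuous g) :
    ∃ C, 0 ≤ C ∧ ∀ p, ‖g p‖ ≤ C := by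
  obtain ⟨C, hC⟩ := isCompact_univ.exists_bound_of_continuousOn hg.continuousOn
  exact ⟨max C 0, le_max_right _ _, fun p => (hC p trivial).trans (le_max_left _ _)⟩

lemma memLp_of_continuous (k : ℕ) [NeZero k] [ChartedSpace (EuclideanHalfSpace k) M]
    [IsFiniteMeasure μ] {g : M → F} (hg : Continuous g) : MemLp g 2 μ := by
  obtain ⟨C, -, hC⟩ := exists_norm_le_of_continuous hg
  exact MemLp.of_bound (aestronglyMeasurable_of_continuous k hg) C
    (Filter.Eventually.of_forall hC)

lemma memLp_bilin (k : ℕ) [NeZero k] [ChartedSpace (EuclideanHalfSpace k) M]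
    (B : E →L[ℝ] F →L[ℝ] G) {f : M → E} {g : M → F} (hf : MemLp f 2 μ)
    (hg : Continuous g) : MemLp (fun p => B (f p) (g p)) 2 μ := by
  obtain ⟨C, hC0, hC⟩ := exists_norm_le_of_continuous hg
  refine MemLp.of_le_mul (c := ‖B‖ * C) hf (B.aestronglyMeasurable_comp₂ hf.1
    (aestronglyMeasurable_of_continuous k hg)) (Filter.Eventually.of_forall fun p => ?_)
  calc ‖B (f p) (g p)‖ ≤ ‖B‖ * ‖f p‖ * ‖g p‖ := B.le_opNorm₂ _ _
    _ ≤ ‖B‖ * ‖f p‖ * C := by gcongr; exact hC p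
    _ = ‖B‖ * C * ‖f p‖ := by ring

lemma memLp_inner (k : ℕ) [NeZero k] [ChartedSpace (EuclideanHalfSpace k) M]
    {f g : M → Amb n} (hf : MemLp f 2 μ) (hg : Continuous g) :
    MemLp (fun p => (inner ℝ (f p) (g p) : ℝ)) 2 μ := memLp_bilin k (innerSL ℝ) hf hg

lemma integrable_inner (k : ℕ) [NeZero k] [ChartedSpace (EuclideanHalfSpace k) M]
    [IsFiniteMeasure μ] {f g : M → Amb n} (hf : MemLp f 2 μ) (hg : Continuous g) :
    Integrable (fun p => (inner ℝ (f p) (g p) : ℝ)) μ :=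
  (memLp_inner k hf hg).integrable one_le_two

lemma integrable_clm_apply (k : ℕ) [NeZero k] [ChartedSpace (EuclideanHalfSpace k) M]
    [IsFiniteMeasure μ] {T : M → E →L[ℝ] F} {g : M → E} (hT : MemLp T 2 μ) (hg : Continuous g) :
    Integrable (fun p => T p (g p)) μ :=
  (memLp_bilin k (ContinuousLinearMap.id ℝ (E →L[ℝ] F)) hT hg).integrable one_le_two

end Continuity

variable (x) in
/-- `γ` is the weak derivative of the function `w`, both being square integrable. Test fields have
compact support in the interior. -/
structure IsScalarPair (w : M → ℝ) (γ : M → Amb n →L[ℝ] ℝ) : Prop where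
  memLp_fun : MemLp w 2 (vol x)
  memLp_deriv : MemLp γ 2 (vol x)
  integral_eq : ∀ Y, IsTangentField x Y → tsupport Y ⊆ (𝓡∂ k).interior M →
    ∫ p, (γ p (Y p) + w p * tanDiv x Y p) ∂(vol x) = 0

variable [T2Space M] [CompactSpace M]

/-- The divergence theorem with compact support says that the constant `1` has weak derivative `0`. -/
lemma isScalarPair_one : IsScalarPair x (fun _ => 1) (fun _ => 0) := by
  refine ⟨memLp_const 1, memLp_const 0, fun Y hY hs => ?_⟩
  simp only [_root_.zero_apply, zero_add, one_mul]
  exact integral_tanDiv_eq_zero x hY hs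

variable {w : M → ℝ} {γ : M → Amb n →L[ℝ] ℝ}

lemma integrable_pairing (hw : MemLp w 2 (vol x)) (hγ : MemLp γ 2 (vol x)) {Y : M → Amb n}
    (hY : ContMDiff (𝓡∂ k) 𝓘(ℝ, Amb n) ∞ Y) :
    Integrable (fun p => γ p (Y p) + w p * tanDiv x Y p) (vol x) := by
  have h1 := integrable_clm_apply k hγ hY.continuous
  have h2 := (memLp_bilin k (ContinuousLinearMap.mul ℝ ℝ) hw
    (continuous_tanDiv x hY)).integrable one_le_two
  exact h1.add h2

/-- The weak derivative may be tested against fields that are tangent to the boundary, although these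
need not have compact support in the interior. -/
lemma IsScalarPair.integral_eq_zero (h : IsScalarPair x w γ) (hx : IsFreeBoundaryMinimal x)
    {Y : M → Amb n} (hY : IsTangentField x Y)
    (hb : ∀ p ∈ (𝓡∂ k).boundary M, inner ℝ (Y p) (x.toFun p) = (0 : ℝ)) :
    ∫ p, (γ p (Y p) + w p * tanDiv x Y p) ∂(vol x) = 0 := by
  obtain ⟨χ, g, K, hχ, hs, hχ1, hev, hD, hgc, hgK⟩ := exists_cutoff (x := x) hx
  obtain ⟨C, hC0, hC⟩ := exists_abs_le_halfSq hx (contMDiff_inner hY.1 x.smooth) hb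
  have hYm : ∀ m, IsTangentField x (fun p => χ m p • Y p) := fun m =>
    isTangentField_smul x (hχ m) hY
  set f := fun p => γ p (Y p) + w p * tanDiv x Y p with hf
  have hfm : ∀ m p, γ p (χ m p • Y p) + w p * tanDiv x (fun p => χ m p • Y p) p =
      χ m p * f p + w p * (g m p * inner ℝ (Y p) (x.toFun p)) := by
    intro m p
    rw [tanDiv_smul x (hχ m) hY, hD, (tanProj_eq_self_iff x).2 (hY.2 p), map_smul, smul_eq_mul, hf,
      real_inner_comm]
    ring
  have hzero : ∀ m, ∫ p, (χ m p * f p + w p * (g m p * inner ℝ (Y p) (x.toFun p))) ∂(vol x)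
      = 0 := by
    intro m
    rw [← h.integral_eq _ (hYm m) ((tsupport_smul_subset_left (χ m) Y).trans (hs m))]
    exact integral_congr_ae (Filter.Eventually.of_forall fun p => (hfm m p).symm)
  -- the gradient term is bounded by `K C |w|`, and vanishes eventually at every interior point
  have hlim : Filter.Tendsto (fun m => ∫ p, (χ m p * f p +
      w p * (g m p * inner ℝ (Y p) (x.toFun p))) ∂(vol x)) Filter.atTop (nhds (∫ p, f p ∂(vol x))) := by
    refine tendsto_integral_of_dominated_convergence (fun p => ‖f p‖ + K * C * ‖w p‖) ?_ ?_ ?_ ?_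
    · intro m
      refine (integrable_pairing h.memLp_fun h.memLp_deriv (hYm m).1).aestronglyMeasurable.congr ?_
      exact Filter.Eventually.of_forall fun p => hfm m p
    · exact (integrable_pairing h.memLp_fun h.memLp_deriv hY.1).norm.add
        ((h.memLp_fun.integrable one_le_two).norm.const_mul _)
    · intro m
      refine Filter.Eventually.of_forall fun p => ?_
      refine (norm_add_le _ _).trans (add_le_add ?_ ?_)
      · rw [norm_mul]
        exact mul_le_of_le_one_left (norm_nonneg _) (hχ1 m p)
      · rw [norm_mul, mul_comm]
        refine mul_le_mul_of_nonneg_right ?_ (norm_nonneg _)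
        rw [norm_mul]
        calc ‖g m p‖ * ‖(inner ℝ (Y p) (x.toFun p) : ℝ)‖ ≤ |g m p| * (C * -halfSq x p) :=
              mul_le_mul_of_nonneg_left (hC p) (abs_nonneg _)
          _ = |g m p| * -halfSq x p * C := by ring
          _ ≤ K * C := mul_le_mul_of_nonneg_right (hgK m p) hC0
    · filter_upwards [ae_mem_interior x] with p hp
      refine tendsto_const_nhds.congr' ?_
      filter_upwards [hev p hp] with m hm
      rw [hm.1, hm.2]
      ring
  simp_rw [hzero] at hlim
  exact (tendsto_nhds_unique tendsto_const_nhds hlim).symm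

end ScalarPair

/-! ### Splitting off the first coordinate -/

section Split

variable {k : ℕ} [NeZero k]

lemma measurePreserving_split_of_unique (p : Fin k → Prop) [DecidablePred p]
    [Unique {i // p i}] : MeasurePreserving
      (fun y : EuclideanSpace ℝ (Fin k) => (y (default : {i // p i}),
        (WithLp.toLp 2 fun i : {i // ¬ p i} => y i : EuclideanSpace ℝ {i // ¬ p i}))) volume
      ((volume : Measure ℝ).prod volume) := by
  have h1 := PiLp.volume_preserving_ofLp (Fin k)
  have h2 : MeasurePreserving _ volume (volume.prod volume) :=
    volume_preserving_piEquivPiSubtypeProd (fun _ : Fin k => ℝ) p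
  have h3 : MeasurePreserving (MeasurableEquiv.funUnique {i // p i} ℝ) volume volume := by
    convert volume_preserving_funUnique {i // p i} ℝ
  have h4 := PiLp.volume_preserving_toLp {i : Fin k // ¬ p i}
  exact (h3.prod h4).comp (h2.comp h1)

/-- Coordinates `y ↦ (y₀, y')` preserve volume. -/
lemma measurePreserving_split : MeasurePreserving
    (fun y : EuclideanSpace ℝ (Fin k) => (y 0, hyperplaneProj k y)) volume
    ((volume : Measure ℝ).prod volume) := by
  have : Unique {i : Fin k // i = 0} := Unique.subtypeEq 0
  have h := measurePreserving_split_of_unique (k := k) (fun i => i = 0)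
  have h0 : ((default : {i : Fin k // i = 0}) : Fin k) = 0 :=
    (default : {i : Fin k // i = 0}).2
  rw [h0] at h
  exact h

lemma integral_split {f : ℝ → ℝ} {g : EuclideanSpace ℝ {i : Fin k // i ≠ 0} → ℝ}
    (hf : Measurable f) (hg : Measurable g) :
    ∫ y : EuclideanSpace ℝ (Fin k), f (y 0) * g (hyperplaneProj k y) = (∫ s, f s) * ∫ z, g z := by
  have h := measurePreserving_split (k := k)
  rw [← integral_prod_mul, ← h.map_eq, integral_map h.aemeasurable]
  exact ((hf.comp measurable_fst).mul (hg.comp measurable_snd)).aestronglyMeasurable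

end Split

/-! ### Fields supported in a chart -/

section OfChart

variable {k : ℕ} [NeZero k] {M : Type*} [TopologicalSpace M]
  [ChartedSpace (EuclideanHalfSpace k) M] [IsManifold (𝓡∂ k) ∞ M] [T2Space M]
  {c : OpenPartialHomeomorph M (EuclideanHalfSpace k)}
  {F : Type*} [NormedAddCommGroup F] [NormedSpace ℝ F]

/-- The function on the manifold that is `g` in the chart `c` and `0` outside of it. -/
def ofChart (c : OpenPartialHomeomorph M (EuclideanHalfSpace k))
    (g : EuclideanSpace ℝ (Fin k) → F) : M → F := c.source.indicator (g ∘ c.extend (𝓡∂ k))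

lemma inChart_ofChart {g : EuclideanSpace ℝ (Fin k) → F} {y : EuclideanSpace ℝ (Fin k)}
    (hy : y ∈ (c.extend (𝓡∂ k)).target) : inChart c (ofChart c g) y = g y := by
  rw [inChart, Function.comp_apply, ofChart, Set.indicator_of_mem (symm_mem_source hy),
    Function.comp_apply, PartialEquiv.right_inv _ hy]

lemma contMDiff_ofChart (hc : c ∈ atlas (EuclideanHalfSpace k) M)
    {g : EuclideanSpace ℝ (Fin k) → F} {K : Set (EuclideanSpace ℝ (Fin k))} (hK : IsCompact K)
    (hKT : K ⊆ (c.extend (𝓡∂ k)).target) (hg : ContDiffOn ℝ ∞ g (c.extend (𝓡∂ k)).target)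
    (h0 : ∀ y ∈ (c.extend (𝓡∂ k)).target, y ∉ K → g y = 0) :
    ContMDiff (𝓡∂ k) 𝓘(ℝ, F) ∞ (ofChart c g) ∧ tsupport (ofChart c g) ⊆ c.source := by
  have hcl : IsClosed ((c.extend (𝓡∂ k)).symm '' K) :=
    (hK.image_of_continuousOn (c.continuousOn_extend_symm.mono hKT)).isClosed
  have hz : ∀ p ∉ (c.extend (𝓡∂ k)).symm '' K, ofChart c g p = 0 := by
    intro p hp
    by_cases hps : p ∈ c.source
    · rw [ofChart, Set.indicator_of_mem hps]
      exact h0 _ (extend_mem_target hps) fun h => hp ⟨_, h, c.extend_left_inv hps⟩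
    · exact Set.indicator_of_notMem hps _
  have hsub : (c.extend (𝓡∂ k)).symm '' K ⊆ c.source := by
    rintro _ ⟨y, hy, rfl⟩
    exact symm_mem_source (hKT hy)
  refine ⟨fun p => ?_, (closure_minimal (fun p hp => by
    by_contra h; exact hp (hz p h)) hcl).trans
    hsub⟩
  by_cases hp : p ∈ (c.extend (𝓡∂ k)).symm '' K
  · have h1 : ContMDiffOn (𝓡∂ k) 𝓘(ℝ, F) ∞ (g ∘ c.extend (𝓡∂ k)) c.source :=
      hg.contMDiffOn.comp (c.contMDiffOn_extend (IsManifold.subset_maximalAtlas hc))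
        fun q hq => extend_mem_target hq
    refine ((h1 p (hsub hp)).contMDiffAt (c.open_source.mem_nhds (hsub hp))).congr_of_eventuallyEq ?_
    filter_upwards [c.open_source.mem_nhds (hsub hp)] with q hq
    exact Set.indicator_of_mem hq _
  · refine (contMDiffAt_const (c := (0 : F))).congr_of_eventuallyEq ?_
    filter_upwards [hcl.isOpen_compl.mem_nhds hp] with q hq using hz q hq

end OfChart

/-! ### Boxes at the boundary -/

section Box

variable {n k : ℕ} [NeZero k] {M : Type*} [TopologicalSpace M]
  [ChartedSpace (EuclideanHalfSpace k) M] [IsManifold (𝓡∂ k) ∞ M] {x : Immersion k n M}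
  {c : OpenPartialHomeomorph M (EuclideanHalfSpace k)}

/-- The point of `ℝᵏ` with first coordinate `s` and other coordinates `z`, for `q = (s, z)`. -/
def boxMap (k : ℕ) [NeZero k] (q : ℝ × EuclideanSpace ℝ {i : Fin k // i ≠ 0}) :
    EuclideanSpace ℝ (Fin k) := hyperplaneIncl k q.2 + q.1 • EuclideanSpace.single 0 1

lemma continuous_boxMap : Continuous (boxMap k) := by unfold boxMap; fun_prop

@[simp] lemma boxMap_zero (q : ℝ × EuclideanSpace ℝ {i : Fin k // i ≠ 0}) : boxMap k q 0 = q.1 := by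
  simp [boxMap]

@[simp] lemma hyperplaneProj_single :
    hyperplaneProj k (EuclideanSpace.single (0 : Fin k) (1 : ℝ)) = 0 := by
  ext i
  simp [i.2]

lemma boxMap_eq (y : EuclideanSpace ℝ (Fin k)) : boxMap k (y 0, hyperplaneProj k y) = y := by
  rw [boxMap, hyperplaneIncl_proj]; abel

lemma boxMap_left_zero (z : EuclideanSpace ℝ {i : Fin k // i ≠ 0}) :
    boxMap k (0, z) = hyperplaneIncl k z := by simp [boxMap]

/-- A box around a boundary point in the image of a chart. -/
lemma exists_box {z₀ : EuclideanSpace ℝ {i : Fin k // i ≠ 0}}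
    (hz : hyperplaneIncl k z₀ ∈ (c.extend (𝓡∂ k)).target) :
    ∃ r > 0, ∀ s ∈ Set.Icc (0 : ℝ) r, ∀ z ∈ Metric.closedBall z₀ r,
      boxMap k (s, z) ∈ (c.extend (𝓡∂ k)).target := by
  obtain ⟨ρ, hρ, hB⟩ := Metric.mem_nhdsWithin_iff.1 (extend_target_mem_nhdsWithin' hz)
  have h1 : (boxMap k) ⁻¹' Metric.ball (hyperplaneIncl k z₀) ρ ∈ nhds ((0 : ℝ), z₀) := by
    refine continuous_boxMap.continuousAt.preimage_mem_nhds ?_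
    rw [boxMap_left_zero]
    exact Metric.ball_mem_nhds _ hρ
  obtain ⟨r, hr, hr'⟩ := Metric.nhds_basis_closedBall.mem_iff.1 h1
  refine ⟨r, hr, fun s hs z hz => hB ⟨hr' ?_, ?_⟩⟩
  · rw [Metric.mem_closedBall, Prod.dist_eq]
    refine max_le ?_ hz
    rw [Real.dist_0_eq_abs, abs_of_nonneg hs.1]
    exact hs.2
  · rw [mem_range_halfSpace_iff, boxMap_zero]
    exact hs.1

lemma fderiv_mul_split {q : EuclideanSpace ℝ {i : Fin k // i ≠ 0} → ℝ} (hq : ContDiff ℝ ∞ q)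
    {θ : ℝ → ℝ} (hθ : ContDiff ℝ ∞ θ) (y : EuclideanSpace ℝ (Fin k)) :
    fderiv ℝ (fun y : EuclideanSpace ℝ (Fin k) => q (hyperplaneProj k y) * θ (y 0)) y
      (EuclideanSpace.single 0 1) = q (hyperplaneProj k y) * deriv θ (y 0) := by
  have h1 := (hq.differentiable (by simp) (hyperplaneProj k y)).hasFDerivAt.comp y
    (hyperplaneProj k).hasFDerivAt
  have h2 := (hθ.differentiable (by simp) (y 0)).hasDerivAt.comp_hasFDerivAt y
    (EuclideanSpace.proj (0 : Fin k) : EuclideanSpace ℝ (Fin k) →L[ℝ] ℝ).hasFDerivAt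
  have h3 := (h1.mul h2).fderiv
  have h4 : (fun y : EuclideanSpace ℝ (Fin k) => q (hyperplaneProj k y) * θ (y 0)) =
    (q ∘ (hyperplaneProj k)) * (θ ∘ (EuclideanSpace.proj (0 : Fin k) :
      EuclideanSpace ℝ (Fin k) →L[ℝ] ℝ)) := rfl
  rw [h4, h3]
  simp

end Box

/-! ### Fields with prescribed flux -/

section LocalExtension

variable {n k : ℕ} [NeZero k] {M : Type*} [TopologicalSpace M]
  [ChartedSpace (EuclideanHalfSpace k) M] [IsManifold (𝓡∂ k) ∞ M] {x : Immersion k n M}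
  {c : OpenPartialHomeomorph M (EuclideanHalfSpace k)}
  [MeasurableSpace M] [BorelSpace M]

lemma continuous_inner_pos {Y : M → Amb n} (hY : Continuous Y) :
    Continuous fun p => (inner ℝ (Y p) (x.toFun p) : ℝ) := hY.inner x.smooth.continuous

/-- The first component, on the hyperplane, of the flux of a field supported in the chart `c`. It is
extended by `0` from the image of the chart. -/
def bdryFlux (x : Immersion k n M) (c : OpenPartialHomeomorph M (EuclideanHalfSpace k))
    (Y : M → Amb n) : EuclideanSpace ℝ {i : Fin k // i ≠ 0} → ℝ :=
  (hyperplaneIncl k ⁻¹' (c.extend (𝓡∂ k)).target).indicator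
    fun z => chartFlux x c Y (hyperplaneIncl k z) 0

/-- The field with flux `q(y') θ(y₀) e₀` in the chart `c`, where `y = (y₀, y')`. -/
def fluxField (x : Immersion k n M) (c : OpenPartialHomeomorph M (EuclideanHalfSpace k))
    (q : EuclideanSpace ℝ {i : Fin k // i ≠ 0} → ℝ) (θ : ℝ → ℝ) : M → Amb n :=
  ofChart c fun y => (q (hyperplaneProj k y) * θ (y 0) * (jac (chartDiff x c y))⁻¹) •
    chartDiff x c y (EuclideanSpace.single 0 1)

variable [CompactSpace M]

lemma contDiff_bdryFlux (hc : c ∈ atlas (EuclideanHalfSpace k) M) {Y : M → Amb n}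
    (hY : ContMDiff (𝓡∂ k) 𝓘(ℝ, Amb n) ∞ Y) (hs : tsupport Y ⊆ c.source)
    {K : Set (EuclideanSpace ℝ {i : Fin k // i ≠ 0})}
    (hK : K = hyperplaneProj k '' chartSupport c (tsupport Y))
    (hKT : ∀ z ∈ K, hyperplaneIncl k z ∈ (c.extend (𝓡∂ k)).target) :
    IsCompact K ∧ ContDiff ℝ ∞ (bdryFlux x c Y) ∧ ∀ z ∉ K, bdryFlux x c Y z = 0 := by
  have hKc : IsCompact K := by
    rw [hK]
    exact (isCompact_chartSupport (isClosed_tsupport Y) hs).image (hyperplaneProj k).continuous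
  refine ⟨hKc, contDiff_indicator (isOpen_preimage_hyperplaneIncl c) hKc hKT ?_ ?_⟩
  · exact ((EuclideanSpace.proj (0 : Fin k) : EuclideanSpace ℝ (Fin k) →L[ℝ] ℝ).contDiff.comp_contDiffOn
      (contDiffOn_chartFlux x hc hY)).comp (hyperplaneIncl k).contDiff.contDiffOn fun z hz => hz
  · intro z hz hzK
    rw [chartFlux_eq_zero x hz, PiLp.zero_apply]
    intro h
    apply hzK
    rw [hK]
    exact ⟨_, h, hyperplaneProj_incl z⟩

variable [T2Space M]

/-- The outward flux through the boundary, in a chart. The sign comes from `y₀` being an inward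
coordinate. -/
lemma integral_bdry_eq (hx : IsFreeBoundaryMinimal x) (hc : c ∈ atlas (EuclideanHalfSpace k) M)
    {Y : M → Amb n} (hY : IsTangentField x Y) (hs : tsupport Y ⊆ c.source) :
    ∫ p, inner ℝ (Y p) (x.toFun p) ∂(bdryVol x) = -∫ z, bdryFlux x c Y z := by
  have h0 : ∀ p ∉ c.source, inner ℝ (Y p) (x.toFun p) = (0 : ℝ) := fun p hp => by
    rw [image_eq_zero_of_notMem_tsupport fun h => hp (hs h), inner_zero_left]
  rw [integral_bdryVol_eq_chart x hc (continuous_inner_pos hY.1.continuous).aestronglyMeasurable h0,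
    bdryFlux, integral_indicator (isOpen_preimage_hyperplaneIncl c).measurableSet, ← integral_neg]
  refine setIntegral_congr_fun (isOpen_preimage_hyperplaneIncl c).measurableSet fun z hz => ?_
  exact jac_mul_inner_pos hx hc hY.2 hz

/-- The flux on the hyperplane is controlled in `L²` by the normal component along the boundary. -/
lemma integral_bdryFlux_sq_le (hx : IsFreeBoundaryMinimal x)
    (hc : c ∈ atlas (EuclideanHalfSpace k) M)
    {Y : M → Amb n} (hY : IsTangentField x Y) (hs : tsupport Y ⊆ c.source) {D : ℝ} (hD0 : 0 ≤ D)
    (hD : ∀ z, hyperplaneIncl k z ∈ (c.extend (𝓡∂ k)).target → bdryFlux x c Y z ≠ 0 →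
      jac ((chartDiff x c (hyperplaneIncl k z)).comp (hyperplaneIncl k)) ≤ D) :
    ∫ z, bdryFlux x c Y z ^ 2 ≤ D * ∫ p, (inner ℝ (Y p) (x.toFun p) : ℝ) ^ 2 ∂(bdryVol x) := by
  have hm := (isOpen_preimage_hyperplaneIncl c).measurableSet
  have hcont : Continuous fun p => (inner ℝ (Y p) (x.toFun p) : ℝ) ^ 2 :=
    (continuous_inner_pos hY.1.continuous).pow 2
  have h0 : ∀ p ∉ c.source, (inner ℝ (Y p) (x.toFun p) : ℝ) ^ 2 = 0 := fun p hp => by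
    rw [image_eq_zero_of_notMem_tsupport fun h => hp (hs h), inner_zero_left]
    norm_num
  rw [integral_bdryVol_eq_chart x hc hcont.aestronglyMeasurable h0]
  have h1 : (fun z => bdryFlux x c Y z ^ 2) =
      (hyperplaneIncl k ⁻¹' (c.extend (𝓡∂ k)).target).indicator
        (fun z => bdryFlux x c Y z ^ 2) := by
    funext z
    by_cases hz : z ∈ hyperplaneIncl k ⁻¹' (c.extend (𝓡∂ k)).target
    · rw [Set.indicator_of_mem hz]
    · rw [Set.indicator_of_notMem hz, bdryFlux, Set.indicator_of_notMem hz]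
      norm_num
  rw [h1, integral_indicator hm, ← integral_const_mul]
  refine integral_mono_of_nonneg (Filter.Eventually.of_forall fun z => sq_nonneg _) ?_ ?_
  · refine Integrable.const_mul ?_ D
    have hint : Integrable (fun p => (inner ℝ (Y p) (x.toFun p) : ℝ) ^ 2) (chartBdryVol x c) := by
      rw [← bdryVol_restrict x hc]
      exact (hcont.integrable_of_hasCompactSupport (HasCompactSupport.of_compactSpace _)).restrict
    rw [chartBdryVol_eq] at hint
    exact (integrable_paramMeasure aemeasurable_symm_incl (aemeasurable_jac_incl x hc)
      (ae_jac_incl_pos x hc) hint.aestronglyMeasurable).1 hint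
  · filter_upwards [ae_restrict_mem hm] with z hz
    have h2 : bdryFlux x c Y z = chartFlux x c Y (hyperplaneIncl k z) 0 :=
      Set.indicator_of_mem hz _
    have h3 := jac_mul_inner_pos hx hc hY.2 hz
    have hJ : 0 < jac ((chartDiff x c (hyperplaneIncl k z)).comp (hyperplaneIncl k)) :=
      jac_pos _ ((chartDiff_injective x hc hz).comp hyperplaneIncl_injective)
    simp only [smul_eq_mul, inChart, Function.comp_apply]
    by_cases hq : bdryFlux x c Y z = 0
    · rw [hq, zero_pow two_ne_zero]
      exact mul_nonneg hD0 (mul_nonneg hJ.le (sq_nonneg _))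
    · have h4 := hD z hz hq
      have h5 : bdryFlux x c Y z ^ 2 =
          (jac ((chartDiff x c (hyperplaneIncl k z)).comp (hyperplaneIncl k)) *
            inner ℝ (Y ((c.extend (𝓡∂ k)).symm (hyperplaneIncl k z)))
              (x.toFun ((c.extend (𝓡∂ k)).symm (hyperplaneIncl k z)))) ^ 2 := by
        rw [h3, h2, neg_sq]
      rw [h5, mul_pow, sq (jac _), mul_assoc]
      gcongr

variable {q : EuclideanSpace ℝ {i : Fin k // i ≠ 0} → ℝ} {θ : ℝ → ℝ}

lemma contDiff_mul_split (hq : ContDiff ℝ ∞ q) (hθ : ContDiff ℝ ∞ θ) :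
    ContDiff ℝ ∞ fun y : EuclideanSpace ℝ (Fin k) => q (hyperplaneProj k y) * θ (y 0) := by
  have hpr : ContDiff ℝ ∞ fun y : EuclideanSpace ℝ (Fin k) => y 0 :=
    (EuclideanSpace.proj (0 : Fin k) : EuclideanSpace ℝ (Fin k) →L[ℝ] ℝ).contDiff
  exact (hq.comp (hyperplaneProj k).contDiff).mul (hθ.comp hpr)

lemma isTangentField_fluxField (hc : c ∈ atlas (EuclideanHalfSpace k) M)
    (hq : ContDiff ℝ ∞ q) (hθ : ContDiff ℝ ∞ θ) {K : Set (EuclideanSpace ℝ (Fin k))}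
    (hK : IsCompact K) (hKT : K ⊆ (c.extend (𝓡∂ k)).target)
    (h0 : ∀ y ∈ (c.extend (𝓡∂ k)).target, y ∉ K → q (hyperplaneProj k y) * θ (y 0) = 0) :
    IsTangentField x (fluxField x c q θ) ∧ tsupport (fluxField x c q θ) ⊆ c.source := by
  have hg : ContDiffOn ℝ ∞ (fun y => (q (hyperplaneProj k y) * θ (y 0) *
      (jac (chartDiff x c y))⁻¹) • chartDiff x c y (EuclideanSpace.single 0 1))
      (c.extend (𝓡∂ k)).target := by
    refine ContDiffOn.smul (ContDiffOn.mul (contDiff_mul_split hq hθ).contDiffOn ?_) ?_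
    · exact (contDiffOn_jac_chartDiff x hc).inv fun y hy =>
        (jac_pos _ (chartDiff_injective x hc hy)).ne'
    · exact (contDiffOn_chartDiff x hc).clm_apply contDiffOn_const
  obtain ⟨h1, h2⟩ := contMDiff_ofChart hc hK hKT hg (fun y hy hyK => by
    rw [h0 y hy hyK, zero_mul, zero_smul])
  refine ⟨⟨h1, fun p => ?_⟩, h2⟩
  rw [fluxField, ofChart]
  by_cases hp : p ∈ c.source
  · rw [Set.indicator_of_mem hp, Function.comp_apply, tangentPlane_eq x hc hp]
    exact Submodule.smul_mem _ _ ⟨_, rfl⟩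
  · rw [Set.indicator_of_notMem hp]
    exact Submodule.zero_mem _

lemma chartFlux_fluxField (hc : c ∈ atlas (EuclideanHalfSpace k) M)
    {y : EuclideanSpace ℝ (Fin k)} (hy : y ∈ (c.extend (𝓡∂ k)).target) :
    chartFlux x c (fluxField x c q θ) y =
      (q (hyperplaneProj k y) * θ (y 0)) • EuclideanSpace.single 0 1 := by
  have hJ := (jac_pos _ (chartDiff_injective x hc hy)).ne'
  rw [chartFlux, chartVec, fluxField, inChart_ofChart hy, map_smul,
    pinv_apply_apply _ (chartDiff_injective x hc hy), smul_smul]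
  congr 1
  field_simp

lemma jac_mul_tanDiv_fluxField (hc : c ∈ atlas (EuclideanHalfSpace k) M) (hq : ContDiff ℝ ∞ q)
    (hθ : ContDiff ℝ ∞ θ) (ht : IsTangentField x (fluxField x c q θ))
    {y : EuclideanSpace ℝ (Fin k)} (hy : y ∈ (c.extend (𝓡∂ k)).target) :
    jac (chartDiff x c y) * inChart c (tanDiv x (fluxField x c q θ)) y =
      q (hyperplaneProj k y) * deriv θ (y 0) := by
  have hd : DifferentiableAt ℝ
      (fun y : EuclideanSpace ℝ (Fin k) => q (hyperplaneProj k y) * θ (y 0)) y :=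
    (contDiff_mul_split hq hθ).differentiable (by simp) y
  have h1 : HasFDerivWithinAt (chartFlux x c (fluxField x c q θ))
      ((fderiv ℝ (fun y : EuclideanSpace ℝ (Fin k) => q (hyperplaneProj k y) * θ (y 0)) y).smulRight
        (EuclideanSpace.single (0 : Fin k) (1 : ℝ))) (Set.range (𝓡∂ k)) y := by
    refine (hd.hasFDerivAt.smul_const _).hasFDerivWithinAt.congr_of_eventuallyEq ?_
      (chartFlux_fluxField hc hy)
    filter_upwards [extend_target_mem_nhdsWithin' hy] with y' hy' using chartFlux_fluxField hc hy'
  rw [jac_mul_tanDiv x hc ht hy,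
    h1.fderivWithin (uniqueDiffWithinAt_range (range_of_mem_extend_target hy)),
    ← fderiv_mul_split hq hθ]
  exact LinearMap.trace_smulRight
    ((fderiv ℝ (fun y : EuclideanSpace ℝ (Fin k) => q (hyperplaneProj k y) * θ (y 0)) y :
      EuclideanSpace ℝ (Fin k) →L[ℝ] ℝ) : EuclideanSpace ℝ (Fin k) →ₗ[ℝ] ℝ) _

end LocalExtension

/-! ### Extension of the boundary flux from a box -/

section BoxExtension

variable {n k : ℕ} [NeZero k] {M : Type*} [TopologicalSpace M]
  [ChartedSpace (EuclideanHalfSpace k) M] [IsManifold (𝓡∂ k) ∞ M] {x : Immersion k n M}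
  {c : OpenPartialHomeomorph M (EuclideanHalfSpace k)}
  [MeasurableSpace M] [BorelSpace M] [CompactSpace M] [T2Space M]

lemma integrable_split {f : ℝ → ℝ} {g : EuclideanSpace ℝ {i : Fin k // i ≠ 0} → ℝ}
    (hf : Integrable f) (hg : Integrable g) :
    Integrable fun y : EuclideanSpace ℝ (Fin k) => f (y 0) * g (hyperplaneProj k y) :=
  (measurePreserving_split (k := k)).integrable_comp_of_integrable (hf.mul_prod hg)

/-- Integration over the manifold of a function dominated in a chart by a product. -/
lemma integral_vol_le_split (hc : c ∈ atlas (EuclideanHalfSpace k) M) {φ : M → ℝ}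
    (hφ : Continuous φ) (h0 : ∀ p ∉ c.source, φ p = 0) (hp : ∀ p, 0 ≤ φ p) {f : ℝ → ℝ}
    {g : EuclideanSpace ℝ {i : Fin k // i ≠ 0} → ℝ} (hf : Continuous f) (hfi : Integrable f)
    (hg : Continuous g) (hgi : Integrable g) (hf0 : ∀ s, 0 ≤ f s) (hg0 : ∀ z, 0 ≤ g z) {D : ℝ}
    (hD : 0 ≤ D) (hle : ∀ y ∈ (c.extend (𝓡∂ k)).target,
      jac (chartDiff x c y) * inChart c φ y ≤ D * (f (y 0) * g (hyperplaneProj k y))) :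
    ∫ p, φ p ∂(vol x) ≤ D * ((∫ s, f s) * ∫ z, g z) := by
  rw [integral_vol_eq_chart x hc (aestronglyMeasurable_of_continuous k hφ) h0,
    ← integral_split hf.measurable hg.measurable, ← integral_const_mul]
  have hint := (integrable_split (k := k) hfi hgi).const_mul D
  refine (integral_mono_of_nonneg (Filter.Eventually.of_forall fun y => ?_) hint.restrict
    ?_).trans (setIntegral_le_integral hint (Filter.Eventually.of_forall fun y => ?_))
  · exact mul_nonneg (Real.sqrt_nonneg _) (hp _)
  · filter_upwards [ae_restrict_mem (measurableSet_extend_target c)] with y hy using hle y hy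
  · exact mul_nonneg hD (mul_nonneg (hf0 _) (hg0 _))

lemma integrable_sq_of_hasCompactSupport {E : Type*} [NormedAddCommGroup E] [NormedSpace ℝ E]
    [FiniteDimensional ℝ E] [MeasurableSpace E] [BorelSpace E] {μ : Measure E}
    [IsFiniteMeasureOnCompacts μ] {f : E → ℝ} (hf : Continuous f) (hc : HasCompactSupport f) :
    Integrable (fun y => f y ^ 2) μ := by
  simp_rw [sq]
  exact (hf.mul hf).integrable_of_hasCompactSupport (hc.mul_left (f := f))

/-- A cutoff function on the line. -/
lemma exists_bump {r : ℝ} (hr : 0 < r) : ∃ θ : ℝ → ℝ, ContDiff ℝ ∞ θ ∧ HasCompactSupport θ ∧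
    θ 0 = 1 ∧ ∀ s, 2 * r / 3 < s → θ s = 0 := by
  let b : ContDiffBump (0 : ℝ) := ⟨r / 3, 2 * r / 3, by positivity, by linarith⟩
  refine ⟨b, b.contDiff, b.hasCompactSupport,
    b.one_of_mem_closedBall (Metric.mem_closedBall_self b.rIn_pos.le), fun s hs => ?_⟩
  refine b.zero_of_le_dist ?_
  rw [Real.dist_0_eq_abs]
  exact hs.le.trans (le_abs_self s)

/-- A tangent field `Y` supported in a chart can be replaced, without changing its normal component
along the boundary, by a field `Y'` that is controlled in `L²`, together with its divergence, by that
component. If `q` is the first component of the flux of `Y` on the hyperplane, `Y'` has flux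
`q(y') θ(y₀) e₀` with a cutoff function `θ` with `θ 0 = 1`; for this field the divergence theorem is
the fundamental theorem of calculus for `θ`. -/
lemma exists_extension_of_box (hx : IsFreeBoundaryMinimal x)
    (hc : c ∈ atlas (EuclideanHalfSpace k) M) {z₀ : EuclideanSpace ℝ {i : Fin k // i ≠ 0}} {r : ℝ}
    (hr : 0 < r) (hbox : ∀ s ∈ Set.Icc (0 : ℝ) r, ∀ z ∈ Metric.closedBall z₀ r,
      boxMap k (s, z) ∈ (c.extend (𝓡∂ k)).target) :
    ∃ C, 0 ≤ C ∧ ∀ Y, IsTangentField x Y → tsupport Y ⊆ c.source →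
      (∀ p ∈ tsupport Y, hyperplaneProj k (c.extend (𝓡∂ k) p) ∈ Metric.ball z₀ r) →
      ∃ Y', IsTangentField x Y' ∧
        (∀ p ∈ (𝓡∂ k).boundary M, (inner ℝ (Y' p) (x.toFun p) : ℝ) = inner ℝ (Y p) (x.toFun p)) ∧
        ∫ p, ‖Y' p‖ ^ 2 ∂(vol x) ≤ C * ∫ p, (inner ℝ (Y p) (x.toFun p) : ℝ) ^ 2 ∂(bdryVol x) ∧
        ∫ p, tanDiv x Y' p ^ 2 ∂(vol x) ≤
          C * ∫ p, (inner ℝ (Y p) (x.toFun p) : ℝ) ^ 2 ∂(bdryVol x) ∧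
        ∫ p, tanDiv x Y' p ∂(vol x) = ∫ p, (inner ℝ (Y p) (x.toFun p) : ℝ) ∂(bdryVol x) := by
  obtain ⟨θ, hθs, hθc, hθ0, hθz⟩ := exists_bump hr
  have hθdz : ∀ s, 2 * r / 3 < s → deriv θ s = 0 := fun s hs => by
    have : θ =ᶠ[nhds s] fun _ => 0 := by
      filter_upwards [eventually_gt_nhds hs] with t ht using hθz t ht
    rw [this.deriv_eq, deriv_const]
  have hθ'c : Continuous (deriv θ) := hθs.continuous_deriv (by simp)
  -- bounds for the chart on the box
  set B := boxMap k '' (Set.Icc (0 : ℝ) r ×ˢ Metric.closedBall z₀ r) with hB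
  have hBc : IsCompact B := (isCompact_Icc.prod (isCompact_closedBall _ _)).image continuous_boxMap
  have hBT : B ⊆ (c.extend (𝓡∂ k)).target := by
    rintro _ ⟨⟨s, z⟩, ⟨hs, hz⟩, rfl⟩
    exact hbox s hs z hz
  have hJc : ContinuousOn (fun y => (jac (chartDiff x c y))⁻¹) (c.extend (𝓡∂ k)).target :=
    ((contDiffOn_jac_chartDiff x hc).inv fun y hy =>
      (jac_pos _ (chartDiff_injective x hc hy)).ne').continuousOn
  have hLc : ContinuousOn (fun y => chartDiff x c y (EuclideanSpace.single 0 1))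
      (c.extend (𝓡∂ k)).target :=
    ((contDiffOn_chartDiff x hc).clm_apply contDiffOn_const).continuousOn
  obtain ⟨D₁, hD₁⟩ := hBc.exists_bound_of_continuousOn (hJc.mono hBT)
  obtain ⟨D₂, hD₂⟩ := hBc.exists_bound_of_continuousOn (hLc.mono hBT)
  have hzT : Metric.closedBall z₀ r ⊆ hyperplaneIncl k ⁻¹' (c.extend (𝓡∂ k)).target :=
    fun z hz => by
      have := hbox 0 ⟨le_rfl, hr.le⟩ z hz
      rwa [boxMap_left_zero] at this
  have hJ₃ : ContinuousOn (fun z => jac ((chartDiff x c (hyperplaneIncl k z)).comp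
      (hyperplaneIncl k))) (Metric.closedBall z₀ r) :=
    (continuousOn_jac_chartDiff_incl x hc).comp (hyperplaneIncl k).continuous.continuousOn hzT
  obtain ⟨D₃, hD₃⟩ := (isCompact_closedBall z₀ r).exists_bound_of_continuousOn hJ₃
  have hz₀ : z₀ ∈ Metric.closedBall z₀ r := Metric.mem_closedBall_self hr.le
  have hb₀ : boxMap k (0, z₀) ∈ B :=
    Set.mem_image_of_mem _ (Set.mk_mem_prod (Set.left_mem_Icc.2 hr.le) hz₀)
  have hD₁0 : 0 ≤ D₁ := (norm_nonneg _).trans (hD₁ _ hb₀)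
  have hD₂0 : 0 ≤ D₂ := (norm_nonneg _).trans (hD₂ _ hb₀)
  have hD₃0 : 0 ≤ D₃ := (norm_nonneg _).trans (hD₃ _ hz₀)
  obtain ⟨I₁, hI₁⟩ : ∃ I, I = ∫ s, θ s ^ 2 := ⟨_, rfl⟩
  obtain ⟨I₂, hI₂⟩ : ∃ I, I = ∫ s, deriv θ s ^ 2 := ⟨_, rfl⟩
  have hI₁0 : 0 ≤ I₁ := hI₁ ▸ integral_nonneg fun s => sq_nonneg _
  have hI₂0 : 0 ≤ I₂ := hI₂ ▸ integral_nonneg fun s => sq_nonneg _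
  have hi₁ : Integrable fun s => θ s ^ 2 :=
    integrable_sq_of_hasCompactSupport hθs.continuous hθc
  have hi₂ : Integrable fun s => deriv θ s ^ 2 :=
    integrable_sq_of_hasCompactSupport hθ'c hθc.deriv
  refine ⟨D₁ * D₂ ^ 2 * I₁ * D₃ + D₁ * I₂ * D₃, by positivity, fun Y hY hs hYb => ?_⟩
  have hKb : ∀ z ∈ hyperplaneProj k '' chartSupport c (tsupport Y), z ∈ Metric.closedBall z₀ r := by
    rintro _ ⟨_, ⟨p, hp, rfl⟩, rfl⟩
    exact Metric.ball_subset_closedBall (hYb p hp)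
  obtain ⟨hK, hq, hq0⟩ := contDiff_bdryFlux hc hY.1 hs rfl fun z hz =>
    hzT (hKb z hz)
  set K := hyperplaneProj k '' chartSupport c (tsupport Y) with hKdef
  set q := bdryFlux x c Y with hqdef
  -- inside the half-space, the new flux is supported in a compact part of the box
  have hK₂ : ∀ y ∈ Set.range (𝓡∂ k), y ∉ boxMap k '' (Set.Icc (0 : ℝ) (2 * r / 3) ×ˢ K) →
      q (hyperplaneProj k y) = 0 ∨ 2 * r / 3 < y 0 := by
    intro y hy hyK
    by_contra! hcon
    refine hyK ⟨(y 0, hyperplaneProj k y), ⟨⟨mem_range_halfSpace_iff.1 hy, hcon.2⟩, ?_⟩, boxMap_eq y⟩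
    by_contra hz
    exact hcon.1 (hq0 _ hz)
  have hK₂B : boxMap k '' (Set.Icc (0 : ℝ) (2 * r / 3) ×ˢ K) ⊆ B :=
    Set.image_mono (Set.prod_mono (Set.Icc_subset_Icc_right (by linarith)) hKb)
  obtain ⟨hY', hs'⟩ := isTangentField_fluxField (x := x) hc hq hθs
    ((isCompact_Icc.prod hK).image continuous_boxMap) (hK₂B.trans hBT) (fun y hy hyK => by
      rcases hK₂ y (range_of_mem_extend_target hy) hyK with h | h
      · rw [h, zero_mul]
      · rw [hθz _ h, mul_zero])
  set Y' := fluxField x c q θ with hY'def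
  have hqc : HasCompactSupport q := HasCompactSupport.intro hK hq0
  have hqi : Integrable fun z => q z ^ 2 :=
    integrable_sq_of_hasCompactSupport hq.continuous hqc
  have hqle : ∫ z, q z ^ 2 ≤ D₃ * ∫ p, (inner ℝ (Y p) (x.toFun p) : ℝ) ^ 2 ∂(bdryVol x) :=
    integral_bdryFlux_sq_le hx hc hY hs hD₃0 fun z hz hqz =>
      (le_abs_self _).trans (hD₃ z (hKb z (by by_contra h; exact hqz (hq0 z h))))
  have hE0 : 0 ≤ ∫ p, (inner ℝ (Y p) (x.toFun p) : ℝ) ^ 2 ∂(bdryVol x) :=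
    integral_nonneg fun p => sq_nonneg _
  have hY'0 : ∀ p ∉ c.source, Y' p = 0 := fun p hp =>
    image_eq_zero_of_notMem_tsupport fun h => hp (hs' h)
  have hd'0 : ∀ p ∉ c.source, tanDiv x Y' p = 0 := fun p hp =>
    tanDiv_eq_zero x fun h => hp (hs' h)
  refine ⟨Y', hY', fun p hp => ?_, ?_, ?_, ?_⟩
  · -- the normal components agree along the boundary, as `θ 0 = 1`
    by_cases hps : p ∈ c.source
    · have hT := extend_mem_target hps
      have hz : hyperplaneIncl k (hyperplaneProj k (c.extend (𝓡∂ k) p)) = c.extend (𝓡∂ k) p := by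
        rw [hyperplaneIncl_proj, (mem_boundary_iff hc hps).1 hp, zero_smul, sub_zero]
      set z := hyperplaneProj k (c.extend (𝓡∂ k) p)
      have hzT : hyperplaneIncl k z ∈ (c.extend (𝓡∂ k)).target := hz ▸ hT
      have h1 := jac_mul_inner_pos hx hc hY'.2 hzT
      have h2 := jac_mul_inner_pos hx hc hY.2 hzT
      have h3 : chartFlux x c Y' (hyperplaneIncl k z) 0 = chartFlux x c Y (hyperplaneIncl k z) 0 := by
        rw [chartFlux_fluxField hc hzT, hyperplaneProj_incl, hyperplaneIncl_apply_zero, hθ0, mul_one,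
          hqdef]
        have h4 : bdryFlux x c Y z = chartFlux x c Y (hyperplaneIncl k z) 0 :=
          Set.indicator_of_mem (s := hyperplaneIncl k ⁻¹' (c.extend (𝓡∂ k)).target) hzT _
        rw [h4]
        simp
      have hJ : 0 < jac ((chartDiff x c (hyperplaneIncl k z)).comp (hyperplaneIncl k)) :=
        jac_pos _ ((chartDiff_injective x hc hzT).comp hyperplaneIncl_injective)
      rw [h3, ← h2, hz, c.extend_left_inv hps] at h1
      rw [hz] at hJ
      exact mul_left_cancel₀ hJ.ne' h1
    · rw [hY'0 p hps, image_eq_zero_of_notMem_tsupport fun h => hps (hs h)]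
  · -- bound for the field
    have h1 : ∫ p, ‖Y' p‖ ^ 2 ∂(vol x) ≤ (D₁ * D₂ ^ 2) * (I₁ * ∫ z, q z ^ 2) := by
      rw [hI₁]
      refine integral_vol_le_split (φ := fun p => ‖Y' p‖ ^ 2) (f := fun s => θ s ^ 2)
        (g := fun z => q z ^ 2) hc (hY'.1.continuous.norm.pow 2)
        (fun p hp => by rw [hY'0 p hp]; norm_num) (fun p => sq_nonneg _)
        (hθs.continuous.pow 2) hi₁ (hq.continuous.pow 2) hqi (fun s => sq_nonneg _)
        (fun z => sq_nonneg _) (by positivity) fun y hy => ?_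
      have hJ := jac_pos _ (chartDiff_injective x hc hy)
      have h2 : inChart c (fun p => ‖Y' p‖ ^ 2) y =
          (q (hyperplaneProj k y) * θ (y 0) * (jac (chartDiff x c y))⁻¹) ^ 2 *
            ‖chartDiff x c y (EuclideanSpace.single 0 1)‖ ^ 2 := by
        have : inChart c Y' y = _ := inChart_ofChart hy
        change ‖inChart c Y' y‖ ^ 2 = _
        rw [this, norm_smul, mul_pow, Real.norm_eq_abs, sq_abs]
      rw [h2]
      by_cases hyK : y ∈ boxMap k '' (Set.Icc (0 : ℝ) (2 * r / 3) ×ˢ K)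
      · have h3 := hD₁ y (hK₂B hyK)
        have h4 := hD₂ y (hK₂B hyK)
        rw [Real.norm_eq_abs, abs_of_pos (inv_pos.2 hJ)] at h3
        calc _ = ((jac (chartDiff x c y))⁻¹ * ‖chartDiff x c y (EuclideanSpace.single 0 1)‖ ^ 2) *
              (θ (y 0) ^ 2 * q (hyperplaneProj k y) ^ 2) := by field_simp
          _ ≤ (D₁ * D₂ ^ 2) * (θ (y 0) ^ 2 * q (hyperplaneProj k y) ^ 2) := by gcongr
      · have : q (hyperplaneProj k y) * θ (y 0) = 0 := by
          rcases hK₂ y (range_of_mem_extend_target hy) hyK with h | h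
          · rw [h, zero_mul]
          · rw [hθz _ h, mul_zero]
        rw [this]
        have : 0 ≤ (D₁ * D₂ ^ 2) * (θ (y 0) ^ 2 * q (hyperplaneProj k y) ^ 2) := by positivity
        simpa using this
    refine h1.trans ?_
    calc D₁ * D₂ ^ 2 * (I₁ * ∫ z, q z ^ 2) ≤ D₁ * D₂ ^ 2 *
          (I₁ * (D₃ * ∫ p, (inner ℝ (Y p) (x.toFun p) : ℝ) ^ 2 ∂(bdryVol x))) := by gcongr
      _ ≤ _ := by
        have : 0 ≤ D₁ * I₂ * D₃ * ∫ p, (inner ℝ (Y p) (x.toFun p) : ℝ) ^ 2 ∂(bdryVol x) := by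
          positivity
        linarith
  · -- bound for the divergence
    have h1 : ∫ p, tanDiv x Y' p ^ 2 ∂(vol x) ≤ D₁ * (I₂ * ∫ z, q z ^ 2) := by
      rw [hI₂]
      refine integral_vol_le_split (φ := fun p => tanDiv x Y' p ^ 2) (f := fun s => deriv θ s ^ 2)
        (g := fun z => q z ^ 2) hc ((continuous_tanDiv x hY'.1).pow 2)
        (fun p hp => by rw [hd'0 p hp]; norm_num) (fun p => sq_nonneg _)
        (hθ'c.pow 2) hi₂ (hq.continuous.pow 2) hqi (fun s => sq_nonneg _)
        (fun z => sq_nonneg _) (by positivity) fun y hy => ?_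
      have hJ := jac_pos _ (chartDiff_injective x hc hy)
      have h2 := jac_mul_tanDiv_fluxField hc hq hθs hY' hy
      have h3 : jac (chartDiff x c y) * inChart c (fun p => tanDiv x Y' p ^ 2) y =
          (jac (chartDiff x c y))⁻¹ * (q (hyperplaneProj k y) * deriv θ (y 0)) ^ 2 := by
        rw [← h2, ← hY'def]
        change jac (chartDiff x c y) * (inChart c (tanDiv x Y') y) ^ 2 = _
        field_simp
      rw [h3]
      by_cases hyK : y ∈ boxMap k '' (Set.Icc (0 : ℝ) (2 * r / 3) ×ˢ K)
      · have h3 := hD₁ y (hK₂B hyK)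
        rw [Real.norm_eq_abs, abs_of_pos (inv_pos.2 hJ)] at h3
        calc _ = (jac (chartDiff x c y))⁻¹ *
              (deriv θ (y 0) ^ 2 * q (hyperplaneProj k y) ^ 2) := by ring
          _ ≤ _ := by gcongr
      · have : q (hyperplaneProj k y) * deriv θ (y 0) = 0 := by
          rcases hK₂ y (range_of_mem_extend_target hy) hyK with h | h
          · rw [h, zero_mul]
          · rw [hθdz _ h, mul_zero]
        rw [this]
        have : 0 ≤ D₁ * (deriv θ (y 0) ^ 2 * q (hyperplaneProj k y) ^ 2) := by positivity
        simpa using this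
    refine h1.trans ?_
    calc D₁ * (I₂ * ∫ z, q z ^ 2) ≤ D₁ *
          (I₂ * (D₃ * ∫ p, (inner ℝ (Y p) (x.toFun p) : ℝ) ^ 2 ∂(bdryVol x))) := by gcongr
      _ ≤ _ := by
        have : 0 ≤ D₁ * D₂ ^ 2 * I₁ * D₃ *
            ∫ p, (inner ℝ (Y p) (x.toFun p) : ℝ) ^ 2 ∂(bdryVol x) := by positivity
        linarith
  · -- the divergence theorem, from `∫ θ' = -θ 0 = -1` over the half-line
    have hm : Measurable ((Set.Ici (0 : ℝ)).indicator (deriv θ)) :=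
      hθ'c.measurable.indicator measurableSet_Ici
    have hθi : ∫ s, (Set.Ici (0 : ℝ)).indicator (deriv θ) s = -1 := by
      rw [integral_indicator measurableSet_Ici, integral_Ici_eq_integral_Ioi,
        hθc.integral_Ioi_deriv_eq (hθs.of_le (by simp)), hθ0]
    rw [integral_bdry_eq hx hc hY hs, integral_vol_eq_chart x hc
      (aestronglyMeasurable_of_continuous k (continuous_tanDiv x hY'.1)) hd'0, ← hqdef,
      ← neg_one_mul (∫ z, q z), ← hθi, ← integral_split hm hq.continuous.measurable,
      ← integral_indicator (measurableSet_extend_target c)]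
    refine integral_congr_ae (Filter.Eventually.of_forall fun y => ?_)
    beta_reduce
    by_cases hy : y ∈ (c.extend (𝓡∂ k)).target
    · rw [Set.indicator_of_mem hy, smul_eq_mul, jac_mul_tanDiv_fluxField hc hq hθs hY' hy,
        Set.indicator_of_mem (show y 0 ∈ Set.Ici (0 : ℝ) from
          mem_range_halfSpace_iff.1 (range_of_mem_extend_target hy)), mul_comm]
    · rw [Set.indicator_of_notMem hy]
      by_cases hy0 : y 0 ∈ Set.Ici (0 : ℝ)
      · rw [Set.indicator_of_mem hy0]
        rcases hK₂ y (mem_range_halfSpace_iff.2 hy0) fun h => hy (hBT (hK₂B h)) with h | h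
        · rw [h, mul_zero]
        · rw [hθdz _ h, zero_mul]
      · rw [Set.indicator_of_notMem hy0, zero_mul]

end BoxExtension

/-! ### Representation of bounded functionals -/

/-- A functional `ℓ` on a space mapped by `A` to a Hilbert space is an inner product with a fixed vector,
if it is bounded in terms of `A`: it factors through the range of `A`, and extends from there by the
Hahn–Banach theorem. -/
lemma exists_riesz {T H : Type*} [AddCommGroup T] [Module ℝ T] [NormedAddCommGroup H]
    [InnerProductSpace ℝ H] [CompleteSpace H] (A : T →ₗ[ℝ] H) (ℓ : T →ₗ[ℝ] ℝ) {C : ℝ}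
    (h : ∀ y, |ℓ y| ≤ C * ‖A y‖) : ∃ t : H, ∀ y, ℓ y = inner ℝ t (A y) := by
  obtain ⟨g, hg⟩ := A.rangeRestrict.exists_rightInverse_of_surjective A.range_rangeRestrict
  have hg' : ∀ r, A (g r) = r := fun r => by
    have := congrArg Subtype.val (LinearMap.congr_fun hg r)
    exact this
  let f : LinearMap.range A →L[ℝ] ℝ := (ℓ.comp g).mkContinuous C fun r => by
    have := h (g r)
    rwa [hg'] at this
  obtain ⟨F, hF, -⟩ := exists_extension_norm_eq _ f
  refine ⟨(InnerProductSpace.toDual ℝ H).symm F, fun y => ?_⟩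
  rw [InnerProductSpace.toDual_symm_apply]
  have h1 : F (A y) = ℓ (g (A.rangeRestrict y)) := hF (A.rangeRestrict y)
  have h2 := h (y - g (A.rangeRestrict y))
  rw [map_sub A, hg', show ((A.rangeRestrict y : LinearMap.range A) : H) = A y from rfl, sub_self,
    norm_zero, mul_zero, map_sub] at h2
  rw [h1]
  have := abs_nonpos_iff.1 h2
  linarith

lemma norm_toLp_sq {α : Type*} [MeasurableSpace α] {μ : Measure α} {f : α → ℝ} (hf : MemLp f 2 μ) :
    ‖hf.toLp f‖ ^ 2 = ∫ p, f p ^ 2 ∂μ := by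
  rw [← real_inner_self_eq_norm_sq, L2.inner_def]
  refine integral_congr_ae ?_
  filter_upwards [hf.coeFn_toLp] with p hp
  rw [hp]
  simp [sq]

/-- The Cauchy–Schwarz inequality. -/
lemma abs_integral_mul_le {α : Type*} [MeasurableSpace α] {μ : Measure α} {f g : α → ℝ}
    (hf : MemLp f 2 μ) (hg : MemLp g 2 μ) :
    |∫ p, f p * g p ∂μ| ≤ ‖hf.toLp f‖ * Real.sqrt (∫ p, g p ^ 2 ∂μ) := by
  have h1 : ∫ p, f p * g p ∂μ = inner ℝ (hg.toLp g) (hf.toLp f) := by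
    rw [L2.inner_def]
    refine integral_congr_ae ?_
    filter_upwards [hf.coeFn_toLp, hg.coeFn_toLp] with p h1 h2
    rw [h1, h2]
    simp
  rw [h1, ← norm_toLp_sq hg, Real.sqrt_sq (norm_nonneg _), mul_comm]
  exact abs_real_inner_le_norm _ _

/-! ### The divergence theorem, and traces of functions -/

section ScalarTrace

variable {n k : ℕ} [NeZero k] {M : Type*} [TopologicalSpace M]
  [ChartedSpace (EuclideanHalfSpace k) M] [IsManifold (𝓡∂ k) ∞ M] {x : Immersion k n M}
  [MeasurableSpace M] [BorelSpace M] [CompactSpace M] [T2Space M]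

lemma integral_bdryVol_eq_zero {f : M → ℝ} (h : ∀ p ∈ (𝓡∂ k).boundary M, f p = 0) :
    ∫ p, f p ∂(bdryVol x) = 0 :=
  integral_eq_zero_of_ae <| by
    filter_upwards [ae_mem_boundary x] with p hp using h p hp

lemma isTangentField_zero : IsTangentField x fun _ => 0 :=
  ⟨contMDiff_const, fun _ => Submodule.zero_mem _⟩

/-- Locally, a tangent field `Y` can be replaced by a field `Y'` with the same normal component along the
boundary, controlled by that component and satisfying the divergence theorem. -/
lemma exists_local_extension (hx : IsFreeBoundaryMinimal x) (p₀ : M) :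
    ∃ V, IsOpen V ∧ p₀ ∈ V ∧ ∃ C, 0 ≤ C ∧ ∀ Y, IsTangentField x Y → tsupport Y ⊆ V →
      ∃ Y', IsTangentField x Y' ∧
        (∀ p ∈ (𝓡∂ k).boundary M, (inner ℝ (Y' p) (x.toFun p) : ℝ) = inner ℝ (Y p) (x.toFun p)) ∧
        ∫ p, ‖Y' p‖ ^ 2 ∂(vol x) ≤ C * ∫ p, (inner ℝ (Y p) (x.toFun p) : ℝ) ^ 2 ∂(bdryVol x) ∧
        ∫ p, tanDiv x Y' p ^ 2 ∂(vol x) ≤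
          C * ∫ p, (inner ℝ (Y p) (x.toFun p) : ℝ) ^ 2 ∂(bdryVol x) ∧
        ∫ p, tanDiv x Y' p ∂(vol x) = ∫ p, (inner ℝ (Y p) (x.toFun p) : ℝ) ∂(bdryVol x) := by
  by_cases hp₀ : p₀ ∈ (𝓡∂ k).boundary M
  · set c := chartAt (EuclideanHalfSpace k) p₀ with hcdef
    have hc : c ∈ atlas (EuclideanHalfSpace k) M := chart_mem_atlas _ _
    have hps : p₀ ∈ c.source := mem_chart_source _ _
    have hz : hyperplaneIncl k (hyperplaneProj k (c.extend (𝓡∂ k) p₀)) = c.extend (𝓡∂ k) p₀ := by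
      rw [hyperplaneIncl_proj, (mem_boundary_iff hc hps).1 hp₀, zero_smul, sub_zero]
    obtain ⟨r, hr, hbox⟩ := exists_box (c := c) (hz.symm ▸ extend_mem_target hps)
    obtain ⟨C, hC, h⟩ := exists_extension_of_box hx hc hr hbox
    have hcont : ContinuousOn (fun q => hyperplaneProj k (c.extend (𝓡∂ k) q)) c.source := by
      refine (hyperplaneProj k).continuous.comp_continuousOn ?_
      simpa only [c.extend_source] using c.continuousOn_extend (I := 𝓡∂ k)
    refine ⟨_, hcont.isOpen_inter_preimage c.open_source
      (Metric.isOpen_ball (x := hyperplaneProj k (c.extend (𝓡∂ k) p₀)) (ε := r)),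
      ⟨hps, Metric.mem_ball_self hr⟩, C, hC, fun Y hY hs => ?_⟩
    exact h Y hY (fun p hp => (hs hp).1) fun p hp => (hs hp).2
  · -- in the interior there is no flux, and the zero field will do
    refine ⟨(𝓡∂ k).interior M, ModelWithCorners.isOpen_interior (n := ∞) (by simp), ?_, 0, le_rfl, fun Y hY hs => ?_⟩
    · rwa [← ModelWithCorners.compl_boundary]
    have h0 : ∀ p ∈ (𝓡∂ k).boundary M, (inner ℝ (Y p) (x.toFun p) : ℝ) = 0 := fun p hp => by
      have h : p ∉ tsupport Y := fun h => by
        have := hs h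
        rw [← ModelWithCorners.compl_boundary] at this
        exact this hp
      rw [image_eq_zero_of_notMem_tsupport h, inner_zero_left]
    have hd : tanDiv x (fun _ : M => (0 : Amb n)) = 0 := by
      funext p
      refine tanDiv_eq_zero x ?_
      simp [tsupport]
    refine ⟨fun _ => 0, isTangentField_zero, fun p hp => ?_, ?_, ?_, ?_⟩
    · rw [h0 p hp, inner_zero_left]
    · simp
    · simp [hd]
    · rw [hd, integral_bdryVol_eq_zero h0]
      simp

variable {w : M → ℝ} {γ : M → Amb n →L[ℝ] ℝ}

lemma IsTangentField.sub {Y Y' : M → Amb n} (hY : IsTangentField x Y) (hY' : IsTangentField x Y') :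
    IsTangentField x (fun p => Y p - Y' p) :=
  ⟨hY.1.sub hY'.1, fun p => Submodule.sub_mem _ (hY.2 p) (hY'.2 p)⟩

lemma tanDiv_sub {Y Y' : M → Amb n} (hY : ContMDiff (𝓡∂ k) 𝓘(ℝ, Amb n) ∞ Y)
    (hY' : ContMDiff (𝓡∂ k) 𝓘(ℝ, Amb n) ∞ Y') (p : M) :
    tanDiv x (fun p => Y p - Y' p) p = tanDiv x Y p - tanDiv x Y' p := by
  simp only [tanDiv, tanDeriv_sub x hY hY', _root_.sub_apply, inner_sub_left,
    Finset.sum_sub_distrib]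

/-- The pairing `∫ (γ(Y) + w div Y)` depends only on the normal component of `Y` along the boundary. -/
lemma IsScalarPair.integral_congr_boundary (h : IsScalarPair x w γ) (hx : IsFreeBoundaryMinimal x)
    {Y Y' : M → Amb n} (hY : IsTangentField x Y) (hY' : IsTangentField x Y')
    (hb : ∀ p ∈ (𝓡∂ k).boundary M,
      (inner ℝ (Y' p) (x.toFun p) : ℝ) = inner ℝ (Y p) (x.toFun p)) :
    ∫ p, (γ p (Y p) + w p * tanDiv x Y p) ∂(vol x) =
      ∫ p, (γ p (Y' p) + w p * tanDiv x Y' p) ∂(vol x) := by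
  have h1 := h.integral_eq_zero hx (hY.sub hY') fun p hp => by
    rw [inner_sub_left, hb p hp, sub_self]
  rw [← sub_eq_zero, ← integral_sub (integrable_pairing h.memLp_fun h.memLp_deriv hY.1)
    (integrable_pairing h.memLp_fun h.memLp_deriv hY'.1), ← h1]
  refine integral_congr_ae (Filter.Eventually.of_forall fun p => ?_)
  simp only [tanDiv_sub hY.1 hY'.1, map_sub]
  ring

/-- The pairing `∫ (γ(Y) + w div Y)`, localized by a partition of unity. -/
lemma IsScalarPair.integral_partition (h : IsScalarPair x w γ) {Y : M → Amb n}
    (hY : IsTangentField x Y) {ι : Type*} [Fintype ι] {ψ : ι → M → ℝ}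
    (hψ : ∀ i, ContMDiff (𝓡∂ k) 𝓘(ℝ, ℝ) ∞ (ψ i)) (h1 : ∀ p, ∑ i, ψ i p = 1) :
    ∫ p, (γ p (Y p) + w p * tanDiv x Y p) ∂(vol x) =
      ∑ i, ∫ p, (γ p (ψ i p • Y p) + w p * tanDiv x (fun p => ψ i p • Y p) p) ∂(vol x) := by
  have hYi : ∀ i, IsTangentField x fun p => ψ i p • Y p := fun i => isTangentField_smul x (hψ i) hY
  have hsum : ∀ p, ∑ i, ψ i p • Y p = Y p := fun p => by rw [← Finset.sum_smul, h1, one_smul]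
  rw [← integral_finsetSum _ fun i _ =>
    integrable_pairing h.memLp_fun h.memLp_deriv (hYi i).1]
  refine integral_congr_ae (Filter.Eventually.of_forall fun p => ?_)
  have h2 := tanDiv_sum x Finset.univ (fun i _ => (hYi i).1) p
  simp only [hsum] at h2
  change γ p (Y p) + w p * tanDiv x (fun p => Y p) p = _
  beta_reduce
  rw [h2, Finset.sum_add_distrib, ← map_sum, hsum, Finset.mul_sum]

/-- The divergence theorem: the conormal is the position vector. The two sides do not change when `Y`
is replaced, after localization, by a field with the same normal component along the boundary. -/
lemma integral_tanDiv (hx : IsFreeBoundaryMinimal x) {Y : M → Amb n} (hY : IsTangentField x Y) :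
    ∫ p, tanDiv x Y p ∂(vol x) = ∫ p, (inner ℝ (Y p) (x.toFun p) : ℝ) ∂(bdryVol x) := by
  choose V hVo hV C hC hext using fun p₀ => exists_local_extension (k := k) hx p₀
  obtain ⟨t, ψ, hψ, hs, h1⟩ := exists_smooth_partition (k := k) V hVo hV
  have h2 := (isScalarPair_one (x := x)).integral_partition hY hψ h1
  simp only [_root_.zero_apply, zero_add, one_mul] at h2
  have h3 : ∀ i, ∫ p, tanDiv x (fun p => ψ i p • Y p) p ∂(vol x) =
      ∫ p, (inner ℝ (ψ i p • Y p) (x.toFun p) : ℝ) ∂(bdryVol x) := by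
    intro i
    have hYi := isTangentField_smul x (hψ i) hY
    obtain ⟨Y', hY', hb, -, -, hd⟩ := hext i _ hYi ((tsupport_smul_subset_left _ _).trans (hs i))
    have h4 := (isScalarPair_one (x := x)).integral_congr_boundary hx hYi hY' hb
    simp only [_root_.zero_apply, zero_add, one_mul] at h4
    rw [h4, hd]
  rw [h2, Finset.sum_congr rfl fun i _ => h3 i, ← integral_finsetSum]
  · refine integral_congr_ae (Filter.Eventually.of_forall fun p => ?_)
    beta_reduce
    rw [← sum_inner, ← Finset.sum_smul, h1, one_smul]
  · intro i _
    exact (continuous_inner_pos (isTangentField_smul x (hψ i) hY).1.continuous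
      |>.integrable_of_hasCompactSupport (HasCompactSupport.of_compactSpace _))

/-- The pairing `∫ (γ(Y) + w div Y)` is bounded by the `L²` norm of the normal component of `Y` along the
boundary. -/
lemma IsScalarPair.exists_bound (h : IsScalarPair x w γ) (hx : IsFreeBoundaryMinimal x) :
    ∃ C, ∀ Y, IsTangentField x Y → |∫ p, (γ p (Y p) + w p * tanDiv x Y p) ∂(vol x)| ≤
      C * Real.sqrt (∫ p, (inner ℝ (Y p) (x.toFun p) : ℝ) ^ 2 ∂(bdryVol x)) := by
  choose V hVo hV C hC hext using fun p₀ => exists_local_extension (k := k) hx p₀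
  obtain ⟨t, ψ, hψ, hs, h1⟩ := exists_smooth_partition (k := k) V hVo hV
  choose B hB0 hB using fun i => exists_norm_le_of_continuous (hψ i).continuous
  have hγn := h.memLp_deriv.norm
  set A := ‖hγn.toLp _‖ + ‖h.memLp_fun.toLp w‖ with hA
  refine ⟨∑ i : t, A * (Real.sqrt (C i) * B i), fun Y hY => ?_⟩
  rw [h.integral_partition hY hψ h1, Finset.sum_mul]
  refine (Finset.abs_sum_le_sum_abs _ _).trans (Finset.sum_le_sum fun i _ => ?_)
  have hYi := isTangentField_smul x (hψ i) hY
  obtain ⟨Y', hY', hb, hn, hd, -⟩ := hext i _ hYi ((tsupport_smul_subset_left _ _).trans (hs i))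
  rw [h.integral_congr_boundary hx hYi hY' hb]
  set E := ∫ p, (inner ℝ (Y p) (x.toFun p) : ℝ) ^ 2 ∂(bdryVol x) with hE
  have hEi : ∫ p, (inner ℝ (ψ i p • Y p) (x.toFun p) : ℝ) ^ 2 ∂(bdryVol x) ≤ B i ^ 2 * E := by
    rw [hE, ← integral_const_mul]
    have hcont : ∀ {Z : M → Amb n}, IsTangentField x Z →
        Integrable (fun p => (inner ℝ (Z p) (x.toFun p) : ℝ) ^ 2) (bdryVol x) := fun {Z} hZ =>
      ((continuous_inner_pos hZ.1.continuous).pow 2).integrable_of_hasCompactSupport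
        (HasCompactSupport.of_compactSpace _)
    refine integral_mono (hcont hYi) ((hcont hY).const_mul _) fun p => ?_
    beta_reduce
    rw [real_inner_smul_left, mul_pow]
    refine mul_le_mul_of_nonneg_right ?_ (sq_nonneg _)
    exact sq_le_sq' (abs_le.1 (hB i p)).1 (abs_le.1 (hB i p)).2
  have hroot : ∀ {I : ℝ}, I ≤ C i * ∫ p, (inner ℝ (ψ i p • Y p) (x.toFun p) : ℝ) ^ 2 ∂(bdryVol x) →
      Real.sqrt I ≤ Real.sqrt (C i) * B i * Real.sqrt E := by
    intro I hI
    refine (Real.sqrt_le_sqrt (hI.trans (mul_le_mul_of_nonneg_left hEi (hC i)))).trans_eq ?_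
    rw [Real.sqrt_mul (hC i), Real.sqrt_mul (sq_nonneg _), Real.sqrt_sq (hB0 i), mul_assoc]
  have hi1 := integrable_clm_apply k h.memLp_deriv hY'.1.continuous
  have hi2 : Integrable (fun p => w p * tanDiv x Y' p) (vol x) :=
    (memLp_bilin k (ContinuousLinearMap.mul ℝ ℝ) h.memLp_fun
    (continuous_tanDiv x hY'.1)).integrable one_le_two
  have hYn : MemLp (fun p => ‖Y' p‖) 2 (vol x) := memLp_of_continuous k hY'.1.continuous.norm
  have hdn : MemLp (tanDiv x Y') 2 (vol x) := memLp_of_continuous k (continuous_tanDiv x hY'.1)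
  have hb1 : |∫ p, γ p (Y' p) ∂(vol x)| ≤
      ‖hγn.toLp _‖ * (Real.sqrt (C i) * B i * Real.sqrt E) := by
    refine le_trans ?_ (mul_le_mul_of_nonneg_left (hroot hn) (norm_nonneg _))
    refine le_trans ?_ (abs_integral_mul_le hγn hYn)
    refine (abs_integral_le_integral_abs).trans (le_trans ?_ (le_abs_self _))
    refine integral_mono hi1.abs ((hγn.integrable_mul hYn)) fun p => (γ p).le_opNorm _
  have hb2 : |∫ p, w p * tanDiv x Y' p ∂(vol x)| ≤
      ‖h.memLp_fun.toLp w‖ * (Real.sqrt (C i) * B i * Real.sqrt E) :=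
    (abs_integral_mul_le h.memLp_fun hdn).trans
      (mul_le_mul_of_nonneg_left (hroot hd) (norm_nonneg _))
  rw [integral_add hi1 hi2]
  refine (abs_add_le _ _).trans ((add_le_add hb1 hb2).trans_eq ?_)
  rw [hA]
  ring

/-- A weakly differentiable function has a square integrable boundary trace: by `exists_bound`, the
defect in the divergence theorem is represented by a square integrable function on the boundary. -/
lemma IsScalarPair.exists_trace (h : IsScalarPair x w γ) (hx : IsFreeBoundaryMinimal x) :
    ∃ t, MemLp t 2 (bdryVol x) ∧ ∀ Y, IsTangentField x Y →
      ∫ p, (γ p (Y p) + w p * tanDiv x Y p) ∂(vol x) =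
        ∫ p, inner ℝ (Y p) (x.toFun p) * t p ∂(bdryVol x) := by
  obtain ⟨C, hC⟩ := h.exists_bound hx
  -- the tangent fields, mapped to their normal components along the boundary
  let T : Submodule ℝ (M → Amb n) :=
    { carrier := {Y | IsTangentField x Y}
      add_mem' := fun {Y Y'} hY hY' => ⟨hY.1.add hY'.1, fun p => Submodule.add_mem _ (hY.2 p) (hY'.2 p)⟩
      zero_mem' := isTangentField_zero
      smul_mem' := fun a Y hY => isTangentField_smul x contMDiff_const hY }
  have hm : ∀ Y : T, MemLp (fun p => (inner ℝ (Y.1 p) (x.toFun p) : ℝ)) 2 (bdryVol x) := fun Y =>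
    memLp_of_continuous k (continuous_inner_pos Y.2.1.continuous)
  let A : T →ₗ[ℝ] Lp ℝ 2 (bdryVol x) :=
    { toFun := fun Y => (hm Y).toLp _
      map_add' := fun Y Y' => by
        rw [← MemLp.toLp_add]
        congr 1
        funext p
        exact inner_add_left _ _ _
      map_smul' := fun a Y => by
        rw [RingHom.id_apply, ← MemLp.toLp_const_smul]
        congr 1
        funext p
        exact real_inner_smul_left _ _ _ }
  -- the defect in the divergence theorem
  let ℓ : T →ₗ[ℝ] ℝ :=
    { toFun := fun Y => ∫ p, (γ p (Y.1 p) + w p * tanDiv x Y.1 p) ∂(vol x)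
      map_add' := fun Y Y' => by
        rw [← integral_add (integrable_pairing h.memLp_fun h.memLp_deriv Y.2.1)
          (integrable_pairing h.memLp_fun h.memLp_deriv Y'.2.1)]
        refine integral_congr_ae (Filter.Eventually.of_forall fun p => ?_)
        have h1 : tanDiv x (Y + Y').1 p = tanDiv x Y.1 p + tanDiv x Y'.1 p := by
          simp only [tanDiv, ← Finset.sum_add_distrib, ← inner_add_left]
          refine Finset.sum_congr rfl fun i _ => ?_
          congr 1
          exact congrArg (fun L : Amb n →L[ℝ] Amb n => L (tanFrame x p i))
            (tanDeriv_add x Y.2.1 Y'.2.1 p)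
        beta_reduce
        rw [h1]
        change γ p (Y.1 p + Y'.1 p) + _ = _
        rw [map_add]
        ring
      map_smul' := fun a Y => by
        rw [RingHom.id_apply, smul_eq_mul, ← integral_const_mul]
        refine integral_congr_ae (Filter.Eventually.of_forall fun p => ?_)
        have h1 : tanDiv x (a • Y).1 p = a * tanDiv x Y.1 p := by
          have := tanDiv_smul x (g := fun _ => a) contMDiff_const Y.2 p
          rw [tanDeriv_const, _root_.zero_apply, zero_add] at this
          exact this
        beta_reduce
        rw [h1]
        change γ p (a • Y.1 p) + _ = _
        rw [map_smul, smul_eq_mul]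
        ring }
  obtain ⟨t, ht⟩ := exists_riesz A ℓ (C := C) fun Y => by
    refine (hC Y.1 Y.2).trans_eq ?_
    rw [← norm_toLp_sq (hm Y), Real.sqrt_sq (norm_nonneg _)]
    rfl
  refine ⟨t, Lp.memLp t, fun Y hY => ?_⟩
  refine (ht ⟨Y, hY⟩).trans ?_
  rw [L2.inner_def]
  refine integral_congr_ae ?_
  filter_upwards [(hm ⟨Y, hY⟩).coeFn_toLp] with p hp
  have h1 : (A ⟨Y, hY⟩ : M → ℝ) p = inner ℝ (Y p) (x.toFun p) := hp
  rw [h1]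
  simp

end ScalarTrace

/-! ### Sobolev sections and their traces -/

section SobolevTriple

variable {n k : ℕ} [NeZero k] {M : Type*} [TopologicalSpace M]
  [ChartedSpace (EuclideanHalfSpace k) M] [IsManifold (𝓡∂ k) ∞ M] {x : Immersion k n M}
  [MeasurableSpace M] [BorelSpace M]

variable (x) in
/-- `G` is the weak covariant derivative and `τ` the boundary trace of the section `W` of the
normal bundle. Green's formula, with the conormal written as the position vector, holds for test
fields without any condition on the boundary. -/
structure IsSobolevTriple (W : M → Amb n) (G : M → Amb n →L[ℝ] Amb n) (τ : M → Amb n) : Prop where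
  isL2Normal : IsL2Normal x W
  isWeakDeriv : IsWeakDeriv x W G
  memLp_trace : MemLp τ 2 (bdryVol x)
  trace_mem : ∀ᵐ p ∂(bdryVol x), τ p ∈ normalSpace x p
  integral_eq : ∀ X Φ : M → Amb n, IsTangentField x X → IsNormalField x Φ →
    ∫ p, (inner ℝ (G p (X p)) (Φ p) + inner ℝ (W p) (norDeriv x Φ p (X p))
      + tanDiv x X p * inner ℝ (W p) (Φ p)) ∂(vol x) =
      ∫ p, inner ℝ (X p) (x.toFun p) * inner ℝ (τ p) (Φ p) ∂(bdryVol x)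

variable [T2Space M] [CompactSpace M] {W : M → Amb n} {G : M → Amb n →L[ℝ] Amb n}

lemma inner_norProj_of_mem {p : M} {u w : Amb n} (hu : u ∈ normalSpace x p) :
    (inner ℝ u (norProj x p w) : ℝ) = inner ℝ u w := by
  rw [← inner_norProj_left, norProj_eq_self x hu]

lemma integrable_inner_deriv (hG : MemLp G 2 (vol x)) {X Φ : M → Amb n}
    (hX : Continuous X) (hΦ : Continuous Φ) :
    Integrable (fun p => (inner ℝ (G p (X p)) (Φ p) : ℝ)) (vol x) :=
  integrable_inner k (memLp_bilin k (ContinuousLinearMap.id ℝ (Amb n →L[ℝ] Amb n)) hG hX) hΦ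

lemma integrable_inner_norDeriv (hW : MemLp W 2 (vol x)) {X Φ : M → Amb n}
    (hX : IsTangentField x X) (hΦ : IsNormalField x Φ) :
    Integrable (fun p => (inner ℝ (W p) (norDeriv x Φ p (X p)) : ℝ)) (vol x) :=
  integrable_inner k hW ((contMDiff_norDeriv x hΦ.1).continuous.clm_apply hX.1.continuous)

lemma integrable_tanDiv_mul (hW : MemLp W 2 (vol x)) {X Φ : M → Amb n}
    (hX : IsTangentField x X) (hΦ : IsNormalField x Φ) :
    Integrable (fun p => tanDiv x X p * (inner ℝ (W p) (Φ p) : ℝ)) (vol x) := by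
  have h := integrable_inner k hW ((continuous_tanDiv x hX.1).smul hΦ.1.continuous)
  refine h.congr (Filter.Eventually.of_forall fun p => ?_)
  exact real_inner_smul_right _ _ _

lemma integral_add_of_normal (hW : MemLp W 2 (vol x)) (hG : MemLp G 2 (vol x)) {X Φ : M → Amb n}
    (hX : IsTangentField x X) (hΦ : IsNormalField x Φ) :
    ∫ p, inner ℝ (G p (X p)) (Φ p) ∂(vol x) + ∫ p, (inner ℝ (W p) (norDeriv x Φ p (X p)) +
      tanDiv x X p * inner ℝ (W p) (Φ p)) ∂(vol x) =
    ∫ p, (inner ℝ (G p (X p)) (Φ p) + inner ℝ (W p) (norDeriv x Φ p (X p)) +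
      tanDiv x X p * inner ℝ (W p) (Φ p)) ∂(vol x) := by
  have h1 := integrable_inner_deriv hG hX.1.continuous hΦ.1.continuous
  have h2 := integrable_inner_norDeriv hW hX hΦ
  have h3 := integrable_tanDiv_mul hW hX hΦ
  rw [integral_add h2 h3, integral_add (f := fun p => (inner ℝ (G p (X p)) (Φ p) : ℝ) +
    inner ℝ (W p) (norDeriv x Φ p (X p))) (h1.add h2) h3, integral_add h1 h2, add_assoc]

/-- The components of a weakly differentiable normal section are weakly differentiable functions. The
second term of the derivative is the derivative of the projection onto the normal spaces. -/
lemma IsWeakDeriv.isScalarPair (hW : IsL2Normal x W) (hG : IsWeakDeriv x W G) (e : Amb n) :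
    IsScalarPair x (fun p => inner ℝ (W p) e) (fun p =>
      (innerSL ℝ e).comp (G p) - (innerSL ℝ (W p)).comp ((dProj x p).flip e)) := by
  have hflip : Continuous fun p => (dProj x p).flip e :=
    ((ContinuousLinearMap.flipₗᵢ ℝ (Amb n) (Amb n) (Amb n)).continuous.comp
      (contMDiff_dProj x).continuous).clm_apply continuous_const
  refine ⟨memLp_inner k hW.1 continuous_const, MemLp.sub ?_ ?_, fun Y hY hs => ?_⟩
  · exact ((ContinuousLinearMap.compL ℝ (Amb n) (Amb n) ℝ) (innerSL ℝ e)).comp_memLp' hG.1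
  · exact memLp_bilin k ((ContinuousLinearMap.compL ℝ (Amb n) (Amb n) ℝ).comp (innerSL ℝ)) hW.1
      hflip
  have hN := isNormalField_norPart x e
  have h := hG.2.2 Y _ hY hs hN
  rw [eq_neg_iff_add_eq_zero, integral_add_of_normal hW.1 hG.1 hY hN] at h
  rw [← h]
  refine integral_congr_ae ?_
  filter_upwards [hW.2, hG.2.1] with p h1 h2
  rw [norDeriv_norPart, inner_neg_right, ← norProj_dProj, inner_norProj_of_mem h1, norPart,
    inner_norProj_of_mem (h2 (Y p)).1, inner_norProj_of_mem h1]
  simp only [_root_.sub_apply, ContinuousLinearMap.comp_apply, innerSL_apply_apply,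
    ContinuousLinearMap.flip_apply]
  rw [real_inner_comm (G p (Y p)) e]
  ring

lemma contMDiff_coord {Φ : M → Amb n} (hΦ : ContMDiff (𝓡∂ k) 𝓘(ℝ, Amb n) ∞ Φ) (e : Amb n) :
    ContMDiff (𝓡∂ k) 𝓘(ℝ, ℝ) ∞ fun p => (inner ℝ (Φ p) e : ℝ) :=
  contMDiff_inner hΦ contMDiff_const

lemma sum_inner_mul_inner (u w : Amb n) :
    ∑ a, (inner ℝ u (bv a) : ℝ) * inner ℝ (bv a) w = inner ℝ u w := by
  conv_rhs => rw [← sum_inner_smul_bv u, sum_inner]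
  simp_rw [real_inner_smul_left]

lemma sum_inner_mul_inner' (u w : Amb n) :
    ∑ a, (inner ℝ u (bv a) : ℝ) * inner ℝ w (bv a) = inner ℝ u w := by
  rw [← sum_inner_mul_inner u w]
  exact Finset.sum_congr rfl fun a _ => by rw [real_inner_comm w]

/-- Sobolev sections of the normal bundle have a boundary trace: its components are the traces of the
components of the section, projected onto the normal space. -/
lemma IsWeakDeriv.exists_trace (hx : IsFreeBoundaryMinimal x) (hW : IsL2Normal x W)
    (hG : IsWeakDeriv x W G) : ∃ τ, IsSobolevTriple x W G τ := by
  have hp := fun e => hG.isScalarPair hW e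
  choose t ht ht' using fun a : Fin n => (hp (bv a)).exists_trace hx
  obtain ⟨τ₀, hτ₀def⟩ : ∃ τ₀ : M → Amb n, τ₀ = fun p => ∑ a, t a p • (bv a : Amb n) := ⟨_, rfl⟩
  have hτ₀ : MemLp τ₀ 2 (bdryVol x) := by
    rw [hτ₀def]
    refine memLp_finsetSum _ fun a _ => ?_
    exact (ContinuousLinearMap.toSpanSingleton ℝ (bv a : Amb n)).comp_memLp' (ht a)
  have hτm : MemLp (fun p => ContinuousLinearMap.apply ℝ (Amb n) (τ₀ p) (norProj x p)) 2
      (bdryVol x) := memLp_bilin k _ hτ₀ (contMDiff_norProj x).continuous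
  refine ⟨fun p => norProj x p (τ₀ p), hW, hG, hτm, Filter.Eventually.of_forall fun p =>
    norProj_mem x p _, fun X Φ hX hΦ => ?_⟩
  have hYa : ∀ a, IsTangentField x fun p => (inner ℝ (Φ p) (bv a) : ℝ) • X p := fun a =>
    isTangentField_smul x (contMDiff_coord hΦ.1 _) hX
  have h1 : ∀ a, Integrable (fun p => (inner ℝ (X p) (x.toFun p) : ℝ) *
      (inner ℝ (Φ p) (bv a) * t a p)) (bdryVol x) := fun a => by
    have hc : Continuous fun p => (inner ℝ (X p) (x.toFun p) : ℝ) * inner ℝ (Φ p) (bv a) :=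
      (continuous_inner_pos hX.1.continuous).mul (contMDiff_coord hΦ.1 _).continuous
    have := (memLp_bilin k (ContinuousLinearMap.mul ℝ ℝ) (ht a) hc).integrable one_le_two
    refine this.congr (Filter.Eventually.of_forall fun p => ?_)
    simp only [ContinuousLinearMap.mul_apply']
    ring
  have h2 : ∫ p, inner ℝ (X p) (x.toFun p) * inner ℝ (norProj x p (τ₀ p)) (Φ p) ∂(bdryVol x) =
      ∑ a, ∫ p, inner ℝ ((inner ℝ (Φ p) (bv a) : ℝ) • X p) (x.toFun p) * t a p ∂(bdryVol x) := by
    simp_rw [real_inner_smul_left, mul_comm (inner ℝ (Φ _) (bv _)) (inner ℝ (X _) _), mul_assoc]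
    rw [← integral_finsetSum _ fun a _ => h1 a]
    refine integral_congr_ae (Filter.Eventually.of_forall fun p => ?_)
    beta_reduce
    rw [← Finset.mul_sum, inner_norProj_left, norProj_eq_self x (hΦ.2 p), hτ₀def]
    simp only [sum_inner, real_inner_smul_left]
    congr 1
    refine Finset.sum_congr rfl fun a _ => ?_
    rw [mul_comm, real_inner_comm]
  rw [h2, ← Finset.sum_congr rfl fun a _ => ht' a _ (hYa a),
    ← integral_finsetSum _ fun a _ => integrable_pairing (hp (bv a)).memLp_fun
      (hp (bv a)).memLp_deriv (hYa a).1]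
  refine integral_congr_ae ?_
  filter_upwards [hW.2] with p hWp
  simp only [tanDiv_smul x (contMDiff_coord hΦ.1 _) hX, _root_.sub_apply,
    ContinuousLinearMap.comp_apply, innerSL_apply_apply, ContinuousLinearMap.flip_apply, map_smul,
    smul_eq_mul, tanDeriv_inner x hΦ.1 contMDiff_const, tanDeriv_const, _root_.zero_apply,
    inner_zero_right, add_zero]
  have e1 : ∑ a, (inner ℝ (Φ p) (bv a) : ℝ) * inner ℝ (bv a) (G p (X p)) =
      inner ℝ (G p (X p)) (Φ p) := by
    rw [sum_inner_mul_inner, real_inner_comm]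
  -- the derivative of the projection drops out, as it maps normal vectors to tangent ones
  have e2 : ∑ a, (inner ℝ (Φ p) (bv a) : ℝ) * inner ℝ (W p) (dProj x p (X p) (bv a)) = 0 := by
    simp_rw [← inner_dProj_left]
    rw [sum_inner_mul_inner', real_inner_comm, inner_dProj_left, ← inner_norProj_of_mem hWp,
      norProj_dProj, (mem_normalSpace_iff x).1 (hΦ.2 p), map_zero, inner_zero_right]
  have e3 : ∑ a, (inner ℝ (W p) (bv a) : ℝ) * inner ℝ (tanDeriv x Φ p (X p)) (bv a) =
      inner ℝ (W p) (norDeriv x Φ p (X p)) := by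
    rw [sum_inner_mul_inner', norDeriv_apply, inner_norProj_of_mem hWp]
  have e4 : ∑ a, (inner ℝ (W p) (bv a) : ℝ) * inner ℝ (Φ p) (bv a) = inner ℝ (W p) (Φ p) := by
    rw [sum_inner_mul_inner']
  rw [← e3, ← e4, ← e1, Finset.mul_sum, ← Finset.sum_add_distrib, ← Finset.sum_add_distrib,
    ← sub_eq_zero, ← e2, ← Finset.sum_sub_distrib]
  refine Finset.sum_congr rfl fun a _ => ?_
  ring

/-- Smooth normal fields are Sobolev sections, with their own boundary values as the trace. -/
lemma isSobolevTriple_of_smooth (hx : IsFreeBoundaryMinimal x) {Ψ : M → Amb n}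
    (hΨ : IsNormalField x Ψ) : IsSobolevTriple x Ψ (norDeriv x Ψ) Ψ := by
  have hdiv : ∀ X Φ : M → Amb n, IsTangentField x X → IsNormalField x Φ →
    ∫ p, (inner ℝ (norDeriv x Ψ p (X p)) (Φ p) + inner ℝ (Ψ p) (norDeriv x Φ p (X p))
      + tanDiv x X p * inner ℝ (Ψ p) (Φ p)) ∂(vol x) =
      ∫ p, inner ℝ (X p) (x.toFun p) * inner ℝ (Ψ p) (Φ p) ∂(bdryVol x) := by
    intro X Φ hX hΦ
    have hg := contMDiff_inner hΨ.1 hΦ.1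
    have h := integral_tanDiv hx (isTangentField_smul x hg hX)
    simp_rw [real_inner_smul_left, mul_comm (inner ℝ (Ψ _) (Φ _)) (inner ℝ (X _) _)] at h
    rw [← h]
    refine integral_congr_ae (Filter.Eventually.of_forall fun p => ?_)
    beta_reduce
    rw [tanDiv_smul x hg hX, tanDeriv_inner x hΨ.1 hΦ.1, norDeriv_apply, norDeriv_apply,
      inner_norProj_left, norProj_eq_self x (hΦ.2 p), inner_norProj_of_mem (hΨ.2 p), mul_comm]
  have hN : IsL2Normal x Ψ := ⟨memLp_of_continuous k hΨ.1.continuous,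
    Filter.Eventually.of_forall hΨ.2⟩
  have hGm : MemLp (norDeriv x Ψ) 2 (vol x) :=
    memLp_of_continuous k (contMDiff_norDeriv x hΨ.1).continuous
  refine ⟨hN, ⟨hGm, Filter.Eventually.of_forall fun p u => ⟨norProj_mem x p _,
    (norDeriv_tanProj x Ψ p u).symm⟩, fun X Φ hX hs hΦ => ?_⟩,
    memLp_of_continuous k hΨ.1.continuous, Filter.Eventually.of_forall hΨ.2, hdiv⟩
  rw [eq_neg_iff_add_eq_zero, integral_add_of_normal hN.1 hGm hX hΦ, hdiv X Φ hX hΦ]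
  refine integral_bdryVol_eq_zero fun p hp => ?_
  have h : p ∉ tsupport X := fun h => by
    have := hs h
    rw [← ModelWithCorners.compl_boundary] at this
    exact this hp
  rw [image_eq_zero_of_notMem_tsupport h, inner_zero_left, zero_mul]

end SobolevTriple

/-! ### Uniqueness of weak derivatives and traces, and Green's formula -/

section Uniqueness

variable {n k : ℕ} [NeZero k] {M : Type*} [TopologicalSpace M]
  [ChartedSpace (EuclideanHalfSpace k) M] [IsManifold (𝓡∂ k) ∞ M] {x : Immersion k n M}
  [MeasurableSpace M] [BorelSpace M] [T2Space M] [CompactSpace M]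
  {W W' : M → Amb n} {G G' : M → Amb n →L[ℝ] Amb n} {τ τ' : M → Amb n}

lemma eq_zero_of_inner_bv {u : Amb n} (h : ∀ b, (inner ℝ u (bv b) : ℝ) = 0) : u = 0 := by
  rw [← sum_inner_smul_bv u]
  exact Finset.sum_eq_zero fun b _ => by rw [h, zero_smul]

lemma clm_eq_of_bv {A B : Amb n →L[ℝ] Amb n}
    (h : ∀ a b, (inner ℝ (A (bv a)) (bv b) : ℝ) = inner ℝ (B (bv a)) (bv b)) : A = B := by
  have h1 : ∀ a, A (bv a) = B (bv a) := fun a => by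
    rw [← sub_eq_zero]
    exact eq_zero_of_inner_bv fun b => by rw [inner_sub_left, h, sub_self]
  ext1 u
  rw [← sum_inner_smul_bv u, map_sum, map_sum]
  exact Finset.sum_congr rfl fun a _ => by rw [map_smul, map_smul, h1]

lemma isTangentField_tanProj {f : M → Amb n} (hf : ContMDiff (𝓡∂ k) 𝓘(ℝ, Amb n) ∞ f) :
    IsTangentField x fun p => tanProj x p (f p) :=
  ⟨(contMDiff_tanProj x).clm_apply hf, fun p => tanProj_mem x p _⟩

/-- The weak derivative is determined by the section, almost everywhere. The boundary is a null set, so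
the fields `φ P εₐ` with `φ` compactly supported in the interior suffice as test fields. -/
lemma IsWeakDeriv.ae_eq (hG : IsWeakDeriv x W G) (hG' : IsWeakDeriv x W' G')
    (hWW' : W =ᵐ[vol x] W') : G =ᵐ[vol x] G' := by
  have key : ∀ a b : Fin n, ∀ᵐ p ∂(vol x), p ∈ (𝓡∂ k).interior M →
      (inner ℝ (G p (bv a)) (bv b) : ℝ) - inner ℝ (G' p (bv a)) (bv b) = 0 := by
    intro a b
    have hi : ∀ {G : M → Amb n →L[ℝ] Amb n}, MemLp G 2 (vol x) →
        Integrable (fun p => (inner ℝ (G p (bv a)) (bv b) : ℝ)) (vol x) := fun hG =>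
      integrable_inner_deriv (X := fun _ => bv a) (Φ := fun _ => bv b) hG continuous_const
        continuous_const
    have hdi : Integrable (fun p => (inner ℝ (G p (bv a)) (bv b) : ℝ) -
        inner ℝ (G' p (bv a)) (bv b)) (vol x) := (hi hG.1).sub (hi hG'.1)
    refine IsOpen.ae_eq_zero_of_integral_contMDiff_smul_eq_zero (𝓡∂ k)
      (ModelWithCorners.isOpen_interior (n := ∞) (by simp))
      (hdi.locallyIntegrable.locallyIntegrableOn _) fun φ hφ _ hs => ?_
    have hX := isTangentField_smul x hφ
      (isTangentField_tanProj (x := x) (contMDiff_const (c := (bv a : Amb n))))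
    have hN := isNormalField_norPart x (bv b)
    have hsX := (tsupport_smul_subset_left φ fun p => tanProj x p (bv a)).trans hs
    have h1 := hG.2.2 _ _ hX hsX hN
    have h2 := hG'.2.2 _ _ hX hsX hN
    have h3 : ∫ p, (inner ℝ (W p) (norDeriv x (norPart x (bv b)) p (φ p • tanProj x p (bv a))) +
        tanDiv x (fun p => φ p • tanProj x p (bv a)) p * inner ℝ (W p) (norPart x (bv b) p)) ∂(vol x)
        = ∫ p, (inner ℝ (W' p) (norDeriv x (norPart x (bv b)) p (φ p • tanProj x p (bv a))) +
        tanDiv x (fun p => φ p • tanProj x p (bv a)) p * inner ℝ (W' p) (norPart x (bv b) p))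
          ∂(vol x) := by
      refine integral_congr_ae ?_
      filter_upwards [hWW'] with p hp
      rw [hp]
    rw [h3, ← h2] at h1
    rw [← sub_eq_zero, ← integral_sub
      (integrable_inner_deriv hG.1 hX.1.continuous hN.1.continuous)
      (integrable_inner_deriv hG'.1 hX.1.continuous hN.1.continuous)] at h1
    rw [← h1]
    refine integral_congr_ae ?_
    filter_upwards [hG.2.1, hG'.2.1] with p hp hp'
    rw [norPart, inner_norProj_of_mem (hp _).1, inner_norProj_of_mem (hp' _).1, map_smul, map_smul,
      ← (hp _).2, ← (hp' _).2, real_inner_smul_left, real_inner_smul_left, smul_eq_mul, mul_sub]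
  have key' : ∀ᵐ p ∂(vol x), ∀ a b : Fin n, p ∈ (𝓡∂ k).interior M →
      (inner ℝ (G p (bv a)) (bv b) : ℝ) - inner ℝ (G' p (bv a)) (bv b) = 0 :=
    ae_all_iff.2 fun a => ae_all_iff.2 fun b => key a b
  filter_upwards [key', ae_mem_interior x] with p hp hpi
  exact clm_eq_of_bv fun a b => sub_eq_zero.1 (hp a b hpi)

/-- The weak derivative and the trace are determined by the section, almost everywhere. -/
lemma IsSobolevTriple.unique (hx : IsFreeBoundaryMinimal x) (h : IsSobolevTriple x W G τ)
    (h' : IsSobolevTriple x W' G' τ') (hWW' : W =ᵐ[vol x] W') :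
    G =ᵐ[vol x] G' ∧ τ =ᵐ[bdryVol x] τ' := by
  have hGG' := h.isWeakDeriv.ae_eq h'.isWeakDeriv hWW'
  refine ⟨hGG', ?_⟩
  have key : ∀ b : Fin n, ∀ᵐ p ∂(bdryVol x),
      (inner ℝ (τ p) (bv b) : ℝ) - inner ℝ (τ' p) (bv b) = 0 := by
    intro b
    have hi : ∀ {τ : M → Amb n}, MemLp τ 2 (bdryVol x) →
        Integrable (fun p => (inner ℝ (τ p) (bv b) : ℝ)) (bdryVol x) := fun hτ =>
      integrable_inner k hτ continuous_const
    have hdi : Integrable (fun p => (inner ℝ (τ p) (bv b) : ℝ) - inner ℝ (τ' p) (bv b))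
        (bdryVol x) := (hi h.memLp_trace).sub (hi h'.memLp_trace)
    refine ae_eq_zero_of_integral_contMDiff_smul_eq_zero (𝓡∂ k) hdi.locallyIntegrable
      fun φ hφ _ => ?_
    -- along the boundary this test field is `φ` times the conormal
    have hX := isTangentField_smul x hφ (isTangentField_tanProj (x := x) x.smooth)
    have hN := isNormalField_norPart x (bv b)
    have h1 := h.integral_eq _ _ hX hN
    rw [integral_congr_ae (g := fun p => inner ℝ (G' p (φ p • tanProj x p (x.toFun p)))
      (norPart x (bv b) p) + inner ℝ (W' p) (norDeriv x (norPart x (bv b)) p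
        (φ p • tanProj x p (x.toFun p))) + tanDiv x (fun p => φ p • tanProj x p (x.toFun p)) p *
          inner ℝ (W' p) (norPart x (bv b) p)) (by
        filter_upwards [hWW', hGG'] with p hp hp'
        rw [hp, hp']), h'.integral_eq _ _ hX hN] at h1
    have hi' : ∀ {τ : M → Amb n}, MemLp τ 2 (bdryVol x) →
        Integrable (fun p => (inner ℝ (φ p • tanProj x p (x.toFun p)) (x.toFun p) : ℝ) *
          inner ℝ (τ p) (norPart x (bv b) p)) (bdryVol x) := fun hτ => by
      refine (integrable_inner k hτ ((continuous_inner_pos (x := x) hX.1.continuous).smul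
        hN.1.continuous)).congr (Filter.Eventually.of_forall fun p => ?_)
      exact real_inner_smul_right _ _ _
    rw [eq_comm, ← sub_eq_zero, ← integral_sub (hi' h.memLp_trace) (hi' h'.memLp_trace)] at h1
    rw [← h1]
    refine integral_congr_ae ?_
    filter_upwards [ae_mem_boundary x, h.trace_mem, h'.trace_mem] with p hp hτ hτ'
    rw [norPart, inner_norProj_of_mem hτ, inner_norProj_of_mem hτ', tanProj_pos hx hp,
      real_inner_smul_left, real_inner_self_eq_norm_sq, norm_pos_boundary hx hp, smul_eq_mul]
    ring
  filter_upwards [ae_all_iff.2 key] with p hp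
  rw [← sub_eq_zero]
  exact eq_zero_of_inner_bv fun b => by rw [inner_sub_left]; exact hp b

/-- For a Sobolev section the chosen weak derivative and trace have their defining properties, as both
exist. -/
lemma IsSobolev.isSobolevTriple (hx : IsFreeBoundaryMinimal x) (h : IsSobolev x W) :
    IsSobolevTriple x W (weakDeriv x W) (trace x W) := by
  have hG : IsWeakDeriv x W (weakDeriv x W) := by
    rw [weakDeriv, dif_pos h.2]
    exact h.2.choose_spec
  obtain ⟨τ, hτ⟩ := hG.exists_trace hx h.1
  have hcon : ∀ (τ X Φ : M → Amb n),
      ∫ p, inner ℝ (X p) (conormal x p) * inner ℝ (τ p) (Φ p) ∂(bdryVol x) =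
        ∫ p, inner ℝ (X p) (x.toFun p) * inner ℝ (τ p) (Φ p) ∂(bdryVol x) := fun τ X Φ =>
    integral_congr_ae (by
      filter_upwards [ae_mem_boundary x] with p hp
      rw [hx.orthogonal p hp])
  have hex : ∃ τ, IsTrace x W τ := ⟨τ, hτ.memLp_trace, hτ.trace_mem, fun X Φ hX hΦ => by
    rw [hcon, hτ.integral_eq X Φ hX hΦ]⟩
  have htr : IsTrace x W (trace x W) := by
    rw [trace, dif_pos hex]
    exact hex.choose_spec
  exact ⟨h.1, hG, htr.1, htr.2.1, fun X Φ hX hΦ => by rw [htr.2.2 X Φ hX hΦ, hcon]⟩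

/-- On a minimal submanifold the tangential part of a constant vector has no divergence. -/
lemma tanDiv_tanProj_const (hH : ∀ p, meanCurv x p = 0) (e : Amb n) (p : M) :
    tanDiv x (fun q => tanProj x q e) p = 0 := by
  rw [tanDiv_eq]
  simp_rw [tanDeriv_clm_apply_const x (contMDiff_tanProj x)]
  change ∑ a, (inner ℝ (dProj x p (bv a) e) (bv a) : ℝ) = 0
  simp_rw [inner_dProj_left]
  rw [← inner_sum, sum_dProj_bv x hH, inner_zero_right]

lemma isNormalField_norDeriv {Φ : M → Amb n} (hΦ : IsNormalField x Φ) (e : Amb n) :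
    IsNormalField x fun p => norDeriv x Φ p e :=
  ⟨(contMDiff_norDeriv x hΦ.1).clm_apply contMDiff_const, fun p => norProj_mem x p _⟩

lemma continuous_norLaplacian (hH : ∀ p, meanCurv x p = 0) {Φ : M → Amb n}
    (hΦ : IsNormalField x Φ) : Continuous (norLaplacian x Φ) := by
  have h : norLaplacian x Φ = fun p => -∑ a, norProj x p
      (tanDeriv x (fun q => norDeriv x Φ q (bv a)) p (bv a)) :=
    funext fun p => norLaplacian_eq x hH hΦ.1 p
  rw [h]
  exact (continuous_finsetSum _ fun a _ => (contMDiff_norProj x).continuous.clm_apply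
    ((contMDiff_tanDeriv x (isNormalField_norDeriv hΦ (bv a)).1).continuous.clm_apply
      continuous_const)).neg

lemma integrable_inner_norDeriv_sum (hG : MemLp G 2 (vol x)) {Φ : M → Amb n}
    (hΦ : IsNormalField x Φ) :
    Integrable (fun p => ∑ a, (inner ℝ (G p (bv a)) (norDeriv x Φ p (bv a)) : ℝ)) (vol x) :=
  integrable_finsetSum _ fun a _ => integrable_inner_deriv (X := fun _ => bv a) hG continuous_const
    (isNormalField_norDeriv hΦ (bv a)).1.continuous

/-- Green's formula for the Laplacian of the normal bundle, summed from the integrations by parts with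
the fields `P εₐ`, which have no divergence. -/
lemma IsSobolevTriple.green (hx : IsFreeBoundaryMinimal x) (h : IsSobolevTriple x W G τ)
    {Φ : M → Amb n} (hΦ : IsNormalField x Φ) :
    ∫ p, (∑ a, inner ℝ (G p (bv a)) (norDeriv x Φ p (bv a)) - inner ℝ (W p) (norLaplacian x Φ p))
      ∂(vol x) = ∫ p, inner ℝ (τ p) (norDeriv x Φ p (x.toFun p)) ∂(bdryVol x) := by
  have hX : ∀ a : Fin n, IsTangentField x fun p => tanProj x p (bv a) := fun a =>
    isTangentField_tanProj contMDiff_const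
  have hΦa := fun a : Fin n => isNormalField_norDeriv hΦ (bv a)
  have h1 := fun a : Fin n => h.integral_eq _ _ (hX a) (hΦa a)
  have hGm := h.isWeakDeriv.1
  have hWm := h.isL2Normal.1
  have h2 : ∫ p, inner ℝ (τ p) (norDeriv x Φ p (x.toFun p)) ∂(bdryVol x) = ∑ a : Fin n,
      ∫ p, inner ℝ (tanProj x p (bv a)) (x.toFun p) * inner ℝ (τ p) (norDeriv x Φ p (bv a))
        ∂(bdryVol x) := by
    rw [← integral_finsetSum]
    · refine integral_congr_ae (Filter.Eventually.of_forall fun p => ?_)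
      beta_reduce
      conv_lhs => rw [← norDeriv_tanProj, ← sum_inner_smul_bv (tanProj x p (x.toFun p)), map_sum,
        inner_sum]
      refine Finset.sum_congr rfl fun a _ => ?_
      rw [map_smul, real_inner_smul_right, inner_tanProj_left, real_inner_comm]
    · intro a _
      refine (integrable_inner k h.memLp_trace ((continuous_inner_pos (x := x) (hX a).1.continuous).smul
        (hΦa a).1.continuous)).congr (Filter.Eventually.of_forall fun p => ?_)
      exact real_inner_smul_right _ _ _
  rw [h2, ← Finset.sum_congr rfl fun a _ => h1 a, ← integral_finsetSum]
  · refine integral_congr_ae ?_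
    filter_upwards [h.isWeakDeriv.2.1] with p hp
    rw [norLaplacian_eq x hx.minimal hΦ.1, inner_neg_right, sub_neg_eq_add, inner_sum,
      ← Finset.sum_add_distrib]
    refine Finset.sum_congr rfl fun a _ => ?_
    rw [tanDiv_tanProj_const hx.minimal, zero_mul, add_zero, ← (hp _).2, norDeriv_tanProj]
    rfl
  · intro a _
    exact ((integrable_inner_deriv hGm (hX a).1.continuous (hΦa a).1.continuous).add
      (integrable_inner_norDeriv hWm (hX a) (hΦa a))).add (integrable_tanDiv_mul hWm (hX a) (hΦa a))

end Uniqueness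

/-! ### The index form on `v^⊥` -/

section IndexForm

variable {n k : ℕ} [NeZero k] {M : Type*} [TopologicalSpace M]
  [ChartedSpace (EuclideanHalfSpace k) M] [IsManifold (𝓡∂ k) ∞ M] {x : Immersion k n M}
  [MeasurableSpace M] [BorelSpace M] [T2Space M] [CompactSpace M]
  {W W' : M → Amb n} {G G' : M → Amb n →L[ℝ] Amb n} {τ τ' : M → Amb n}

/-- A smooth field that vanishes on the boundary is bounded by a multiple of `1 - |x|²`. -/
lemma exists_norm_le_halfSq (hx : IsFreeBoundaryMinimal x) {Φ : M → Amb n}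
    (hΦ : ContMDiff (𝓡∂ k) 𝓘(ℝ, Amb n) ∞ Φ) (h0 : ∀ p ∈ (𝓡∂ k).boundary M, Φ p = 0) :
    ∃ C, 0 ≤ C ∧ ∀ p, ‖Φ p‖ ≤ C * -halfSq x p := by
  choose C hC0 hC using fun a : Fin n => exists_abs_le_halfSq hx (contMDiff_coord hΦ (bv a))
    fun p hp => by rw [h0 p hp, inner_zero_left]
  refine ⟨∑ a, C a, Finset.sum_nonneg fun a _ => hC0 a, fun p => ?_⟩
  rw [Finset.sum_mul]
  conv_lhs => rw [← sum_inner_smul_bv (Φ p)]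
  refine (norm_sum_le _ _).trans (Finset.sum_le_sum fun a _ => ?_)
  rw [norm_smul, PiLp.norm_single, norm_one, mul_one]
  exact hC a p

lemma norDeriv_eq_zero {Φ : M → Amb n} {p : M} (hp : p ∉ tsupport Φ) : norDeriv x Φ p = 0 := by
  rw [norDeriv, tanDeriv_eq_zero x hp, ContinuousLinearMap.comp_zero]

lemma notMem_tsupport_of_boundary {Φ : M → Amb n} (hs : tsupport Φ ⊆ (𝓡∂ k).interior M) {p : M}
    (hp : p ∈ (𝓡∂ k).boundary M) : p ∉ tsupport Φ := fun h => by
  have := hs h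
  rw [← ModelWithCorners.compl_boundary] at this
  exact this hp

/-- Green's formula when the test field has compact support in the interior. -/
lemma IsSobolevTriple.green_interior (hx : IsFreeBoundaryMinimal x) (h : IsSobolevTriple x W G τ)
    {Φ : M → Amb n} (hΦ : IsNormalField x Φ) (hs : tsupport Φ ⊆ (𝓡∂ k).interior M) :
    ∫ p, ∑ a, inner ℝ (G p (bv a)) (norDeriv x Φ p (bv a)) ∂(vol x) =
      ∫ p, inner ℝ (W p) (norLaplacian x Φ p) ∂(vol x) := by
  have h1 := h.green hx hΦ
  rw [integral_bdryVol_eq_zero fun p hp => by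
    rw [norDeriv_eq_zero (notMem_tsupport_of_boundary hs hp), _root_.zero_apply, inner_zero_right],
    integral_sub (integrable_inner_norDeriv_sum h.isWeakDeriv.1 hΦ)
      (integrable_inner k h.isL2Normal.1 (continuous_norLaplacian hx.minimal hΦ)), sub_eq_zero] at h1
  exact h1

lemma continuous_simons {Φ : M → Amb n} (hΦ : IsNormalField x Φ) :
    Continuous fun p => simons x p (Φ p) := by
  have h : (fun p => simons x p (Φ p)) =
      fun p => ∑ a, dProj x p (bv a) (dProj x p (bv a) (Φ p)) :=
    funext fun p => simons_eq x (hΦ.2 p)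
  rw [h]
  have hc : ∀ a : Fin n, Continuous fun p => dProj x p (bv a) := fun a =>
    (contMDiff_dProj x).continuous.clm_apply continuous_const
  exact continuous_finsetSum _ fun a _ => (hc a).clm_apply ((hc a).clm_apply hΦ.1.continuous)

lemma inner_simons (p : M) (u w : Amb n) :
    (inner ℝ (simons x p u) w : ℝ) = ∑ i, ∑ j,
      inner ℝ (sff x p (tanFrame x p i) (tanFrame x p j)) u *
        inner ℝ (sff x p (tanFrame x p i) (tanFrame x p j)) w := by
  simp_rw [simons, sum_inner, real_inner_smul_left]

lemma inner_simons_comm (p : M) (u w : Amb n) :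
    (inner ℝ (simons x p u) w : ℝ) = inner ℝ u (simons x p w) := by
  rw [real_inner_comm (simons x p w) u, inner_simons, inner_simons]
  simp_rw [mul_comm]

lemma sum_inner_mul_clm (T : Amb n →L[ℝ] Amb n) (u z : Amb n) :
    ∑ a, (inner ℝ u (bv a) : ℝ) * inner ℝ (T (bv a)) z = inner ℝ (T u) z := by
  conv_rhs => rw [← sum_inner_smul_bv u, map_sum, sum_inner]
  simp_rw [map_smul, real_inner_smul_left]

/-- A weakly Jacobi section satisfies the weak Jacobi equation, after one integration by parts, with all
smooth test fields `Φ` that vanish on the boundary: the gradients of the cutoff functions are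
compensated by the decay of `Φ` at the boundary. -/
lemma IsSobolevTriple.integral_of_vanish (hx : IsFreeBoundaryMinimal x)
    (h : IsSobolevTriple x W G τ) (hJ : IsWeaklyJacobi x W) {Φ : M → Amb n}
    (hΦ : IsNormalField x Φ) (h0 : ∀ p ∈ (𝓡∂ k).boundary M, Φ p = 0) :
    ∫ p, (∑ a, inner ℝ (G p (bv a)) (norDeriv x Φ p (bv a)) - inner ℝ (W p) (simons x p (Φ p)))
      ∂(vol x) = 0 := by
  obtain ⟨χ, g, K, hχ, hs, hχ1, hev, hD, hgc, hgK⟩ := exists_cutoff (x := x) hx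
  obtain ⟨C, hC0, hC⟩ := exists_norm_le_halfSq hx hΦ.1 h0
  have hGm := h.isWeakDeriv.1
  have hWm := h.isL2Normal.1
  have hΦm : ∀ m, IsNormalField x (fun p => χ m p • Φ p) := fun m =>
    ⟨(hχ m).smul hΦ.1, fun p => Submodule.smul_mem _ _ (hΦ.2 p)⟩
  set f := fun p => ∑ a, inner ℝ (G p (bv a)) (norDeriv x Φ p (bv a)) -
    inner ℝ (W p) (simons x p (Φ p)) with hf
  set e := fun p => (inner ℝ (G p (x.toFun p)) (Φ p) : ℝ) with he
  have hint : ∀ {Ψ : M → Amb n}, IsNormalField x Ψ → Integrable (fun p =>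
      ∑ a, inner ℝ (G p (bv a)) (norDeriv x Ψ p (bv a)) - inner ℝ (W p) (simons x p (Ψ p)))
      (vol x) := fun hΨ => (integrable_inner_norDeriv_sum hGm hΨ).sub
    (integrable_inner k hWm (continuous_simons hΨ))
  have hfm : ∀ m, (fun p => ∑ a, inner ℝ (G p (bv a)) (norDeriv x (fun p => χ m p • Φ p) p (bv a)) -
      inner ℝ (W p) (simons x p (χ m p • Φ p))) =ᵐ[vol x] fun p => χ m p * f p + g m p * e p := by
    intro m
    filter_upwards [h.isWeakDeriv.2.1] with p hp
    have h1 : ∑ a, (inner ℝ (x.toFun p) (tanProj x p (bv a)) : ℝ) * inner ℝ (G p (bv a)) (Φ p) =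
        e p := by
      simp_rw [← inner_tanProj_left]
      rw [sum_inner_mul_clm, ← (hp _).2]
    rw [simons_smul, real_inner_smul_right, ← h1, hf]
    simp_rw [norDeriv_smul x (hχ m) hΦ, hD, inner_add_right, real_inner_smul_right]
    rw [Finset.sum_add_distrib, mul_sub, Finset.mul_sum, Finset.mul_sum]
    simp_rw [mul_assoc]
    ring
  have hzero : ∀ m, ∫ p, (χ m p * f p + g m p * e p) ∂(vol x) = 0 := by
    intro m
    have hsm : tsupport (fun p => χ m p • Φ p) ⊆ (𝓡∂ k).interior M :=
      (tsupport_smul_subset_left (χ m) Φ).trans (hs m)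
    rw [← integral_congr_ae (hfm m), integral_sub (integrable_inner_norDeriv_sum hGm (hΦm m))
      (integrable_inner k hWm (continuous_simons (hΦm m))), h.green_interior hx (hΦm m) hsm,
      ← integral_sub (integrable_inner k hWm (continuous_norLaplacian hx.minimal (hΦm m)))
      (integrable_inner k hWm (continuous_simons (hΦm m))), ← hJ _ (hΦm m) hsm]
    refine integral_congr_ae (Filter.Eventually.of_forall fun p => ?_)
    exact (inner_sub_right _ _ _).symm
  -- the gradient term is bounded by `K C |G(x)|`, and vanishes eventually at every interior point
  have hlim : Filter.Tendsto (fun m => ∫ p, (χ m p * f p + g m p * e p) ∂(vol x)) Filter.atTop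
      (nhds (∫ p, f p ∂(vol x))) := by
    refine tendsto_integral_of_dominated_convergence
      (fun p => ‖f p‖ + K * C * ‖G p (x.toFun p)‖) ?_ ?_ ?_ ?_
    · exact fun m => (hint (hΦm m)).aestronglyMeasurable.congr (hfm m)
    · exact (hint hΦ).norm.add
        ((integrable_clm_apply k hGm x.smooth.continuous).norm.const_mul _)
    · refine fun m => Filter.Eventually.of_forall fun p => ?_
      refine (norm_add_le _ _).trans (add_le_add ?_ ?_)
      · rw [norm_mul]
        exact mul_le_of_le_one_left (norm_nonneg _) (hχ1 m p)
      · rw [norm_mul]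
        calc ‖g m p‖ * ‖e p‖ ≤ |g m p| * (‖G p (x.toFun p)‖ * (C * -halfSq x p)) :=
              mul_le_mul_of_nonneg_left ((norm_inner_le_norm _ _).trans
                (mul_le_mul_of_nonneg_left (hC p) (norm_nonneg _))) (abs_nonneg _)
          _ = |g m p| * -halfSq x p * (C * ‖G p (x.toFun p)‖) := by ring
          _ ≤ K * (C * ‖G p (x.toFun p)‖) := mul_le_mul_of_nonneg_right (hgK m p)
              (mul_nonneg hC0 (norm_nonneg _))
          _ = K * C * ‖G p (x.toFun p)‖ := by ring
    · filter_upwards [ae_mem_interior x] with p hp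
      refine tendsto_const_nhds.congr' ?_
      filter_upwards [hev p hp] with m hm
      rw [hm.1, hm.2]
      ring
  simp_rw [hzero] at hlim
  exact (tendsto_nhds_unique tendsto_const_nhds hlim).symm

/-- The section `v^⊥` is weakly Jacobi. -/
lemma isWeaklyJacobi_norPart (hx : IsFreeBoundaryMinimal x) (v : Amb n) :
    IsWeaklyJacobi x (norPart x v) := by
  intro Φ hΦ hs
  have hV := isNormalField_norPart x v
  have h1 := (isSobolevTriple_of_smooth hx hV).green_interior hx hΦ hs
  have h2 := (isSobolevTriple_of_smooth hx hΦ).green hx hV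
  have hVc := hV.1.continuous
  have hVm : MemLp (norPart x v) 2 (vol x) := memLp_of_continuous k hVc
  have hΦm : MemLp Φ 2 (vol x) := memLp_of_continuous k hΦ.1.continuous
  rw [integral_bdryVol_eq_zero fun p hp => by
    rw [image_eq_zero_of_notMem_tsupport (notMem_tsupport_of_boundary hs hp), inner_zero_left],
    integral_sub (integrable_inner_norDeriv_sum
      (memLp_of_continuous k (contMDiff_norDeriv x hΦ.1).continuous) hV)
      (integrable_inner k hΦm (continuous_norLaplacian hx.minimal hV)), sub_eq_zero] at h2
  simp_rw [jacobi, inner_sub_right]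
  rw [integral_sub (integrable_inner k hVm (continuous_norLaplacian hx.minimal hΦ))
    (integrable_inner k hVm (continuous_simons hΦ)), sub_eq_zero, ← h1]
  simp_rw [norLaplacian_norPart x hx.minimal, ← inner_simons_comm] at h2
  simp_rw [real_inner_comm (norPart x v _)] at h2
  rw [← h2]
  refine integral_congr_ae (Filter.Eventually.of_forall fun p => ?_)
  exact Finset.sum_congr rfl fun a _ => real_inner_comm _ _

/-- Along the boundary the conormal derivative of `Φ` is `v^⊥` minus the conormal derivative of `v^⊥`.
The field `x^⊥` vanishes on the boundary, so that `σ(x, u) = ⟨x, u⟩ σ(x, x)` for tangent `u`. -/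
lemma norDeriv_boundary (hx : IsFreeBoundaryMinimal x) (v : Amb n) {p : M}
    (hp : p ∈ (𝓡∂ k).boundary M) :
    norDeriv x (norPart x v) p (x.toFun p) - norPart x v p =
      -norDeriv x (confNor x v) p (x.toFun p) := by
  have h1 := tanDeriv_of_vanish hx (isNormalField_posNor x).1 (fun q hq => posNor_boundary hx hq) hp v
  rw [tanDeriv_posNor, tanDeriv_posNor, smul_neg, neg_inj] at h1
  have h2 : dProj x p (x.toFun p) (tanProj x p v) =
      (inner ℝ v (x.toFun p) : ℝ) • dProj x p (x.toFun p) (x.toFun p) := by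
    rw [dProj_comm, tanProj_pos hx hp, h1]
  rw [norDeriv_norPart, norDeriv_confNor, h2, halfSq_boundary hx hp, posNor_boundary hx hp,
    tanProj_pos hx hp, real_inner_self_eq_norm_sq, norm_pos_boundary hx hp,
    real_inner_comm v]
  simp only [one_pow, one_smul, zero_smul, smul_zero, zero_sub, sub_zero]
  abel

/-- The index form on `v^⊥` and a Jacobi section `W`, by the computation
`Q(v^⊥, W) = ∫_∂ ⟨W, D_x v^⊥ - v^⊥⟩ = -∫_∂ ⟨W, D_x Φ⟩ = ∫ ⟨W, J Φ⟩ = -k ∫ ⟨v^⊥, W⟩`. -/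
lemma indexForm_norPart (hx : IsFreeBoundaryMinimal x) (v : Amb n) {V : M → Amb n}
    (hV : IsSobolev x V) (hVv : V =ᵐ[vol x] norPart x v) (hW : IsSobolev x W)
    (hJ : IsWeaklyJacobi x W) :
    indexForm x V W = -(k : ℝ) * ∫ p, inner ℝ (norPart x v p) (W p) ∂(vol x) := by
  have hN := isNormalField_norPart x v
  have hC := isNormalField_confNor x v
  have ht := hW.isSobolevTriple hx
  -- the weak derivative and the trace of `v^⊥` are the classical ones
  obtain ⟨hG, hτ⟩ := (hV.isSobolevTriple hx).unique hx (isSobolevTriple_of_smooth hx hN) hVv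
  have hGm := ht.isWeakDeriv.1
  have hWm := ht.isL2Normal.1
  have g1 := ht.green hx hN
  have g2 := ht.green hx hC
  have g3 := ht.integral_of_vanish hx hJ hC fun p hp => confNor_boundary hx v hp
  have iL := integrable_inner k hWm (continuous_norLaplacian hx.minimal hC)
  have iS := integrable_inner k hWm (continuous_simons hC)
  have iG := integrable_inner_norDeriv_sum hGm hC
  rw [integral_sub iG iL] at g2
  rw [integral_sub iG iS, sub_eq_zero] at g3
  have g4 : ∫ p, inner ℝ (W p) (norLaplacian x (confNor x v) p) ∂(vol x) -
      ∫ p, inner ℝ (W p) (simons x p (confNor x v p)) ∂(vol x) =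
      -(k : ℝ) * ∫ p, inner ℝ (norPart x v p) (W p) ∂(vol x) := by
    rw [← integral_sub iL iS, ← integral_const_mul]
    refine integral_congr_ae (Filter.Eventually.of_forall fun p => ?_)
    beta_reduce
    rw [← inner_sub_right]
    change inner ℝ (W p) (jacobi x (confNor x v) p) = _
    rw [jacobi_confNor x hx.minimal, real_inner_smul_right, real_inner_comm]
  -- the interior part of `Q(v^⊥, W)`, in the form that Green's formula applies to
  have hvol : ∫ p, ((∑ i, inner ℝ (weakDeriv x V p (tanFrame x p i))
      (weakDeriv x W p (tanFrame x p i)))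
      - ∑ i, ∑ j, inner ℝ (sff x p (tanFrame x p i) (tanFrame x p j)) (V p) *
        inner ℝ (sff x p (tanFrame x p i) (tanFrame x p j)) (W p)) ∂(vol x) =
      ∫ p, (∑ a, inner ℝ (weakDeriv x W p (bv a)) (norDeriv x (norPart x v) p (bv a)) -
        inner ℝ (W p) (norLaplacian x (norPart x v) p)) ∂(vol x) := by
    refine integral_congr_ae ?_
    filter_upwards [hVv, hG] with p h1 h2
    rw [h1, h2, ← inner_simons, norLaplacian_norPart x hx.minimal, real_inner_comm (W p)]
    congr 1
    have h3 := sum_tanFrame_clm x p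
      (((ContinuousLinearMap.compL ℝ (Amb n) (Amb n) ℝ).flip (weakDeriv x W p)).comp
        ((innerSL ℝ).comp (norDeriv x (norPart x v) p)))
    simp only [ContinuousLinearMap.comp_apply, ContinuousLinearMap.flip_apply,
      ContinuousLinearMap.compL_apply, innerSL_apply_apply, norDeriv_tanProj] at h3
    rw [h3]
    exact Finset.sum_congr rfl fun a _ => real_inner_comm _ _
  -- the boundary part
  have hb : ∫ p, inner ℝ (trace x W p) (norDeriv x (norPart x v) p (x.toFun p)) ∂(bdryVol x) -
      ∫ p, inner ℝ (trace x V p) (trace x W p) ∂(bdryVol x) =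
      -∫ p, inner ℝ (trace x W p) (norDeriv x (confNor x v) p (x.toFun p)) ∂(bdryVol x) := by
    have hτm := ht.memLp_trace
    have i1 := integrable_inner k hτm
      ((contMDiff_norDeriv x hN.1).continuous.clm_apply x.smooth.continuous)
    have i2 := integrable_inner k hτm hN.1.continuous
    have h4 : ∫ p, inner ℝ (trace x V p) (trace x W p) ∂(bdryVol x) =
        ∫ p, inner ℝ (trace x W p) (norPart x v p) ∂(bdryVol x) := by
      refine integral_congr_ae ?_
      filter_upwards [hτ] with p hp
      rw [hp, real_inner_comm]
    rw [h4, ← integral_sub i1 i2, ← integral_neg]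
    refine integral_congr_ae ?_
    filter_upwards [ae_mem_boundary x] with p hp
    rw [← inner_sub_right, norDeriv_boundary hx v hp, inner_neg_right]
  rw [indexForm, hvol, g1, hb, ← g2, g3, neg_sub, g4]

lemma IsSobolev.congr (h : IsSobolev x W) (hWW' : W =ᵐ[vol x] W') : IsSobolev x W' := by
  obtain ⟨⟨h1, h2⟩, G, hG1, hG2, hG3⟩ := h
  refine ⟨⟨h1.ae_eq hWW', ?_⟩, G, hG1, hG2, fun X Φ hX hs hΦ => ?_⟩
  · filter_upwards [h2, hWW'] with p hp hp'
    rwa [← hp']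
  · rw [hG3 X Φ hX hs hΦ]
    congr 1
    refine integral_congr_ae ?_
    filter_upwards [hWW'] with p hp
    rw [hp]

lemma IsWeaklyJacobi.congr (h : IsWeaklyJacobi x W) (hWW' : W =ᵐ[vol x] W') :
    IsWeaklyJacobi x W' := by
  intro Φ hΦ hs
  rw [← h Φ hΦ hs]
  refine integral_congr_ae ?_
  filter_upwards [hWW'] with p hp
  rw [hp]

lemma isSobolev_norPart (hx : IsFreeBoundaryMinimal x) (v : Amb n) : IsSobolev x (norPart x v) :=
  ⟨(isSobolevTriple_of_smooth hx (isNormalField_norPart x v)).isL2Normal, _,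
    (isSobolevTriple_of_smooth hx (isNormalField_norPart x v)).isWeakDeriv⟩

lemma memLp_norPart (v : Amb n) : MemLp (norPart x v) 2 (vol x) :=
  memLp_of_continuous k (isNormalField_norPart x v).1.continuous

lemma toLp_norPart_mem_hardy (hx : IsFreeBoundaryMinimal x) (v : Amb n) :
    (memLp_norPart v).toLp (norPart x v) ∈ hardy x :=
  ⟨(isSobolev_norPart hx v).congr (memLp_norPart v).coeFn_toLp.symm,
    (isWeaklyJacobi_norPart hx v).congr (memLp_norPart v).coeFn_toLp.symm⟩

lemma neg_smul_toLp_norPart (v : Amb n) :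
    (-(k : ℝ)) • (memLp_norPart v).toLp (norPart x v) =
      (memLp_norPart (-(k : ℝ) • v)).toLp (norPart x (-(k : ℝ) • v)) := by
  rw [← MemLp.toLp_const_smul]
  congr 1
  funext p
  exact (map_smul (norProj x p) _ _).symm

/-- The element `-k v^⊥` represents the functional `Q(v^⊥, ·)`. -/
lemma represents_norPart (hx : IsFreeBoundaryMinimal x) (v : Amb n) :
    Represents x ((memLp_norPart v).toLp (norPart x v))
      ((-(k : ℝ)) • (memLp_norPart v).toLp (norPart x v)) := by
  refine ⟨subset_closure ?_, fun W hW => ?_⟩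
  · rw [neg_smul_toLp_norPart]
    exact toLp_norPart_mem_hardy hx _
  · rw [indexForm_norPart hx v (toLp_norPart_mem_hardy hx v).1 (memLp_norPart v).coeFn_toLp hW.1 hW.2,
      ← integral_const_mul]
    refine integral_congr_ae ?_
    filter_upwards [Lp.coeFn_smul (-(k : ℝ)) ((memLp_norPart v).toLp (norPart x v)),
      (memLp_norPart v).coeFn_toLp] with p h1 h2
    rw [h1, Pi.smul_apply, h2, real_inner_smul_left]

/-- The form determines the operator, because the representing elements lie in the closure of the
form domain. -/
lemma Represents.unique {U F F' : Lp (Amb n) 2 (vol x)} (h : Represents x U F)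
    (h' : Represents x U F') : F = F' := by
  have h1 : ∀ V ∈ closure (hardy x), (inner ℝ (F - F') V : ℝ) = 0 := by
    refine closure_minimal (fun V hV => ?_)
      (isClosed_eq (continuous_const.inner continuous_id) continuous_const)
    change (inner ℝ (F - F') V : ℝ) = 0
    rw [inner_sub_left, L2.inner_def, L2.inner_def, ← h.2 V hV, ← h'.2 V hV, sub_self]
  rw [← sub_eq_zero, ← inner_self_eq_zero (𝕜 := ℝ), inner_sub_right, h1 _ h.1, h1 _ h'.1, sub_zero]

end IndexForm

end FreeBoundary

end

theorem mainTheorem1 (n k : ℕ) [NeZero k] (hk : 2 ≤ k) (hkn : k + 1 ≤ n)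
    {M : Type*} [TopologicalSpace M] [T2Space M] [CompactSpace M]
    [ChartedSpace (EuclideanHalfSpace k) M] [IsManifold (𝓡∂ k) ∞ M]
    [MeasurableSpace M] [BorelSpace M]
    (x : FreeBoundary.Immersion k n M) (hx : FreeBoundary.IsFreeBoundaryMinimal x)
    (v : FreeBoundary.Amb n) (hv : v ≠ 0) :
    (∃ hL : MemLp (FreeBoundary.norPart x v) 2 (FreeBoundary.vol x),
      hL.toLp (FreeBoundary.norPart x v) ∈ FreeBoundary.opDomain x ∧
      FreeBoundary.formOp x (hL.toLp (FreeBoundary.norPart x v)) =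
        (-(k : ℝ)) • hL.toLp (FreeBoundary.norPart x v)) ∧
    ∀ W ∈ FreeBoundary.hardy x,
      FreeBoundary.indexForm x (FreeBoundary.norPart x v) W =
        -(k : ℝ) * ∫ p, inner ℝ (FreeBoundary.norPart x v p) (W p) ∂(FreeBoundary.vol x) := by
  have hrep := FreeBoundary.represents_norPart hx v
  have hdom : (FreeBoundary.memLp_norPart v).toLp (FreeBoundary.norPart x v) ∈
      FreeBoundary.opDomain x := ⟨FreeBoundary.toLp_norPart_mem_hardy hx v, _, hrep⟩
  refine ⟨⟨FreeBoundary.memLp_norPart v, hdom, ?_⟩, fun W hW => ?_⟩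
  · rw [FreeBoundary.formOp, dif_pos hdom]
    exact hdom.2.choose_spec.unique hrep
  · exact FreeBoundary.indexForm_norPart hx v (FreeBoundary.isSobolev_norPart hx v)
      Filter.EventuallyEq.rfl hW.1 hW.2
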